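/- Let $K=\mathbb{Q}(\beta)$, and for a strict partition $\lambda=(\lambda_1>\dots>\lambda_r>0)$ let $\ell(\lambda)=r$. Put $x\oplus y=x+y+\beta xy$, $x\ominus y=\frac{x-y}{1+\beta y}$, $\overline{x}=\frac{-x}{1+\beta x}$. *$K$-theoretic functions.* Let $GP_\lambda(x)$ be the $K$-theoretic $P$-function in $x=(x_1,x_2,\dots)$, i.e. the stable limit as $n\to\infty$ of the polynomials $$GP_\lambda(x_1,\dots,x_n)=\frac{1}{(n-r)!}\sum_{w\in S_n}w\Bigl(x_1^{\lambda_1}\cdots x_r^{\lambda_r}\prod_{i=1}^{r}\prod_{j=i+1}^{n}\frac{x_i\oplus x_j}{x_i\ominus x_j}\Bigr)\quad(r\le n),\qquad GP_\lambda(x_1,\dots,x_n)=0\quad(r>n).$$ The dual $K$-theoretic $Q$-functions $gq_\lambda$ are the unique family, indexed by strict partitions, with $$\sum_{\lambda\ \mathrm{strict}}GP_\lambda(x)\,gq_\lambda(y)=\prod_{i,j}\frac{1-\overline{x_i}\,y_j}{1-x_iy_j}.$$ *Fermions.* Let $\mathcal{F}$ be the Fock space over $K$ of the neutral fermions $\phi_n$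 ($n\in\mathbb{Z}$), $\phi_m\phi_n+\phi_n\phi_m=2(-1)^m\delta_{m+n,0}$, generated by the vacuum $|0\rangle$ with $\phi_{-n}|0\rangle=0$ for $n>0$; it has the basis $\phi_{n_1}\cdots\phi_{n_k}|0\rangle$, $n_1>\dots>n_k\ge0$, and $\langle 0|v\rangle$ denotes the coefficient of $|0\rangle$ in $v$. Let $\mathcal{F}_{even}$ be the span of the vectors obtained from $|0\rangle$ by applying an even number of $\phi_n$, $n\ge0$. Define operators $\phi^{[\beta]}_n$ on $\mathcal F$ by $$\sum_{n\ge1}\phi^{[\beta]}_nz^n=\sum_{n\ge1}\phi_n\Bigl(\frac{z}{1+\frac{\beta}{2}z}\Bigr)^n,\qquad \sum_{n\ge0}\phi^{[\beta]}_{-n}z^{-n}=\sum_{n\ge0}\phi_{-n}\bigl(z^{-1}+\tfrac{\beta}{2}\bigr)^n.$$ Let $b_m=\frac14\sum_{i\in\mathbb{Z}}(-1)^i\phi_{-i-m}\phi_i$ for odd $m$, $\theta=2\sum_{n=1,3,5,\dots}\bigl(\frac{\beta}{2}\bigr)^n\frac{b_n}{n}$, and for $n\ge1$ let $b^{[\beta]}_n$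 be obtained from the expansion of $\frac12\bigl((X-\frac{\beta}{2})^{-n}-(-X-\frac{\beta}{2})^{-n}\bigr)$ in powers of $X^{-1}$ (in which only odd powers occur) by replacing $X^{-k}$ with $b_k$. Let $p_n(x)=\sum_ix_i^n$ and $$\mathcal{H}^{[\beta]}(x)=2\sum_{n\ge1}\frac{p_n(x)}{n}\,b^{[\beta]}_n .$$ Let $p^{[\beta]}_n=\sum_{i=1}^n\binom{n}{i}\bigl(\frac{\beta}{2}\bigr)^{n-i}p_i$ and $g\Gamma=K[p^{[\beta]}_1,p^{[\beta]}_3,p^{[\beta]}_5,\dots]$, and let $\chi(|v\rangle)=\langle0|e^{\mathcal{H}^{[\beta]}}|v\rangle$ for $|v\rangle\in\mathcal{F}_{even}$. Finally put $$|\lambda\rangle_q=\begin{cases}\phi^{[\beta]}_{\lambda_1}e^{-\theta}\phi^{[\beta]}_{\lambda_2}e^{-\theta}\cdots\phi^{[\beta]}_{\lambda_r}e^{-\theta}|0\rangle&(r\text{ even}),\\ \phi^{[\beta]}_{\lambda_1}e^{-\theta}\phi^{[\beta]}_{\lambda_2}e^{-\theta}\cdots\phi^{[\beta]}_{\lambda_r}e^{-\theta}\phi^{[\beta]}_0e^{-\theta}|0\rangle&(r\text{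 odd}).\end{cases}$$ **Theorem.** There is exactly one family $(gq_\lambda)$ of formal power series over $K$ satisfying the Cauchy identity above, and for every strict partition $\lambda$ one has $gq_\lambda\in g\Gamma$, $|\lambda\rangle_q\in\mathcal{F}_{even}$ and $$gq_\lambda(x)=\langle0|e^{\mathcal{H}^{[\beta]}}|\lambda\rangle_q=\chi(|\lambda\rangle_q).$$ -/

import Mathlib

open scoped TensorProduct

noncomputable section

namespace NeutralFermion

/-- A strict partition `λ₁ > λ₂ > ⋯ > λ_r > 0`. -/
@[ext]
structure StrictPartition where
  parts : List ℕ
  decreasing : parts.Pairwise (fun a b => b < a)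
  pos : ∀ a ∈ parts, 0 < a

namespace StrictPartition

/-- The length `r` of a strict partition. -/
def length (lam : StrictPartition) : ℕ := lam.parts.length

end StrictPartition

/-! ### Locally finite sums and exponentials of operators -/

section LocallyFinite

variable {K M N : Type*} [Field K] [AddCommGroup M] [Module K M] [AddCommGroup N] [Module K N]

/-- A family of linear maps is locally finite if only finitely many members act nontrivially
on any given vector. -/
def LocallyFinite {ι : Type*} (f : ι → M →ₗ[K] N) : Prop :=
  ∀ v, (Function.support fun i => f i v).Finite

open Classical in
/-- The sum `v ↦ ∑ᵢ fᵢ v` of a locally finite family of linear maps (and `0` by convention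
if the family is not locally finite). -/
def opSum {ι : Type*} (f : ι → M →ₗ[K] N) : M →ₗ[K] N :=
  if h : LocallyFinite f then
    { toFun := fun v => ∑ᶠ i, f i v
      map_add' := fun v w => by
        simp only [map_add]
        exact finsum_add_distrib (h v) (h w)
      map_smul' := fun c v => by
        simp only [map_smul, RingHom.id_apply]
        exact (smul_finsum c _).symm }
  else 0

/-- `e^A = ∑ₖ Aᵏ / k!` for a locally nilpotent operator `A`. -/
def opExp (A : M →ₗ[K] M) : M →ₗ[K] M :=
  opSum fun k : ℕ => ((k.factorial : K)⁻¹) • A ^ k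

end LocallyFinite

section Fock

variable (K : Type*) [Field K]

/-- The Fock space `ℱ = 𝒜 · |0⟩` of neutral fermions, with basis
`φ_{n₁} ⋯ φ_{nₖ} |0⟩` for `n₁ > ⋯ > nₖ ≥ 0`, realised as the exterior algebra on
`e₀, e₁, e₂, …`; the vector above is `e_{n₁} ∧ ⋯ ∧ e_{nₖ}`. -/
abbrev Fock : Type _ := ExteriorAlgebra K (ℕ →₀ K)

/-- The vacuum vector `|0⟩`. -/
def vac : Fock K := 1

/-- The functional `|v⟩ ↦ ⟨0|v⟩`, i.e. the coefficient of `|0⟩`. -/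
def bra0 : Fock K →ₗ[K] K :=
  (ExteriorAlgebra.algebraMapInv : Fock K →ₐ[K] K).toLinearMap

/-- Exterior multiplication `e_n ∧ ·`. -/
def wedge (n : ℕ) : Fock K →ₗ[K] Fock K :=
  LinearMap.mulLeft K (ExteriorAlgebra.ι K (Finsupp.single n (1 : K)))

/-- Contraction against the `n`-th coordinate. -/
def contract (n : ℕ) : Fock K →ₗ[K] Fock K :=
  CliffordAlgebra.contractLeft (Q := (0 : QuadraticForm K (ℕ →₀ K)))
    (Finsupp.lapply n : (ℕ →₀ K) →ₗ[K] K)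

/-- The neutral fermion `φ_n`, `n ∈ ℤ`, acting on the Fock space. -/
def phi (n : ℤ) : Fock K →ₗ[K] Fock K :=
  if n = 0 then wedge K 0 + contract K 0
  else if 0 < n then wedge K n.natAbs
  else (2 * (-1 : K) ^ n) • contract K n.natAbs

lemma wedge_wedge (m n : ℕ) (v : Fock K) :
    wedge K m (wedge K n v) + wedge K n (wedge K m v) = 0 := by
  simp only [wedge, LinearMap.mulLeft_apply, ← mul_assoc, ← add_mul]
  rw [ExteriorAlgebra.ι_add_mul_swap, zero_mul]

lemma contract_contract (m n : ℕ) (v : Fock K) :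
    contract K m (contract K n v) + contract K n (contract K m v) = 0 := by
  unfold contract
  rw [CliffordAlgebra.contractLeft_comm, neg_add_cancel]

lemma contract_wedge (m n : ℕ) (v : Fock K) :
    contract K m (wedge K n v) + wedge K n (contract K m v) = if m = n then v else 0 := by
  simp only [wedge, contract, LinearMap.mulLeft_apply, ExteriorAlgebra.ι]
  rw [CliffordAlgebra.contractLeft_ι_mul]
  by_cases h : m = n
  · simp [h]
  · simp [h]

lemma phi_zero : phi K 0 = wedge K 0 + contract K 0 := by
  simp [phi]

lemma phi_of_pos {n : ℤ} (hn : 0 < n) : phi K n = wedge K n.natAbs := by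
  simp [phi, hn, hn.ne']

lemma phi_of_neg {n : ℤ} (hn : n < 0) :
    phi K n = (2 * (-1 : K) ^ n) • contract K n.natAbs := by
  simp [phi, hn.ne, not_lt.mpr hn.le]

/-- The defining relation `[φ_m, φ_n]₊ = 2 (-1)^m δ_{m+n,0}`. -/
theorem phi_anticomm (m n : ℤ) (v : Fock K) :
    phi K m (phi K n v) + phi K n (phi K m v) =
      if m + n = 0 then (2 * (-1 : K) ^ m) • v else 0 := by
  have key : ∀ m n : ℤ, m ≤ n → phi K m (phi K n v) + phi K n (phi K m v) =
      if m + n = 0 then (2 * (-1 : K) ^ m) • v else 0 := by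
    intro m n hmn
    rcases lt_trichotomy m 0 with hm | rfl | hm <;> rcases lt_trichotomy n 0 with hn | rfl | hn
    · rw [phi_of_neg K hm, phi_of_neg K hn, if_neg (by omega)]
      simp only [LinearMap.smul_apply, map_smul]
      rw [smul_comm, ← smul_add, ← smul_add, contract_contract, smul_zero, smul_zero]
    · rw [phi_of_neg K hm, phi_zero, if_neg (by omega)]
      have h1 := contract_contract K m.natAbs 0 v
      have h2 := contract_wedge K m.natAbs 0 v
      rw [if_neg (by omega)] at h2
      simp only [LinearMap.smul_apply, LinearMap.add_apply, map_smul, map_add, ← smul_add]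
      rw [add_add_add_comm, h1, h2, add_zero, smul_zero]
    · rw [phi_of_neg K hm, phi_of_pos K hn]
      have h2 := contract_wedge K m.natAbs n.natAbs v
      simp only [LinearMap.smul_apply, map_smul, ← smul_add]
      rw [h2]
      by_cases h : m + n = 0
      · rw [if_pos (by omega), if_pos h]
      · rw [if_neg (by omega), if_neg h, smul_zero]
    · omega
    · have h1 := contract_contract K 0 0 v
      have h2 := contract_wedge K 0 0 v
      have h3 := wedge_wedge K 0 0 v
      rw [if_pos rfl] at h2
      simp only [phi_zero, LinearMap.add_apply, map_add, add_zero, if_true, zpow_zero, mul_one]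
      rw [two_smul]
      refine Eq.trans (b := (contract K 0 (contract K 0 v) + contract K 0 (contract K 0 v)) +
        (wedge K 0 (wedge K 0 v) + wedge K 0 (wedge K 0 v)) +
        ((contract K 0 (wedge K 0 v) + wedge K 0 (contract K 0 v)) +
          (contract K 0 (wedge K 0 v) + wedge K 0 (contract K 0 v)))) (by abel) ?_
      rw [h1, h2, h3, zero_add, zero_add]
    · rw [phi_zero, phi_of_pos K hn, if_neg (by omega)]
      have h1 := wedge_wedge K 0 n.natAbs v
      have h2 := contract_wedge K 0 n.natAbs v
      rw [if_neg (by omega)] at h2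
      simp only [LinearMap.add_apply, map_add]
      rw [add_add_add_comm, h1, h2, add_zero]
    · omega
    · omega
    · rw [phi_of_pos K hm, phi_of_pos K hn, if_neg (by omega), wedge_wedge]
  rcases le_total m n with h | h
  · exact key m n h
  · rw [add_comm, key n m h, add_comm n m]
    by_cases h0 : m + n = 0
    · obtain rfl : n = -m := by omega
      simp [zpow_neg, ← inv_zpow]
    · simp [h0]

/-- `φ_{-n} |0⟩ = 0` for `n > 0`. -/
theorem phi_neg_vac (n : ℤ) (hn : 0 < n) : phi K (-n) (vac K) = 0 := by
  rw [phi_of_neg K (by omega : -n < 0)]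
  simp [vac, contract]

/-- `⟨0| φ_n = 0` for `n > 0`. -/
theorem bra0_phi (n : ℤ) (hn : 0 < n) (v : Fock K) : bra0 K (phi K n v) = 0 := by
  simp [phi, hn.ne', hn, bra0, wedge, ExteriorAlgebra.algebraMapInv]

/-- `⟨0|0⟩ = 1`. -/
theorem bra0_vac : bra0 K (vac K) = 1 := by
  simp [bra0, vac]

/-- `⟨0| φ_0 |0⟩ = 0`. -/
theorem bra0_phi_zero_vac : bra0 K (phi K 0 (vac K)) = 0 := by
  simp [phi, bra0, vac, wedge, contract, ExteriorAlgebra.algebraMapInv]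

/-- The subspace `ℱ_even` spanned by the vectors obtained from `|0⟩` by applying an even
number of operators `φ_n` with `n ≥ 0`. -/
def Feven : Submodule K (Fock K) :=
  Submodule.span K
    {v | ∃ l : List ℕ, Even l.length ∧ v = l.foldr (fun n w => phi K (n : ℤ) w) (vac K)}

/-- The current operator `b_m = ¼ ∑_{i ∈ ℤ} (-1)^i φ_{-i-m} φ_i`, for odd `m`. -/
def current (m : ℤ) : Fock K →ₗ[K] Fock K :=
  opSum fun i : ℤ => ((1 / 4 : K) * (-1) ^ i) • (phi K (-i - m) ∘ₗ phi K i)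

end Fock

section Deformed

variable {K : Type*} [Field K] (β : K)

/-- The deformed fermions `φ^{[β]}_n`, the coefficients of the fields
`∑_{n ≥ 1} φ^{[β]}_n z^n = ∑_{k ≥ 1} φ_k (z / (1 + (β/2) z))^k` and
`∑_{n ≥ 0} φ^{[β]}_{-n} z^{-n} = ∑_{k ≥ 0} φ_{-k} (z⁻¹ + β/2)^k`. -/
def phiBr (n : ℤ) : Fock K →ₗ[K] Fock K :=
  if 0 < n then
    ∑ k ∈ Finset.Icc 1 n.natAbs,
      PowerSeries.coeff n.natAbs
        ((PowerSeries.X * (1 + PowerSeries.C (β / 2) * PowerSeries.X)⁻¹ : PowerSeries K) ^ k) •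
        phi K (k : ℤ)
  else
    opSum fun k : ℕ =>
      ((Polynomial.X + Polynomial.C (β / 2) : Polynomial K) ^ k).coeff n.natAbs •
        phi K (-(k : ℤ))

/-- `θ = 2 ∑_{n = 1, 3, 5, …} (β/2)^n b_n / n`. -/
def theta : Fock K →ₗ[K] Fock K :=
  opSum fun j : ℕ =>
    (2 * (β / 2) ^ (2 * j + 1) / ((2 * j + 1 : ℕ) : K)) • current K ((2 * j + 1 : ℕ) : ℤ)

/-- The expansion of `((X - β/2)^{-n} - (-X - β/2)^{-n}) / 2` as a power series in `t = X⁻¹`. -/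
def currentSeries (n : ℕ) : PowerSeries K :=
  PowerSeries.C (1 / 2 : K) *
    ((PowerSeries.X * (1 - PowerSeries.C (β / 2) * PowerSeries.X)⁻¹) ^ n -
      (-PowerSeries.X * (1 + PowerSeries.C (β / 2) * PowerSeries.X)⁻¹) ^ n)

/-- The deformed current `b^{[β]}_n = (b^{(β)}_{-n})^*` for `n ≥ 1`, where `b^{(β)}_{-n}` is
obtained from `((X - β/2)^{-n} - (-X - β/2)^{-n}) / 2` by `X^{-k} ↦ b_{-k}`, and
`(b_{-k})^* = b_k`. Only odd `k` occur. -/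
def currentBr (n : ℕ) : Fock K →ₗ[K] Fock K :=
  opSum fun j : ℕ =>
    PowerSeries.coeff (2 * j + 1) (currentSeries β n) • current K ((2 * j + 1 : ℕ) : ℤ)

/-- `|λ⟩_q`: the product `φ^{[β]}_{λ₁} e^{-θ} ⋯ φ^{[β]}_{λ_r} e^{-θ} |0⟩`, with the sequence
`λ` extended by a final `0` when `r` is odd. -/
def ketq (lam : StrictPartition) : Fock K :=
  (if Even lam.length then lam.parts else lam.parts ++ [0]).foldr
    (fun n v => phiBr β (n : ℤ) (opExp (-theta β) v)) (vac K)

end Deformed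

section Symmetric

variable (K : Type*) [Field K]

open Classical in
/-- The power sum `p_n(x) = ∑ᵢ xᵢ^n`, `n ≥ 1`, in the variables `x₀, x₁, x₂, …`. -/
def psum (n : ℕ) : MvPowerSeries ℕ K :=
  fun d => if ∃ i, d = Finsupp.single i n then 1 else 0

variable {K}
variable (β : K)

/-- The deformed power sum `p^{[β]}_n(x) = p_n(x + β/2) - p_n(β/2)`. -/
def psumBr (n : ℕ) : MvPowerSeries ℕ K :=
  ∑ i ∈ Finset.Icc 1 n, ((n.choose i : K) * (β / 2) ^ (n - i)) • psum K i

/-- The algebra `gΓ = K[p^{[β]}_1, p^{[β]}_3, p^{[β]}_5, …]`. -/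
def gGamma : Subalgebra K (MvPowerSeries ℕ K) :=
  Algebra.adjoin K (Set.range fun j : ℕ => psumBr β (2 * j + 1))

/-- The Hamiltonian `ℋ^{[β]}(x) = 2 ∑_{n ≥ 1} (p_n(x) / n) b^{[β]}_n`, acting on the Fock space
with coefficients extended to power series in `x`. -/
def hamBr : (MvPowerSeries ℕ K ⊗[K] Fock K) →ₗ[K] (MvPowerSeries ℕ K ⊗[K] Fock K) :=
  opSum fun m : ℕ =>
    TensorProduct.map (LinearMap.mulLeft K (psum K (m + 1)))
      ((2 / ((m + 1 : ℕ) : K)) • currentBr β (m + 1))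

/-- The map `|v⟩ ↦ ⟨0| e^{ℋ^{[β]}(x)} |v⟩`. -/
def vevBr : Fock K →ₗ[K] MvPowerSeries ℕ K :=
  (TensorProduct.rid K (MvPowerSeries ℕ K)).toLinearMap ∘ₗ
    (bra0 K).lTensor (MvPowerSeries ℕ K) ∘ₗ
      opExp (hamBr β) ∘ₗ
        TensorProduct.mk K (MvPowerSeries ℕ K) (Fock K) 1

/-- The deformed boson-fermion correspondence `χ` on `ℱ_even`. -/
def chi : Feven K →ₗ[K] MvPowerSeries ℕ K := (vevBr β).domRestrict (Feven K)

/-! ### The `K`-theoretic `P`-functions -/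

/-- `a ⊕ b = a + b + β a b`. -/
def oplus {F : Type*} [Field F] (b x y : F) : F := x + y + b * x * y

/-- `a ⊖ b = (a - b) / (1 + β b)`. -/
def ominus {F : Type*} [Field F] (b x y : F) : F := (x - y) / (1 + b * y)

/-- The field of rational functions in `x₀, …, x_{n-1}`. -/
abbrev RatFun (K : Type*) [Field K] (n : ℕ) : Type _ := FractionRing (MvPolynomial (Fin n) K)

/-- The `K`-theoretic `P`-function in `n` variables,
`(1/(n-r)!) ∑_{w ∈ S_n} w (x₁^{λ₁} ⋯ x_r^{λ_r} ∏_{i ≤ r} ∏_{i < j ≤ n} (xᵢ ⊕ xⱼ)/(xᵢ ⊖ xⱼ))`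
for `r ≤ n`, and `0` for `r > n`, as a rational function. -/
def GPrat (lam : StrictPartition) (n : ℕ) : RatFun K n :=
  let b : RatFun K n := algebraMap (MvPolynomial (Fin n) K) _ (MvPolynomial.C β)
  let x : Fin n → RatFun K n := fun i => algebraMap (MvPolynomial (Fin n) K) _ (MvPolynomial.X i)
  if lam.length ≤ n then
    (((n - lam.length).factorial : RatFun K n))⁻¹ *
      ∑ w : Equiv.Perm (Fin n),
        ∏ i : Fin n,
          if (i : ℕ) < lam.length then
            x (w i) ^ (lam.parts.getD i 0) *
              ∏ j ∈ Finset.Ioi i, oplus b (x (w i)) (x (w j)) / ominus b (x (w i)) (x (w j))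
          else 1
  else 0

/-- The rational function `GPrat` is a polynomial; this is that polynomial, the unique
preimage of `GPrat` under the inclusion of polynomials into rational functions. -/
def GPpoly (lam : StrictPartition) (n : ℕ) : MvPolynomial (Fin n) K :=
  Function.invFun (algebraMap (MvPolynomial (Fin n) K) (RatFun K n)) (GPrat β lam n)

/-- `GP_λ(x)` in infinitely many variables `x₀, x₁, …`: the stable limit of the polynomials
in finitely many variables. The coefficient of a monomial is read off from the polynomial in
`x₀, …, x_{N-1}`, where these variables include all those of the monomial. -/
def GP (lam : StrictPartition) : MvPowerSeries ℕ K := fun d =>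
  let N := d.support.sup (fun i => i + 1)
  (GPpoly β lam N).coeff (d.comapDomain (Fin.val : Fin N → ℕ) Fin.val_injective.injOn)

/-! ### The Cauchy identity -/

/-- `∑ᵢ fᵢ = a` as formal power series: each coefficient of the finite partial sums is
eventually that of `a`. -/
def FormalHasSum {σ ι : Type*} (f : ι → MvPowerSeries σ K) (a : MvPowerSeries σ K) : Prop :=
  ∀ d, ∀ᶠ s : Finset ι in Filter.atTop,
    MvPowerSeries.coeff d (∑ i ∈ s, f i) = MvPowerSeries.coeff d a

/-- `∏ᵢ fᵢ = a` as formal power series: each coefficient of the finite partial products is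
eventually that of `a`. -/
def FormalHasProd {σ ι : Type*} (f : ι → MvPowerSeries σ K) (a : MvPowerSeries σ K) : Prop :=
  ∀ d, ∀ᶠ s : Finset ι in Filter.atTop,
    MvPowerSeries.coeff d (∏ i ∈ s, f i) = MvPowerSeries.coeff d a

/-- The factor `(1 - x̄ᵢ yⱼ) / (1 - xᵢ yⱼ)`, with `x̄ = -x / (1 + β x)`, as a power series in
the two sets of variables `xᵢ` (left summand) and `yⱼ` (right summand). -/
def cauchyFactor (ij : ℕ × ℕ) : MvPowerSeries (ℕ ⊕ ℕ) K :=
  let x : MvPowerSeries (ℕ ⊕ ℕ) K := MvPowerSeries.X (Sum.inl ij.1)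
  let y : MvPowerSeries (ℕ ⊕ ℕ) K := MvPowerSeries.X (Sum.inr ij.2)
  let xbar : MvPowerSeries (ℕ ⊕ ℕ) K := -x * (1 + MvPowerSeries.C β * x)⁻¹
  (1 - xbar * y) * (1 - x * y)⁻¹

/-- The family `g` satisfies the Cauchy identity
`∑_λ GP_λ(x) g_λ(y) = ∏_{i,j} (1 - x̄ᵢ yⱼ) / (1 - xᵢ yⱼ)`, which characterises the dual
`K`-theoretic `Q`-functions `gq_λ`. -/
def IsDualQ (g : StrictPartition → MvPowerSeries ℕ K) : Prop :=
  ∃ P : MvPowerSeries (ℕ ⊕ ℕ) K,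
    FormalHasProd (cauchyFactor β) P ∧
    FormalHasSum
      (fun lam => MvPowerSeries.rename (Function.Embedding.inl : ℕ ↪ ℕ ⊕ ℕ) (GP β lam) *
        MvPowerSeries.rename (Function.Embedding.inr : ℕ ↪ ℕ ⊕ ℕ) (g lam)) P

end Symmetric

end NeutralFermion

end

open scoped TensorProduct

noncomputable section

namespace NeutralFermion

/-! ### Locally finite sums of operators -/

section OpSum

variable {K M N : Type*} [Field K] [AddCommGroup M] [Module K M] [AddCommGroup N] [Module K N]
  {ι : Type*} {f : ι → M →ₗ[K] N}

/-! Over the ring of power series in `y`, the Cauchy kernel is `∏ₖ ω(xₖ)` for the single series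
`ω(x) = ∏ⱼ (1 - x̄yⱼ)/(1 - xyⱼ)`. For a family `f` of series, one for each finite set of variables,
let `L_λ(f)` with `r = ℓ(λ)` be the coefficient of `x₁^{λ₁} ⋯ x_r^{λ_r}` in `f(x₁, …, x_r) ∏_{i<j}
κᵢⱼ`, where `κᵢⱼ = (xᵢ ⊖ xⱼ)/(xᵢ ⊕ xⱼ)` is expanded for `xⱼ/xᵢ` small. This expansion is made
algebraic by putting `xᵢ = s₀ ⋯ sᵢ`: the ratio `xⱼ/xᵢ` becomes a monomial, and everything lives in
the ordinary power series ring in the `s`. Three facts give the theorem.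

First, `L_λ(∏ ω) = ⟨0|e^ℋ|λ⟩_q` (`vevBr_ketq`). If `⟨ℓ|` is killed by every `φ_n` with `n > 0`, then
`⟨ℓ|φ(z) = ⟨ℓ|φ₀ exp(-2 ∑ b_n z^{-n}/n)`, sum over odd `n`. Hence moving `φ(z)` to the left through
`exp(∑ τⱼ b_{2j+1})` produces the scalar `exp(∑ τⱼ z^{2j+1})` and a shift of the parameters `τ`
(`covX_phi`). The operator `e^{-θ}` is a further shift of `τ`. In the variable `Z` with `z = Z/(1 +
βZ/2)` the two shifts together multiply `ω(x)` by exactly `κ` for the pair `(Z, x)`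
(`omegaSer_nextPar`). Peeling off the fermions one by one therefore builds `∏ ω(xᵢ) ∏ κᵢⱼ`
(`coeff_omegaProd_cons`, `covX_ketFold`).

Second, `L_λ(GP_μ) = δ_{λμ}` (`coeff_gpKap`, `coeff_gpPoly_mul_kapProd`). The factors `(xᵢ ⊕ xⱼ)/(xᵢ
⊖ xⱼ)` in `GP_μ` cancel against `κ` up to units, and comparison of leading exponents leaves a single
term.

Third, the `L_λ` separate symmetric stable families with the cancellation property `f(x, t, t̄) =
f(x)` (`IsKSym.coeff_eq_zero`). The lowest form `h` of such a family, taken in the least number of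
variables where it is nonzero, vanishes at `xⱼ = -xᵢ` and at `xₖ = 0`. So `∏ xₖ ∏ (xᵢ + xⱼ)` divides
`h`, and multiplication by the kernel `∏ (xᵢ - xⱼ)/(xᵢ + xⱼ)` at `β = 0` gives a nonzero alternating
polynomial divisible by all `xₖ`; it has a nonzero coefficient at some strict partition
(`exists_coeff_ne_zero`).

Both `∏ ω` and `GP_λ` are such families (`isKSym_omegaFam`, `isKSym_gpSer`). Subtracting `∑
⟨0|e^ℋ|λ⟩_q GP_λ` over a finite set containing all `λ` of size at most `D` leaves nothing in degrees
up to `D`, which is the Cauchy identity (`isDualQ_vevBr`). Uniqueness needs only the second fact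
(`IsDualQ.unique`). Membership in `gΓ` holds because `ℋ` rewritten in the `b_{2j+1}` has only the
odd `p^{[β]}` as coefficients (`hamPar_eq_sum`, `vevBr_mem_gGamma`).

Exponentials are handled throughout by Euler's identity: in characteristic zero the degree operator
turns an exponential into a recursion with a unique solution (`covX_euler`, `covX_unique`,
`ode_unique`). -/

theorem opSum_apply (h : LocallyFinite f) (v : M) : opSum f v = ∑ᶠ i, f i v := by
  simp [opSum, h]

theorem opSum_eq_sum (h : LocallyFinite f) {v : M} {s : Finset ι} (hs : ∀ i ∉ s, f i v = 0) :
    opSum f v = ∑ i ∈ s, f i v := by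
  rw [opSum_apply h]
  refine finsum_eq_sum_of_support_subset _ fun i hi => ?_
  by_contra hn
  exact hi (hs i hn)

theorem opSum_mem {p : Submodule K N} {v : M} (h : ∀ i, f i v ∈ p) : opSum f v ∈ p := by
  by_cases hf : LocallyFinite f
  · rw [opSum_apply hf]
    exact finsum_induction (· ∈ p) p.zero_mem (fun _ _ => p.add_mem) h
  · simp [opSum, hf]

end OpSum

/-! ### Degree and parity on the Fock space -/

section Grading

variable (K : Type*) [Field K]

/-- The vector `φ_{n₁} ⋯ φ_{nₖ} |0⟩` for a list of nonnegative indices. -/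
def ketList (l : List ℕ) : Fock K := l.foldr (fun n w => phi K (n : ℤ) w) (vac K)

@[simp] theorem ketList_nil : ketList K [] = vac K := rfl

@[simp] theorem ketList_cons (n : ℕ) (l : List ℕ) :
    ketList K (n :: l) = phi K (n : ℤ) (ketList K l) := rfl

/-- The homogeneous component of degree `d` of the Fock space. -/
def Fdeg (d : ℤ) : Submodule K (Fock K) :=
  Submodule.span K {v | ∃ l : List ℕ, (l.sum : ℤ) = d ∧ v = ketList K l}

/-- The span of the `ketList l` with `l` of the given parity. -/
def Fpar (p : Prop) : Submodule K (Fock K) :=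
  Submodule.span K {v | ∃ l : List ℕ, (Even l.length ↔ p) ∧ v = ketList K l}

variable {K}

theorem ketList_mem_Fdeg (l : List ℕ) : ketList K l ∈ Fdeg K (l.sum : ℤ) :=
  Submodule.subset_span ⟨l, rfl, rfl⟩

theorem vac_mem_Fdeg : vac K ∈ Fdeg K 0 := ketList_mem_Fdeg []

/-- A negative mode is moved to the right through the anticommutators until it kills the vacuum.
Each contraction on the way deletes one factor of index `-m`, so the total degree and the change of
parity are as claimed. -/
theorem phi_ketList_mem (m : ℤ) (l : List ℕ) :
    phi K m (ketList K l) ∈ Submodule.span K {v | ∃ l' : List ℕ, (l'.sum : ℤ) = l.sum + m ∧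
      (Even l'.length ↔ ¬ Even l.length) ∧ v = ketList K l'} := by
  rcases le_or_gt 0 m with hm | hm
  · lift m to ℕ using hm
    refine Submodule.subset_span ⟨m :: l, ?_, ?_, rfl⟩
    · simp [add_comm]
    · simp [Nat.even_add_one]
  induction l with
  | nil =>
    have := phi_neg_vac K (-m) (by omega)
    rw [neg_neg] at this
    rw [ketList_nil, this]
    exact zero_mem _
  | cons n l ih =>
    have h := phi_anticomm K m n (ketList K l)
    rw [ketList_cons, eq_sub_of_add_eq h]
    refine Submodule.sub_mem _ ?_ ?_
    · split_ifs with h0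
      · refine Submodule.smul_mem _ _ (Submodule.subset_span ⟨l, ?_, ?_, rfl⟩)
        · simp only [List.sum_cons, Nat.cast_add]; omega
        · simp [Nat.even_add_one]
      · exact zero_mem _
    · refine Submodule.span_induction (p := fun x _ => phi K (n : ℤ) x ∈ Submodule.span K _)
        ?_ (by simp) (fun x y _ _ hx hy => by rw [map_add]; exact add_mem hx hy)
        (fun c x _ hx => by rw [map_smul]; exact Submodule.smul_mem _ _ hx) ih
      rintro _ ⟨l', h1, h2, rfl⟩
      refine Submodule.subset_span ⟨n :: l', ?_, ?_, rfl⟩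
      · simp only [List.sum_cons, Nat.cast_add]; omega
      · simp [Nat.even_add_one, h2]

theorem phi_mem_Fdeg {d : ℤ} {v : Fock K} (hv : v ∈ Fdeg K d) (m : ℤ) :
    phi K m v ∈ Fdeg K (d + m) := by
  refine Submodule.span_induction (p := fun x _ => phi K m x ∈ Fdeg K (d + m))
    ?_ (by simp) (fun x y _ _ hx hy => by rw [map_add]; exact add_mem hx hy)
    (fun c x _ hx => by rw [map_smul]; exact Submodule.smul_mem _ _ hx) hv
  rintro _ ⟨l, rfl, rfl⟩
  refine Submodule.span_mono ?_ (phi_ketList_mem m l)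
  rintro _ ⟨l', h1, -, rfl⟩
  exact ⟨l', h1, rfl⟩

theorem phi_mem_Fpar {p : Prop} {v : Fock K} (hv : v ∈ Fpar K p) (m : ℤ) :
    phi K m v ∈ Fpar K (¬ p) := by
  refine Submodule.span_induction (p := fun x _ => phi K m x ∈ Fpar K (¬ p))
    ?_ (by simp) (fun x y _ _ hx hy => by rw [map_add]; exact add_mem hx hy)
    (fun c x _ hx => by rw [map_smul]; exact Submodule.smul_mem _ _ hx) hv
  rintro _ ⟨l, hl, rfl⟩
  refine Submodule.span_mono ?_ (phi_ketList_mem m l)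
  rintro _ ⟨l', -, h2, rfl⟩
  exact ⟨l', by rw [h2, hl], rfl⟩

theorem Fdeg_of_neg {d : ℤ} (hd : d < 0) {v : Fock K} (hv : v ∈ Fdeg K d) : v = 0 := by
  have : {v | ∃ l : List ℕ, (l.sum : ℤ) = d ∧ v = ketList K l} = ∅ := by
    ext v
    simp only [Set.mem_ofPred_eq, Set.mem_empty_iff_false, iff_false]
    rintro ⟨l, h, -⟩
    omega
  rw [Fdeg, this, Submodule.span_empty] at hv
  exact hv

/-- Contraction against index zero is not itself a fermion mode, only a summand of `φ₀`; this
closure is what allows `wedge K 0` to be recovered from `φ₀` in `span_ketList`. -/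
theorem contract_zero_ketList_mem (l : List ℕ) :
    contract K 0 (ketList K l) ∈ Submodule.span K (Set.range (ketList K)) := by
  induction l with
  | nil => simp [contract, vac]
  | cons n l ih =>
    have hphi : ∀ x ∈ Submodule.span K (Set.range (ketList K)),
        phi K (n : ℤ) x ∈ Submodule.span K (Set.range (ketList K)) := fun x hx => by
      refine Submodule.span_induction (p := fun x _ => phi K n x ∈ Submodule.span K _)
        ?_ (by simp) (fun x y _ _ hx hy => by rw [map_add]; exact add_mem hx hy)
        (fun c x _ hx => by rw [map_smul]; exact Submodule.smul_mem _ _ hx) hx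
      rintro _ ⟨l, rfl⟩
      exact Submodule.subset_span ⟨n :: l, rfl⟩
    have hl : ketList K l ∈ Submodule.span K (Set.range (ketList K)) :=
      Submodule.subset_span ⟨l, rfl⟩
    have h1 := contract_wedge K 0 n (ketList K l)
    rw [ketList_cons]
    rcases Nat.eq_zero_or_pos n with rfl | hn
    · have h2 := contract_contract K 0 0 (ketList K l)
      -- The square of the contraction is added twice; it vanishes by `contract_contract`, and no
      -- division by two is needed.
      have : contract K 0 (phi K ((0 : ℕ) : ℤ) (ketList K l)) =
          ketList K l - phi K ((0 : ℕ) : ℤ) (contract K 0 (ketList K l)) +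
            (contract K 0 (contract K 0 (ketList K l)) +
              contract K 0 (contract K 0 (ketList K l))) := by
        simp only [Nat.cast_zero, phi_zero, LinearMap.add_apply, map_add]
        rw [if_pos rfl] at h1
        rw [eq_sub_of_add_eq h1]
        abel
      rw [this, h2, add_zero]
      exact sub_mem hl (hphi _ ih)
    · rw [phi_of_pos K (by exact_mod_cast hn)] at hphi ⊢
      simp only [Int.natAbs_natCast] at hphi ⊢
      rw [if_neg hn.ne] at h1
      rw [eq_neg_of_add_eq_zero_left h1]
      exact neg_mem (hphi _ ih)

/-- Wedges generate the exterior algebra from `1`, and each wedge preserves the span: it is a mode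
`φ_n` for `n > 0`, and `φ₀` minus a contraction for `n = 0`. -/
theorem span_ketList : Submodule.span K (Set.range (ketList K)) = ⊤ := by
  rw [eq_top_iff]
  rintro v -
  have hphi : ∀ (n : ℕ), ∀ x ∈ Submodule.span K (Set.range (ketList K)),
      phi K (n : ℤ) x ∈ Submodule.span K (Set.range (ketList K)) := fun n x hx => by
    refine Submodule.span_induction (p := fun x _ => phi K n x ∈ Submodule.span K _)
      ?_ (by simp) (fun x y _ _ hx hy => by rw [map_add]; exact add_mem hx hy)
      (fun c x _ hx => by rw [map_smul]; exact Submodule.smul_mem _ _ hx) hx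
    rintro _ ⟨l, rfl⟩
    exact Submodule.subset_span ⟨n :: l, rfl⟩
  have hcon : ∀ x ∈ Submodule.span K (Set.range (ketList K)),
      contract K 0 x ∈ Submodule.span K (Set.range (ketList K)) := fun x hx => by
    refine Submodule.span_induction (p := fun x _ => contract K 0 x ∈ Submodule.span K _)
      ?_ (by simp) (fun x y _ _ hx hy => by rw [map_add]; exact add_mem hx hy)
      (fun c x _ hx => by rw [map_smul]; exact Submodule.smul_mem _ _ hx) hx
    rintro _ ⟨l, rfl⟩
    exact contract_zero_ketList_mem l
  have hwedge : ∀ (n : ℕ), ∀ x ∈ Submodule.span K (Set.range (ketList K)),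
      wedge K n x ∈ Submodule.span K (Set.range (ketList K)) := fun n x hx => by
    rcases Nat.eq_zero_or_pos n with rfl | hn
    · have : wedge K 0 x = phi K ((0 : ℕ) : ℤ) x - contract K 0 x := by
        simp [phi_zero]
      rw [this]
      exact sub_mem (hphi 0 x hx) (hcon x hx)
    · have := hphi n x hx
      rwa [phi_of_pos K (by exact_mod_cast hn)] at this
  induction v using CliffordAlgebra.left_induction with
  | algebraMap r =>
    rw [Algebra.algebraMap_eq_smul_one]
    exact Submodule.smul_mem _ _ (Submodule.subset_span ⟨[], rfl⟩)
  | add x y hx hy => exact add_mem hx hy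
  | ι_mul x m hx =>
    induction m using Finsupp.induction_linear with
    | zero => simp
    | add f g hf hg => rw [map_add, add_mul]; exact add_mem hf hg
    | single n c =>
      have : (Finsupp.single n c : ℕ →₀ K) = c • Finsupp.single n 1 := by simp
      rw [this, map_smul, smul_mul_assoc]
      exact Submodule.smul_mem _ _ (hwedge n x hx)

theorem fock_induction {P : Fock K → Prop} (hl : ∀ l, P (ketList K l)) (h0 : P 0)
    (hadd : ∀ x y, P x → P y → P (x + y)) (hsmul : ∀ (c : K) x, P x → P (c • x)) (v : Fock K) :
    P v := by
  have : v ∈ Submodule.span K (Set.range (ketList K)) := by rw [span_ketList]; trivial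
  refine Submodule.span_induction (p := fun x _ => P x) ?_ h0 (fun x y _ _ => hadd x y)
    (fun c x _ => hsmul c x) this
  rintro _ ⟨l, rfl⟩
  exact hl l

theorem fock_ext {N : Type*} [AddCommGroup N] [Module K N] {f g : Fock K →ₗ[K] N}
    (h : ∀ l, f (ketList K l) = g (ketList K l)) : f = g := by
  refine LinearMap.ext fun v => ?_
  exact fock_induction (P := fun v => f v = g v) h (by simp)
    (fun x y hx hy => by simp [hx, hy]) (fun c x hx => by simp [hx]) v

theorem locallyFinite_of_Fdeg {N : Type*} [AddCommGroup N] [Module K N] {ι : Type*}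
    {f : ι → Fock K →ₗ[K] N}
    (h : ∀ d : ℕ, ∀ v ∈ Fdeg K d, (Function.support fun i => f i v).Finite) :
    LocallyFinite f := by
  refine fock_induction (fun l => h l.sum _ ?_) (by simp) (fun x y hx hy => ?_)
    (fun c x hx => ?_)
  · exact_mod_cast ketList_mem_Fdeg l
  · refine (hx.union hy).subset ?_
    simp only [map_add]
    exact Function.support_add _ _
  · refine hx.subset ?_
    simp only [map_smul]
    exact Function.support_const_smul_subset _ _

end Grading

/-! ### Currents and their commutators with the fermions -/

section Current

variable {K : Type*} [Field K]

theorem phi_eq_zero {d m : ℤ} {v : Fock K} (hv : v ∈ Fdeg K d) (h : d + m < 0) :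
    phi K m v = 0 :=
  Fdeg_of_neg h (phi_mem_Fdeg hv m)

theorem phi_phi_swap {m n : ℤ} (h : m + n ≠ 0) (v : Fock K) :
    phi K m (phi K n v) = - phi K n (phi K m v) := by
  have := phi_anticomm K m n v
  rw [if_neg h] at this
  exact eq_neg_of_add_eq_zero_left this

/-- For `n ≠ 0` the two modes anticommute, so whichever of them lowers the degree below zero may be
applied first. -/
theorem current_term_eq_zero {d n i : ℤ} (hn : n ≠ 0) {v : Fock K} (hv : v ∈ Fdeg K d)
    (hi : i < -d ∨ d - n < i) : phi K (-i - n) (phi K i v) = 0 := by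
  rcases hi with hi | hi
  · rw [phi_eq_zero hv (by omega), map_zero]
  · rw [phi_phi_swap (by omega), phi_eq_zero hv (m := -i - n) (by omega), map_zero, neg_zero]

theorem current_locallyFinite {n : ℤ} (hn : n ≠ 0) :
    LocallyFinite fun i : ℤ => ((1 / 4 : K) * (-1) ^ i) • (phi K (-i - n) ∘ₗ phi K i) := by
  refine locallyFinite_of_Fdeg fun d v hv => ?_
  refine (Set.finite_Icc (-d : ℤ) (d - n)).subset fun i hi => ?_
  by_contra hni
  refine hi ?_
  simp only [LinearMap.smul_apply, LinearMap.comp_apply]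
  rw [current_term_eq_zero hn hv, smul_zero]
  simp only [Set.mem_Icc] at hni
  omega

theorem current_apply {n d : ℤ} (hn : n ≠ 0) {v : Fock K} (hv : v ∈ Fdeg K d) {s : Finset ℤ}
    (hs : Finset.Icc (-d) (d - n) ⊆ s) :
    current K n v = ∑ i ∈ s, ((1 / 4 : K) * (-1) ^ i) • phi K (-i - n) (phi K i v) := by
  rw [current, opSum_eq_sum (current_locallyFinite hn) (s := s)]
  · rfl
  · intro i hi
    simp only [LinearMap.smul_apply, LinearMap.comp_apply]
    rw [current_term_eq_zero hn hv, smul_zero]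
    have : i ∉ Finset.Icc (-d) (d - n) := fun h => hi (hs h)
    simp only [Finset.mem_Icc] at this
    omega

theorem current_mem_Fdeg {n d : ℤ} {v : Fock K} (hv : v ∈ Fdeg K d) :
    current K n v ∈ Fdeg K (d - n) := by
  refine opSum_mem fun i => ?_
  refine Submodule.smul_mem _ _ ?_
  have := phi_mem_Fdeg (phi_mem_Fdeg hv i) (-i - n)
  rwa [show d + i + (-i - n) = d - n by ring] at this

theorem current_mem_Fpar {n : ℤ} {p : Prop} {v : Fock K} (hv : v ∈ Fpar K p) :
    current K n v ∈ Fpar K p := by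
  refine opSum_mem fun i => ?_
  refine Submodule.smul_mem _ _ ?_
  have := phi_mem_Fpar (phi_mem_Fpar hv i) (-i - n)
  simpa using this

theorem current_eq_zero {n d : ℤ} {v : Fock K} (hv : v ∈ Fdeg K d) (h : d < n) :
    current K n v = 0 :=
  Fdeg_of_neg (by omega) (current_mem_Fdeg hv)

theorem phi_phi_phi (a c m : ℤ) (v : Fock K) :
    phi K a (phi K c (phi K m v)) = phi K m (phi K a (phi K c v))
      + ((if c = -m then (2 * (-1 : K) ^ c) • phi K a v else 0)
      - (if a = -m then (2 * (-1 : K) ^ a) • phi K c v else 0)) := by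
  have h1 := phi_anticomm K c m v
  have h2 := phi_anticomm K a m (phi K c v)
  rw [eq_sub_of_add_eq h1, map_sub, eq_sub_of_add_eq h2]
  have e1 : c + m = 0 ↔ c = -m := by omega
  have e2 : a + m = 0 ↔ a = -m := by omega
  simp only [e1, e2, apply_ite (phi K a), map_smul, map_zero]
  abel

/-- `[b_n, φ_m] = φ_{m-n}` for odd `n`. -/
theorem current_phi [CharZero K] {n : ℤ} (hn : Odd n) (m : ℤ) (v : Fock K) :
    current K n (phi K m v) = phi K m (current K n v) + phi K (m - n) v := by
  have hn0 : n ≠ 0 := by rintro rfl; simp at hn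
  suffices h : current K n ∘ₗ phi K m = phi K m ∘ₗ current K n + phi K (m - n) from
    LinearMap.congr_fun h v
  refine fock_ext fun l => ?_
  have hv := ketList_mem_Fdeg (K := K) l
  generalize ketList K l = v at hv
  set d : ℤ := (l.sum : ℤ)
  -- One window of indices large enough for both occurrences of the current, so that the two sums
  -- can be subtracted term by term.
  set B : ℤ := |d| + |m| + |n|
  have hB : |d| + |m| + |n| = B := rfl
  have b1 := abs_nonneg d; have b2 := abs_nonneg m; have b3 := abs_nonneg n
  have c1 := abs_le.1 (le_refl |d|); have c2 := abs_le.1 (le_refl |m|)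
  have c3 := abs_le.1 (le_refl |n|)
  set s : Finset ℤ := Finset.Icc (-B) B with hs
  have hs1 : Finset.Icc (-d) (d - n) ⊆ s := Finset.Icc_subset_Icc (by omega) (by omega)
  have hs2 : Finset.Icc (-(d + m)) (d + m - n) ⊆ s :=
    Finset.Icc_subset_Icc (by omega) (by omega)
  have m1 : -m ∈ s := Finset.mem_Icc.2 ⟨by omega, by omega⟩
  have m2 : m - n ∈ s := Finset.mem_Icc.2 ⟨by omega, by omega⟩
  simp only [LinearMap.comp_apply, LinearMap.add_apply]
  rw [current_apply hn0 (phi_mem_Fdeg hv m) hs2, current_apply hn0 hv hs1, map_sum,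
    ← sub_eq_iff_eq_add', ← Finset.sum_sub_distrib]
  -- Only `i = -m` and `i = m - n` leave a contraction. Each contributes one half of `φ_{m-n}`, the
  -- second with the same sign as the first because `n` is odd.
  have key : ∀ i ∈ s, ((1 / 4 : K) * (-1) ^ i) • phi K (-i - n) (phi K i (phi K m v)) -
      phi K m (((1 / 4 : K) * (-1) ^ i) • phi K (-i - n) (phi K i v)) =
      (if i = -m then (1 / 2 : K) • phi K (m - n) v else 0) +
      (if i = m - n then (1 / 2 : K) • phi K (m - n) v else 0) := by
    intro i _
    rw [map_smul, ← smul_sub, phi_phi_phi, add_sub_cancel_left, smul_sub, sub_eq_add_neg]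
    congr 1
    · split_ifs with h
      · subst h
        rw [smul_smul]
        have : (1 / 4 : K) * (-1) ^ (-m) * (2 * (-1) ^ (-m)) = 1 / 2 := by
          have h2 : ((-1 : K) ^ (-m)) * (-1) ^ (-m) = 1 := by
            rw [← mul_zpow]; simp
          linear_combination (1 / 2 : K) * h2
        rw [this, neg_neg]
      · simp
    · have e : (-i - n = -m) ↔ i = m - n := by omega
      simp only [e]
      split_ifs with h
      · subst h
        have e2 : -(m - n) - n = -m := by ring
        rw [e2, smul_smul, ← neg_smul]
        congr 1
        have h2 : ((-1 : K) ^ (m - n)) * (-1) ^ (-m) = -1 := by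
          rw [← zpow_add₀ (by norm_num)]
          have : m - n + -m = -n := by ring
          rw [this, zpow_neg, hn.neg_one_zpow]; norm_num
        linear_combination (-1 / 2 : K) * h2
      · simp
  rw [Finset.sum_congr rfl key, Finset.sum_add_distrib, Finset.sum_ite_eq' s, Finset.sum_ite_eq' s,
    if_pos m1, if_pos m2, ← add_smul]
  norm_num

theorem current_vac {n : ℤ} (hn : 0 < n) : current K n (vac K) = 0 :=
  current_eq_zero vac_mem_Fdeg hn

/-- Both currents kill the vacuum, and commuting them past `φ_a` in either order produces the same
term `φ_{a-m-n}`; induction on the number of fermions finishes. -/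
theorem current_comm [CharZero K] {m n : ℤ} (hm : Odd m) (hn : Odd n) (hm0 : 0 < m) (hn0 : 0 < n)
    (v : Fock K) : current K m (current K n v) = current K n (current K m v) := by
  suffices h : current K m ∘ₗ current K n = current K n ∘ₗ current K m from
    LinearMap.congr_fun h v
  refine fock_ext fun l => ?_
  induction l with
  | nil => simp [current_vac hm0, current_vac hn0]
  | cons a l ih =>
    simp only [LinearMap.comp_apply] at ih
    simp only [LinearMap.comp_apply, ketList_cons, current_phi hm, current_phi hn, map_add, ih]
    rw [show (a : ℤ) - n - m = a - m - n by ring]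
    abel

end Current

/-! ### Exponentials of currents acting on covectors; Euler's identity -/

section CovectorExp

variable {K : Type*} [Field K]

variable (K) in
/-- The odd currents `b_{2j+1}`. -/
def cur (j : ℕ) : Fock K →ₗ[K] Fock K := current K ((2 * j + 1 : ℕ) : ℤ)

theorem cur_mem_Fdeg {d : ℤ} {v : Fock K} (hv : v ∈ Fdeg K d) (j : ℕ) :
    cur K j v ∈ Fdeg K (d - (2 * j + 1 : ℕ)) :=
  current_mem_Fdeg hv

theorem cur_eq_zero {d : ℤ} {v : Fock K} (hv : v ∈ Fdeg K d) {j : ℕ} (h : d ≤ j) :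
    cur K j v = 0 :=
  current_eq_zero hv (by push_cast; omega)

theorem odd_cast (j : ℕ) : Odd ((2 * j + 1 : ℕ) : ℤ) := by
  exact_mod_cast odd_two_mul_add_one j

theorem cur_phi [CharZero K] (j : ℕ) (m : ℤ) (v : Fock K) :
    cur K j (phi K m v) = phi K m (cur K j v) + phi K (m - (2 * j + 1 : ℕ)) v :=
  current_phi (odd_cast j) m v

theorem cur_comm [CharZero K] (i j : ℕ) (v : Fock K) :
    cur K i (cur K j v) = cur K j (cur K i v) :=
  current_comm (odd_cast i) (odd_cast j) (by positivity) (by positivity) v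

theorem locallyFinite_of_cur {N : Type*} [AddCommGroup N] [Module K N]
    (g : ℕ → Fock K →ₗ[K] N) : LocallyFinite fun j => g j ∘ₗ cur K j := by
  refine locallyFinite_of_Fdeg fun d v hv => (Set.finite_Iio d).subset fun j hj => ?_
  by_contra h
  refine hj ?_
  simp only [Set.mem_Iio, not_lt] at h
  simp [cur_eq_zero hv (by exact_mod_cast h : (d : ℤ) ≤ j)]

theorem Fdeg_ext {N : Type*} [AddCommGroup N] [Module K N] {f g : Fock K →ₗ[K] N}
    (h : ∀ (d : ℕ), ∀ v ∈ Fdeg K d, f v = g v) : f = g :=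
  fock_ext fun l => h l.sum _ (ketList_mem_Fdeg l)

variable {R : Type*} [CommRing R] [Algebra K R]

/-- The covector `∑ⱼ τⱼ ℓ b_{2j+1}`. -/
def covN (τ : ℕ → R) (l : Fock K →ₗ[K] R) : Fock K →ₗ[K] R :=
  opSum fun j => (LinearMap.mulLeft K (τ j) ∘ₗ l) ∘ₗ cur K j

theorem covN_apply (τ : ℕ → R) (l : Fock K →ₗ[K] R) {d : ℤ} {v : Fock K} (hv : v ∈ Fdeg K d)
    {M : ℕ} (hM : d ≤ M) : covN τ l v = ∑ j ∈ Finset.range M, τ j * l (cur K j v) := by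
  rw [covN, opSum_eq_sum (locallyFinite_of_cur _) (s := Finset.range M)]
  · rfl
  · intro j hj
    simp only [Finset.mem_range, not_lt] at hj
    simp [cur_eq_zero hv (by omega : d ≤ j)]

/-- The covector `ℓ exp(∑ⱼ τⱼ b_{2j+1})`. -/
def covX (τ : ℕ → R) (l : Fock K →ₗ[K] R) : Fock K →ₗ[K] R :=
  opSum fun k : ℕ => ((k.factorial : K)⁻¹) • (covN τ)^[k] l

theorem covN_iterate_eq_zero (τ : ℕ → R) (l : Fock K →ₗ[K] R) (k : ℕ) :
    ∀ {d : ℤ} {v : Fock K}, v ∈ Fdeg K d → d < k → (covN τ)^[k] l v = 0 := by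
  induction k with
  | zero =>
    intro d v hv hd
    rw [Fdeg_of_neg (by simpa using hd) hv, map_zero]
  | succ k ih =>
    intro d v hv hd
    rw [Function.iterate_succ_apply', covN_apply τ _ hv (M := k + 1) (by push_cast at *; omega)]
    refine Finset.sum_eq_zero fun j _ => ?_
    rw [ih (cur_mem_Fdeg hv j) (by push_cast at *; omega), mul_zero]

theorem covX_locallyFinite (τ : ℕ → R) (l : Fock K →ₗ[K] R) :
    LocallyFinite fun k : ℕ => ((k.factorial : K)⁻¹) • (covN τ)^[k] l := by
  refine locallyFinite_of_Fdeg fun d v hv => (Set.finite_Iic d).subset fun k hk => ?_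
  by_contra h
  refine hk ?_
  simp only [Set.mem_Iic, not_le] at h
  simp [covN_iterate_eq_zero τ l k hv (by exact_mod_cast h)]

theorem covX_apply (τ : ℕ → R) (l : Fock K →ₗ[K] R) {d : ℤ} {v : Fock K} (hv : v ∈ Fdeg K d)
    {M : ℕ} (hM : d < M) :
    covX τ l v = ∑ k ∈ Finset.range M, ((k.factorial : K)⁻¹) • (covN τ)^[k] l v := by
  rw [covX, opSum_eq_sum (covX_locallyFinite τ l) (s := Finset.range M)]
  · rfl
  · intro k hk
    simp only [Finset.mem_range, not_lt] at hk
    simp [covN_iterate_eq_zero τ l k hv (by omega)]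

theorem covX_of_deg_zero (τ : ℕ → R) (l : Fock K →ₗ[K] R) {v : Fock K} (hv : v ∈ Fdeg K 0) :
    covX τ l v = l v := by
  rw [covX_apply τ l hv (M := 1) (by simp)]
  simp

/-- The positive odd currents commute with one another. -/
theorem covN_comm [CharZero K] (τ σ : ℕ → R) (l : Fock K →ₗ[K] R) :
    covN τ (covN σ l) = covN σ (covN τ l) := by
  refine Fdeg_ext fun d v hv => ?_
  have hc : ∀ j, ((d : ℤ) - (2 * j + 1 : ℕ)) ≤ d := fun j => by push_cast; omega
  rw [covN_apply τ _ hv le_rfl, covN_apply σ _ hv le_rfl]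
  simp only [covN_apply σ l (cur_mem_Fdeg hv _) (hc _),
    covN_apply τ l (cur_mem_Fdeg hv _) (hc _), Finset.mul_sum]
  rw [Finset.sum_comm]
  refine Finset.sum_congr rfl fun i _ => Finset.sum_congr rfl fun j _ => ?_
  rw [cur_comm]
  ring

/-- The sequence `(2j+1) τⱼ`. -/
def eul (τ : ℕ → R) (j : ℕ) : R := ((2 * j + 1 : ℕ) : R) * τ j

/-- A covector supported in degree zero. -/
def DegZero (l : Fock K →ₗ[K] R) : Prop := ∀ d : ℤ, d ≠ 0 → ∀ v ∈ Fdeg K d, l v = 0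

theorem DegZero.euler {l : Fock K →ₗ[K] R} (hl : DegZero l) (d : ℤ) (v : Fock K)
    (hv : v ∈ Fdeg K d) : (d : R) * l v = covN 0 l v := by
  rw [covN_apply 0 l hv (M := d.toNat) (by omega)]
  by_cases h : d = 0
  · simp [h]
  · simp [hl d h v hv]

/-- Since `b_{2j+1}` lowers the degree by `2j+1`, commuting the degree operator past `∑ τⱼ b_{2j+1}`
yields `∑ (2j+1) τⱼ b_{2j+1}`; all these operators commute, so a power contributes its exponent as a
factor. -/
theorem covN_iterate_euler [CharZero K] (τ ρ : ℕ → R) {l : Fock K →ₗ[K] R}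
    (hl : ∀ (d : ℤ), ∀ v ∈ Fdeg K d, (d : R) * l v = covN ρ l v)
    (k : ℕ) : ∀ {d : ℤ} {v : Fock K}, v ∈ Fdeg K d →
      (d : R) * (covN τ)^[k + 1] l v = covN ρ ((covN τ)^[k + 1] l) v +
        (k + 1 : R) * covN (eul τ) ((covN τ)^[k] l) v := by
  induction k with
  | zero =>
    intro d v hv
    have hM : d ≤ d.toNat := by omega
    simp only [Function.iterate_zero, id, zero_add, Function.iterate_one, Nat.cast_zero, one_mul]
    rw [covN_comm, covN_apply _ _ hv hM, covN_apply _ _ hv hM, covN_apply _ _ hv hM,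
      Finset.mul_sum, ← Finset.sum_add_distrib]
    refine Finset.sum_congr rfl fun j _ => ?_
    have := hl _ _ (cur_mem_Fdeg hv j)
    rw [eul]
    push_cast at this ⊢
    linear_combination (τ j) * this
  | succ k ih =>
    intro d v hv
    have hM : d ≤ d.toNat := by omega
    have h1 : (d : R) * (covN τ)^[k + 1 + 1] l v =
        covN (eul τ) ((covN τ)^[k + 1] l) v + (covN τ (covN ρ ((covN τ)^[k + 1] l)) v +
          (k + 1 : R) * covN τ (covN (eul τ) ((covN τ)^[k] l)) v) := by
      rw [Function.iterate_succ_apply', covN_apply _ _ hv hM, covN_apply _ _ hv hM,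
        covN_apply _ _ hv hM, covN_apply _ _ hv hM, Finset.mul_sum, Finset.mul_sum,
        ← Finset.sum_add_distrib, ← Finset.sum_add_distrib]
      refine Finset.sum_congr rfl fun j _ => ?_
      have := ih (cur_mem_Fdeg hv j)
      rw [eul]
      push_cast at this ⊢
      linear_combination (τ j) * this
    rw [h1, covN_comm τ ρ, covN_comm τ (eul τ), ← Function.iterate_succ_apply' (covN τ),
      ← Function.iterate_succ_apply' (covN τ)]
    push_cast
    ring

/-- Summation of `covN_iterate_euler` with the weights `1/(k+1)!`. The parameter `ρ` lets `l` be an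
exponential already, which is what composing two exponentials requires. -/
theorem covX_euler_add [CharZero K] (τ ρ : ℕ → R) {l : Fock K →ₗ[K] R}
    (hl : ∀ (d : ℤ), ∀ v ∈ Fdeg K d, (d : R) * l v = covN ρ l v) {d : ℤ}
    {v : Fock K} (hv : v ∈ Fdeg K d) {M : ℕ} (hM : d ≤ M) :
    (d : R) * covX τ l v = ∑ j ∈ Finset.range M, (ρ j + eul τ j) * covX τ l (cur K j v) := by
  have hc : ∀ j, (d - (2 * j + 1 : ℕ)) < M := fun j => by push_cast; omega
  have hc' : ∀ j, (d - (2 * j + 1 : ℕ)) < (M + 1 : ℕ) := fun j => by push_cast; omega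
  have hf : ∀ k : ℕ, (((k + 1).factorial : K))⁻¹ * (k + 1) = ((k.factorial : K))⁻¹ := fun k => by
    have : ((k : K) + 1) ≠ 0 := by exact_mod_cast Nat.succ_ne_zero k
    have h2 : (k.factorial : K) ≠ 0 := by exact_mod_cast Nat.factorial_ne_zero k
    rw [Nat.factorial_succ]; push_cast; field_simp
  simp only [add_mul, Finset.sum_add_distrib]
  have h1 : ∀ k ∈ Finset.range M, (d : R) * ((((k + 1).factorial : K)⁻¹) • (covN τ)^[k + 1] l v) =
      ∑ j ∈ Finset.range M,
        ρ j * ((((k + 1).factorial : K)⁻¹) • (covN τ)^[k + 1] l (cur K j v)) +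
      ∑ j ∈ Finset.range M, eul τ j * (((k.factorial : K)⁻¹) • (covN τ)^[k] l (cur K j v)) := by
    intro k _
    rw [mul_smul_comm, covN_iterate_euler τ ρ hl k hv, covN_apply _ _ hv hM, covN_apply _ _ hv hM,
      smul_add]
    simp only [mul_smul_comm, ← Finset.smul_sum]
    rw [show ((k : R) + 1) = algebraMap K R (k + 1) by simp, ← Algebra.smul_def, smul_smul, hf]
  have h0 : (d : R) * (((Nat.factorial 0 : ℕ) : K)⁻¹ • (covN τ)^[0] l v) =
      ∑ j ∈ Finset.range M, ρ j *
        (((Nat.factorial 0 : ℕ) : K)⁻¹ • (covN τ)^[0] l (cur K j v)) := by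
    simp [hl d v hv, covN_apply _ _ hv hM]
  rw [covX_apply τ l hv (M := M + 1) (by push_cast; omega), Finset.sum_range_succ', mul_add,
    Finset.mul_sum, Finset.sum_congr rfl h1, h0, Finset.sum_add_distrib, add_right_comm]
  congr 1
  · rw [Finset.sum_comm, ← Finset.sum_add_distrib]
    refine Finset.sum_congr rfl fun j _ => ?_
    rw [covX_apply τ l (cur_mem_Fdeg hv j) (hc' j), Finset.sum_range_succ', mul_add,
      Finset.mul_sum]
  · rw [Finset.sum_comm]
    refine Finset.sum_congr rfl fun j _ => ?_
    rw [covX_apply τ l (cur_mem_Fdeg hv j) (hc j), Finset.mul_sum]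

theorem covX_euler [CharZero K] (τ : ℕ → R) {l : Fock K →ₗ[K] R} (hl : DegZero l) {d : ℤ}
    {v : Fock K} (hv : v ∈ Fdeg K d) {M : ℕ} (hM : d ≤ M) :
    (d : R) * covX τ l v = ∑ j ∈ Finset.range M, eul τ j * covX τ l (cur K j v) := by
  simpa using covX_euler_add τ 0 hl.euler hv hM

variable (K) in
theorem intCast_mul_cancel [CharZero K] {d : ℤ} (hd : d ≠ 0) {x y : R}
    (h : (d : R) * x = (d : R) * y) : x = y := by
  have hdK : (d : K) ≠ 0 := by exact_mod_cast hd
  rw [show (d : R) = algebraMap K R d by simp, ← Algebra.smul_def, ← Algebra.smul_def] at h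
  exact smul_right_injective R hdK h

/-- Strong induction on the degree. -/
theorem Fdeg_induction {P : Fock K → Prop}
    (h : ∀ d : ℕ, (∀ e : ℤ, e < d → ∀ v ∈ Fdeg K e, P v) → ∀ v ∈ Fdeg K d, P v)
    (h0 : P 0) : ∀ d : ℤ, ∀ v ∈ Fdeg K d, P v := by
  have key : ∀ n : ℕ, ∀ d : ℤ, d < n → ∀ v ∈ Fdeg K d, P v := by
    intro n
    induction n with
    | zero =>
      intro d hd v hv
      rw [Fdeg_of_neg (by simpa using hd) hv]
      exact h0
    | succ n ih =>
      intro d hd v hv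
      rcases lt_or_ge d n with hn | hn
      · exact ih d hn v hv
      · obtain rfl : d = n := by push_cast at hd; omega
        exact h n ih v hv
  exact fun d v hv => key (d.toNat + 1) d (by push_cast; omega) v hv

/-- Division by the positive degree `d` turns Euler's identity into a recursion on degree.
Additivity in `τ` and compatibility with algebra maps below are both obtained from this uniqueness.
-/
theorem covX_unique [CharZero K] (τ : ℕ → R) {l : Fock K →ₗ[K] R} (hl : DegZero l)
    {Y : Fock K →ₗ[K] R} (h0 : ∀ v ∈ Fdeg K 0, Y v = l v)
    (hY : ∀ d : ℕ, d ≠ 0 → ∀ v ∈ Fdeg K d,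
      (d : R) * Y v = ∑ j ∈ Finset.range d, eul τ j * Y (cur K j v)) :
    Y = covX τ l := by
  refine Fdeg_ext fun d v hv => ?_
  refine Fdeg_induction (P := fun v => Y v = covX τ l v) (fun d ih v hv => ?_) (by simp) d v hv
  rcases eq_or_ne d 0 with rfl | hd
  · rw [h0 v (by simpa using hv), covX_of_deg_zero _ _ (by simpa using hv)]
  · refine intCast_mul_cancel K (d := d) (by exact_mod_cast hd) ?_
    rw [covX_euler τ hl hv le_rfl, Int.cast_natCast, hY d hd v hv]
    refine Finset.sum_congr rfl fun j _ => ?_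
    rw [ih _ _ _ (cur_mem_Fdeg hv j)]
    push_cast; omega

theorem covX_covX [CharZero K] (τ σ : ℕ → R) {l : Fock K →ₗ[K] R} (hl : DegZero l) :
    covX σ (covX τ l) = covX (τ + σ) l := by
  refine covX_unique _ hl (fun v hv => ?_) fun d _ v hv => ?_
  · rw [covX_of_deg_zero _ _ hv, covX_of_deg_zero _ _ hv]
  · have := covX_euler_add σ (eul τ) (l := covX τ l) (fun d v hv => by
      rw [covX_euler τ hl hv (M := d.toNat) (by omega), covN_apply _ _ hv (M := d.toNat) (by omega)]) hv le_rfl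
    rw [Int.cast_natCast] at this
    rw [this]
    simp only [eul, Pi.add_apply, mul_add]

theorem DegZero.comp {R' : Type*} [CommRing R'] [Algebra K R'] {l : Fock K →ₗ[K] R}
    (hl : DegZero l) (f : R →ₗ[K] R') : DegZero (f ∘ₗ l) := fun d hd v hv => by
  simp [hl d hd v hv]

theorem map_covX [CharZero K] {R' : Type*} [CommRing R'] [Algebra K R'] (f : R →ₐ[K] R')
    (τ : ℕ → R) {l : Fock K →ₗ[K] R} (hl : DegZero l) (v : Fock K) :
    f (covX τ l v) = covX (fun j => f (τ j)) (f.toLinearMap ∘ₗ l) v := by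
  suffices h : f.toLinearMap ∘ₗ covX τ l = covX (fun j => f (τ j)) (f.toLinearMap ∘ₗ l) from
    LinearMap.congr_fun h v
  refine covX_unique _ (hl.comp _) (fun v hv => by simp [covX_of_deg_zero τ l hv])
    fun d _ v hv => ?_
  have := congrArg f (covX_euler τ hl hv le_rfl)
  simpa [eul, map_ofNat] using this

/-- Differentiating Euler's identity shows that both sides satisfy the same recursion on degree, the
double sums agreeing because the currents commute. -/
theorem derivation_covX [CharZero K] (δ : Derivation K R R) (τ : ℕ → R) {l : Fock K →ₗ[K] R}
    (hl : DegZero l) (hδ : ∀ v, δ (l v) = 0) : ∀ d : ℤ, ∀ v ∈ Fdeg K d, ∀ {M : ℕ}, d ≤ M →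
      δ (covX τ l v) = ∑ j ∈ Finset.range M, δ (τ j) * covX τ l (cur K j v) := by
  suffices h : δ.toLinearMap ∘ₗ covX τ l = covN (fun j => δ (τ j)) (covX τ l) by
    intro d v hv M hM
    rw [← covN_apply (fun j => δ (τ j)) (covX τ l) hv hM, ← h]
    rfl
  refine Fdeg_ext fun d v hv => ?_
  refine Fdeg_induction
    (P := fun v => (δ.toLinearMap ∘ₗ covX τ l) v = covN (fun j => δ (τ j)) (covX τ l) v)
    (fun d ih v hv => ?_) (by simp) d v hv
  rcases eq_or_ne d 0 with rfl | hd
  · rw [covN_apply (M := 0) _ _ hv le_rfl]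
    simp [covX_of_deg_zero τ l (by simpa using hv), hδ]
  · refine intCast_mul_cancel K (d := d) (by exact_mod_cast hd) ?_
    have hc : ∀ j, ((d : ℤ) - (2 * j + 1 : ℕ)) ≤ d := fun j => by push_cast; omega
    have e1 : ((d : ℤ) : R) * (δ.toLinearMap ∘ₗ covX τ l) v =
        ∑ j ∈ Finset.range d, (((2 * j + 1 : ℕ) : R) * δ (τ j) * covX τ l (cur K j v) +
          eul τ j * ∑ k ∈ Finset.range d, δ (τ k) * covX τ l (cur K k (cur K j v))) := by
      have := congrArg δ (covX_euler τ hl hv le_rfl)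
      simp only [Derivation.leibniz, smul_eq_mul, map_sum, Derivation.map_intCast, mul_zero,
        add_zero] at this
      change ((d : ℤ) : R) * δ (covX τ l v) = _
      rw [this]
      refine Finset.sum_congr rfl fun j _ => ?_
      have h2 := ih _ (by push_cast; omega) _ (cur_mem_Fdeg hv j)
      rw [covN_apply _ _ (cur_mem_Fdeg hv j) (hc j)] at h2
      change δ (covX τ l (cur K j v)) = _ at h2
      rw [h2, eul, Derivation.leibniz, Derivation.map_natCast]
      simp only [smul_eq_mul]
      ring
    have e2 : ((d : ℤ) : R) * covN (fun j => δ (τ j)) (covX τ l) v =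
        ∑ k ∈ Finset.range d, (((2 * k + 1 : ℕ) : R) * δ (τ k) * covX τ l (cur K k v) +
          δ (τ k) * ∑ j ∈ Finset.range d, eul τ j * covX τ l (cur K j (cur K k v))) := by
      rw [covN_apply _ _ hv le_rfl, Finset.mul_sum]
      refine Finset.sum_congr rfl fun k _ => ?_
      rw [← covX_euler τ hl (cur_mem_Fdeg hv k) (hc k)]
      push_cast; ring
    rw [e1, e2, Finset.sum_add_distrib, Finset.sum_add_distrib]
    congr 1
    simp only [Finset.mul_sum]
    rw [Finset.sum_comm]
    refine Finset.sum_congr rfl fun i _ => Finset.sum_congr rfl fun j _ => ?_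
    rw [cur_comm]
    ring

theorem covX_mem (S : Subalgebra K R) (τ : ℕ → R) (hτ : ∀ j, τ j ∈ S) {l : Fock K →ₗ[K] R}
    (hl : ∀ v, l v ∈ S) (v : Fock K) : covX τ l v ∈ S := by
  have key : ∀ (k : ℕ) (v : Fock K), (covN τ)^[k] l v ∈ S := by
    intro k
    induction k with
    | zero => exact hl
    | succ k ih =>
      intro v
      rw [Function.iterate_succ_apply']
      exact opSum_mem (p := Subalgebra.toSubmodule S) fun j => S.mul_mem (hτ j) (ih _)
  exact opSum_mem (p := Subalgebra.toSubmodule S) fun k => S.smul_mem (key k v) _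

end CovectorExp

/-! ### Covectors killed by creation modes -/

section Bosonization

variable {K : Type*} [Field K]

/-- A covector annihilated by all `φ_n`, `n > 0`. -/
def Ann (l : Fock K →ₗ[K] K) : Prop := ∀ n : ℤ, 0 < n → ∀ v, l (phi K n v) = 0

theorem ann_bra0 : Ann (bra0 K) := fun n hn v => bra0_phi K n hn v

/-- Each fermion peeled off replaces `⟨ℓ|` by `⟨ℓ|φ₀`, so the induction over the ket must run over
this class of covectors and not over the vacuum alone. -/
theorem Ann.comp_phi_zero {l : Fock K →ₗ[K] K} (hl : Ann l) : Ann (l ∘ₗ phi K 0) := by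
  intro n hn v
  rw [LinearMap.comp_apply, phi_phi_swap (by omega), map_neg, hl n hn, neg_zero]

theorem phi_zero_phi_zero [CharZero K] (v : Fock K) : phi K 0 (phi K 0 v) = v := by
  have := phi_anticomm K 0 0 v
  rw [if_pos (by simp), zpow_zero, mul_one, ← two_smul K] at this
  exact smul_right_injective _ (two_ne_zero : (2 : K) ≠ 0) this

theorem Ann.ketList_eq_zero (L : List ℕ) : ∀ {l : Fock K →ₗ[K] K}, Ann l → L.sum ≠ 0 →
    l (ketList K L) = 0 := by
  induction L with
  | nil => simp
  | cons n L ih =>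
    intro l hl hs
    rcases Nat.eq_zero_or_pos n with rfl | hn
    · exact ih hl.comp_phi_zero (by simpa using hs)
    · exact hl n (by exact_mod_cast hn) _

theorem Ann.degZero {l : Fock K →ₗ[K] K} (hl : Ann l) : DegZero l := by
  intro d hd v hv
  refine Submodule.span_induction (p := fun x _ => l x = 0)
    ?_ (by simp) (fun x y _ _ hx hy => by rw [map_add, hx, hy, add_zero])
    (fun c x _ hx => by rw [map_smul, hx, smul_zero]) hv
  rintro _ ⟨L, rfl, rfl⟩
  exact hl.ketList_eq_zero L (by exact_mod_cast hd)

/-- Of the infinite quadratic sum, the terms containing a creation mode disappear: that mode is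
brought to the left, where `l` kills it. What is left is a finite sum over pairs of nonpositive
modes. -/
theorem Ann.apply_cur {l : Fock K →ₗ[K] K} (hl : Ann l) (j : ℕ) {d : ℤ} {w : Fock K}
    (hw : w ∈ Fdeg K d) : l (cur K j w) = (1 / 4 : K) *
      ∑ p ∈ Finset.HasAntidiagonal.antidiagonal (2 * j + 1),
        (-1 : K) ^ p.2 * l (phi K (-(p.1 : ℤ)) (phi K (-(p.2 : ℤ)) w)) := by
  set n : ℕ := 2 * j + 1 with hn
  -- The first interval is where the current can act nontrivially on `w`; the second is where `l`
  -- can see it. The union allows passing from one to the other.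
  set s : Finset ℤ := Finset.Icc (-d) (d - n) ∪ Finset.Icc (-n : ℤ) 0
  rw [cur, current_apply (n := (n : ℤ)) (by positivity) hw (s := s) Finset.subset_union_left,
    map_sum, ← Finset.sum_subset (Finset.subset_union_right : Finset.Icc (-n : ℤ) 0 ⊆ s)]
  · rw [Finset.mul_sum]
    symm
    refine Finset.sum_nbij' (fun p => -(p.2 : ℤ)) (fun i => (((n : ℤ) + i).toNat, (-i).toNat))
      ?_ ?_ ?_ ?_ ?_
    · rintro ⟨p, q⟩ h
      simp only [Finset.HasAntidiagonal.mem_antidiagonal] at h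
      simp only [Finset.mem_Icc]; omega
    · intro i h
      simp only [Finset.mem_Icc] at h
      simp only [Finset.HasAntidiagonal.mem_antidiagonal]; omega
    · rintro ⟨p, q⟩ h
      simp only [Finset.HasAntidiagonal.mem_antidiagonal] at h
      simp only [Prod.mk.injEq]; omega
    · intro i h
      simp only [Finset.mem_Icc] at h
      simp only; omega
    · rintro ⟨p, q⟩ h
      simp only [Finset.HasAntidiagonal.mem_antidiagonal] at h
      simp only [map_smul, smul_eq_mul]
      rw [show -(-(q : ℤ)) - (n : ℤ) = -p by omega, zpow_neg, zpow_natCast, ← inv_pow]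
      norm_num [mul_assoc]
  · intro i _ hi
    simp only [Finset.mem_Icc, not_and_or, not_le] at hi
    rw [map_smul]
    rcases hi with hi | hi
    · rw [hl _ (by omega), smul_zero]
    · rw [phi_phi_swap (by omega), map_neg, hl _ hi, neg_zero, smul_zero]

/-- The triples `(p, q, s)` with `p + q + s = d` and `p + q` odd. -/
def oddTriples (d : ℕ) : Finset (ℕ × ℕ × ℕ) :=
  (Finset.range (d + 1) ×ˢ Finset.range (d + 1) ×ˢ Finset.range (d + 1)).filter
    fun t => t.1 + t.2.1 + t.2.2 = d ∧ (t.1 + t.2.1) % 2 = 1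

theorem mem_oddTriples {d p q s : ℕ} :
    (p, q, s) ∈ oddTriples d ↔ p + q + s = d ∧ (p + q) % 2 = 1 := by
  simp only [oddTriples, Finset.mem_filter, Finset.mem_product, Finset.mem_range]
  omega

/-- Nonpositive modes anticommute unless both indices are zero, so a suitable transposition of the
triple pairs terms of opposite sign; only the contribution of `φ₀² = 1` can survive. -/
theorem sum_oddTriples [CharZero K] {l : Fock K →ₗ[K] K} (d : ℕ) (v : Fock K) :
    ∑ t ∈ oddTriples d, (-1 : K) ^ t.2.1 *
      l (phi K (-(t.1 : ℤ)) (phi K (-(t.2.1 : ℤ)) (phi K (-(t.2.2 : ℤ)) v))) =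
      if d % 2 = 1 then 2 * l (phi K (-(d : ℤ)) v) else 0 := by
  set A : ℕ × ℕ × ℕ → K := fun t =>
    l (phi K (-(t.1 : ℤ)) (phi K (-(t.2.1 : ℤ)) (phi K (-(t.2.2 : ℤ)) v))) with hA
  set S1 := (oddTriples d).filter fun t => t.1 % 2 = 1 with hS1
  have mS1 : ∀ {p q s : ℕ}, (p, q, s) ∈ S1 ↔ p + q + s = d ∧ p % 2 = 1 ∧ q % 2 = 0 := by
    intro p q s
    rw [hS1, Finset.mem_filter, mem_oddTriples]
    simp only
    omega
  -- Exactly one of `p`, `q` is odd. Exchanging them costs a sign, which the factor `(-1)^q`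
  -- compensates, so the two cases contribute equally.
  have h2 : ∑ t ∈ oddTriples d, (-1 : K) ^ t.2.1 * A t = 2 * ∑ t ∈ S1, A t := by
    rw [← Finset.sum_filter_add_sum_filter_not (oddTriples d) (fun t => t.1 % 2 = 1), two_mul]
    congr 1
    · refine Finset.sum_congr rfl ?_
      rintro ⟨p, q, s⟩ h
      have := mS1.1 h
      simp only
      rw [Even.neg_one_pow (by rw [Nat.even_iff]; exact this.2.2), one_mul]
    · refine Finset.sum_nbij' (fun t => (t.2.1, t.1, t.2.2)) (fun t => (t.2.1, t.1, t.2.2))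
        ?_ ?_ (fun _ _ => rfl) (fun _ _ => rfl) ?_
      · rintro ⟨p, q, s⟩ h
        rw [Finset.mem_filter, mem_oddTriples] at h
        simp only at h
        refine mS1.2 ?_; dsimp only; omega
      · rintro ⟨p, q, s⟩ h
        rw [mS1] at h
        rw [Finset.mem_filter, mem_oddTriples]
        simp only; omega
      · rintro ⟨p, q, s⟩ h
        rw [Finset.mem_filter, mem_oddTriples] at h
        simp only at h
        simp only [hA]
        rw [Odd.neg_one_pow (by rw [Nat.odd_iff]; omega), phi_phi_swap (by omega), map_neg]
        ring
  rw [h2]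
  split_ifs with hd
  -- For `d` odd, `q` and `s` are both even and may be exchanged; the pairs cancel except at `(d, 0,
  -- 0)`.
  · have h3 : ∑ t ∈ S1, A t = ∑ t ∈ S1, A (t.1, t.2.2, t.2.1) := by
      refine Finset.sum_nbij' (fun t => (t.1, t.2.2, t.2.1)) (fun t => (t.1, t.2.2, t.2.1))
        ?_ ?_ (fun _ _ => rfl) (fun _ _ => rfl) (fun _ _ => rfl)
      · rintro ⟨p, q, s⟩ h
        have h := mS1.1 h; refine mS1.2 ?_; dsimp only; omega
      · rintro ⟨p, q, s⟩ h
        have h := mS1.1 h; refine mS1.2 ?_; dsimp only; omega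
    have h4 : ∑ t ∈ S1, A t + ∑ t ∈ S1, A (t.1, t.2.2, t.2.1) = 2 * l (phi K (-(d : ℤ)) v) := by
      rw [← Finset.sum_add_distrib, Finset.sum_eq_single_of_mem (d, 0, 0)]
      · simp [hA, phi_zero_phi_zero, two_mul]
      · rw [mS1]; omega
      · rintro ⟨p, q, s⟩ h hne
        have h' := mS1.1 h
        have hqs : q + s ≠ 0 := fun h0 => hne (by simp only [Prod.mk.injEq]; omega)
        simp only [hA]
        rw [phi_phi_swap (m := -(q : ℤ)) (n := -(s : ℤ)) (by omega), map_neg, map_neg,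
          neg_add_cancel]
    rw [← h3] at h4
    linear_combination h4
  -- For `d` even, `p` and `s` are both odd. Reversing the triple takes three anticommutations,
  -- hence a sign, and everything cancels.
  · have h3 : ∑ t ∈ S1, A t = ∑ t ∈ S1, A (t.2.2, t.2.1, t.1) := by
      refine Finset.sum_nbij' (fun t => (t.2.2, t.2.1, t.1)) (fun t => (t.2.2, t.2.1, t.1))
        ?_ ?_ (fun _ _ => rfl) (fun _ _ => rfl) (fun _ _ => rfl)
      · rintro ⟨p, q, s⟩ h
        have h := mS1.1 h; refine mS1.2 ?_; dsimp only; omega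
      · rintro ⟨p, q, s⟩ h
        have h := mS1.1 h; refine mS1.2 ?_; dsimp only; omega
    have h4 : ∑ t ∈ S1, A t + ∑ t ∈ S1, A (t.2.2, t.2.1, t.1) = 0 := by
      rw [← Finset.sum_add_distrib]
      refine Finset.sum_eq_zero ?_
      rintro ⟨p, q, s⟩ h
      have h' := mS1.1 h
      simp only [hA]
      rw [phi_phi_swap (m := -(p : ℤ)) (n := -(q : ℤ)) (by omega),
        phi_phi_swap (m := -(p : ℤ)) (n := -(s : ℤ)) (by omega)]
      simp only [map_neg]
      rw [phi_phi_swap (m := -(q : ℤ)) (n := -(s : ℤ)) (by omega)]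
      simp
    rw [← h3] at h4
    linear_combination h4

/-- The recursion for `⟨ℓ| φ_{-d}` equivalent to
`⟨ℓ| ∑ₖ φ_{-k} u^k = ⟨ℓ| φ₀ exp(-2 ∑ₙ b_n u^n / n)`. -/
theorem Ann.euler_phi [CharZero K] {l : Fock K →ₗ[K] K} (hl : Ann l) (d : ℕ) {v : Fock K}
    (hv : v ∈ Fdeg K d) : (d : K) * l (phi K (-(d : ℤ)) v) =
      -2 * ∑ j ∈ Finset.range d, l (phi K ((2 * j + 1 : ℕ) - (d : ℤ)) (cur K j v)) := by
  set y := l (phi K (-(d : ℤ)) v) with hy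
  set J := (Finset.range d).filter fun j => 2 * j + 1 ≤ d with hJ
  have hcard : J.card = (d + 1) / 2 := by
    have : J = Finset.range ((d + 1) / 2) := by
      ext j; simp only [hJ, Finset.mem_filter, Finset.mem_range]; omega
    rw [this, Finset.card_range]
  -- Moving the current to the left of the mode makes it quadratic under `l` and costs one copy of
  -- `y` for each `j`.
  have h1 : ∑ j ∈ Finset.range d, l (phi K ((2 * j + 1 : ℕ) - (d : ℤ)) (cur K j v)) =
      ∑ j ∈ J, ((1 / 4 : K) * ∑ p ∈ Finset.HasAntidiagonal.antidiagonal (2 * j + 1),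
        (-1 : K) ^ p.2 * l (phi K (-(p.1 : ℤ)) (phi K (-(p.2 : ℤ))
          (phi K (-((d - (2 * j + 1) : ℕ) : ℤ)) v))) - y) := by
    rw [hJ, Finset.sum_filter]
    refine Finset.sum_congr rfl fun j _ => ?_
    split_ifs with h
    · have e : ((2 * j + 1 : ℕ) - (d : ℤ)) = -((d - (2 * j + 1) : ℕ) : ℤ) := by omega
      rw [e, ← hl.apply_cur j (phi_mem_Fdeg hv _), cur_phi, map_add, hy,
        show -((d - (2 * j + 1) : ℕ) : ℤ) - (2 * j + 1 : ℕ) = -(d : ℤ) by omega]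
      ring
    · have := current_eq_zero (n := ((2 * j + 1 : ℕ) : ℤ)) hv (by omega)
      rw [cur, this, map_zero, map_zero]
  have h2 : ∑ j ∈ J, ∑ p ∈ Finset.HasAntidiagonal.antidiagonal (2 * j + 1),
        (-1 : K) ^ p.2 * l (phi K (-(p.1 : ℤ)) (phi K (-(p.2 : ℤ))
          (phi K (-((d - (2 * j + 1) : ℕ) : ℤ)) v))) =
      ∑ t ∈ oddTriples d, (-1 : K) ^ t.2.1 *
        l (phi K (-(t.1 : ℤ)) (phi K (-(t.2.1 : ℤ)) (phi K (-(t.2.2 : ℤ)) v))) := by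
    rw [Finset.sum_sigma']
    refine Finset.sum_nbij' (fun x => (x.2.1, x.2.2, d - (2 * x.1 + 1)))
      (fun t => ⟨(t.1 + t.2.1) / 2, (t.1, t.2.1)⟩) ?_ ?_ ?_ ?_ ?_
    · rintro ⟨j, p, q⟩ h
      simp only [Finset.mem_sigma, Finset.HasAntidiagonal.mem_antidiagonal, hJ, Finset.mem_filter,
        Finset.mem_range] at h
      refine mem_oddTriples.2 ?_; dsimp only; omega
    · rintro ⟨p, q, s⟩ h
      rw [mem_oddTriples] at h
      simp only [Finset.mem_sigma, Finset.HasAntidiagonal.mem_antidiagonal, hJ, Finset.mem_filter,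
        Finset.mem_range]
      omega
    · rintro ⟨j, p, q⟩ h
      simp only [Finset.mem_sigma, Finset.HasAntidiagonal.mem_antidiagonal, hJ, Finset.mem_filter,
        Finset.mem_range] at h
      simp only [Sigma.mk.injEq, heq_eq_eq, and_true]; omega
    · rintro ⟨p, q, s⟩ h
      rw [mem_oddTriples] at h
      simp only [Prod.mk.injEq, true_and]; omega
    · rintro ⟨j, p, q⟩ h
      rfl
  rw [h1, Finset.sum_sub_distrib, ← Finset.mul_sum, h2, sum_oddTriples, Finset.sum_const, hcard,
    nsmul_eq_mul, ← hy]
  -- The copies of `y` number `(d+1)/2`, rounded down. For odd `d` the surviving triple removes one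
  -- half of a copy, so the total is `d/2` in both parities.
  split_ifs with hd
  · have : (d : K) + 1 = 2 * ((d + 1) / 2 : ℕ) := by
      have : d + 1 = 2 * ((d + 1) / 2) := by omega
      exact_mod_cast this
    linear_combination y * this
  · have : (d : K) = 2 * ((d + 1) / 2 : ℕ) := by
      have : d = 2 * ((d + 1) / 2) := by omega
      exact_mod_cast this
    linear_combination y * this

end Bosonization

/-! ### The action of a fermion in the bosonic picture -/

section VertexOperator

variable (K : Type*) [Field K] {R : Type*} [CommRing R] [Algebra K R]

/-- The coefficients of `exp(∑ⱼ τⱼ z^{2j+1})`. -/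
def expCoeff (τ : ℕ → R) : ℕ → R
  | 0 => 1
  | k + 1 => ((k + 1 : K)⁻¹) • ∑ j : Fin (k / 2 + 1), eul τ j * expCoeff τ (k - 2 * j)

/-- The power series `exp(∑ⱼ τⱼ z^{2j+1})`. -/
def expSeries (τ : ℕ → R) : PowerSeries R := PowerSeries.mk (expCoeff K τ)

/-- The coefficients of `exp(∑ⱼ τⱼ z^{2j+1})`, extended by zero to negative indices. -/
def expCoeffInt (τ : ℕ → R) (k : ℤ) : R := if k < 0 then 0 else expCoeff K τ k.toNat

variable {K}

theorem expCoeff_zero (τ : ℕ → R) : expCoeff K τ 0 = 1 := by rw [expCoeff]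

theorem expCoeffInt_of_neg (τ : ℕ → R) {k : ℤ} (hk : k < 0) : expCoeffInt K τ k = 0 := if_pos hk

@[simp] theorem expCoeffInt_natCast (τ : ℕ → R) (k : ℕ) :
    expCoeffInt K τ k = expCoeff K τ k := by
  simp [expCoeffInt]

theorem expCoeffInt_euler [CharZero K] (τ : ℕ → R) (k : ℤ) {M : ℕ} (hM : k ≤ M) :
    (k : R) * expCoeffInt K τ k =
      ∑ j ∈ Finset.range M, eul τ j * expCoeffInt K τ (k - (2 * j + 1 : ℕ)) := by
  rcases lt_or_ge k 1 with hk | hk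
  · rw [Finset.sum_eq_zero fun j _ => by
      rw [expCoeffInt_of_neg τ (by push_cast; omega), mul_zero]]
    rcases lt_or_eq_of_le (show k ≤ 0 by omega) with h | rfl
    · rw [expCoeffInt_of_neg τ h, mul_zero]
    · simp
  · obtain ⟨n, rfl⟩ : ∃ n : ℕ, k = (n + 1 : ℕ) := ⟨(k - 1).toNat, by omega⟩
    have hn : ((n : K) + 1) ≠ 0 := by exact_mod_cast Nat.succ_ne_zero n
    rw [expCoeffInt_natCast, expCoeff, Fin.sum_univ_eq_sum_range
      (fun j => eul τ j * expCoeff K τ (n - 2 * j)), mul_smul_comm,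
      show (((n + 1 : ℕ) : ℤ) : R) = algebraMap K R (n + 1) by simp, ← Algebra.smul_def, smul_smul,
      inv_mul_cancel₀ hn, one_smul]
    have hsub : Finset.range (n / 2 + 1) ⊆ Finset.range M := by
      refine Finset.range_subset_range.2 ?_
      push_cast at hM
      omega
    rw [← Finset.sum_subset hsub]
    · refine Finset.sum_congr rfl fun j hj => ?_
      rw [Finset.mem_range] at hj
      rw [show ((n + 1 : ℕ) : ℤ) - (2 * j + 1 : ℕ) = (n - 2 * j : ℕ) by omega,
        expCoeffInt_natCast]
    · intro j _ hj
      rw [Finset.mem_range] at hj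
      rw [expCoeffInt_of_neg τ (by push_cast; omega), mul_zero]

variable (K) in
/-- The functional `P ↦ [z^m] (q(z) P(z⁻¹))` on polynomials, where
`q(z) = exp(∑ⱼ τⱼ z^{2j+1})`. -/
def extr (τ : ℕ → R) (m : ℤ) : Polynomial R →ₗ[R] R :=
  Polynomial.lsum fun p => LinearMap.mulLeft R (expCoeffInt K τ (m + p))

theorem extr_monomial (τ : ℕ → R) (m : ℤ) (p : ℕ) (c : R) :
    extr K τ m (Polynomial.monomial p c) = expCoeffInt K τ (m + p) * c := by
  simp [extr, Polynomial.lsum_apply, Polynomial.sum_monomial_index]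

theorem extr_apply (τ : ℕ → R) (m : ℤ) {P : Polynomial R} {D : ℕ} (hD : P.natDegree < D) :
    extr K τ m P = ∑ p ∈ Finset.range D, expCoeffInt K τ (m + p) * P.coeff p := by
  rw [extr, Polynomial.lsum_apply, Polynomial.sum_over_range' P _ D hD]
  · rfl
  · simp

theorem extr_C_mul (τ : ℕ → R) (m : ℤ) (c : R) (P : Polynomial R) :
    extr K τ m (Polynomial.C c * P) = c * extr K τ m P := by
  rw [← Polynomial.smul_eq_C_mul, map_smul, smul_eq_mul]

/-- This is `z d/dz` applied to `q(z) P(z⁻¹)`, read off at `z^m`: the derivative of `P(z⁻¹)` enters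
with a minus sign and has been moved to the left. -/
theorem extr_euler [CharZero K] (τ : ℕ → R) (m : ℤ) {P : Polynomial R} {D M : ℕ}
    (hD : P.natDegree ≤ D) (hM : m + D ≤ M) :
    (m : R) * extr K τ m P + extr K τ m (Polynomial.X * Polynomial.derivative P) =
      ∑ j ∈ Finset.range M, eul τ j * extr K τ (m - (2 * j + 1 : ℕ)) P := by
  have hPD : P.natDegree < D + 1 := by omega
  have h2 : (Polynomial.X * Polynomial.derivative P).natDegree < D + 1 := by
    refine Nat.lt_succ_of_le ?_
    rw [Polynomial.natDegree_le_iff_coeff_eq_zero]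
    intro N hN
    obtain ⟨N, rfl⟩ : ∃ n, N = n + 1 := ⟨N - 1, by omega⟩
    rw [Polynomial.coeff_X_mul, Polynomial.coeff_derivative,
      Polynomial.coeff_eq_zero_of_natDegree_lt (by omega), zero_mul]
  simp only [extr_apply τ _ hPD, extr_apply τ _ h2, Finset.mul_sum]
  rw [Finset.sum_comm, ← Finset.sum_add_distrib]
  refine Finset.sum_congr rfl fun p hp => ?_
  rw [Finset.mem_range] at hp
  have := expCoeffInt_euler (K := K) τ (m + p) (M := M) (by omega)
  have hX : (Polynomial.X * Polynomial.derivative P).coeff p = p * P.coeff p := by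
    cases p with
    | zero => simp
    | succ p => rw [Polynomial.coeff_X_mul, Polynomial.coeff_derivative]; push_cast; ring
  rw [hX]
  have h3 : ∀ j : ℕ, m - ((2 * j + 1 : ℕ) : ℤ) + p = m + p - (2 * j + 1 : ℕ) := fun j => by ring
  simp only [h3, ← mul_assoc, ← Finset.sum_mul]
  rw [← this]
  push_cast
  ring

variable (R) in
/-- A covector with values in `K`, viewed with values in the `K`-algebra `R`. -/
def liftCov (l : Fock K →ₗ[K] K) : Fock K →ₗ[K] R := Algebra.linearMap K R ∘ₗ l

theorem liftCov_apply (l : Fock K →ₗ[K] K) (v : Fock K) :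
    liftCov R l v = algebraMap K R (l v) := rfl

theorem Ann.liftCov_degZero {l : Fock K →ₗ[K] K} (hl : Ann l) : DegZero (liftCov R l) :=
  hl.degZero.comp _

variable (K) in
/-- The parameters `τⱼ - 2 u^{2j+1} / (2j+1)`. -/
def shiftPar (τ : ℕ → R) (u : R) (j : ℕ) : R :=
  τ j - algebraMap K R (2 / (2 * j + 1 : ℕ)) * u ^ (2 * j + 1)

theorem algebraMap_two_div [CharZero K] (j : ℕ) :
    ((2 * j + 1 : ℕ) : R) * algebraMap K R (2 / (2 * j + 1 : ℕ)) = 2 := by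
  have h : ((2 * j + 1 : ℕ) : K) ≠ 0 := by exact_mod_cast Nat.succ_ne_zero (2 * j)
  rw [← map_natCast (algebraMap K R), ← map_mul, mul_div_cancel₀ _ h, map_ofNat]

theorem eul_shiftPar [CharZero K] (τ : ℕ → R) (u : R) (j : ℕ) :
    eul (shiftPar K τ u) j = eul τ j - 2 * u ^ (2 * j + 1) := by
  rw [eul, shiftPar, eul, mul_sub, ← mul_assoc, algebraMap_two_div]

/-- The polynomial in `u` with value `⟨ℓ| exp(∑ⱼ (τⱼ - 2 u^{2j+1}/(2j+1)) b_{2j+1}) |v⟩`. -/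
def shiftPoly (τ : ℕ → R) (l : Fock K →ₗ[K] K) : Fock K →ₗ[K] Polynomial R :=
  covX (shiftPar K (fun j => Polynomial.C (τ j)) Polynomial.X) (liftCov (Polynomial R) l)

theorem eul_C (τ : ℕ → R) (j : ℕ) :
    eul (fun j => Polynomial.C (τ j)) j = Polynomial.C (eul τ j) := by
  simp [eul, map_ofNat]

theorem shiftPoly_euler [CharZero K] (τ : ℕ → R) {l : Fock K →ₗ[K] K} (hl : Ann l) {d : ℤ}
    {v : Fock K} (hv : v ∈ Fdeg K d) {M : ℕ} (hM : d ≤ M) :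
    (d : Polynomial R) * shiftPoly τ l v = ∑ j ∈ Finset.range M,
      (Polynomial.C (eul τ j) - 2 * Polynomial.X ^ (2 * j + 1)) * shiftPoly τ l (cur K j v) := by
  simpa only [eul_shiftPar, eul_C, shiftPoly] using
    covX_euler (shiftPar K (fun j => Polynomial.C (τ j)) Polynomial.X)
      (hl.liftCov_degZero (R := Polynomial R)) hv hM

theorem shiftPoly_derivative [CharZero K] (τ : ℕ → R) {l : Fock K →ₗ[K] K} (hl : Ann l) {d : ℤ}
    {v : Fock K} (hv : v ∈ Fdeg K d) {M : ℕ} (hM : d ≤ M) :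
    Polynomial.X * Polynomial.derivative (shiftPoly τ l v) = ∑ j ∈ Finset.range M,
      (- 2 * Polynomial.X ^ (2 * j + 1)) * shiftPoly τ l (cur K j v) := by
  let δ : Derivation K (Polynomial R) (Polynomial R) :=
    ((Polynomial.X : Polynomial R) • Polynomial.derivative' (R := R)).restrictScalars K
  have hδ : ∀ P, δ P = Polynomial.X * Polynomial.derivative P := fun P => rfl
  have := derivation_covX δ (shiftPar K (fun j => Polynomial.C (τ j)) Polynomial.X)
    (hl.liftCov_degZero (R := Polynomial R)) (fun v => by
      rw [liftCov_apply]; exact δ.map_algebraMap _) d v hv hM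
  rw [hδ] at this
  rw [shiftPoly, this]
  refine Finset.sum_congr rfl fun j _ => ?_
  congr 1
  rw [hδ, shiftPar]
  have e : algebraMap K (Polynomial R) (2 / (2 * j + 1 : ℕ)) =
      Polynomial.C (algebraMap K R (2 / (2 * j + 1 : ℕ))) := rfl
  have h2 := algebraMap_two_div (K := K) (R := R) j
  rw [e, Polynomial.derivative_sub, Polynomial.derivative_C, Polynomial.derivative_C_mul,
    Polynomial.derivative_X_pow, zero_sub, Nat.add_sub_cancel]
  have h3 : (Polynomial.C (algebraMap K R (2 / (2 * j + 1 : ℕ))) : Polynomial R) *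
      Polynomial.C (((2 * j + 1 : ℕ) : R)) = 2 := by
    rw [← Polynomial.C_mul, mul_comm, h2]; rfl
  linear_combination (-Polynomial.X ^ (2 * j + 1)) * h3

theorem Fdeg_induction_deg {P : ℤ → Fock K → Prop}
    (h : ∀ d : ℕ, (∀ e : ℤ, e < d → ∀ v ∈ Fdeg K e, P e v) → ∀ v ∈ Fdeg K d, P d v)
    (h0 : ∀ d, P d 0) : ∀ d : ℤ, ∀ v ∈ Fdeg K d, P d v := by
  have key : ∀ n : ℕ, ∀ d : ℤ, d < n → ∀ v ∈ Fdeg K d, P d v := by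
    intro n
    induction n with
    | zero =>
      intro d hd v hv
      rw [Fdeg_of_neg (by simpa using hd) hv]
      exact h0 d
    | succ n ih =>
      intro d hd v hv
      rcases lt_or_ge d n with hn | hn
      · exact ih d hn v hv
      · obtain rfl : d = n := by push_cast at hd; omega
        exact h n ih v hv
  exact fun d v hv => key (d.toNat + 1) d (by push_cast; omega) v hv

/-- Every factor `u^{2j+1}` comes with a current lowering the degree by `2j+1`, so the degree in `u`
cannot exceed that of the vector. -/
theorem shiftPoly_coeff_eq_zero [CharZero K] (τ : ℕ → R) {l : Fock K →ₗ[K] K} (hl : Ann l) :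
    ∀ d : ℤ, ∀ v ∈ Fdeg K d, ∀ p : ℕ, d < p → (shiftPoly τ l v).coeff p = 0 := by
  refine Fdeg_induction_deg (fun d ih v hv p hp => ?_) (by simp)
  rcases Nat.eq_zero_or_pos d with rfl | hd
  · rw [shiftPoly, covX_of_deg_zero _ _ (by simpa using hv), liftCov_apply,
      Polynomial.algebraMap_apply, Polynomial.coeff_C, if_neg (by rintro rfl; simp at hp)]
  · refine intCast_mul_cancel K (d := d) (by exact_mod_cast hd.ne') ?_
    have := congrArg (fun Q => Polynomial.coeff Q p) (shiftPoly_euler τ hl hv le_rfl)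
    simp only [Polynomial.finsetSum_coeff, sub_mul, mul_assoc, Polynomial.coeff_sub,
      Polynomial.coeff_C_mul, Int.cast_natCast, Polynomial.coeff_natCast_mul,
      Polynomial.coeff_ofNat_mul, Polynomial.coeff_X_pow_mul'] at this
    rw [Int.cast_natCast, this, mul_zero]
    refine Finset.sum_eq_zero fun j _ => ?_
    rw [ih _ (by push_cast; omega) _ (cur_mem_Fdeg hv j) p (by push_cast; omega)]
    split_ifs with h
    · rw [ih _ (by push_cast; omega) _ (cur_mem_Fdeg hv j) (p - (2 * j + 1)) (by omega)]
      simp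
    · simp

/-- In top degree the parameters `τ` drop out of Euler's identity, and the remaining recursion is
the one `Ann.euler_phi` gives for `⟨ℓ|φ_{-d}`. -/
theorem shiftPoly_coeff_top [CharZero K] (τ : ℕ → R) {l : Fock K →ₗ[K] K} (hl : Ann l) :
    ∀ d : ℤ, ∀ v ∈ Fdeg K d, (shiftPoly τ (l ∘ₗ phi K 0) v).coeff d.toNat =
      algebraMap K R (l (phi K (-d) v)) := by
  refine Fdeg_induction_deg (fun d ih v hv => ?_) (by simp)
  rcases Nat.eq_zero_or_pos d with rfl | hd
  · rw [shiftPoly, covX_of_deg_zero _ _ (by simpa using hv), liftCov_apply,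
      Polynomial.algebraMap_apply, Polynomial.coeff_C]
    simp
  · refine intCast_mul_cancel K (d := d) (by exact_mod_cast hd.ne') ?_
    have := congrArg (fun Q => Polynomial.coeff Q d)
      (shiftPoly_euler τ hl.comp_phi_zero hv le_rfl)
    simp only [Polynomial.finsetSum_coeff, sub_mul, mul_assoc, Polynomial.coeff_sub,
      Polynomial.coeff_C_mul, Int.cast_natCast, Polynomial.coeff_natCast_mul,
      Polynomial.coeff_ofNat_mul, Polynomial.coeff_X_pow_mul'] at this
    rw [Int.cast_natCast, Int.toNat_natCast, this, ← map_natCast (algebraMap K R), ← map_mul,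
      hl.euler_phi d hv, Finset.mul_sum, map_sum]
    refine Finset.sum_congr rfl fun j _ => ?_
    rw [shiftPoly_coeff_eq_zero τ hl.comp_phi_zero _ _ (cur_mem_Fdeg hv j) d
      (by push_cast; omega)]
    split_ifs with h
    · have e := ih _ (by push_cast; omega) _ (cur_mem_Fdeg hv j)
      rw [show ((d : ℤ) - (2 * j + 1 : ℕ)).toNat = d - (2 * j + 1) by omega, neg_sub] at e
      rw [e, map_mul]
      simp [map_ofNat]
    · have h0 := current_eq_zero (n := ((2 * j + 1 : ℕ) : ℤ)) hv (by omega)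
      rw [cur, h0]
      simp

/-- The action of `φ_m` in the bosonic picture. -/
theorem covX_phi [CharZero K] (τ : ℕ → R) {l : Fock K →ₗ[K] K} (hl : Ann l) (m : ℤ)
    (v : Fock K) : covX τ (liftCov R l) (phi K m v) =
      extr K τ m (shiftPoly τ (l ∘ₗ phi K 0) v) := by
  -- The induction is on the degree `m + d` of `φ_m v`, with `m` and `d` free: Euler's identity
  -- produces terms lowering `d` and terms lowering `m`.
  have key : ∀ n : ℕ, ∀ (m d : ℤ), m + d < n → ∀ v ∈ Fdeg K d,
      covX τ (liftCov R l) (phi K m v) = extr K τ m (shiftPoly τ (l ∘ₗ phi K 0) v) := by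
    intro n
    induction n with
    | zero =>
      intro m d hmd v hv
      rw [phi_eq_zero hv (by push_cast at hmd; omega), map_zero]
      have hdeg : (shiftPoly τ (l ∘ₗ phi K 0) v).natDegree < d.toNat + 1 := by
        refine Nat.lt_succ_of_le ?_
        rw [Polynomial.natDegree_le_iff_coeff_eq_zero]
        exact fun p hp => shiftPoly_coeff_eq_zero τ hl.comp_phi_zero d v hv p (by omega)
      rw [extr_apply τ m hdeg]
      refine (Finset.sum_eq_zero fun p hp => ?_).symm
      rw [Finset.mem_range] at hp
      rcases lt_or_ge d 0 with hd | hd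
      · rw [Fdeg_of_neg hd hv]; simp
      · rw [expCoeffInt_of_neg τ (by push_cast at hmd; omega), zero_mul]
    | succ n ih =>
      intro m d hmd v hv
      rcases lt_or_ge (m + d) n with hn | hn
      · exact ih m d hn v hv
      have hmd' : m + d = n := by push_cast at hmd; omega
      have hdeg : (shiftPoly τ (l ∘ₗ phi K 0) v).natDegree ≤ d.toNat := by
        rw [Polynomial.natDegree_le_iff_coeff_eq_zero]
        exact fun p hp => shiftPoly_coeff_eq_zero τ hl.comp_phi_zero d v hv p (by omega)
      rcases lt_or_ge d 0 with hd0 | hd0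
      · rw [Fdeg_of_neg hd0 hv]; simp
      rcases Nat.eq_zero_or_pos n with rfl | hnpos
      -- In total degree zero only the top coefficient of the polynomial meets a nonzero coefficient
      -- of the exponential, namely its constant term.
      · obtain rfl : m = -d := by push_cast at hmd'; omega
        rw [covX_of_deg_zero _ _ (by simpa using phi_mem_Fdeg hv (-d)), liftCov_apply,
          ← shiftPoly_coeff_top τ hl d v hv, extr_apply τ _ (Nat.lt_succ_of_le hdeg),
          Finset.sum_range_succ, Finset.sum_eq_zero, zero_add,
          show -d + (d.toNat : ℤ) = (0 : ℕ) by simp [hd0], expCoeffInt_natCast, expCoeff_zero,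
          one_mul]
        intro p hp
        rw [Finset.mem_range] at hp
        rw [expCoeffInt_of_neg τ (by omega), zero_mul]
      · set M : ℕ := (|m| + |d| + n).toNat with hMdef
        have b1 := abs_le.1 (le_refl |d|); have b2 := abs_le.1 (le_refl |m|)
        have hM1 : m + d ≤ M := by omega
        have hM2 : d ≤ M := by omega
        have hM3 : m + (d.toNat : ℕ) ≤ M := by omega
        refine intCast_mul_cancel K (d := n) (by exact_mod_cast hnpos.ne') ?_
        have e1 : ((n : ℤ) : R) * covX τ (liftCov R l) (phi K m v) =
            ∑ j ∈ Finset.range M, eul τ j * (covX τ (liftCov R l) (phi K m (cur K j v)) +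
              covX τ (liftCov R l) (phi K (m - (2 * j + 1 : ℕ)) v)) := by
          have := covX_euler τ (hl.liftCov_degZero (R := R)) (phi_mem_Fdeg hv m) (M := M)
            (by omega)
          rw [show d + m = n by omega] at this
          rw [this]
          simp only [cur_phi, map_add]
        -- Subtracting `u d/du` from the degree operator removes the `u`-dependent part of the
        -- shifted parameters and leaves the scalars `eul τ j`.
        have e2 : extr K τ m ((d : Polynomial R) * shiftPoly τ (l ∘ₗ phi K 0) v -
            Polynomial.X * Polynomial.derivative (shiftPoly τ (l ∘ₗ phi K 0) v)) =
            ∑ j ∈ Finset.range M, eul τ j *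
              extr K τ m (shiftPoly τ (l ∘ₗ phi K 0) (cur K j v)) := by
          rw [shiftPoly_euler τ hl.comp_phi_zero hv hM2,
            shiftPoly_derivative τ hl.comp_phi_zero hv hM2, ← Finset.sum_sub_distrib, map_sum]
          refine Finset.sum_congr rfl fun j _ => ?_
          rw [← extr_C_mul]
          congr 1
          ring
        rw [map_sub, show (d : Polynomial R) = Polynomial.C (d : R) by simp, extr_C_mul] at e2
        have e3 := extr_euler (K := K) τ m hdeg hM3
        have e4 : ((n : ℤ) : R) = (m : R) + d := by rw [← hmd']; push_cast; ring
        rw [e1]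
        simp only [mul_add, Finset.sum_add_distrib]
        have i1 : ∀ j, covX τ (liftCov R l) (phi K m (cur K j v)) =
            extr K τ m (shiftPoly τ (l ∘ₗ phi K 0) (cur K j v)) := fun j =>
          ih m _ (by push_cast; omega) _ (cur_mem_Fdeg hv j)
        have i2 : ∀ j : ℕ, covX τ (liftCov R l) (phi K (m - (2 * j + 1 : ℕ)) v) =
            extr K τ (m - (2 * j + 1 : ℕ)) (shiftPoly τ (l ∘ₗ phi K 0) v) := fun j =>
          ih _ d (by push_cast; omega) _ hv
        simp only [i1, i2, ← e2, ← e3, e4]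
        ring
  suffices h : covX τ (liftCov R l) ∘ₗ phi K m =
      (extr K τ m).restrictScalars K ∘ₗ shiftPoly τ (l ∘ₗ phi K 0) from LinearMap.congr_fun h v
  exact Fdeg_ext fun d v hv => key ((m + d).toNat + 1) m d (by push_cast; omega) v hv

end VertexOperator

/-! ### The series `exp(∑ τⱼ z^{2j+1})` and its differential equation -/

section Series

variable {K : Type*} [Field K] {R : Type*} [CommRing R] [Algebra K R]

/-- The series `∑ⱼ (2j+1) τⱼ z^{2j+1}`. -/
def logDerSeries (τ : ℕ → R) : PowerSeries R :=
  PowerSeries.mk fun n => if n % 2 = 1 then eul τ (n / 2) else 0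

variable (K) in
theorem expSeries_ode [CharZero K] (τ : ℕ → R) :
    PowerSeries.X * PowerSeries.derivative R (expSeries K τ) =
      logDerSeries τ * expSeries K τ := by
  ext k
  have e1 : PowerSeries.coeff k (PowerSeries.X * PowerSeries.derivative R (expSeries K τ)) =
      (k : R) * expCoeff K τ k := by
    cases k with
    | zero => simp
    | succ k =>
      rw [PowerSeries.coeff_succ_X_mul, PowerSeries.coeff_derivative, expSeries,
        PowerSeries.coeff_mk]
      push_cast; ring
  have h := expCoeffInt_euler (K := K) τ k (M := k) le_rfl
  rw [expCoeffInt_natCast, Int.cast_natCast] at h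
  rw [e1, h, PowerSeries.coeff_mul, Finset.Nat.sum_antidiagonal_eq_sum_range_succ_mk]
  simp only [logDerSeries, expSeries, PowerSeries.coeff_mk, ite_mul, zero_mul]
  rw [← Finset.sum_filter]
  have hsub : (Finset.range k).filter (fun j => 2 * j + 1 ≤ k) ⊆ Finset.range k :=
    Finset.filter_subset _ _
  rw [← Finset.sum_subset hsub]
  · refine Finset.sum_nbij' (fun j => 2 * j + 1) (fun n => n / 2) ?_ ?_ ?_ ?_ ?_
    · intro j hj
      simp only [Finset.mem_filter, Finset.mem_range] at hj ⊢; omega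
    · intro j hj
      simp only [Finset.mem_filter, Finset.mem_range] at hj ⊢; omega
    · intro j hj
      simp only [Finset.mem_filter, Finset.mem_range] at hj ⊢; omega
    · intro j hj
      simp only [Finset.mem_filter, Finset.mem_range] at hj ⊢; omega
    · intro j hj
      simp only [Finset.mem_filter, Finset.mem_range] at hj
      rw [show (k : ℤ) - (2 * j + 1 : ℕ) = (k - (2 * j + 1) : ℕ) by omega, expCoeffInt_natCast,
        show (2 * j + 1) / 2 = j by omega]
  · intro j _ hj
    simp only [Finset.mem_filter, Finset.mem_range, not_and_or] at hj
    rw [expCoeffInt_of_neg τ (by push_cast; omega), mul_zero]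

-- An equation `z f' = A f` with `A(0) = 0` expresses `k` times the `k`-th coefficient through
-- earlier ones, so in characteristic zero the constant term determines the solution.
variable (K) in
theorem ode_unique [CharZero K] {A f g : PowerSeries R}
    (hA : PowerSeries.constantCoeff A = 0)
    (hf : PowerSeries.X * PowerSeries.derivative R f = A * f)
    (hg : PowerSeries.X * PowerSeries.derivative R g = A * g)
    (h0 : PowerSeries.constantCoeff f = PowerSeries.constantCoeff g) : f = g := by
  have hc : ∀ (h : PowerSeries R) (k : ℕ),
      PowerSeries.coeff k (PowerSeries.X * PowerSeries.derivative R h) =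
        (k : R) * PowerSeries.coeff k h := fun h k => by
    cases k with
    | zero => simp
    | succ k =>
      rw [PowerSeries.coeff_succ_X_mul, PowerSeries.coeff_derivative]
      push_cast; ring
  ext k
  induction k using Nat.strong_induction_on with
  | _ k ih =>
    rcases Nat.eq_zero_or_pos k with rfl | hk
    · simpa using h0
    · refine intCast_mul_cancel K (d := k) (by exact_mod_cast hk.ne') ?_
      rw [Int.cast_natCast, ← hc, ← hc, hf, hg, PowerSeries.coeff_mul, PowerSeries.coeff_mul]
      refine Finset.sum_congr rfl ?_
      rintro ⟨i, j⟩ hij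
      rw [Finset.HasAntidiagonal.mem_antidiagonal] at hij
      simp only at hij ⊢
      rcases Nat.eq_zero_or_pos i with rfl | hi
      · simp [hA]
      · rw [ih j (by omega)]

@[simp] theorem constantCoeff_expSeries (τ : ℕ → R) :
    PowerSeries.constantCoeff (expSeries K τ) = 1 := by
  rw [← PowerSeries.coeff_zero_eq_constantCoeff_apply, expSeries, PowerSeries.coeff_mk,
    expCoeff_zero]

@[simp] theorem constantCoeff_logDerSeries (τ : ℕ → R) :
    PowerSeries.constantCoeff (logDerSeries τ) = 0 := by
  rw [← PowerSeries.coeff_zero_eq_constantCoeff_apply, logDerSeries, PowerSeries.coeff_mk]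
  simp

/-- The difference is the odd geometric series `2 ∑ (uz)^{2j+1} = 2uz/(1 - u²z²)`. -/
theorem logDerSeries_shiftPar [CharZero K] (τ : ℕ → R) (u : R) :
    (logDerSeries τ - logDerSeries (shiftPar K τ u)) *
      ((1 + PowerSeries.C u * PowerSeries.X) * (1 - PowerSeries.C u * PowerSeries.X)) =
      2 * PowerSeries.C u * PowerSeries.X := by
  have h : logDerSeries τ - logDerSeries (shiftPar K τ u) =
      PowerSeries.mk fun n => if n % 2 = 1 then 2 * u ^ n else 0 := by
    ext n
    simp only [logDerSeries, map_sub, PowerSeries.coeff_mk]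
    split_ifs with hn
    · rw [eul_shiftPar, sub_sub_cancel, show 2 * (n / 2) + 1 = n by omega]
    · simp
  rw [h]
  have e : (1 + PowerSeries.C u * PowerSeries.X) * (1 - PowerSeries.C u * PowerSeries.X) =
      1 - PowerSeries.C (u ^ 2) * PowerSeries.X ^ 2 := by rw [map_pow]; ring
  rw [e, mul_sub, mul_one]
  ext n
  rw [map_sub, mul_left_comm, PowerSeries.coeff_C_mul, PowerSeries.coeff_mul_X_pow',
    PowerSeries.coeff_mk, show (2 : PowerSeries R) * PowerSeries.C u = PowerSeries.C (2 * u) by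
      rw [map_mul, map_ofNat], PowerSeries.coeff_C_mul, PowerSeries.coeff_X]
  rcases lt_or_ge n 2 with hn | hn
  · interval_cases n <;> simp
  · rw [if_pos hn, PowerSeries.coeff_mk, if_neg (show n ≠ 1 by omega), mul_zero,
      show (n - 2) % 2 = n % 2 by omega]
    split_ifs
    · obtain ⟨m, rfl⟩ : ∃ m, n = m + 2 := ⟨n - 2, by omega⟩
      rw [Nat.add_sub_cancel]; ring
    · simp

/-- `exp(-2 ∑ₙ u^n z^n / n) = (1 - u z) / (1 + u z)`, sum over odd `n`. -/
theorem expSeries_shiftPar [CharZero K] (τ : ℕ → R) (u : R) :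
    expSeries K (shiftPar K τ u) * (1 + PowerSeries.C u * PowerSeries.X) =
      expSeries K τ * (1 - PowerSeries.C u * PowerSeries.X) := by
  set a : PowerSeries R := PowerSeries.C u * PowerSeries.X with ha
  have hda : PowerSeries.X * PowerSeries.derivative R a = a := by
    rw [ha, Derivation.leibniz]
    simp [PowerSeries.derivative_C, mul_comm]
  have h1 := expSeries_ode K τ
  have h2 := expSeries_ode K (shiftPar K τ u)
  have h3 := logDerSeries_shiftPar (K := K) τ u
  rw [mul_assoc 2, ← ha] at h3
  set q := expSeries K τ
  set q' := expSeries K (shiftPar K τ u)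
  set A := logDerSeries τ
  set A' := logDerSeries (shiftPar K τ u)
  have ca : PowerSeries.constantCoeff a = 0 := by simp [ha]
  -- The extra factor `1 + a` clears the denominator `1 - a²` on the right: both sides then have
  -- logarithmic derivative `A' + 2a/(1 + a)`.
  have key : q' * (1 + a) * (1 + a) = q * (1 - a) * (1 + a) := by
    refine ode_unique K (A := A' + 2 * a * PowerSeries.invOfUnit (1 + a) 1) (by simp [A', ca])
      ?_ ?_ (by simp [q, q', ca])
    · have hu : PowerSeries.invOfUnit (1 + a) 1 * (1 + a) = 1 :=
        PowerSeries.invOfUnit_mul _ _ (by simp [ca])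
      simp only [Derivation.leibniz, map_add, smul_eq_mul, Derivation.map_one_eq_zero]
      linear_combination (1 + a) ^ 2 * h2 + 2 * q' * (1 + a) * hda
        - 2 * a * q' * (1 + a) * hu
    · have hu : PowerSeries.invOfUnit (1 + a) 1 * (1 + a) = 1 :=
        PowerSeries.invOfUnit_mul _ _ (by simp [ca])
      simp only [Derivation.leibniz, map_add, map_sub, smul_eq_mul, Derivation.map_one_eq_zero]
      linear_combination (1 - a) * (1 + a) * h1 + q * h3 - 2 * a * q * hda
        - 2 * a * q * (1 - a) * hu
  have hunit : IsUnit (1 + a) := by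
    rw [PowerSeries.isUnit_iff_constantCoeff]; simp [ca]
  exact hunit.mul_right_cancel key

theorem map_expSeries [CharZero K] {R' : Type*} [CommRing R'] [Algebra K R'] (f : R →ₐ[K] R')
    (τ : ℕ → R) :
    PowerSeries.map (f : R →+* R') (expSeries K τ) = expSeries K (fun j => f (τ j)) := by
  refine ode_unique K (A := logDerSeries fun j => f (τ j)) (by simp) ?_ (expSeries_ode K _) ?_
  · have h := congrArg (PowerSeries.map (f : R →+* R')) (expSeries_ode K τ)
    have hA : PowerSeries.map (f : R →+* R') (logDerSeries τ) =
        logDerSeries fun j => f (τ j) := by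
      ext n
      simp only [logDerSeries, PowerSeries.coeff_map, PowerSeries.coeff_mk]
      split_ifs <;> simp [eul, map_ofNat]
    have hd : PowerSeries.map (f : R →+* R') (PowerSeries.derivative R (expSeries K τ)) =
        PowerSeries.derivative R' (PowerSeries.map (f : R →+* R') (expSeries K τ)) := by
      ext n
      simp [PowerSeries.coeff_derivative]
    rw [map_mul, map_mul, hA, hd, PowerSeries.map_X] at h
    exact h
  · rw [← PowerSeries.coeff_zero_eq_constantCoeff_apply, PowerSeries.coeff_map,
      PowerSeries.coeff_zero_eq_constantCoeff_apply]
    simp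

end Series

/-! ### The substitution `z = Z/(1 + bZ)` -/

section ChangeOfVariable

variable {K : Type*} [Field K] (R : Type*) [CommRing R] [Algebra K R] (b : K)

/-- The series `z = Z / (1 + b Z)`, with coefficients in `R`. -/
def zSeries : PowerSeries R :=
  PowerSeries.map (algebraMap K R) (PowerSeries.X * (1 + PowerSeries.C b * PowerSeries.X)⁻¹)

theorem zSeries_mul :
    zSeries R b * (1 + PowerSeries.C (algebraMap K R b) * PowerSeries.X) = PowerSeries.X := by
  have h : (1 + PowerSeries.C b * PowerSeries.X : PowerSeries K)⁻¹ *
      (1 + PowerSeries.C b * PowerSeries.X) = 1 := PowerSeries.inv_mul_cancel _ (by simp)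
  have h2 : PowerSeries.map (algebraMap K R) (1 + PowerSeries.C b * PowerSeries.X) =
      1 + PowerSeries.C (algebraMap K R b) * PowerSeries.X := by simp
  rw [← h2, zSeries, ← map_mul, mul_assoc, h, mul_one, PowerSeries.map_X]

theorem constantCoeff_zSeries : PowerSeries.constantCoeff (zSeries R b) = 0 := by
  rw [zSeries, ← PowerSeries.coeff_zero_eq_constantCoeff_apply, PowerSeries.coeff_map]
  simp

theorem hasSubst_zSeries : PowerSeries.HasSubst (zSeries R b) :=
  PowerSeries.HasSubst.of_constantCoeff_zero' (constantCoeff_zSeries R b)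

variable {R}

theorem coeff_mul_subst_zSeries (g q : PowerSeries R) (N : ℕ) :
    PowerSeries.coeff N (g * PowerSeries.subst (zSeries R b) q : PowerSeries R) =
      ∑ n ∈ Finset.range (N + 1), PowerSeries.coeff n q *
        PowerSeries.coeff N (g * zSeries R b ^ n) := by
  have hz : ∀ n k : ℕ, k < n → PowerSeries.coeff k (zSeries R b ^ n) = 0 := fun n k hk => by
    refine PowerSeries.coeff_of_lt_order _ (lt_of_lt_of_le (by exact_mod_cast hk)
      (PowerSeries.le_order_pow_of_constantCoeff_eq_zero n (constantCoeff_zSeries R b)))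
  have h : ∀ k ≤ N, PowerSeries.coeff k (PowerSeries.subst (zSeries R b) q : PowerSeries R) =
      ∑ n ∈ Finset.range (N + 1), PowerSeries.coeff n q *
        PowerSeries.coeff k (zSeries R b ^ n) := fun k hk => by
    rw [PowerSeries.coeff_subst' (hasSubst_zSeries R b)]
    refine finsum_eq_sum_of_support_subset _ fun n hn => ?_
    by_contra hnot
    simp only [Finset.coe_range, Set.mem_Iio, not_lt] at hnot
    exact hn (by simp only [hz n k (by omega), smul_zero])
  rw [PowerSeries.coeff_mul]
  simp only [PowerSeries.coeff_mul, Finset.mul_sum]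
  rw [Finset.sum_comm]
  refine Finset.sum_congr rfl ?_
  rintro ⟨i, j⟩ hij
  rw [Finset.HasAntidiagonal.mem_antidiagonal] at hij
  rw [h j (by simp only at hij; omega), Finset.mul_sum]
  refine Finset.sum_congr rfl fun n _ => ?_
  ring

/-- The functional `P ↦ [Z^a] (ω(Z) P(Z⁻¹))` on polynomials. -/
def extrW (ω : PowerSeries R) (a : ℕ) : Polynomial R →ₗ[R] R :=
  Polynomial.lsum fun p => LinearMap.mulLeft R (PowerSeries.coeff (a + p) ω)

theorem extrW_monomial (ω : PowerSeries R) (a p : ℕ) (c : R) :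
    extrW ω a (Polynomial.monomial p c) = PowerSeries.coeff (a + p) ω * c := by
  simp [extrW, Polynomial.lsum_apply, Polynomial.sum_monomial_index]

theorem extrW_X_mul (ω : PowerSeries R) (a : ℕ) (P : Polynomial R) :
    extrW ω a (Polynomial.X * P) = extrW ω (a + 1) P := by
  induction P using Polynomial.induction_on' with
  | add p q hp hq => rw [mul_add, map_add, map_add, hp, hq]
  | monomial p c =>
    rw [Polynomial.X_mul, Polynomial.monomial_mul_X, extrW_monomial, extrW_monomial]
    rw [add_comm p, add_assoc]

/-- Multiplication by `Z^p` turns `(Z⁻¹ + c)^p` into `(1 + cZ)^p`, which avoids negative powers. -/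
theorem extrW_pow (ω : PowerSeries R) (c : R) (p : ℕ) : ∀ a : ℕ,
    extrW ω a ((Polynomial.X + Polynomial.C c) ^ p) =
      PowerSeries.coeff (a + p) ((1 + PowerSeries.C c * PowerSeries.X) ^ p * ω) := by
  induction p with
  | zero =>
    intro a
    rw [pow_zero, pow_zero, one_mul, ← Polynomial.monomial_zero_one, extrW_monomial, mul_one]
  | succ p ih =>
    intro a
    rw [pow_succ', add_mul, map_add, extrW_X_mul, ← Polynomial.smul_eq_C_mul, map_smul, ih, ih,
      pow_succ', mul_assoc, add_mul, one_mul, map_add, mul_assoc, PowerSeries.coeff_C_mul,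
      ← add_assoc, PowerSeries.coeff_succ_X_mul, smul_eq_mul, add_right_comm a 1 p]

/-- Formally this replaces `z` by `Z/(1 + bZ)` in `q(z) P(z⁻¹)`, using `z⁻¹ = Z⁻¹ + b`. The sum runs
only over positive powers of `z`, as in the definition of `φ^{[β]}_a`, so the nonpositive powers
must be shown not to reach `Z^a` with `a > 0`. -/
theorem sum_coeff_zSeries_extr (τ : ℕ → R) {a : ℕ} (ha : 0 < a) (P : Polynomial R) :
    ∑ k ∈ Finset.Icc 1 a, PowerSeries.coeff a (zSeries R b ^ k) * extr K τ (k : ℤ) P =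
      extrW (PowerSeries.subst (zSeries R b) (expSeries K τ)) a
        (P.comp (Polynomial.X + Polynomial.C (algebraMap K R b))) := by
  induction P using Polynomial.induction_on' with
  | add p q hp hq => simp only [Polynomial.add_comp, map_add, mul_add, Finset.sum_add_distrib, hp, hq]
  | monomial p c =>
    rw [Polynomial.monomial_comp, ← Polynomial.smul_eq_C_mul, map_smul, extrW_pow,
      coeff_mul_subst_zSeries, smul_eq_mul, Finset.mul_sum]
    set e : PowerSeries R := 1 + PowerSeries.C (algebraMap K R b) * PowerSeries.X
    have hze : zSeries R b * e = PowerSeries.X := zSeries_mul R b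
    -- Since `z e = Z`, for `n ≤ p` this is `e^{p-n} Z^n`, a polynomial of degree at most `p`, and
    -- `a > 0` puts the coefficient out of reach.
    have hlow : ∀ n ≤ p, PowerSeries.coeff (a + p) (e ^ p * zSeries R b ^ n) = 0 := by
      intro n hn
      obtain ⟨m, rfl⟩ := Nat.exists_eq_add_of_le hn
      have h1 : e ^ (n + m) * zSeries R b ^ n = e ^ m * PowerSeries.X ^ n := by
        rw [← hze, mul_pow, pow_add, mul_right_comm, mul_comm, mul_comm (e ^ n)]
      have h2 : e ^ m = (((1 + Polynomial.C (algebraMap K R b) * Polynomial.X) ^ m :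
          Polynomial R) : PowerSeries R) := by simp [e]
      rw [h1, show a + (n + m) = a + m + n by ring, PowerSeries.coeff_mul_X_pow, h2,
        Polynomial.coeff_coe]
      refine Polynomial.coeff_eq_zero_of_natDegree_lt (lt_of_le_of_lt ?_ (by omega : m < a + m))
      refine (Polynomial.natDegree_pow_le).trans ?_
      have : (1 + Polynomial.C (algebraMap K R b) * Polynomial.X : Polynomial R).natDegree ≤ 1 := by
        compute_degree
      nlinarith
    have hhigh : ∀ k, PowerSeries.coeff (a + p) (e ^ p * zSeries R b ^ (p + k)) =
        PowerSeries.coeff a (zSeries R b ^ k) := by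
      intro k
      have h1 : e ^ p * zSeries R b ^ (p + k) = zSeries R b ^ k * PowerSeries.X ^ p := by
        rw [← hze, mul_pow, pow_add, ← mul_assoc, mul_comm, mul_comm (e ^ p)]
      rw [h1, PowerSeries.coeff_mul_X_pow]
    have hsub : (Finset.Icc (p + 1) (p + a)) ⊆ Finset.range (a + p + 1) := by
      intro n hn
      rw [Finset.mem_Icc] at hn
      rw [Finset.mem_range]; omega
    rw [← Finset.sum_subset hsub]
    · refine Finset.sum_nbij' (fun k => p + k) (fun n => n - p) ?_ ?_ ?_ ?_ ?_
      · intro k hk; simp only [Finset.mem_Icc] at hk ⊢; omega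
      · intro k hk; simp only [Finset.mem_Icc] at hk ⊢; omega
      · intro k hk; simp only [Finset.mem_Icc] at hk ⊢; omega
      · intro k hk; simp only [Finset.mem_Icc] at hk ⊢; omega
      · intro k _
        rw [hhigh, extr_monomial, ← Nat.cast_add, expCoeffInt_natCast, expSeries,
          PowerSeries.coeff_mk, add_comm k p]
        ring
    · intro n hn1 hn2
      simp only [Finset.mem_Icc, Finset.mem_range] at hn1 hn2
      rw [hlow n (by omega), mul_zero, mul_zero]

end ChangeOfVariable

/-! ### The deformed fermions and `e^{-θ}` as shifts of parameters -/

section Deformed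

variable {K : Type*} [Field K] {R : Type*} [CommRing R] [Algebra K R] (β : K)

theorem theta_apply {d : ℤ} {v : Fock K} (hv : v ∈ Fdeg K d) {M : ℕ} (hM : d ≤ M) :
    theta β v = ∑ j ∈ Finset.range M,
      (2 * (β / 2) ^ (2 * j + 1) / ((2 * j + 1 : ℕ) : K)) • cur K j v := by
  have hlf := locallyFinite_of_cur (K := K) (N := Fock K) fun j : ℕ =>
    (2 * (β / 2) ^ (2 * j + 1) / ((2 * j + 1 : ℕ) : K)) • LinearMap.id
  have : theta β = opSum fun j : ℕ => ((2 * (β / 2) ^ (2 * j + 1) / ((2 * j + 1 : ℕ) : K)) •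
    (LinearMap.id : Fock K →ₗ[K] Fock K)) ∘ₗ cur K j := rfl
  rw [this, opSum_eq_sum hlf (s := Finset.range M)]
  · rfl
  · intro j hj
    simp only [Finset.mem_range, not_lt] at hj
    simp [cur_eq_zero hv (by omega : d ≤ j)]

/-- The parameters of `-θ`. -/
def thetaPar (R : Type*) [CommRing R] [Algebra K R] (j : ℕ) : R :=
  - algebraMap K R (2 * (β / 2) ^ (2 * j + 1) / ((2 * j + 1 : ℕ) : K))

theorem comp_theta (l : Fock K →ₗ[K] R) : l ∘ₗ (-theta β) = covN (thetaPar β R) l := by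
  refine Fdeg_ext fun d v hv => ?_
  rw [covN_apply _ _ hv le_rfl, LinearMap.comp_apply, LinearMap.neg_apply, theta_apply β hv le_rfl,
    map_neg, map_sum, ← Finset.sum_neg_distrib]
  refine Finset.sum_congr rfl fun j _ => ?_
  rw [map_smul, thetaPar, Algebra.smul_def, neg_mul]

theorem comp_theta_pow (l : Fock K →ₗ[K] R) (k : ℕ) :
    l ∘ₗ (-theta β) ^ k = (covN (thetaPar β R))^[k] l := by
  induction k with
  | zero => rfl
  | succ k ih =>
    rw [Function.iterate_succ_apply', ← ih, ← comp_theta, pow_succ]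
    rfl

/-- Since `θ` is not homogeneous, local nilpotence is read off from the filtration by degree. -/
theorem theta_mem {e : ℤ} {v : Fock K} (hv : v ∈ ⨆ d : {d : ℤ // d ≤ e}, Fdeg K d) :
    theta β v ∈ ⨆ d : {d : ℤ // d ≤ e - 1}, Fdeg K d := by
  induction hv using Submodule.iSup_induction' with
  | mem d v hv =>
    rw [theta_apply β hv (M := d.1.toNat) (by omega)]
    refine Submodule.sum_mem _ fun j _ => Submodule.smul_mem _ _ ?_
    have h : (d : ℤ) - (2 * j + 1 : ℕ) ≤ e - 1 := by have := d.2; push_cast; omega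
    exact Submodule.mem_iSup_of_mem (p := fun d : {d : ℤ // d ≤ e - 1} => Fdeg K d)
      ⟨_, h⟩ (cur_mem_Fdeg hv j)
  | zero => simp
  | add x y _ _ hx hy => rw [map_add]; exact add_mem hx hy

theorem opExp_theta_locallyFinite :
    LocallyFinite fun k : ℕ => ((k.factorial : K)⁻¹) • (-theta β) ^ k := by
  refine locallyFinite_of_Fdeg fun d v hv => (Set.finite_Iic d).subset fun k hk => ?_
  by_contra h
  refine hk ?_
  simp only [Set.mem_Iic, not_le] at h
  have key : ∀ k : ℕ, ((-theta β) ^ k) v ∈ ⨆ e : {e : ℤ // e ≤ (d : ℤ) - k}, Fdeg K e := by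
    intro k
    induction k with
    | zero =>
      exact Submodule.mem_iSup_of_mem (p := fun e : {e : ℤ // e ≤ (d : ℤ) - (0 : ℕ)} => Fdeg K e)
        ⟨d, by simp⟩ hv
    | succ k ih =>
      rw [pow_succ', Module.End.mul_apply, LinearMap.neg_apply]
      have := neg_mem (theta_mem β ih)
      rwa [show (d : ℤ) - k - 1 = d - (k + 1 : ℕ) by push_cast; ring] at this
  have hbot : (⨆ e : {e : ℤ // e ≤ (d : ℤ) - k}, Fdeg K e) = ⊥ := by
    rw [iSup_eq_bot]
    rintro ⟨e, he⟩
    rw [Submodule.eq_bot_iff]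
    intro x hx
    have he' : e ≤ d - k := he
    exact Fdeg_of_neg (d := e) (by omega) hx
  have := key k
  rw [hbot, Submodule.mem_bot] at this
  simp [this]

theorem opExp_theta_eq_sum (v : Fock K) : ∃ M : ℕ, ∀ N ≥ M, opExp (-theta β) v =
    ∑ k ∈ Finset.range N, ((k.factorial : K)⁻¹) • ((-theta β) ^ k) v := by
  have h := opExp_theta_locallyFinite β v
  obtain ⟨M, hM⟩ := h.bddAbove
  refine ⟨M + 1, fun N hN => ?_⟩
  rw [opExp, opSum_eq_sum (opExp_theta_locallyFinite β) (s := Finset.range N)]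
  · rfl
  · intro k hk
    by_contra hne
    have := hM hne
    rw [Finset.mem_range] at hk
    omega

theorem comp_opExp_theta (l : Fock K →ₗ[K] R) :
    l ∘ₗ opExp (-theta β) = covX (thetaPar β R) l := by
  refine Fdeg_ext fun d v hv => ?_
  obtain ⟨M, hM⟩ := opExp_theta_eq_sum β v
  rw [LinearMap.comp_apply, hM (M + d + 1) (by omega),
    covX_apply _ _ hv (M := M + d + 1) (by push_cast; omega), map_sum]
  refine Finset.sum_congr rfl fun k _ => ?_
  rw [map_smul, ← comp_theta_pow]
  rfl

/-- The exponent `-θ` is a combination of the same commuting currents, so the exponentials add; its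
coefficients are precisely a shift by `u = β/2`. -/
theorem covX_opExp_theta [CharZero K] (τ : ℕ → R) {l : Fock K →ₗ[K] R} (hl : DegZero l) (v : Fock K) :
    covX τ l (opExp (-theta β) v) = covX (shiftPar K τ (algebraMap K R (β / 2))) l v := by
  have h := LinearMap.congr_fun (comp_opExp_theta β (covX τ l)) v
  rw [LinearMap.comp_apply] at h
  rw [h, covX_covX _ _ hl]
  congr 2
  funext j
  rw [Pi.add_apply, thetaPar, shiftPar, ← map_pow, ← map_mul, sub_eq_add_neg]
  congr 3
  ring

variable (R) in
/-- The generating series `ω(Z) = exp(∑ⱼ τⱼ z^{2j+1})` with `z = Z / (1 + (β/2) Z)`. -/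
def omegaSer (τ : ℕ → R) : PowerSeries R :=
  PowerSeries.subst (zSeries R (β / 2)) (expSeries K τ)

/-- The parameters over `R[U]` produced by commuting the field past the Hamiltonian. -/
def nextPar (τ : ℕ → R) : ℕ → Polynomial R :=
  shiftPar K (shiftPar K (fun j => Polynomial.C (τ j))
    (Polynomial.X + Polynomial.C (algebraMap K R (β / 2)))) (algebraMap K (Polynomial R) (β / 2))

/-- This is the step that removes one fermion. The new parameters live over `R[U]`, with `U`
standing for `Z⁻¹`; the shift at `z⁻¹` is evaluated at `U + β/2`, and `e^{-θ}` adds the shift at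
`β/2`. -/
theorem covX_phiBr [CharZero K] (τ : ℕ → R) {l : Fock K →ₗ[K] K} (hl : Ann l) {a : ℕ} (ha : 0 < a)
    (v : Fock K) : covX τ (liftCov R l) (phiBr β (a : ℤ) (opExp (-theta β) v)) =
      extrW (omegaSer R β τ) a
        (covX (nextPar β τ) (liftCov (Polynomial R) (l ∘ₗ phi K 0)) v) := by
  set w := opExp (-theta β) v with hw
  have h1 : phiBr β (a : ℤ) w = ∑ k ∈ Finset.Icc 1 a,
      PowerSeries.coeff a ((PowerSeries.X * (1 + PowerSeries.C (β / 2) * PowerSeries.X)⁻¹ :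
        PowerSeries K) ^ k) • phi K (k : ℤ) w := by
    rw [phiBr, if_pos (by exact_mod_cast ha)]
    simp [LinearMap.sum_apply]
  have h2 : ∀ k : ℕ, algebraMap K R (PowerSeries.coeff a
      ((PowerSeries.X * (1 + PowerSeries.C (β / 2) * PowerSeries.X)⁻¹ : PowerSeries K) ^ k)) =
      PowerSeries.coeff a (zSeries R (β / 2) ^ k) := fun k => by
    rw [zSeries, ← map_pow, PowerSeries.coeff_map]
  have h3 := sum_coeff_zSeries_extr (K := K) (β / 2) τ ha (shiftPoly τ (l ∘ₗ phi K 0) w)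
  rw [h1, map_sum]
  have h3' : ∀ k ∈ Finset.Icc 1 a, covX τ (liftCov R l) (PowerSeries.coeff a
      ((PowerSeries.X * (1 + PowerSeries.C (β / 2) * PowerSeries.X)⁻¹ : PowerSeries K) ^ k) •
      phi K (k : ℤ) w) = PowerSeries.coeff a (zSeries R (β / 2) ^ k) *
        extr K τ (k : ℤ) (shiftPoly τ (l ∘ₗ phi K 0) w) := fun k _ => by
    rw [map_smul, Algebra.smul_def, h2, covX_phi τ hl]
  rw [Finset.sum_congr rfl h3', h3, omegaSer]
  congr 1
  have h4 := map_covX ((Polynomial.aeval (R := R)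
    (Polynomial.X + Polynomial.C (algebraMap K R (β / 2)))).restrictScalars K)
    (shiftPar K (fun j => Polynomial.C (τ j)) Polynomial.X)
    (hl.comp_phi_zero.liftCov_degZero (R := Polynomial R)) w
  have h5 : ∀ P : Polynomial R, ((Polynomial.aeval (R := R)
      (Polynomial.X + Polynomial.C (algebraMap K R (β / 2)))).restrictScalars K) P =
      P.comp (Polynomial.X + Polynomial.C (algebraMap K R (β / 2))) := fun P => rfl
  rw [shiftPoly, ← h5, h4]
  have h6 : (((Polynomial.aeval (R := R)
      (Polynomial.X + Polynomial.C (algebraMap K R (β / 2)))).restrictScalars K).toLinearMap ∘ₗ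
      liftCov (Polynomial R) (l ∘ₗ phi K 0)) = liftCov (Polynomial R) (l ∘ₗ phi K 0) := by
    refine LinearMap.ext fun x => ?_
    exact ((Polynomial.aeval (R := R)
      (Polynomial.X + Polynomial.C (algebraMap K R (β / 2)))).restrictScalars K).commutes _
  have h7 : (fun j => ((Polynomial.aeval (R := R)
      (Polynomial.X + Polynomial.C (algebraMap K R (β / 2)))).restrictScalars K)
      (shiftPar K (fun j => Polynomial.C (τ j)) Polynomial.X j)) =
      shiftPar K (fun j => Polynomial.C (τ j))
        (Polynomial.X + Polynomial.C (algebraMap K R (β / 2))) := by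
    funext j
    rw [shiftPar, shiftPar, map_sub, map_mul, map_pow, AlgHom.commutes, h5, h5, Polynomial.C_comp,
      Polynomial.X_comp]
  rw [h6, h7, hw, covX_opExp_theta β _ hl.comp_phi_zero.liftCov_degZero, nextPar]

/-- After `z = Z/(1 + (β/2)Z)`, a linear factor `1 + cz` becomes `(1 + (β/2 + c)Z)/(1 + (β/2)Z)`,
and the common denominators cancel. -/
theorem subst_shift {τ σ : ℕ → R} {c d : R}
    (h : expSeries K τ * (1 + PowerSeries.C c * PowerSeries.X) =
      expSeries K σ * (1 + PowerSeries.C d * PowerSeries.X)) :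
    omegaSer R β τ * (1 + PowerSeries.C (algebraMap K R (β / 2) + c) * PowerSeries.X) =
      omegaSer R β σ * (1 + PowerSeries.C (algebraMap K R (β / 2) + d) * PowerSeries.X) := by
  have hs := hasSubst_zSeries R (β / 2)
  set φ : PowerSeries R →ₐ[R] PowerSeries R := PowerSeries.substAlgHom hs with hφ
  have h' := congrArg φ h
  have hX : φ PowerSeries.X = zSeries R (β / 2) := PowerSeries.substAlgHom_X hs
  have hC : ∀ r : R, φ (PowerSeries.C r) = PowerSeries.C r := fun r => φ.commutes r
  have hO : ∀ τ : ℕ → R, φ (expSeries K τ) = omegaSer R β τ := fun τ => by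
    rw [hφ, PowerSeries.coe_substAlgHom]; rfl
  simp only [map_mul, map_add, map_one, hX, hC, hO] at h'
  have hz := zSeries_mul R (β / 2)
  simp only [map_add]
  linear_combination (1 + PowerSeries.C (algebraMap K R (β / 2)) * PowerSeries.X) * h' +
    (omegaSer R β σ * PowerSeries.C d - omegaSer R β τ * PowerSeries.C c) * hz

/-- The shift at `U + β/2` contributes `(1 - UZ)/(1 + (U+β)Z)` and the one at `β/2` contributes
`1/(1 + βZ)`. Their product is `κ` for a first variable `U⁻¹` and second variable `Z`; this is where
`e^{-θ}` becomes indispensable. -/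
theorem omegaSer_nextPar [CharZero K] (τ : ℕ → R) :
    omegaSer (Polynomial R) β (nextPar β τ) *
      ((1 + PowerSeries.C (algebraMap K (Polynomial R) β) * PowerSeries.X) *
        (1 + PowerSeries.C (Polynomial.X + algebraMap K (Polynomial R) β) * PowerSeries.X)) =
      PowerSeries.map Polynomial.C (omegaSer R β τ) *
        (1 - PowerSeries.C Polynomial.X * PowerSeries.X) := by
  have hb : algebraMap K (Polynomial R) β =
      algebraMap K (Polynomial R) (β / 2) + algebraMap K (Polynomial R) (β / 2) := by
    rw [← map_add, add_halves]
  have hcc : Polynomial.C (algebraMap K R (β / 2)) = algebraMap K (Polynomial R) (β / 2) := rfl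
  have e1 := subst_shift β (τ := nextPar β τ) (σ := shiftPar K (fun j => Polynomial.C (τ j))
    (Polynomial.X + Polynomial.C (algebraMap K R (β / 2))))
    (c := algebraMap K (Polynomial R) (β / 2)) (d := - algebraMap K (Polynomial R) (β / 2))
    (by rw [nextPar, expSeries_shiftPar]; simp [sub_eq_add_neg])
  have e2 := subst_shift β (τ := shiftPar K (fun j => Polynomial.C (τ j))
    (Polynomial.X + Polynomial.C (algebraMap K R (β / 2)))) (σ := fun j => Polynomial.C (τ j))
    (c := (Polynomial.X + Polynomial.C (algebraMap K R (β / 2))))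
    (d := - (Polynomial.X + Polynomial.C (algebraMap K R (β / 2))))
    (by rw [expSeries_shiftPar, map_neg, neg_mul, ← sub_eq_add_neg])
  have e3 : omegaSer (Polynomial R) β (fun j => Polynomial.C (τ j)) =
      PowerSeries.map Polynomial.C (omegaSer R β τ) := by
    have hm := map_expSeries (K := K) (Algebra.ofId R (Polynomial R) |>.restrictScalars K) τ
    have hm' : PowerSeries.map (Polynomial.C : R →+* Polynomial R) (expSeries K τ) =
      expSeries K (fun j => (Polynomial.C (τ j) : Polynomial R)) := hm
    rw [omegaSer, ← hm', omegaSer]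
    have := PowerSeries.map_subst (hasSubst_zSeries R (β / 2)) (h := Polynomial.C)
      (expSeries K τ)
    rw [PowerSeries.map, this]
    congr 1
  rw [hcc] at e2
  rw [e3] at e2
  simp only [hb, map_add, map_neg, hcc] at e1 e2 ⊢
  linear_combination (1 + (PowerSeries.C Polynomial.X + (PowerSeries.C (algebraMap K (Polynomial R)
    (β / 2)) + PowerSeries.C (algebraMap K (Polynomial R) (β / 2)))) * PowerSeries.X) * e1 + e2

end Deformed

/-! ### The Hamiltonian in terms of odd currents -/

section Hamiltonian

variable {K : Type*} [Field K] (β : K)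

theorem coeff_geom_pow (b : K) (n k : ℕ) :
    PowerSeries.coeff (k + n + 1)
      ((PowerSeries.X * (1 - PowerSeries.C b * PowerSeries.X)⁻¹ : PowerSeries K) ^ (n + 1)) =
      ((n + k).choose n : K) * b ^ k := by
  have h1 : (1 - PowerSeries.C b * PowerSeries.X : PowerSeries K)⁻¹ =
      PowerSeries.rescale b (PowerSeries.mk 1) := by
    rw [PowerSeries.inv_eq_iff_mul_eq_one (by simp)]
    have := congrArg (PowerSeries.rescale b) (PowerSeries.mk_one_mul_one_sub_eq_one K)
    simpa [PowerSeries.rescale_X] using this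
  rw [h1, mul_pow, ← map_pow, PowerSeries.mk_one_pow_eq_mk_choose_add, add_assoc,
    PowerSeries.coeff_X_pow_mul, PowerSeries.coeff_rescale, PowerSeries.coeff_mk, mul_comm]

theorem coeff_geom_pow_of_lt (b : K) {n k : ℕ} (h : k < n) :
    PowerSeries.coeff k
      ((PowerSeries.X * (1 - PowerSeries.C b * PowerSeries.X)⁻¹ : PowerSeries K) ^ n) = 0 := by
  rw [mul_pow, PowerSeries.coeff_X_pow_mul', if_neg (by omega)]

theorem currentSeries_eq (n : ℕ) : currentSeries β n = PowerSeries.C (1 / 2 : K) *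
    ((PowerSeries.X * (1 - PowerSeries.C (β / 2) * PowerSeries.X)⁻¹) ^ n -
      PowerSeries.C ((-1) ^ n) *
        (PowerSeries.X * (1 - PowerSeries.C (-(β / 2)) * PowerSeries.X)⁻¹) ^ n) := by
  rw [currentSeries]
  congr 2
  rw [map_pow, ← mul_pow, map_neg, map_neg, map_one, neg_mul, neg_mul, one_mul, neg_mul,
    sub_neg_eq_add]

theorem coeff_currentSeries_of_lt {n k : ℕ} (h : k < n) :
    PowerSeries.coeff k (currentSeries β n) = 0 := by
  rw [currentSeries_eq, PowerSeries.coeff_C_mul, map_sub, PowerSeries.coeff_C_mul,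
    coeff_geom_pow_of_lt _ h, coeff_geom_pow_of_lt _ h]
  simp

/-- The two halves of the series agree in odd degree, leaving `binom(2j, m) (β/2)^{2j-m}`; the
identity `(m+1) binom(2j+1, m+1) = (2j+1) binom(2j, m)` then exchanges the denominators. This is how
the binomials of `p^{[β]}_{2j+1}` arise. -/
theorem coeff_currentSeries [CharZero K] {j m : ℕ} (h : m ≤ 2 * j) :
    2 / ((m + 1 : ℕ) : K) * PowerSeries.coeff (2 * j + 1) (currentSeries β (m + 1)) =
      2 / ((2 * j + 1 : ℕ) : K) * (((2 * j + 1).choose (m + 1) : K) * (β / 2) ^ (2 * j - m)) := by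
  obtain ⟨k, hk⟩ := Nat.exists_eq_add_of_le h
  have e : 2 * j + 1 = k + m + 1 := by omega
  have hc : ((m + 1 : ℕ) : K) * ((k + m + 1).choose (m + 1) : K) =
      ((k + m + 1 : ℕ) : K) * ((m + k).choose m : K) := by
    have := Nat.add_one_mul_choose_eq (k + m) m
    rw [add_comm m k, ← Nat.cast_mul, ← Nat.cast_mul, this, mul_comm]
  have hs : (-1 : K) ^ (m + 1) * (-(β / 2)) ^ k = - (β / 2) ^ k := by
    rw [neg_pow (β / 2) k, ← mul_assoc, ← pow_add, (by omega : m + 1 + k = 2 * j + 1), pow_succ,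
      pow_mul]
    simp
  rw [show 2 * j - m = k by omega, e, currentSeries_eq, PowerSeries.coeff_C_mul, map_sub,
    PowerSeries.coeff_C_mul, coeff_geom_pow, coeff_geom_pow]
  have h1 : ((m + 1 : ℕ) : K) ≠ 0 := by exact_mod_cast Nat.succ_ne_zero m
  have h2 : ((k + m + 1 : ℕ) : K) ≠ 0 := by exact_mod_cast Nat.succ_ne_zero (k + m)
  rw [show (-1 : K) ^ (m + 1) * (((m + k).choose m : K) * (-(β / 2)) ^ k) =
    ((m + k).choose m : K) * ((-1 : K) ^ (m + 1) * (-(β / 2)) ^ k) by ring, hs]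
  generalize (β / 2) ^ k = B
  field_simp
  linear_combination - 2 * B * hc

theorem currentBr_apply (n : ℕ) {d : ℤ} {v : Fock K} (hv : v ∈ Fdeg K d) {M : ℕ} (hM : d ≤ M) :
    currentBr β n v = ∑ j ∈ Finset.range M,
      PowerSeries.coeff (2 * j + 1) (currentSeries β n) • cur K j v := by
  have hlf := locallyFinite_of_cur (K := K) (N := Fock K) fun j : ℕ =>
    PowerSeries.coeff (2 * j + 1) (currentSeries β n) • LinearMap.id
  have : currentBr β n = opSum fun j : ℕ =>
    (PowerSeries.coeff (2 * j + 1) (currentSeries β n) •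
      (LinearMap.id : Fock K →ₗ[K] Fock K)) ∘ₗ cur K j := rfl
  rw [this, opSum_eq_sum hlf (s := Finset.range M)]
  · rfl
  · intro j hj
    simp only [Finset.mem_range, not_lt] at hj
    simp [cur_eq_zero hv (by omega : d ≤ j)]

theorem currentBr_eq_zero {n : ℕ} {d : ℕ} {v : Fock K} (hv : v ∈ Fdeg K d) (h : 2 * d < n) :
    currentBr β n v = 0 := by
  rw [currentBr_apply β n hv le_rfl]
  refine Finset.sum_eq_zero fun j hj => ?_
  rw [Finset.mem_range] at hj
  rw [coeff_currentSeries_of_lt β (by omega), zero_smul]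

theorem LocallyFinite.tensorMap {M N A : Type*} [AddCommGroup M] [Module K M] [AddCommGroup N]
    [Module K N] [AddCommGroup A] [Module K A] {ι : Type*} {f : ι → M →ₗ[K] N}
    (hf : LocallyFinite f) (g : ι → A →ₗ[K] A) :
    LocallyFinite fun i => TensorProduct.map (g i) (f i) := by
  intro x
  induction x using TensorProduct.induction_on with
  | zero => simp
  | tmul a v =>
    refine (hf v).subset fun i hi => ?_
    rw [Function.mem_support] at hi ⊢
    contrapose! hi
    simp [hi]
  | add x y hx hy =>
    refine (hx.union hy).subset fun i hi => ?_
    rw [Function.mem_support] at hi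
    by_contra h
    simp only [Set.mem_union, Function.mem_support, not_or, not_not] at h
    exact hi (by rw [map_add, h.1, h.2, add_zero])

theorem hamBr_locallyFinite : LocallyFinite fun m : ℕ =>
    TensorProduct.map (LinearMap.mulLeft K (psum K (m + 1)))
      ((2 / ((m + 1 : ℕ) : K)) • currentBr β (m + 1)) := by
  refine LocallyFinite.tensorMap (f := fun m : ℕ => (2 / ((m + 1 : ℕ) : K)) • currentBr β (m + 1))
    (locallyFinite_of_Fdeg fun d v hv => (Set.finite_Iic (2 * d)).subset fun m hm => ?_)
    (fun m => LinearMap.mulLeft K (psum K (m + 1)))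
  by_contra h
  simp only [Set.mem_Iic, not_le] at h
  refine hm ?_
  simp [currentBr_eq_zero β hv (by omega : 2 * d < m + 1)]

/-- Extension of a covector with values in an algebra to a linear form on the scalar extension. -/
def extCov {R : Type*} [CommRing R] [Algebra K R] (l : Fock K →ₗ[K] R) : R ⊗[K] Fock K →ₗ[K] R :=
  LinearMap.mul' K R ∘ₗ l.lTensor R

theorem extCov_tmul {R : Type*} [CommRing R] [Algebra K R] (l : Fock K →ₗ[K] R) (r : R)
    (v : Fock K) : extCov l (r ⊗ₜ v) = r * l v := rfl

/-- The parameters `2 p^{[β]}_{2j+1} / (2j+1)` of the Hamiltonian. -/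
def hamPar (j : ℕ) : MvPowerSeries ℕ K := (2 / ((2 * j + 1 : ℕ) : K)) • psumBr β (2 * j + 1)

theorem hamPar_eq_sum [CharZero K] (j : ℕ) {M : ℕ} (hM : 2 * j + 1 ≤ M) :
    hamPar β j = ∑ m ∈ Finset.range M, (2 / ((m + 1 : ℕ) : K) *
      PowerSeries.coeff (2 * j + 1) (currentSeries β (m + 1))) • psum K (m + 1) := by
  rw [hamPar, psumBr, ← Finset.sum_subset (Finset.range_mono hM), Finset.smul_sum]
  · refine Finset.sum_nbij' (fun i => i - 1) (fun m => m + 1) ?_ ?_ ?_ ?_ ?_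
    · intro i hi; simp only [Finset.mem_Icc, Finset.mem_range] at hi ⊢; omega
    · intro i hi; simp only [Finset.mem_Icc, Finset.mem_range] at hi ⊢; omega
    · intro i hi; simp only [Finset.mem_Icc] at hi; omega
    · intro i _; rfl
    · intro i hi
      rw [Finset.mem_Icc] at hi
      obtain ⟨m, rfl⟩ := Nat.exists_eq_add_of_le hi.1
      rw [Nat.add_sub_cancel_left, add_comm 1 m, coeff_currentSeries β (by omega), smul_smul,
        show 2 * j + 1 - (m + 1) = 2 * j - m by omega]
  · intro m _ hm
    rw [Finset.mem_range, not_lt] at hm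
    rw [coeff_currentSeries_of_lt β (by omega), mul_zero, zero_smul]

/-- Exchange of the sums over `n` and over the currents: on a vector of degree `d` both are finite,
and `hamPar_eq_sum` collects the coefficient of each `b_{2j+1}`. -/
theorem extCov_hamBr [CharZero K] (l : Fock K →ₗ[K] MvPowerSeries ℕ K) :
    extCov l ∘ₗ hamBr β = extCov (covN (hamPar β) l) := by
  refine TensorProduct.ext' fun r v => ?_
  rw [extCov_tmul]
  suffices h : (extCov l ∘ₗ hamBr β) ∘ₗ TensorProduct.mk K _ _ r =
      LinearMap.mulLeft K r ∘ₗ covN (hamPar β) l from LinearMap.congr_fun h v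
  refine Fdeg_ext fun d v hv => ?_
  rw [LinearMap.comp_apply, LinearMap.comp_apply, LinearMap.comp_apply, covN_apply _ _ hv le_rfl,
    TensorProduct.mk_apply, hamBr,
    opSum_eq_sum (hamBr_locallyFinite β) (s := Finset.range (2 * d + 1)), map_sum]
  · have h1 : ∀ m ∈ Finset.range (2 * d + 1), extCov l
        (TensorProduct.map (LinearMap.mulLeft K (psum K (m + 1)))
          ((2 / ((m + 1 : ℕ) : K)) • currentBr β (m + 1)) (r ⊗ₜ v)) =
        ∑ j ∈ Finset.range d, r * (((2 / ((m + 1 : ℕ) : K) *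
          PowerSeries.coeff (2 * j + 1) (currentSeries β (m + 1))) • psum K (m + 1)) *
            l (cur K j v)) := by
      intro m _
      rw [TensorProduct.map_tmul, extCov_tmul, LinearMap.smul_apply,
        currentBr_apply β _ hv le_rfl, map_smul, map_sum, LinearMap.mulLeft_apply,
        Finset.smul_sum, Finset.mul_sum]
      refine Finset.sum_congr rfl fun j _ => ?_
      rw [map_smul, smul_smul, mul_smul_comm, smul_mul_assoc, mul_smul_comm]
      congr 1
      ring
    rw [Finset.sum_congr rfl h1, Finset.sum_comm, LinearMap.mulLeft_apply, Finset.mul_sum]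
    refine Finset.sum_congr rfl fun j hj => ?_
    rw [Finset.mem_range] at hj
    rw [← Finset.mul_sum, ← Finset.sum_mul, ← hamPar_eq_sum β j (by omega)]
  · intro m hm
    rw [Finset.mem_range, not_lt] at hm
    rw [TensorProduct.map_tmul, LinearMap.smul_apply,
      currentBr_eq_zero β hv (by omega : 2 * d < m + 1), smul_zero, TensorProduct.tmul_zero]

theorem extCov_hamBr_pow [CharZero K] (l : Fock K →ₗ[K] MvPowerSeries ℕ K) (k : ℕ) :
    extCov l ∘ₗ hamBr β ^ k = extCov ((covN (hamPar β))^[k] l) := by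
  induction k with
  | zero => rfl
  | succ k ih =>
    rw [Function.iterate_succ_apply', ← extCov_hamBr, ← ih, pow_succ]
    rfl

/-- The tensors whose Fock components have degree at most `e`. -/
def tensorDegLE (K : Type*) [Field K] (e : ℤ) : Submodule K (MvPowerSeries ℕ K ⊗[K] Fock K) :=
  Submodule.span K {x | ∃ d ≤ e, ∃ r, ∃ v ∈ Fdeg K d, x = r ⊗ₜ v}

theorem hamBr_mem {e : ℤ} {x : MvPowerSeries ℕ K ⊗[K] Fock K} (hx : x ∈ tensorDegLE K e) :
    hamBr β x ∈ tensorDegLE K (e - 1) := by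
  induction hx using Submodule.span_induction with
  | zero => simp
  | add x y _ _ hx hy => rw [map_add]; exact add_mem hx hy
  | smul c x _ hx => rw [map_smul]; exact Submodule.smul_mem _ _ hx
  | mem x hx =>
    obtain ⟨d, hd, r, v, hv, rfl⟩ := hx
    refine opSum_mem fun m => ?_
    rw [TensorProduct.map_tmul, LinearMap.smul_apply, TensorProduct.tmul_smul,
      currentBr_apply β _ hv (M := d.toNat) (by omega), TensorProduct.tmul_sum]
    refine Submodule.smul_mem _ _ (Submodule.sum_mem _ fun j _ => ?_)
    rw [TensorProduct.tmul_smul]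
    exact Submodule.smul_mem _ _ (Submodule.subset_span
      ⟨_, by push_cast; omega, _, _, cur_mem_Fdeg hv j, rfl⟩)

theorem tensorDegLE_of_neg {e : ℤ} (he : e < 0) {x : MvPowerSeries ℕ K ⊗[K] Fock K}
    (hx : x ∈ tensorDegLE K e) : x = 0 := by
  induction hx using Submodule.span_induction with
  | zero => rfl
  | add x y _ _ hx hy => rw [hx, hy, add_zero]
  | smul c x _ hx => rw [hx, smul_zero]
  | mem x hx =>
    obtain ⟨d, hd, r, v, hv, rfl⟩ := hx
    rw [Fdeg_of_neg (by omega : d < 0) hv, TensorProduct.tmul_zero]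

theorem hamBr_pow_eq_zero (v : MvPowerSeries ℕ K ⊗[K] Fock K) :
    ∃ M : ℕ, ∀ k ≥ M, (hamBr β ^ k) v = 0 := by
  have key : ∀ e : ℤ, ∀ x ∈ tensorDegLE K e, ∀ k : ℕ,
      (hamBr β ^ k) x ∈ tensorDegLE K (e - k) := by
    intro e x hx k
    induction k with
    | zero => simpa using hx
    | succ k ih =>
      rw [pow_succ', Module.End.mul_apply]
      have := hamBr_mem β ih
      rwa [show e - (k : ℤ) - 1 = e - (k + 1 : ℕ) by push_cast; ring] at this
  induction v using TensorProduct.induction_on with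
  | zero => exact ⟨0, fun k _ => map_zero _⟩
  | tmul r v =>
    induction v using fock_induction with
    | hl l =>
      refine ⟨l.sum + 1, fun k hk => tensorDegLE_of_neg (e := (l.sum : ℤ) - k) (by omega)
        (key _ _ (Submodule.subset_span ⟨_, le_rfl, r, _, ketList_mem_Fdeg l, rfl⟩) k)⟩
    | h0 => exact ⟨0, fun k _ => by rw [TensorProduct.tmul_zero, map_zero]⟩
    | hadd x y hx hy =>
      obtain ⟨M, hM⟩ := hx
      obtain ⟨N, hN⟩ := hy
      refine ⟨max M N, fun k hk => ?_⟩
      rw [TensorProduct.tmul_add, map_add, hM k (le_of_max_le_left hk),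
        hN k (le_of_max_le_right hk), add_zero]
    | hsmul c x hx =>
      obtain ⟨M, hM⟩ := hx
      exact ⟨M, fun k hk => by rw [TensorProduct.tmul_smul, map_smul, hM k hk, smul_zero]⟩
  | add x y hx hy =>
    obtain ⟨M, hM⟩ := hx
    obtain ⟨N, hN⟩ := hy
    refine ⟨max M N, fun k hk => ?_⟩
    rw [map_add, hM k (le_of_max_le_left hk), hN k (le_of_max_le_right hk), add_zero]

theorem vevBr_eq_covX [CharZero K] :
    vevBr β = covX (hamPar β) (liftCov (MvPowerSeries ℕ K) (bra0 K)) := by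
  have hlf : LocallyFinite fun k : ℕ => ((k.factorial : K)⁻¹) • hamBr β ^ k := fun x => by
    obtain ⟨M, hM⟩ := hamBr_pow_eq_zero β x
    refine (Set.finite_Iio M).subset fun k hk => ?_
    by_contra h
    simp only [Set.mem_Iio, not_lt] at h
    exact hk (by simp [hM k h])
  have hext : (TensorProduct.rid K (MvPowerSeries ℕ K)).toLinearMap ∘ₗ
      (bra0 K).lTensor (MvPowerSeries ℕ K) =
      extCov (liftCov (MvPowerSeries ℕ K) (bra0 K)) := by
    refine TensorProduct.ext' fun r v => ?_
    rw [extCov_tmul, liftCov_apply, mul_comm, ← Algebra.smul_def]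
    simp
  refine Fdeg_ext fun d v hv => ?_
  obtain ⟨M, hM⟩ := hamBr_pow_eq_zero β ((1 : MvPowerSeries ℕ K) ⊗ₜ[K] v)
  have h1 : vevBr β v = extCov (liftCov (MvPowerSeries ℕ K) (bra0 K))
      (opExp (hamBr β) ((1 : MvPowerSeries ℕ K) ⊗ₜ[K] v)) := by
    rw [← hext]; rfl
  rw [h1, opExp, opSum_eq_sum hlf (s := Finset.range (M + d + 1)), map_sum,
    covX_apply _ _ hv (M := M + d + 1) (by push_cast; omega)]
  · refine Finset.sum_congr rfl fun k _ => ?_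
    rw [LinearMap.smul_apply, map_smul]
    congr 1
    have := LinearMap.congr_fun (extCov_hamBr_pow β (liftCov (MvPowerSeries ℕ K) (bra0 K)) k)
      ((1 : MvPowerSeries ℕ K) ⊗ₜ[K] v)
    rw [extCov_tmul, one_mul] at this
    exact this
  · intro k hk
    rw [Finset.mem_range, not_lt] at hk
    rw [LinearMap.smul_apply, hM k (by omega), smul_zero]

/-- Each value is a finite polynomial expression in the parameters `hamPar`, which are multiples of
the generators. -/
theorem vevBr_mem_gGamma [CharZero K] (v : Fock K) : vevBr β v ∈ gGamma β := by
  rw [vevBr_eq_covX]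
  refine covX_mem _ _ (fun j => Subalgebra.smul_mem _ (Algebra.subset_adjoin (Set.mem_range_self j)) _)
    (fun v => ?_) v
  rw [liftCov_apply]
  exact Subalgebra.algebraMap_mem _ _

end Hamiltonian

/-! ### The vectors `|λ⟩_q` -/

section Ket

variable {K : Type*} [Field K] (β : K)

theorem Feven_eq_Fpar : Feven K = Fpar K True := by
  rw [Feven, Fpar]
  congr 1
  ext v
  simp [ketList]

theorem opExp_theta_mem_Fpar {p : Prop} {v : Fock K} (hv : v ∈ Fpar K p) :
    opExp (-theta β) v ∈ Fpar K p := by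
  refine opSum_mem fun k => Submodule.smul_mem _ _ ?_
  induction k with
  | zero => exact hv
  | succ k ih =>
    rw [pow_succ', Module.End.mul_apply, LinearMap.neg_apply]
    exact neg_mem (opSum_mem fun j => Submodule.smul_mem _ _ (current_mem_Fpar ih))

theorem phiBr_mem_Fpar {p : Prop} {v : Fock K} (hv : v ∈ Fpar K p) (n : ℤ) :
    phiBr β n v ∈ Fpar K (¬ p) := by
  rw [phiBr]
  split_ifs
  · rw [LinearMap.sum_apply]
    exact Submodule.sum_mem _ fun k _ => Submodule.smul_mem _ _ (phi_mem_Fpar hv _)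
  · exact opSum_mem fun k => Submodule.smul_mem _ _ (phi_mem_Fpar hv _)

/-- The vector `φ^{[β]}_{a₁} e^{-θ} ⋯ φ^{[β]}_{aᵣ} e^{-θ} v`. -/
def ketFold (l : List ℕ) (v : Fock K) : Fock K :=
  l.foldr (fun (n : ℕ) v => phiBr β (n : ℤ) (opExp (-theta β) v)) v

theorem ketq_eq_ketFold (lam : StrictPartition) : ketq β lam =
    ketFold β (if Even lam.length then lam.parts else lam.parts ++ [0]) (vac K) := by
  rw [ketq]
  generalize (if Even lam.length then lam.parts else lam.parts ++ [0]) = l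
  induction l with
  | nil => rfl
  | cons a l ih => exact congrArg (fun v => phiBr β (a : ℤ) (opExp (-theta β) v)) ih

theorem ketFold_cons (a : ℕ) (l : List ℕ) (v : Fock K) :
    ketFold β (a :: l) v = phiBr β (a : ℤ) (opExp (-theta β) (ketFold β l v)) := rfl

theorem ketFold_mem_Fpar (l : List ℕ) : ketFold β l (vac K) ∈ Fpar K (Even l.length) := by
  induction l with
  | nil => exact Submodule.subset_span ⟨[], by simp, rfl⟩
  | cons a l ih =>
    rw [ketFold_cons, List.length_cons, show Even (l.length + 1) = ¬ Even l.length from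
      propext Nat.even_add_one]
    exact phiBr_mem_Fpar β (opExp_theta_mem_Fpar β ih) _

theorem ketq_mem_Feven (lam : StrictPartition) : ketq β lam ∈ Feven K := by
  rw [Feven_eq_Fpar]
  have h := ketFold_mem_Fpar β (if Even lam.length then lam.parts else lam.parts ++ [0])
  have hE : Even (if Even lam.length then lam.parts else lam.parts ++ [0]).length = True := by
    split_ifs with h
    · exact eq_true h
    · rw [List.length_append, List.length_singleton]
      exact eq_true (Nat.even_add_one.mpr h)
  rw [hE] at h
  rwa [ketq_eq_ketFold]

theorem opExp_theta_vac : opExp (-theta β) (vac K) = vac K := by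
  obtain ⟨M, hM⟩ := opExp_theta_eq_sum β (vac K)
  have h0 : theta β (vac K) = 0 := by
    rw [theta_apply β vac_mem_Fdeg (M := 0) (by simp)]; simp
  rw [hM (M + 1) (by omega), Finset.sum_range_succ']
  rw [Finset.sum_eq_zero]
  · simp
  · intro k _
    rw [pow_succ, Module.End.mul_apply, LinearMap.neg_apply, h0]
    simp

theorem phiBr_zero_vac : phiBr β 0 (vac K) = phi K 0 (vac K) := by
  have hlf : LocallyFinite fun k : ℕ =>
      ((Polynomial.X + Polynomial.C (β / 2) : Polynomial K) ^ k).coeff (0 : ℤ).natAbs •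
        phi K (-(k : ℤ)) := by
    refine locallyFinite_of_Fdeg fun d v hv => (Set.finite_Iic d).subset fun k hk => ?_
    by_contra h
    simp only [Set.mem_Iic, not_le] at h
    exact hk (by simp [phi_eq_zero hv (by omega : (d : ℤ) + -(k : ℤ) < 0)])
  rw [phiBr, if_neg (lt_irrefl _), opSum_eq_sum hlf (s := {0})]
  · simp
  · intro k hk
    rw [Finset.mem_singleton] at hk
    rw [LinearMap.smul_apply, phi_neg_vac K _ (by omega), smul_zero]

/-- The vector `|λ⟩_q` is obtained from a vector of degree zero which pairs to one with the
corresponding covector. -/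
theorem exists_ketq_eq [CharZero K] (lam : StrictPartition) :
    ∃ v ∈ Fdeg K 0, bra0 K ((phi K 0)^[lam.parts.length] v) = 1 ∧
      ketq β lam = ketFold β lam.parts v := by
  have hit : ∀ n : ℕ, (phi K 0)^[2 * n] (vac K) = vac K := fun n => by
    rw [Function.iterate_mul]
    exact Function.iterate_fixed (phi_zero_phi_zero (vac K)) n
  by_cases h : Even lam.length
  · refine ⟨vac K, vac_mem_Fdeg, ?_, ?_⟩
    · obtain ⟨n, hn⟩ := h
      rw [show lam.parts.length = 2 * n by rw [← two_mul] at hn; exact hn, hit, bra0_vac]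
    · rw [ketq_eq_ketFold, if_pos h]
  -- For odd length the appended `φ^{[β]}_0 e^{-θ}` acts on the vacuum as plain `φ₀`, which pairs
  -- with the odd power of `φ₀` accumulated by the covector.
  · refine ⟨phi K 0 (vac K), by simpa using phi_mem_Fdeg vac_mem_Fdeg 0, ?_, ?_⟩
    · rw [Nat.not_even_iff_odd] at h
      obtain ⟨n, hn⟩ := h
      rw [← Function.iterate_succ_apply, show lam.parts.length = 2 * n + 1 from hn,
        show (2 * n + 1).succ = 2 * (n + 1) by omega, hit, bra0_vac]
    · rw [ketq_eq_ketFold, if_neg h, ketFold, List.foldr_append]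
      simp only [List.foldr_cons, List.foldr_nil]
      rw [opExp_theta_vac, Nat.cast_zero, phiBr_zero_vac]; rfl

end Ket

/-! ### Power series in a union of two sets of variables -/

section Curry

variable {R σ τ υ : Type*} [CommRing R]

/-- The function underlying `mvCurry`. -/
def mvCurryFun (e : (υ →₀ ℕ) ≃+ (σ →₀ ℕ) × (τ →₀ ℕ)) (f : MvPowerSeries υ R) :
    MvPowerSeries τ (MvPowerSeries σ R) :=
  fun n => (fun m => MvPowerSeries.coeff (e.symm (m, n)) f : MvPowerSeries σ R)

theorem coeff_coeff_mvCurryFun (e : (υ →₀ ℕ) ≃+ (σ →₀ ℕ) × (τ →₀ ℕ)) (f : MvPowerSeries υ R)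
    (n : τ →₀ ℕ) (m : σ →₀ ℕ) : MvPowerSeries.coeff m (MvPowerSeries.coeff n (mvCurryFun e f)) =
      MvPowerSeries.coeff (e.symm (m, n)) f := rfl

/-- Power series in a union of two sets of variables, viewed as power series in the second set
with coefficients power series in the first set. -/
def mvCurry (e : (υ →₀ ℕ) ≃+ (σ →₀ ℕ) × (τ →₀ ℕ)) :
    MvPowerSeries υ R →+* MvPowerSeries τ (MvPowerSeries σ R) where
  toFun := mvCurryFun e
  map_zero' := rfl
  map_add' _ _ := rfl
  map_one' := by
    classical
    refine MvPowerSeries.ext fun n => MvPowerSeries.ext fun m => ?_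
    rw [coeff_coeff_mvCurryFun]
    have h : e.symm (m, n) = 0 ↔ m = 0 ∧ n = 0 := by
      rw [AddEquiv.map_eq_zero_iff, Prod.mk_eq_zero]
    rw [MvPowerSeries.coeff_one, MvPowerSeries.coeff_one, apply_ite (MvPowerSeries.coeff m),
      MvPowerSeries.coeff_one, map_zero]
    simp only [h, ite_and]
    split_ifs <;> rfl
  map_mul' f g := by
    classical
    refine MvPowerSeries.ext fun n => MvPowerSeries.ext fun m => ?_
    rw [coeff_coeff_mvCurryFun]
    rw [MvPowerSeries.coeff_mul, MvPowerSeries.coeff_mul, map_sum]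
    simp only [MvPowerSeries.coeff_mul, coeff_coeff_mvCurryFun]
    rw [← Finset.sum_product']
    refine Finset.sum_bij' (fun p _ => (((e p.1).2, (e p.2).2), ((e p.1).1, (e p.2).1)))
      (fun p _ => (e.symm (p.2.1, p.1.1), e.symm (p.2.2, p.1.2))) ?_ ?_ ?_ ?_ ?_
    · rintro ⟨p, q⟩ h
      rw [Finset.HasAntidiagonal.mem_antidiagonal] at h
      have h' := congrArg e h
      rw [map_add, AddEquiv.apply_symm_apply] at h'
      simp only [Finset.mem_product, Finset.HasAntidiagonal.mem_antidiagonal]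
      exact ⟨congrArg Prod.snd h', congrArg Prod.fst h'⟩
    · rintro ⟨⟨a, b⟩, ⟨c, d⟩⟩ h
      simp only [Finset.mem_product, Finset.HasAntidiagonal.mem_antidiagonal] at h ⊢
      rw [← map_add, Prod.mk_add_mk, h.1, h.2]
    · rintro ⟨p, q⟩ _
      simp
    · rintro ⟨⟨a, b⟩, ⟨c, d⟩⟩ _
      simp
    · rintro ⟨p, q⟩ _
      simp

theorem coeff_coeff_mvCurry (e : (υ →₀ ℕ) ≃+ (σ →₀ ℕ) × (τ →₀ ℕ)) (f : MvPowerSeries υ R)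
    (n : τ →₀ ℕ) (m : σ →₀ ℕ) : MvPowerSeries.coeff m (MvPowerSeries.coeff n (mvCurry e f)) =
      MvPowerSeries.coeff (e.symm (m, n)) f := rfl

theorem mvCurry_monomial (e : (υ →₀ ℕ) ≃+ (σ →₀ ℕ) × (τ →₀ ℕ)) (m : σ →₀ ℕ) (n : τ →₀ ℕ)
    (r : R) : mvCurry e (MvPowerSeries.monomial (e.symm (m, n)) r) =
      MvPowerSeries.monomial n (MvPowerSeries.monomial m r) := by
  classical
  refine MvPowerSeries.ext fun n' => MvPowerSeries.ext fun m' => ?_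
  rw [coeff_coeff_mvCurry, MvPowerSeries.coeff_monomial, MvPowerSeries.coeff_monomial,
    apply_ite (MvPowerSeries.coeff m'), MvPowerSeries.coeff_monomial, map_zero, ← ite_and]
  refine if_congr ?_ rfl rfl
  rw [e.symm.injective.eq_iff, Prod.mk.injEq, and_comm]

end Curry

/-! ### Exponents in the variables `s₀, s₁, …` with `xᵢ = s₀ ⋯ sᵢ` -/

section Exponents

/-- Splitting off the zeroth exponent. -/
def expEquiv : (ℕ →₀ ℕ) ≃+ (Unit →₀ ℕ) × (ℕ →₀ ℕ) :=
  (Finsupp.domCongr (Equiv.natSumPUnitEquivNat.symm.trans (Equiv.sumComm ℕ Unit))).trans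
    Finsupp.sumFinsuppAddEquivProdFinsupp

/-- The exponent `(n, m₀, m₁, …)`. -/
def consExp (n : ℕ) (m : ℕ →₀ ℕ) : ℕ →₀ ℕ := expEquiv.symm (Finsupp.single () n, m)

theorem consExp_zero (n : ℕ) (m : ℕ →₀ ℕ) : consExp n m 0 = n := by
  have : consExp n m 0 = Finsupp.single () n () := rfl
  simp [this]

theorem consExp_succ (n : ℕ) (m : ℕ →₀ ℕ) (k : ℕ) : consExp n m (k + 1) = m k := rfl

/-- The exponent of `s₀ s₁ ⋯ sᵢ`. -/
def preExp (i : ℕ) : ℕ →₀ ℕ := ∑ k ∈ Finset.range (i + 1), Finsupp.single k 1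

/-- The exponent of `s_{i+1} ⋯ sⱼ`. -/
def segExp (i j : ℕ) : ℕ →₀ ℕ := ∑ k ∈ Finset.Ioc i j, Finsupp.single k 1

theorem preExp_apply (i k : ℕ) : preExp i k = if k ≤ i then 1 else 0 := by
  simp [preExp, Finsupp.finsetSum_apply, Finsupp.single_apply]

theorem segExp_apply (i j k : ℕ) : segExp i j k = if i < k ∧ k ≤ j then 1 else 0 := by
  simp [segExp, Finsupp.finsetSum_apply, Finsupp.single_apply]

theorem preExp_zero : preExp 0 = consExp 1 0 := by
  ext k
  cases k with
  | zero => rw [preExp_apply, consExp_zero]; simp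
  | succ k => rw [preExp_apply, consExp_succ]; simp

theorem preExp_succ (j : ℕ) : preExp (j + 1) = consExp 1 (preExp j) := by
  ext k
  cases k with
  | zero => rw [preExp_apply, consExp_zero]; simp
  | succ k => rw [preExp_apply, consExp_succ, preExp_apply]; simp

theorem segExp_zero_succ (j : ℕ) : segExp 0 (j + 1) = consExp 0 (preExp j) := by
  ext k
  cases k with
  | zero => rw [segExp_apply, consExp_zero]; simp
  | succ k => rw [segExp_apply, consExp_succ, preExp_apply]; simp

theorem segExp_succ_succ (i j : ℕ) : segExp (i + 1) (j + 1) = consExp 0 (segExp i j) := by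
  ext k
  cases k with
  | zero => rw [segExp_apply, consExp_zero]; simp
  | succ k => rw [segExp_apply, consExp_succ, segExp_apply]; simp

theorem preExp_ne_zero (i : ℕ) : preExp i ≠ 0 := fun h => by
  have := DFunLike.congr_fun h 0
  simp [preExp_apply] at this

theorem segExp_ne_zero {i j : ℕ} (hij : i < j) : segExp i j ≠ 0 := fun h => by
  have := DFunLike.congr_fun h j
  simp [segExp_apply, hij] at this

/-- The exponent of `x₀^{a₁} x₁^{a₂} ⋯` in terms of `xᵢ = s₀ ⋯ sᵢ`. -/
def tailList : List ℕ → ℕ →₀ ℕ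
  | [] => 0
  | a :: l => consExp (a + l.sum) (tailList l)

theorem tailList_zero (l : List ℕ) : tailList l 0 = l.sum := by
  cases l with
  | nil => rfl
  | cons a l => rw [tailList, consExp_zero, List.sum_cons]

end Exponents

/-! ### The kernel `∏ κᵢⱼ` -/

section Kappa

variable {R : Type*} [CommRing R]

/-- The element `xᵢ = s₀ s₁ ⋯ sᵢ`. -/
def xs (R : Type*) [CommRing R] (i : ℕ) : MvPowerSeries ℕ R := MvPowerSeries.monomial (preExp i) 1

/-- The element `xⱼ / xᵢ = s_{i+1} ⋯ sⱼ`. -/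
def ratio (R : Type*) [CommRing R] (i j : ℕ) : MvPowerSeries ℕ R :=
  MvPowerSeries.monomial (segExp i j) 1

theorem constantCoeff_xs (i : ℕ) : MvPowerSeries.constantCoeff (xs R i) = 0 := by
  classical
  rw [xs, ← MvPowerSeries.coeff_zero_eq_constantCoeff_apply, MvPowerSeries.coeff_monomial,
    if_neg (preExp_ne_zero i).symm]

theorem constantCoeff_ratio {i j : ℕ} (h : i < j) :
    MvPowerSeries.constantCoeff (ratio R i j) = 0 := by
  classical
  rw [ratio, ← MvPowerSeries.coeff_zero_eq_constantCoeff_apply, MvPowerSeries.coeff_monomial,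
    if_neg (segExp_ne_zero h).symm]

theorem xs_eq_mul_ratio {i j : ℕ} (h : i < j) : xs R j = xs R i * ratio R i j := by
  have hs : preExp j = preExp i + segExp i j := by
    ext k
    simp only [Finsupp.add_apply, preExp_apply, segExp_apply]
    split_ifs <;> omega
  rw [xs, xs, ratio, MvPowerSeries.monomial_mul_monomial, one_mul, hs]

/-- The denominator of `κᵢⱼ`. -/
def kapDen (b : R) (i j : ℕ) : MvPowerSeries ℕ R :=
  (1 + MvPowerSeries.C b * xs R j) * (1 + ratio R i j + MvPowerSeries.C b * xs R j)

/-- `κᵢⱼ = (xᵢ ⊖ xⱼ) / (xᵢ ⊕ xⱼ)`, expanded for `xⱼ / xᵢ` small. -/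
def kap (b : R) (i j : ℕ) : MvPowerSeries ℕ R :=
  (1 - ratio R i j) * MvPowerSeries.invOfUnit (kapDen b i j) 1

theorem constantCoeff_kapDen (b : R) {i j : ℕ} (h : i < j) :
    MvPowerSeries.constantCoeff (kapDen b i j) = 1 := by
  simp [kapDen, constantCoeff_xs, constantCoeff_ratio h]

theorem kap_mul_kapDen (b : R) {i j : ℕ} (h : i < j) :
    kap b i j * kapDen b i j = 1 - ratio R i j := by
  rw [kap, mul_assoc, MvPowerSeries.invOfUnit_mul _ _ (constantCoeff_kapDen b h), mul_one]

theorem isUnit_kapDen (b : R) {i j : ℕ} (h : i < j) : IsUnit (kapDen b i j) := by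
  rw [MvPowerSeries.isUnit_iff_constantCoeff, constantCoeff_kapDen b h]
  exact isUnit_one

/-- `∏_{i < j} κᵢⱼ` over a finite set of indices. -/
def kapProd (b : R) (S : Finset ℕ) : MvPowerSeries ℕ R :=
  ∏ i ∈ S, ∏ j ∈ S, if i < j then kap b i j else 1

/-- The pairs involving the variable `x₀` are split off in preparation for removing it. -/
theorem kapProd_range_succ (b : R) (q : ℕ) : kapProd b (Finset.range (q + 1)) =
    (∏ i ∈ Finset.range q, ∏ j ∈ Finset.range q, if i < j then kap b (i + 1) (j + 1) else 1) *
      ∏ j ∈ Finset.range q, kap b 0 (j + 1) := by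
  rw [kapProd, Finset.prod_range_succ', Finset.prod_range_succ']
  congr 1
  · refine Finset.prod_congr rfl fun i _ => ?_
    rw [Finset.prod_range_succ']
    simp
  · simp

/-- The series `∏_{i < q} ω(xᵢ) ∏_{i < j < q} κᵢⱼ`. -/
def omegaProd (b : R) (q : ℕ) (ω : PowerSeries R) : MvPowerSeries ℕ R :=
  (∏ i ∈ Finset.range q, PowerSeries.subst (xs R i) ω) * kapProd b (Finset.range q)

end Kappa

/-! ### Removing the first variable from `∏ ω(xᵢ) ∏ κᵢⱼ` -/

section Recursion

variable (R : Type*) [CommRing R]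

/-- Separation of `s₀`, with values in Laurent series in `s₀`. -/
def splitHom : MvPowerSeries ℕ R →+* MvPowerSeries ℕ (LaurentSeries R) :=
  (MvPowerSeries.map (HahnSeries.ofPowerSeries ℤ R)).comp (mvCurry expEquiv)

/-- The specialisation `U ↦ Z⁻¹`. -/
def invEval : Polynomial R →+* LaurentSeries R :=
  Polynomial.eval₂RingHom (HahnSeries.C : R →+* LaurentSeries R) (HahnSeries.single (-1) 1)

/-- The specialisation `U ↦ Z⁻¹`, `s₀ ↦ Z s₀`. -/
def scaleHom : MvPowerSeries ℕ (Polynomial R) →+* MvPowerSeries ℕ (LaurentSeries R) :=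
  (MvPowerSeries.rescale fun i => if i = 0 then HahnSeries.single 1 1 else 1).comp
    (MvPowerSeries.map (invEval R))

variable {R}

theorem coeff_coeff_splitHom (f : MvPowerSeries ℕ R) (n : ℕ) (m : ℕ →₀ ℕ) :
    (MvPowerSeries.coeff m (splitHom R f)).coeff (n : ℤ) =
      MvPowerSeries.coeff (consExp n m) f := by
  rw [splitHom, RingHom.comp_apply, MvPowerSeries.coeff_map, HahnSeries.ofPowerSeries_apply_coeff]
  rfl

theorem coeff_scaleHom (f : MvPowerSeries ℕ (Polynomial R)) (m : ℕ →₀ ℕ) :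
    MvPowerSeries.coeff m (scaleHom R f) =
      HahnSeries.single (m 0 : ℤ) 1 * invEval R (MvPowerSeries.coeff m f) := by
  rw [scaleHom, RingHom.comp_apply, MvPowerSeries.coeff_rescale, MvPowerSeries.coeff_map]
  congr 1
  rw [Finsupp.prod, Finset.prod_eq_single 0]
  · rw [if_pos rfl, HahnSeries.single_pow]
    simp
  · intro k _ hk
    rw [if_neg hk, one_pow]
  · intro h
    rw [Finsupp.notMem_support_iff] at h
    rw [h, pow_zero]

/-- Identifies the functional `extrW` of the fermionic recursion with coefficient extraction in
Laurent series at `U = Z⁻¹`. The factor `Z^n` comes from the scaling of `s₀` in `scaleHom`. -/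
theorem coeff_mul_invEval (ω : PowerSeries R) (a n : ℕ) (c : Polynomial R) :
    (HahnSeries.ofPowerSeries ℤ R ω * (HahnSeries.single (n : ℤ) 1 * invEval R c)).coeff
      ((a + n : ℕ) : ℤ) = extrW ω a c := by
  induction c using Polynomial.induction_on' with
  | add p q hp hq => rw [map_add, mul_add, mul_add, HahnSeries.coeff_add, hp, hq, map_add]
  | monomial p r =>
    have h1 : invEval R (Polynomial.monomial p r) = HahnSeries.single (-(p : ℤ)) r := by
      rw [invEval, Polynomial.coe_eval₂RingHom, Polynomial.eval₂_monomial, HahnSeries.single_pow,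
        HahnSeries.C_apply, HahnSeries.single_mul_single]
      simp
    rw [h1, HahnSeries.single_mul_single, one_mul, extrW_monomial]
    have h2 : ((a + n : ℕ) : ℤ) = ((a + p : ℕ) : ℤ) + ((n : ℤ) + -(p : ℤ)) := by push_cast; ring
    rw [h2, HahnSeries.coeff_mul_single_add, HahnSeries.ofPowerSeries_apply_coeff]

theorem splitHom_monomial (n : ℕ) (m : ℕ →₀ ℕ) (r : R) :
    splitHom R (MvPowerSeries.monomial (consExp n m) r) =
      MvPowerSeries.monomial m (HahnSeries.single (n : ℤ) r) := by
  rw [splitHom, RingHom.comp_apply, consExp, mvCurry_monomial, MvPowerSeries.map_monomial]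
  congr 1
  have h : (MvPowerSeries.monomial (Finsupp.single () n) r : PowerSeries R) =
      PowerSeries.C r * PowerSeries.X ^ n := PowerSeries.monomial_eq_mk n r ▸ by
    ext k; simp [PowerSeries.coeff_X_pow]
  rw [h, map_mul, map_pow, HahnSeries.ofPowerSeries_C, HahnSeries.ofPowerSeries_X,
    HahnSeries.single_pow, HahnSeries.C_apply, HahnSeries.single_mul_single]
  simp

theorem scaleHom_monomial (m : ℕ →₀ ℕ) (r : Polynomial R) :
    scaleHom R (MvPowerSeries.monomial m r) =
      MvPowerSeries.monomial m (HahnSeries.single (m 0 : ℤ) 1 * invEval R r) := by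
  classical
  refine MvPowerSeries.ext fun n => ?_
  rw [coeff_scaleHom, MvPowerSeries.coeff_monomial, MvPowerSeries.coeff_monomial]
  split_ifs with h
  · rw [h]
  · rw [map_zero (invEval R), mul_zero]

/-- The powers of a nonconstant monomial have distinct exponents, so at most one coefficient of `ω`
contributes. -/
theorem coeff_subst_monomial {σ : Type*} {m : σ →₀ ℕ} (hm : m ≠ 0) (ω : PowerSeries R)
    (d : σ →₀ ℕ) : (∀ k : ℕ, d ≠ k • m) ∧
        MvPowerSeries.coeff d (PowerSeries.subst (MvPowerSeries.monomial m (1 : R)) ω) = 0 ∨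
      ∃ k : ℕ, d = k • m ∧
        MvPowerSeries.coeff d (PowerSeries.subst (MvPowerSeries.monomial m (1 : R)) ω) =
          PowerSeries.coeff k ω := by
  classical
  have h := PowerSeries.coeff_subst (PowerSeries.HasSubst.monomial hm (1 : R)) ω d
  simp only [MvPowerSeries.monomial_pow, MvPowerSeries.coeff_monomial, one_pow, smul_eq_mul,
    mul_ite, mul_one, mul_zero] at h
  by_cases hd : ∀ k : ℕ, d ≠ k • m
  · refine Or.inl ⟨hd, ?_⟩
    rw [h]
    exact finsum_eq_zero_of_forall_eq_zero fun k => if_neg (hd k)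
  · push Not at hd
    obtain ⟨k, hk⟩ := hd
    refine Or.inr ⟨k, hk, ?_⟩
    rw [h, finsum_eq_single _ k, if_pos hk]
    intro k' hk'
    refine if_neg fun h' => hk' ?_
    obtain ⟨i, hi⟩ := Finsupp.ne_iff.mp hm
    have := DFunLike.congr_fun (h'.symm.trans hk) i
    simp only [Finsupp.smul_apply, smul_eq_mul] at this
    exact Nat.eq_of_mul_eq_mul_right (Nat.pos_of_ne_zero hi) this

theorem coeff_subst_monomial_of_eq {σ : Type*} {m : σ →₀ ℕ} (hm : m ≠ 0) (ω : PowerSeries R)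
    (k : ℕ) : MvPowerSeries.coeff (k • m)
      (PowerSeries.subst (MvPowerSeries.monomial m (1 : R)) ω) = PowerSeries.coeff k ω := by
  rcases coeff_subst_monomial hm ω (k • m) with ⟨h, _⟩ | ⟨k', h1, h2⟩
  · exact absurd rfl (h k)
  · obtain ⟨i, hi⟩ := Finsupp.ne_iff.mp hm
    have := DFunLike.congr_fun h1 i
    simp only [Finsupp.smul_apply, smul_eq_mul] at this
    rw [h2, Nat.eq_of_mul_eq_mul_right (Nat.pos_of_ne_zero hi) this]

end Recursion

section Recursion

variable {R : Type*} [CommRing R]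

theorem nsmul_consExp (k n : ℕ) (m : ℕ →₀ ℕ) : k • consExp n m = consExp (k * n) (k • m) := by
  rw [consExp, consExp, ← map_nsmul, Prod.smul_mk, Finsupp.smul_single, smul_eq_mul]

theorem consExp_inj {n n' : ℕ} {m m' : ℕ →₀ ℕ} :
    consExp n m = consExp n' m' ↔ n = n' ∧ m = m' := by
  rw [consExp, consExp, expEquiv.symm.injective.eq_iff, Prod.mk.injEq,
    (Finsupp.single_injective ()).eq_iff]

theorem hasSubst_xs (i : ℕ) : PowerSeries.HasSubst (xs R i) :=
  PowerSeries.HasSubst.monomial (preExp_ne_zero i) 1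

/-- Evaluation of a power series at `xᵢ`. -/
def xsEval (i : ℕ) : PowerSeries R →ₐ[R] MvPowerSeries ℕ R :=
  PowerSeries.substAlgHom (hasSubst_xs i)

theorem xsEval_apply (i : ℕ) (ω : PowerSeries R) : xsEval i ω = PowerSeries.subst (xs R i) ω := by
  rw [xsEval, PowerSeries.coe_substAlgHom]

theorem xsEval_linear (i : ℕ) (c : R) : xsEval i (1 + PowerSeries.C c * PowerSeries.X) =
    1 + MvPowerSeries.C c * xs R i := by
  rw [map_add, map_mul, map_one]
  congr 2
  · exact (xsEval i).commutes c
  · exact PowerSeries.substAlgHom_X _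

theorem coeff_splitHom (f : MvPowerSeries ℕ R) (m : ℕ →₀ ℕ) :
    MvPowerSeries.coeff m (splitHom R f) = HahnSeries.ofPowerSeries ℤ R
      (PowerSeries.mk fun n => MvPowerSeries.coeff (consExp n m) f) := by
  rw [splitHom, RingHom.comp_apply, MvPowerSeries.coeff_map]
  congr 1
  ext n
  rw [PowerSeries.coeff_mk]
  rfl

theorem splitHom_xsEval_zero (ω : PowerSeries R) :
    splitHom R (xsEval 0 ω) = MvPowerSeries.C (HahnSeries.ofPowerSeries ℤ R ω) := by
  classical
  refine MvPowerSeries.ext fun m => ?_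
  rw [coeff_splitHom, MvPowerSeries.coeff_C]
  have hk : ∀ k : ℕ, k • preExp 0 = consExp k 0 := fun k => by
    rw [preExp_zero, nsmul_consExp, mul_one, smul_zero]
  split_ifs with h
  · subst h
    congr 1
    ext n
    rw [PowerSeries.coeff_mk, ← hk, xsEval_apply, xs, coeff_subst_monomial_of_eq (preExp_ne_zero 0)]
  · rw [← map_zero (HahnSeries.ofPowerSeries ℤ R)]
    congr 1
    ext n
    rw [PowerSeries.coeff_mk, xsEval_apply, xs]
    rcases coeff_subst_monomial (preExp_ne_zero 0) ω (consExp n m) with ⟨_, h2⟩ | ⟨k, h1, _⟩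
    · rw [h2, map_zero]
    · rw [hk, consExp_inj] at h1
      exact absurd h1.2 h

theorem invEval_C (r : R) : invEval R (Polynomial.C r) = HahnSeries.single 0 r := by
  rw [invEval, Polynomial.coe_eval₂RingHom, Polynomial.eval₂_C, HahnSeries.C_apply]

theorem invEval_X : invEval R Polynomial.X = HahnSeries.single (-1) 1 := by
  rw [invEval, Polynomial.coe_eval₂RingHom, Polynomial.eval₂_X]

/-- With `Z = s₀` and the other `s`-variables renumbered from zero, the old `x_{j+1}` is `Z` times
the new `xⱼ`, which is what the scaling does. -/
theorem splitHom_xsEval_succ (j : ℕ) (ω : PowerSeries R) :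
    splitHom R (xsEval (j + 1) ω) =
      scaleHom R (xsEval j (PowerSeries.map Polynomial.C ω)) := by
  refine MvPowerSeries.ext fun m => ?_
  rw [coeff_splitHom, coeff_scaleHom, xsEval_apply, xsEval_apply, xs, xs]
  have hk : ∀ k : ℕ, k • preExp (j + 1) = consExp k (k • preExp j) := fun k => by
    rw [preExp_succ, nsmul_consExp, mul_one]
  rcases coeff_subst_monomial (preExp_ne_zero j) (PowerSeries.map Polynomial.C ω) m with
    ⟨h1, h2⟩ | ⟨k, h1, h2⟩
  · rw [h2, map_zero (invEval R), mul_zero, ← map_zero (HahnSeries.ofPowerSeries ℤ R)]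
    congr 1
    ext n
    rw [PowerSeries.coeff_mk, map_zero]
    rcases coeff_subst_monomial (preExp_ne_zero (j + 1)) ω (consExp n m) with
      ⟨_, h4⟩ | ⟨k, h3, _⟩
    · exact h4
    · rw [hk, consExp_inj] at h3
      exact absurd h3.2 (h1 k)
  · rw [h2, PowerSeries.coeff_map, invEval_C, HahnSeries.single_mul_single, one_mul, add_zero]
    have hm0 : m 0 = k := by
      rw [h1, Finsupp.smul_apply, preExp_apply]; simp
    have : (PowerSeries.mk fun n => MvPowerSeries.coeff (consExp n m)
        (PowerSeries.subst (MvPowerSeries.monomial (preExp (j + 1)) (1 : R)) ω)) =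
        PowerSeries.C (PowerSeries.coeff k ω) * PowerSeries.X ^ k := by
      ext n
      rw [PowerSeries.coeff_mk, PowerSeries.coeff_C_mul, PowerSeries.coeff_X_pow, mul_ite, mul_one,
        mul_zero]
      split_ifs with hn
      · rw [hn, h1, ← hk, coeff_subst_monomial_of_eq (preExp_ne_zero (j + 1))]
      · rcases coeff_subst_monomial (preExp_ne_zero (j + 1)) ω (consExp n m) with
          ⟨_, h4⟩ | ⟨k', h3, _⟩
        · exact h4
        · rw [hk, consExp_inj] at h3
          have := DFunLike.congr_fun h3.2 0
          rw [hm0, Finsupp.smul_apply, preExp_apply] at this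
          simp only [zero_le, if_true, smul_eq_mul, mul_one] at this
          exact absurd (h3.1.trans this.symm) hn
    rw [this, map_mul, HahnSeries.ofPowerSeries_C, HahnSeries.ofPowerSeries_X_pow,
      HahnSeries.C_apply, HahnSeries.single_mul_single, hm0]
    simp

theorem splitHom_xs_succ (j : ℕ) : splitHom R (xs R (j + 1)) =
    MvPowerSeries.monomial (preExp j) (HahnSeries.single 1 1) := by
  rw [xs, preExp_succ, splitHom_monomial, Nat.cast_one]

theorem scaleHom_xs (j : ℕ) : scaleHom R (xs (Polynomial R) j) = splitHom R (xs R (j + 1)) := by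
  rw [splitHom_xs_succ, xs, scaleHom_monomial, preExp_apply]
  simp

theorem scaleHom_ratio (i j : ℕ) :
    scaleHom R (ratio (Polynomial R) i j) = splitHom R (ratio R (i + 1) (j + 1)) := by
  rw [ratio, ratio, segExp_succ_succ, splitHom_monomial, scaleHom_monomial, segExp_apply]
  simp

theorem scaleHom_C (b : R) :
    scaleHom R (MvPowerSeries.C (Polynomial.C b)) = splitHom R (MvPowerSeries.C b) := by
  have h0 : (0 : ℕ →₀ ℕ) = consExp 0 0 := by
    ext k; cases k with
    | zero => rw [consExp_zero]; rfl
    | succ k => rfl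
  rw [← MvPowerSeries.monomial_zero_eq_C_apply, ← MvPowerSeries.monomial_zero_eq_C_apply,
    scaleHom_monomial, invEval_C]
  conv_rhs => rw [h0, splitHom_monomial]
  rw [HahnSeries.single_mul_single]
  simp

theorem scaleHom_kapDen (b : R) (i j : ℕ) :
    scaleHom R (kapDen (Polynomial.C b) i j) = splitHom R (kapDen b (i + 1) (j + 1)) := by
  simp only [kapDen, map_mul, map_add, map_one, scaleHom_xs, scaleHom_ratio, scaleHom_C]

theorem scaleHom_kap (b : R) {i j : ℕ} (h : i < j) :
    scaleHom R (kap (Polynomial.C b) i j) = splitHom R (kap b (i + 1) (j + 1)) := by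
  have h' : i + 1 < j + 1 := by omega
  have hu := (isUnit_kapDen b h').map (splitHom R)
  rw [← hu.mul_left_inj, ← map_mul, kap_mul_kapDen b h', ← scaleHom_kapDen, ← map_mul,
    kap_mul_kapDen _ h, map_sub, map_sub, map_one, map_one, scaleHom_ratio]

/-- Under the scaling, `U xⱼ` becomes the ratio of `x_{j+1}` to `x₀`. The relation between `ω'` and
`ω` is therefore multiplication by `κ_{0,j+1}`; it is checked after clearing the unit denominator.
-/
theorem scaleHom_xsEval (b : R) {ω : PowerSeries R} {ω' : PowerSeries (Polynomial R)}
    (h : ω' * ((1 + PowerSeries.C (Polynomial.C b) * PowerSeries.X) *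
      (1 + PowerSeries.C (Polynomial.X + Polynomial.C b) * PowerSeries.X)) =
      PowerSeries.map Polynomial.C ω * (1 - PowerSeries.C Polynomial.X * PowerSeries.X)) (j : ℕ) :
    scaleHom R (xsEval j ω') = splitHom R (xsEval (j + 1) ω) * splitHom R (kap b 0 (j + 1)) := by
  have h' : 0 < j + 1 := by omega
  have hu := (isUnit_kapDen b h').map (splitHom R)
  have hX : scaleHom R (MvPowerSeries.C Polynomial.X * xs (Polynomial R) j) =
      splitHom R (ratio R 0 (j + 1)) := by
    rw [← MvPowerSeries.monomial_zero_eq_C_apply, xs, MvPowerSeries.monomial_mul_monomial,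
      scaleHom_monomial, ratio, segExp_zero_succ, splitHom_monomial, zero_add, mul_one, invEval_X,
      HahnSeries.single_mul_single, preExp_apply]
    simp
  have h1 := congrArg (fun f => scaleHom R (xsEval j f)) h
  rw [sub_eq_add_neg, ← neg_mul, ← map_neg] at h1
  simp only [map_mul (xsEval j), xsEval_linear] at h1
  simp only [map_mul, map_add, map_one, map_neg, scaleHom_C, scaleHom_xs, add_mul, neg_mul] at h1 hX
  rw [hX] at h1
  rw [← hu.mul_left_inj, mul_assoc, ← map_mul (splitHom R) (kap b 0 (j + 1)), kap_mul_kapDen b h',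
    splitHom_xsEval_succ, map_sub, map_one]
  simp only [kapDen, map_mul, map_add, map_one]
  linear_combination h1

theorem splitHom_omegaProd (b : R) {ω : PowerSeries R} {ω' : PowerSeries (Polynomial R)}
    (h : ω' * ((1 + PowerSeries.C (Polynomial.C b) * PowerSeries.X) *
      (1 + PowerSeries.C (Polynomial.X + Polynomial.C b) * PowerSeries.X)) =
      PowerSeries.map Polynomial.C ω * (1 - PowerSeries.C Polynomial.X * PowerSeries.X)) (q : ℕ) :
    splitHom R (omegaProd b (q + 1) ω) = MvPowerSeries.C (HahnSeries.ofPowerSeries ℤ R ω) *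
      scaleHom R (omegaProd (Polynomial.C b) q ω') := by
  simp only [omegaProd, ← xsEval_apply]
  rw [Finset.prod_range_succ', kapProd_range_succ, kapProd]
  simp only [map_mul, map_prod, splitHom_xsEval_zero, scaleHom_xsEval b h, Finset.prod_mul_distrib]
  have : ∀ i j : ℕ, scaleHom R (if i < j then kap (Polynomial.C b) i j else 1) =
      splitHom R (if i < j then kap b (i + 1) (j + 1) else 1) := fun i j => by
    split_ifs with hij
    · exact scaleHom_kap b hij
    · rw [map_one, map_one]
  simp only [this]
  ring

/-- The same recursion as `covX_phiBr` on the fermionic side. The exponent of `s₀` is `a + l.sum`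
because every `xᵢ` contains `s₀`. -/
theorem coeff_omegaProd_cons (b : R) {ω : PowerSeries R} {ω' : PowerSeries (Polynomial R)}
    (h : ω' * ((1 + PowerSeries.C (Polynomial.C b) * PowerSeries.X) *
      (1 + PowerSeries.C (Polynomial.X + Polynomial.C b) * PowerSeries.X)) =
      PowerSeries.map Polynomial.C ω * (1 - PowerSeries.C Polynomial.X * PowerSeries.X))
    (q a : ℕ) (l : List ℕ) :
    MvPowerSeries.coeff (tailList (a :: l)) (omegaProd b (q + 1) ω) =
      extrW ω a (MvPowerSeries.coeff (tailList l) (omegaProd (Polynomial.C b) q ω')) := by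
  rw [tailList, ← coeff_coeff_splitHom, splitHom_omegaProd b h, MvPowerSeries.coeff_C_mul,
    coeff_scaleHom, tailList_zero, coeff_mul_invEval]

end Recursion

/-! ### Expectation values as coefficients -/

section Fermionic

universe u

variable {K : Type*} [Field K] [CharZero K] (β : K)

/-- The fermionic expectation values are the coefficients of `∏ᵢ ω(xᵢ) ∏_{i < j} κᵢⱼ`. -/
theorem covX_ketFold {v : Fock K} (hv : v ∈ Fdeg K 0) (L : List ℕ) :
    ∀ {R : Type u} [CommRing R] [Algebra K R] (τ : ℕ → R) {l : Fock K →ₗ[K] K}, Ann l →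
      (∀ a ∈ L, 0 < a) → l ((phi K 0)^[L.length] v) = 1 →
      covX τ (liftCov R l) (ketFold β L v) = MvPowerSeries.coeff (tailList L)
        (omegaProd (algebraMap K R β) L.length (omegaSer R β τ)) := by
  induction L with
  | nil =>
    intro R _ _ τ l hl _ h1
    rw [ketFold, List.foldr_nil, covX_of_deg_zero _ _ hv, liftCov_apply]
    simp only [List.length_nil, Function.iterate_zero, id_eq] at h1
    rw [h1, map_one]
    simp [omegaProd, kapProd, tailList]
  | cons a L ih =>
    intro R _ _ τ l hl hpos h1
    rw [ketFold_cons, covX_phiBr β τ hl (hpos a (by simp)),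
      ih (nextPar β τ) hl.comp_phi_zero (fun c hc => hpos c (by simp [hc])), List.length_cons]
    · exact (coeff_omegaProd_cons (algebraMap K R β) (omegaSer_nextPar β τ) _ _ _).symm
    · rw [LinearMap.comp_apply]
      rwa [List.length_cons, Function.iterate_succ_apply'] at h1

theorem vevBr_ketq (lam : StrictPartition) : vevBr β (ketq β lam) =
    MvPowerSeries.coeff (tailList lam.parts)
      (omegaProd (algebraMap K (MvPowerSeries ℕ K) β) lam.parts.length
        (omegaSer (MvPowerSeries ℕ K) β (hamPar β))) := by
  obtain ⟨v, hv, h1, h2⟩ := exists_ketq_eq β lam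
  rw [vevBr_eq_covX, h2, covX_ketFold β hv _ _ ann_bra0 lam.pos h1]

end Fermionic

/-! ### The `P`-functions by recursion on the exponents -/

section RationalGP

variable {F ι : Type*} [Field F] [DecidableEq ι]

/-- `(x ⊕ y) / (x ⊖ y)`. -/
def rho (b x y : F) : F := oplus b x y / ominus b x y

theorem rho_eq (b x y : F) : rho b x y = (x + y + b * x * y) * (1 + b * y) / (x - y) := by
  rw [rho, oplus, ominus, div_div_eq_mul_div]

/-- The `K`-theoretic `P`-function of a list of exponents in the variables indexed by a finite
set, with values in a field. -/
def GPR (b : F) (x : ι → F) : List ℕ → Finset ι → F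
  | [], _ => 1
  | a :: l, S => ∑ i ∈ S, x i ^ a * (∏ j ∈ S.erase i, rho b (x i) (x j)) * GPR b x l (S.erase i)

theorem GPR_congr {b : F} {x y : ι → F} (l : List ℕ) : ∀ {S : Finset ι}, (∀ i ∈ S, x i = y i) →
    GPR b x l S = GPR b y l S := by
  induction l with
  | nil => intros; rfl
  | cons a l ih =>
    intro S h
    rw [GPR, GPR]
    refine Finset.sum_congr rfl fun i hi => ?_
    rw [ih fun j hj => h j (Finset.mem_of_mem_erase hj), h i hi]
    congr 2
    exact Finset.prod_congr rfl fun j hj => by rw [h j (Finset.mem_of_mem_erase hj)]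

theorem GPR_map {κ : Type*} [DecidableEq κ] (b : F) (x : κ → F) (e : ι ↪ κ) (l : List ℕ) :
    ∀ S : Finset ι, GPR b x l (S.map e) = GPR b (fun i => x (e i)) l S := by
  induction l with
  | nil => intros; rfl
  | cons a l ih =>
    intro S
    rw [GPR, GPR, Finset.sum_map]
    refine Finset.sum_congr rfl fun i _ => ?_
    rw [← Finset.map_erase, ih, Finset.prod_map]

/-- Stability: a zero variable cannot carry a positive exponent, and `rho b x 0 = 1` for `x ≠ 0`. -/
theorem GPR_insert_zero (b : F) (x : ι → F) {k : ι} (hk : x k = 0) (l : List ℕ) :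
    ∀ {S : Finset ι}, (∀ a ∈ l, 0 < a) → k ∉ S → (∀ i ∈ S, x i ≠ 0) →
      GPR b x l (insert k S) = GPR b x l S := by
  induction l with
  | nil => intros; rfl
  | cons a l ih =>
    intro S hl hkS hS
    rw [GPR, GPR, Finset.sum_insert hkS, hk, zero_pow (hl a (by simp)).ne', zero_mul, zero_mul,
      zero_add]
    refine Finset.sum_congr rfl fun i hi => ?_
    have hki : i ≠ k := fun h => hkS (h ▸ hi)
    have hrho : rho b (x i) (x k) = 1 := by
      rw [rho_eq, hk]
      simp [hS i hi]
    rw [Finset.erase_insert_of_ne hki.symm, ih (fun c hc => hl c (by simp [hc]))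
      (fun h => hkS (Finset.mem_of_mem_erase h))
      (fun j hj => hS j (Finset.mem_of_mem_erase hj)), Finset.prod_insert
      (fun h => hkS (Finset.mem_of_mem_erase h)), hrho, one_mul]

/-- When `v = ū`, one has `w ⊕ u = (w - v)(1 + bu)` and `w ⊖ v = (w - v)/(1 + bv)`, with `(1 + bu)(1
+ bv) = 1`, so numerators and denominators match crosswise. -/
theorem rho_mul_rho_eq_one {b u v w : F} (huv : u + v + b * u * v = 0)
    (hwu : w ≠ u) (hwv : w ≠ v) : rho b w u * rho b w v = 1 := by
  have h1 : w - u ≠ 0 := sub_ne_zero.mpr hwu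
  have h2 : w - v ≠ 0 := sub_ne_zero.mpr hwv
  have h3 : (w + u + b * w * u) = (w - v) * (1 + b * u) := by
    linear_combination huv
  have h4 : (w + v + b * w * v) * (1 + b * u) = w - u := by
    linear_combination (1 + b * w) * huv
  have h5 : (1 + b * v) * (1 + b * u) = 1 := by
    linear_combination b * huv
  rw [rho_eq, rho_eq, div_mul_div_comm, div_eq_one_iff_eq (mul_ne_zero h1 h2), h3]
  linear_combination (w - v) * (1 + b * u) * (1 + b * v) * h4 + (w - v) * (w - u) * h5

/-- The terms in which `i` or `j` is chosen contain `xᵢ ⊕ xⱼ = 0`; in all others the two factors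
involving `i` and `j` multiply to one. -/
theorem GPR_insert_insert (b : F) (x : ι → F) {i j : ι} (hij : i ≠ j)
    (hx : x i + x j + b * x i * x j = 0) (l : List ℕ) :
    ∀ {S : Finset ι}, i ∉ S → j ∉ S → (∀ k ∈ S, x k ≠ x i ∧ x k ≠ x j) →
      GPR b x l (insert i (insert j S)) = GPR b x l S := by
  have hr : rho b (x i) (x j) = 0 := by rw [rho_eq, hx, zero_mul, zero_div]
  have hr' : rho b (x j) (x i) = 0 := by
    rw [rho_eq, show x j + x i + b * x j * x i = x i + x j + b * x i * x j by ring, hx, zero_mul,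
      zero_div]
  induction l with
  | nil => intros; rfl
  | cons a l ih =>
    intro S hiS hjS hS
    have hiS' : i ∉ insert j S := by simp [hij, hiS]
    rw [GPR, GPR, Finset.sum_insert hiS', Finset.sum_insert hjS, Finset.erase_insert hiS',
      Finset.prod_eq_zero (Finset.mem_insert_self j S) hr,
      Finset.prod_eq_zero (i := i) (by simp [hij]) hr']
    simp only [mul_zero, zero_mul, zero_add]
    refine Finset.sum_congr rfl fun k hk => ?_
    have hki : i ≠ k := fun h => hiS (h ▸ hk)
    have hkj : j ≠ k := fun h => hjS (h ▸ hk)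
    have hi' : i ∉ S.erase k := fun h => hiS (Finset.mem_of_mem_erase h)
    have hj' : j ∉ S.erase k := fun h => hjS (Finset.mem_of_mem_erase h)
    rw [Finset.erase_insert_of_ne hki, Finset.erase_insert_of_ne hkj,
      ih hi' hj' (fun m hm => hS m (Finset.mem_of_mem_erase hm)),
      Finset.prod_insert (by simp [hij, hi']), Finset.prod_insert hj', ← mul_assoc (rho b _ _),
      rho_mul_rho_eq_one hx (hS k hk).1 (hS k hk).2, one_mul]

/-- The symmetrised product defining the `K`-theoretic `P`-functions, without the
normalisation. -/
def permSum (b : F) {n : ℕ} (x : Fin n → F) (l : List ℕ) : F :=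
  ∑ w : Equiv.Perm (Fin n), ∏ i : Fin n, if (i : ℕ) < l.length then
    x (w i) ^ (l.getD i 0) * ∏ j ∈ Finset.Ioi i, rho b (x (w i)) (x (w j)) else 1

theorem permSum_nil (b : F) {n : ℕ} (x : Fin n → F) : permSum b x [] = (n.factorial : F) := by
  simp [permSum, Fintype.card_perm]

/-- Permutations are sorted by the image `p` of the first position; the rest is a permutation of the
remaining indices, enumerated through the transposition of `0` and `p`. -/
theorem permSum_cons (b : F) {n : ℕ} (x : Fin (n + 1) → F) (a : ℕ) (l : List ℕ) :
    permSum b x (a :: l) = ∑ p : Fin (n + 1), x p ^ a *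
      (∏ k : Fin n, rho b (x p) (x (Equiv.swap 0 p k.succ))) *
        permSum b (fun k => x (Equiv.swap 0 p k.succ)) l := by
  have hIoi : ∀ (f : Fin (n + 1) → F), ∏ j ∈ Finset.Ioi (0 : Fin (n + 1)), f j =
      ∏ k : Fin n, f k.succ := fun f => by
    rw [Fin.Ioi_zero_eq_map, Finset.prod_map]; rfl
  have hIoi' : ∀ (i : Fin n) (f : Fin (n + 1) → F), ∏ j ∈ Finset.Ioi i.succ, f j =
      ∏ k ∈ Finset.Ioi i, f k.succ := fun i f => by
    rw [← Fin.map_succEmb_Ioi, Finset.prod_map]; rfl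
  have hperm : ∀ (p : Fin (n + 1)) (g : Fin n → F) (σ : Equiv.Perm (Fin n)),
      ∏ k, g (σ k) = ∏ k, g k := fun p g σ => Equiv.prod_comp σ g
  rw [permSum, ← Equiv.sum_comp Equiv.Perm.decomposeFin.symm, Fintype.sum_prod_type]
  refine Finset.sum_congr rfl fun p _ => ?_
  rw [permSum, Finset.mul_sum]
  refine Finset.sum_congr rfl fun σ _ => ?_
  rw [Fin.prod_univ_succ, hIoi]
  simp only [Fin.val_zero, List.length_cons, Nat.zero_lt_succ, if_true, List.getD_cons_zero,
    Equiv.Perm.decomposeFin_symm_apply_zero, Equiv.Perm.decomposeFin_symm_apply_succ,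
    Fin.val_succ, Nat.add_lt_add_iff_right, List.getD_cons_succ, hIoi']
  rw [hperm p (fun k => rho b (x p) (x (Equiv.swap 0 p k.succ))) σ]

theorem permSum_eq (b : F) (l : List ℕ) : ∀ {n : ℕ} (x : Fin n → F), l.length ≤ n →
    permSum b x l = ((n - l.length).factorial : F) * GPR b x l Finset.univ := by
  induction l with
  | nil => intro n x _; rw [permSum_nil, GPR, mul_one]; rfl
  | cons a l ih =>
    intro n x hn
    obtain _ | n := n
    · simp at hn
    rw [permSum_cons, GPR, Finset.mul_sum]
    refine Finset.sum_congr rfl fun p _ => ?_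
    let e : Fin n ↪ Fin (n + 1) :=
      ⟨fun k => Equiv.swap 0 p k.succ, fun k k' h => Fin.succ_injective _
        ((Equiv.swap 0 p).injective h)⟩
    have he : Finset.univ.map e = Finset.univ.erase p := by
      refine Finset.eq_of_subset_of_card_le ?_ ?_
      · intro q hq
        rw [Finset.mem_map] at hq
        obtain ⟨k, _, rfl⟩ := hq
        refine Finset.mem_erase.mpr ⟨fun h => ?_, Finset.mem_univ _⟩
        have h' : Equiv.swap 0 p k.succ = Equiv.swap 0 p 0 := by
          rw [Equiv.swap_apply_left]; exact h
        exact Fin.succ_ne_zero k ((Equiv.swap 0 p).injective h')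
      · rw [Finset.card_map, Finset.card_erase_of_mem (Finset.mem_univ _)]
        simp
    rw [← he, GPR_map, Finset.prod_map, ih _ (by simpa using hn), List.length_cons,
      Nat.add_sub_add_right]
    change x p ^ a * (∏ k, rho b (x p) (x (e k))) *
      (_ * GPR b (fun k => x (e k)) l Finset.univ) = _
    ring

end RationalGP

/-! ### Comparison with the symmetrised definition -/

section Link

variable {K : Type*} [Field K] [CharZero K] (β : K)

theorem GPR_eq_zero_of_card_lt {F ι : Type*} [Field F] [DecidableEq ι] (b : F) (x : ι → F)
    (l : List ℕ) : ∀ {S : Finset ι}, S.card < l.length → GPR b x l S = 0 := by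
  induction l with
  | nil => intro S h; simp at h
  | cons a l ih =>
    intro S h
    rw [GPR]
    refine Finset.sum_eq_zero fun i hi => ?_
    have := Finset.card_erase_of_mem hi
    have := Finset.card_pos.mpr ⟨i, hi⟩
    rw [List.length_cons] at h
    rw [ih (by omega), mul_zero]

theorem GPrat_eq_GPR (lam : StrictPartition) (n : ℕ) : GPrat β lam n =
    GPR (algebraMap (MvPolynomial (Fin n) K) (RatFun K n) (MvPolynomial.C β))
      (fun i => algebraMap (MvPolynomial (Fin n) K) (RatFun K n) (MvPolynomial.X i))
      lam.parts Finset.univ := by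
  have : CharZero (RatFun K n) := charZero_of_injective_algebraMap (R := MvPolynomial (Fin n) K)
    (IsFractionRing.injective _ _)
  rw [GPrat]
  simp only [StrictPartition.length]
  split_ifs with h
  · have hs := permSum_eq (algebraMap (MvPolynomial (Fin n) K) (RatFun K n) (MvPolynomial.C β))
      lam.parts (fun i => algebraMap (MvPolynomial (Fin n) K) (RatFun K n) (MvPolynomial.X i)) h
    rw [permSum] at hs
    simp only [rho] at hs
    rw [hs, inv_mul_cancel_left₀]
    exact_mod_cast Nat.factorial_ne_zero _
  · rw [GPR_eq_zero_of_card_lt]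
    simpa using h

end Link

/-! ### Specialising rational functions where they are defined -/

section Specialisation

variable {A F : Type*} [CommRing A] [Field F] (ev : A →+* F)

/-- The rational function `q` is defined at the point `ev` and takes there the value `v`. -/
def SpecRel (q : FractionRing A) (v : F) : Prop :=
  ∃ a d : A, ev d ≠ 0 ∧ q * algebraMap A _ d = algebraMap A _ a ∧ v * ev d = ev a

variable {ev}

theorem specRel_algebraMap (a : A) : SpecRel ev (algebraMap A _ a) (ev a) :=
  ⟨a, 1, by simp, by simp, by simp⟩

theorem SpecRel.add {q q' : FractionRing A} {v v' : F} (h : SpecRel ev q v)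
    (h' : SpecRel ev q' v') : SpecRel ev (q + q') (v + v') := by
  obtain ⟨a, d, h0, h1, h2⟩ := h
  obtain ⟨a', d', h0', h1', h2'⟩ := h'
  refine ⟨a * d' + a' * d, d * d', by simp [h0, h0'], ?_, ?_⟩
  · simp only [map_mul, map_add, ← h1, ← h1']; ring
  · simp only [map_mul, map_add, ← h2, ← h2']; ring

theorem SpecRel.mul {q q' : FractionRing A} {v v' : F} (h : SpecRel ev q v)
    (h' : SpecRel ev q' v') : SpecRel ev (q * q') (v * v') := by
  obtain ⟨a, d, h0, h1, h2⟩ := h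
  obtain ⟨a', d', h0', h1', h2'⟩ := h'
  refine ⟨a * a', d * d', by simp [h0, h0'], ?_, ?_⟩
  · simp only [map_mul, ← h1, ← h1']; ring
  · simp only [map_mul, ← h2, ← h2']; ring

theorem SpecRel.unique {q : FractionRing A} {v v' : F} (h : SpecRel ev q v)
    (h' : SpecRel ev q v') : v = v' := by
  obtain ⟨a, d, h0, h1, h2⟩ := h
  obtain ⟨a', d', h0', h1', h2'⟩ := h'
  have : a * d' = a' * d := IsFractionRing.injective A (FractionRing A) (by
    rw [map_mul, map_mul, ← h1, ← h1']; ring)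
  have h3 := congrArg ev this
  rw [map_mul, map_mul, ← h2, ← h2'] at h3
  exact mul_right_cancel₀ (mul_ne_zero h0 h0') (by linear_combination h3)

theorem SpecRel.sum {ι : Type*} (s : Finset ι) {q : ι → FractionRing A} {v : ι → F}
    (h : ∀ i ∈ s, SpecRel ev (q i) (v i)) : SpecRel ev (∑ i ∈ s, q i) (∑ i ∈ s, v i) := by
  classical
  induction s using Finset.induction_on with
  | empty => simpa using specRel_algebraMap (ev := ev) 0
  | insert i s hi ih =>
    rw [Finset.sum_insert hi, Finset.sum_insert hi]
    exact (h i (by simp)).add (ih fun j hj => h j (by simp [hj]))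

theorem SpecRel.prod {ι : Type*} (s : Finset ι) {q : ι → FractionRing A} {v : ι → F}
    (h : ∀ i ∈ s, SpecRel ev (q i) (v i)) : SpecRel ev (∏ i ∈ s, q i) (∏ i ∈ s, v i) := by
  classical
  induction s using Finset.induction_on with
  | empty => simpa using specRel_algebraMap (ev := ev) 1
  | insert i s hi ih =>
    rw [Finset.prod_insert hi, Finset.prod_insert hi]
    exact (h i (by simp)).mul (ih fun j hj => h j (by simp [hj]))

variable [IsDomain A]

theorem SpecRel.div_algebraMap {q : FractionRing A} {v : F} (h : SpecRel ev q v) {c : A}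
    (hc : ev c ≠ 0) : SpecRel ev (q / algebraMap A _ c) (v / ev c) := by
  obtain ⟨a, d, h0, h1, h2⟩ := h
  have hc' : algebraMap A (FractionRing A) c ≠ 0 := fun h => hc (by
    rw [(IsFractionRing.injective A (FractionRing A)) (h.trans (map_zero _).symm), map_zero])
  refine ⟨a, d * c, by simp [h0, hc], ?_, ?_⟩
  · rw [← h1, map_mul]; field_simp
  · rw [← h2, map_mul]; field_simp

theorem specRel_rho (b : A) {x y : A} (hxy : ev x ≠ ev y) :
    SpecRel ev (rho (algebraMap A _ b) (algebraMap A _ x) (algebraMap A _ y))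
      (rho (ev b) (ev x) (ev y)) := by
  have h1 := (specRel_algebraMap (ev := ev) ((x + y + b * x * y) * (1 + b * y))).div_algebraMap
    (c := x - y) (by rw [map_sub]; exact sub_ne_zero.mpr hxy)
  rw [rho_eq, rho_eq]
  simpa only [map_mul, map_add, map_sub, map_one] using h1

theorem specRel_GPR {ι : Type*} [DecidableEq ι] (b : A) (x : ι → A) (l : List ℕ) :
    ∀ {S : Finset ι}, (∀ i ∈ S, ∀ j ∈ S, i ≠ j → ev (x i) ≠ ev (x j)) →
    SpecRel ev (GPR (algebraMap A _ b) (fun i => algebraMap A _ (x i)) l S)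
      (GPR (ev b) (fun i => ev (x i)) l S) := by
  induction l with
  | nil => intro S _; simpa [GPR] using specRel_algebraMap (ev := ev) 1
  | cons a l ih =>
    intro S h
    rw [GPR, GPR]
    refine SpecRel.sum S fun i hi => ((?_ : SpecRel _ _ _).mul
      (SpecRel.prod _ fun j hj => specRel_rho b ?_)).mul (ih ?_)
    · rw [← map_pow, ← map_pow]; exact specRel_algebraMap _
    · exact h i hi j (Finset.mem_of_mem_erase hj) (Finset.ne_of_mem_erase hj).symm
    · exact fun j hj k hk => h j (Finset.mem_of_mem_erase hj) k (Finset.mem_of_mem_erase hk)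

end Specialisation

/-! ### Products over pairs of indices -/

section PairProducts

variable {M : Type*} [CommMonoid M]

/-- The product of `f i j` over the pairs `i < j` in a finite set. -/
def pairProd (f : ℕ → ℕ → M) (S : Finset ℕ) : M :=
  ∏ i ∈ S, ∏ j ∈ S, if i < j then f i j else 1

theorem pairProd_insert (f : ℕ → ℕ → M) {k : ℕ} {S : Finset ℕ} (hk : k ∉ S) :
    pairProd f (insert k S) =
      pairProd f S * ∏ j ∈ S, if k < j then f k j else f j k := by
  rw [pairProd, Finset.prod_insert hk, Finset.prod_insert hk, if_neg (lt_irrefl k), one_mul]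
  have h : ∀ i ∈ S, (∏ j ∈ insert k S, if i < j then f i j else 1) =
      (if i < k then f i k else 1) * ∏ j ∈ S, if i < j then f i j else 1 := fun i _ => by
    rw [Finset.prod_insert hk]
  rw [Finset.prod_congr rfl h, Finset.prod_mul_distrib, ← mul_assoc, ← Finset.prod_mul_distrib,
    mul_comm, pairProd]
  congr 1
  refine Finset.prod_congr rfl fun j hj => ?_
  have hjk : j ≠ k := fun h => hk (h ▸ hj)
  rcases lt_or_gt_of_ne hjk with h | h
  · rw [if_neg h.asymm, if_pos h, one_mul]; simp [h.asymm]
  · rw [if_pos h, if_neg h.asymm, mul_one, if_pos h]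

theorem map_pairProd {N G : Type*} [CommMonoid N] [FunLike G M N] [MonoidHomClass G M N] (g : G)
    (f : ℕ → ℕ → M) (S : Finset ℕ) : g (pairProd f S) = pairProd (fun i j => g (f i j)) S := by
  simp only [pairProd, map_prod, apply_ite g, map_one]

theorem pairProd_eq_prod_filter (f : ℕ → ℕ → M) (S : Finset ℕ) :
    pairProd f S = ∏ p ∈ (S ×ˢ S).filter (fun p => p.1 < p.2), f p.1 p.2 := by
  rw [Finset.prod_filter, Finset.prod_product]; rfl

theorem pairProd_congr {f g : ℕ → ℕ → M} {S : Finset ℕ}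
    (h : ∀ i ∈ S, ∀ j ∈ S, i < j → f i j = g i j) : pairProd f S = pairProd g S := by
  refine Finset.prod_congr rfl fun i hi => Finset.prod_congr rfl fun j hj => ?_
  split_ifs with hij
  · exact h i hi j hj hij
  · rfl

theorem pairProd_mul (f g : ℕ → ℕ → M) (S : Finset ℕ) :
    pairProd (fun i j => f i j * g i j) S = pairProd f S * pairProd g S := by
  simp only [pairProd_eq_prod_filter, Finset.prod_mul_distrib]

/-- For an antisymmetric function, the pair product changes by a sign when computed from a
chosen new element. -/
theorem pairProd_insert_sign {A : Type*} [CommRing A] {f : ℕ → ℕ → A}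
    (hf : ∀ i j, f j i = - f i j) {k : ℕ} {S : Finset ℕ} (hk : k ∉ S) :
    pairProd f (insert k S) =
      (∏ j ∈ S, if k < j then (1 : A) else -1) * (pairProd f S * ∏ j ∈ S, f k j) := by
  rw [pairProd_insert f hk, mul_left_comm, ← Finset.prod_mul_distrib]
  congr 1
  refine Finset.prod_congr rfl fun j _ => ?_
  split_ifs
  · rw [one_mul]
  · rw [hf k j, neg_one_mul]

end PairProducts

/-! ### Divisibility by products of linear forms -/

section Divisibility

/-- Each `e i` tests divisibility by `d i` and does not kill the other factors, so the divisors can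
be split off one at a time; no unique factorisation is needed. -/
theorem prod_dvd_of_ker {A B ι : Type*} [CommRing A] [CommRing B] [IsDomain B] (s : Finset ι)
    (d : ι → A) (e : ι → A →+* B) (hker : ∀ i ∈ s, ∀ a, e i a = 0 → d i ∣ a)
    (hne : ∀ i ∈ s, ∀ j ∈ s, i ≠ j → e i (d j) ≠ 0) {P : A} (hP : ∀ i ∈ s, e i P = 0) :
    ∏ i ∈ s, d i ∣ P := by
  classical
  induction s using Finset.induction_on with
  | empty => simp
  | insert i s hi ih =>
    obtain ⟨Q, rfl⟩ := ih (fun j hj => hker j (by simp [hj]))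
      (fun j hj k hk => hne j (by simp [hj]) k (by simp [hk])) (fun j hj => hP j (by simp [hj]))
    have h := hP i (by simp)
    rw [map_mul, map_prod, mul_eq_zero, Finset.prod_eq_zero_iff] at h
    obtain ⟨j, hj, h0⟩ | h := h
    · exact absurd h0 (hne i (by simp) j (by simp [hj]) fun h => hi (h ▸ hj))
    · rw [Finset.prod_insert hi, mul_comm]
      exact mul_dvd_mul_left _ (hker i (by simp) Q h)

theorem dvd_sub_aeval {R σ : Type*} [CommRing R] {d : MvPolynomial σ R}
    {u : σ → MvPolynomial σ R} (h : ∀ i, d ∣ MvPolynomial.X i - u i) (p : MvPolynomial σ R) :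
    d ∣ p - MvPolynomial.aeval u p := by
  have h1 : (Ideal.Quotient.mkₐ R (Ideal.span {d})).comp (AlgHom.id R (MvPolynomial σ R)) =
      (Ideal.Quotient.mkₐ R (Ideal.span {d})).comp (MvPolynomial.aeval u) := by
    refine MvPolynomial.algHom_ext fun i => ?_
    simp only [AlgHom.comp_apply, AlgHom.id_apply, MvPolynomial.aeval_X]
    exact (Ideal.Quotient.mk_eq_mk_iff_sub_mem _ _).mpr (Ideal.mem_span_singleton.mpr (h i))
  have h2 := AlgHom.congr_fun h1 p
  exact Ideal.mem_span_singleton.mp ((Ideal.Quotient.mk_eq_mk_iff_sub_mem _ _).mp h2)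

/-- The substitution `xⱼ ↦ u`. -/
def substVar {R : Type*} [CommRing R] (j : ℕ) (u : MvPolynomial ℕ R) :
    MvPolynomial ℕ R →ₐ[R] MvPolynomial ℕ R :=
  MvPolynomial.aeval (Function.update MvPolynomial.X j u)

theorem substVar_X {R : Type*} [CommRing R] (j : ℕ) (u : MvPolynomial ℕ R) (k : ℕ) :
    substVar j u (MvPolynomial.X k) = if k = j then u else MvPolynomial.X k := by
  rw [substVar, MvPolynomial.aeval_X, Function.update_apply]

theorem dvd_of_substVar {R : Type*} [CommRing R] {j : ℕ} {u p : MvPolynomial ℕ R}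
    (h : substVar j u p = 0) : MvPolynomial.X j - u ∣ p := by
  have := dvd_sub_aeval (d := MvPolynomial.X j - u)
    (u := Function.update MvPolynomial.X j u) (fun i => ?_) p
  · rw [substVar] at h
    rwa [h, sub_zero] at this
  · rw [Function.update_apply]
    split_ifs with hi
    · rw [hi]
    · simp

theorem X_ne_X {R : Type*} [CommRing R] [Nontrivial R] {i j : ℕ} (h : i ≠ j) :
    (MvPolynomial.X i : MvPolynomial ℕ R) ≠ MvPolynomial.X j :=
  fun h' => h (MvPolynomial.X_injective h')

end Divisibility

/-! ### The `P`-functions are polynomials -/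

section Polynomiality

variable {K : Type*} [Field K] (β : K)

/-- The field of rational functions in `x₀, x₁, …`. -/
abbrev RatFunNat (K : Type*) [Field K] : Type _ := FractionRing (MvPolynomial ℕ K)

/-- The `K`-theoretic `P`-function in the variables indexed by `S`, as a rational function. -/
def gpRat (l : List ℕ) (S : Finset ℕ) : RatFunNat K :=
  GPR (algebraMap (MvPolynomial ℕ K) _ (MvPolynomial.C β))
    (fun i => algebraMap (MvPolynomial ℕ K) _ (MvPolynomial.X i)) l S

/-- The Vandermonde product `∏_{i < j} (xᵢ - xⱼ)`. -/
def vander (R : Type*) [CommRing R] (S : Finset ℕ) : MvPolynomial ℕ R :=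
  pairProd (fun i j => MvPolynomial.X i - MvPolynomial.X j) S

/-- The denominators in the term for `i` are `xᵢ - xⱼ`, which the Vandermonde product supplies up to
sign; the remaining Vandermonde product serves the recursive call. -/
theorem exists_vander_mul_gpRat (l : List ℕ) : ∀ S : Finset ℕ, ∃ P : MvPolynomial ℕ K,
    algebraMap _ (RatFunNat K) P = algebraMap _ _ (vander K S) * gpRat β l S := by
  induction l with
  | nil => intro S; exact ⟨vander K S, by rw [gpRat, GPR, mul_one]⟩
  | cons a l ih =>
    intro S
    choose P hP using fun i => ih (S.erase i)
    refine ⟨∑ i ∈ S, (∏ j ∈ S.erase i, if i < j then (1 : MvPolynomial ℕ K) else -1) *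
      (MvPolynomial.X i ^ a * (∏ j ∈ S.erase i, ((MvPolynomial.X i + MvPolynomial.X j +
        MvPolynomial.C β * MvPolynomial.X i * MvPolynomial.X j) *
          (1 + MvPolynomial.C β * MvPolynomial.X j)))) * P i, ?_⟩
    rw [gpRat, GPR, map_sum, Finset.mul_sum]
    refine Finset.sum_congr rfl fun i hi => ?_
    have h1 : vander K S = (∏ j ∈ S.erase i, if i < j then (1 : MvPolynomial ℕ K) else -1) *
        (vander K (S.erase i) * ∏ j ∈ S.erase i, (MvPolynomial.X i - MvPolynomial.X j)) := by
      conv_lhs => rw [← Finset.insert_erase hi]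
      exact pairProd_insert_sign (fun _ _ => (neg_sub _ _).symm) (Finset.notMem_erase i S)
    have h2 : algebraMap (MvPolynomial ℕ K) (RatFunNat K) (∏ j ∈ S.erase i,
        (MvPolynomial.X i - MvPolynomial.X j)) * (∏ j ∈ S.erase i,
          rho (algebraMap (MvPolynomial ℕ K) _ (MvPolynomial.C β))
            (algebraMap (MvPolynomial ℕ K) (RatFunNat K) (MvPolynomial.X i))
            (algebraMap (MvPolynomial ℕ K) _ (MvPolynomial.X j))) =
        algebraMap _ _ (∏ j ∈ S.erase i, ((MvPolynomial.X i + MvPolynomial.X j +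
          MvPolynomial.C β * MvPolynomial.X i * MvPolynomial.X j) *
            (1 + MvPolynomial.C β * MvPolynomial.X j))) := by
      rw [map_prod, map_prod, ← Finset.prod_mul_distrib]
      refine Finset.prod_congr rfl fun j hj => ?_
      have hne : algebraMap (MvPolynomial ℕ K) (RatFunNat K)
          (MvPolynomial.X i - MvPolynomial.X j) ≠ 0 := by
        rw [Ne, IsFractionRing.to_map_eq_zero_iff, sub_eq_zero]
        exact X_ne_X (Finset.ne_of_mem_erase hj).symm
      rw [rho_eq, ← map_sub, mul_div_cancel₀ _ hne]
      simp only [map_mul, map_add, map_one]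
    have h3 := hP i
    rw [gpRat] at h3
    rw [h1, map_mul, map_mul, map_mul, map_mul, map_mul, h3, ← h2, map_pow]
    ring

theorem rename_vander_swap {S : Finset ℕ} {i j : ℕ} (hi : i ∈ S) (hj : j ∈ S) (hij : i ≠ j)
    (R : Type*) [CommRing R] :
    MvPolynomial.rename (Equiv.swap i j) (vander R S) = - vander R S := by
  set T := (S.erase i).erase j with hT
  have hiT : i ∉ T := fun h => Finset.notMem_erase i S (Finset.mem_of_mem_erase h)
  have hjT : j ∉ T := Finset.notMem_erase j _
  have hS : S = insert i (insert j T) := by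
    rw [hT, Finset.insert_erase (Finset.mem_erase.mpr ⟨hij.symm, hj⟩), Finset.insert_erase hi]
  have hiT' : i ∉ insert j T := by simp [hij, hiT]
  have hfix : ∀ k ∈ T, Equiv.swap i j k = k := fun k hk =>
    Equiv.swap_apply_of_ne_of_ne (fun h => hiT (h ▸ hk)) (fun h => hjT (h ▸ hk))
  have hanti : ∀ a c : ℕ, (MvPolynomial.X c - MvPolynomial.X a : MvPolynomial ℕ R) =
      -(MvPolynomial.X a - MvPolynomial.X c) := fun _ _ => (neg_sub _ _).symm
  have hV : vander R S = (∏ k ∈ insert j T, if i < k then (1 : MvPolynomial ℕ R) else -1) *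
      (∏ k ∈ T, if j < k then (1 : MvPolynomial ℕ R) else -1) *
      (vander R T * (∏ k ∈ T, ((MvPolynomial.X j - MvPolynomial.X k) *
        (MvPolynomial.X i - MvPolynomial.X k))) * (MvPolynomial.X i - MvPolynomial.X j)) := by
    rw [hS, vander, pairProd_insert_sign hanti hiT', pairProd_insert_sign hanti hjT,
      Finset.prod_insert (f := fun k => (MvPolynomial.X i - MvPolynomial.X k :
        MvPolynomial ℕ R)) hjT, Finset.prod_mul_distrib, vander]
    ring
  have hVT : MvPolynomial.rename (Equiv.swap i j) (vander R T) = vander R T := by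
    rw [vander, map_pairProd]
    refine pairProd_congr fun a ha c hc _ => ?_
    rw [map_sub, MvPolynomial.rename_X, MvPolynomial.rename_X, hfix a ha, hfix c hc]
  have hsign : ∀ (U : Finset ℕ) (m : ℕ), MvPolynomial.rename (Equiv.swap i j)
      (∏ k ∈ U, if m < k then (1 : MvPolynomial ℕ R) else -1) =
      ∏ k ∈ U, if m < k then (1 : MvPolynomial ℕ R) else -1 := fun U m => by
    rw [map_prod]
    refine Finset.prod_congr rfl fun k _ => ?_
    split_ifs <;> simp
  have hprod : MvPolynomial.rename (Equiv.swap i j) (∏ k ∈ T,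
      ((MvPolynomial.X j - MvPolynomial.X k) * (MvPolynomial.X i - MvPolynomial.X k)) :
        MvPolynomial ℕ R) = ∏ k ∈ T,
      ((MvPolynomial.X j - MvPolynomial.X k) * (MvPolynomial.X i - MvPolynomial.X k)) := by
    rw [map_prod]
    refine Finset.prod_congr rfl fun k hk => ?_
    simp only [map_mul, map_sub, MvPolynomial.rename_X, hfix k hk, Equiv.swap_apply_left,
      Equiv.swap_apply_right]
    ring
  rw [hV]
  simp only [map_mul, hsign, hVT, hprod, map_sub, MvPolynomial.rename_X, Equiv.swap_apply_left,
    Equiv.swap_apply_right]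
  ring

theorem map_swap_of_mem {S : Finset ℕ} {i j : ℕ} (hi : i ∈ S) (hj : j ∈ S) :
    S.map (Equiv.swap i j).toEmbedding = S := by
  refine Finset.eq_of_subset_of_card_le ?_ (by rw [Finset.card_map])
  intro k hk
  rw [Finset.mem_map] at hk
  obtain ⟨m, hm, rfl⟩ := hk
  simp only [Equiv.coe_toEmbedding, Equiv.swap_apply_def]
  split_ifs <;> assumption

/-- The `P`-function is symmetric and the Vandermonde product antisymmetric, so the polynomial
product of the two vanishes on each `xᵢ = xⱼ` and is divisible by the Vandermonde product. -/
theorem exists_gpRat [CharZero K] (l : List ℕ) (S : Finset ℕ) :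
    ∃ P : MvPolynomial ℕ K, algebraMap _ (RatFunNat K) P = gpRat β l S := by
  obtain ⟨P, hP⟩ := exists_vander_mul_gpRat β l S
  have hswap : ∀ i ∈ S, ∀ j ∈ S, i ≠ j →
      MvPolynomial.rename (Equiv.swap i j) P = - P := by
    intro i hi j hj hij
    let ev : MvPolynomial ℕ K →+* RatFunNat K :=
      (algebraMap _ _).comp (MvPolynomial.rename (R := K) (Equiv.swap i j)).toRingHom
    have hev : ∀ p, ev p = algebraMap _ _ (MvPolynomial.rename (Equiv.swap i j) p) := fun _ => rfl
    have h1 : SpecRel ev (algebraMap _ (RatFunNat K) P) (ev P) := specRel_algebraMap P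
    have h2 : SpecRel ev (algebraMap _ _ (vander K S) * gpRat β l S)
        (ev (vander K S) * GPR (ev (MvPolynomial.C β)) (fun i => ev (MvPolynomial.X i)) l S) := by
      refine (specRel_algebraMap _).mul (specRel_GPR _ _ l fun a _ c _ hac => ?_)
      rw [hev, hev, MvPolynomial.rename_X, MvPolynomial.rename_X]
      exact fun h => hac ((Equiv.swap i j).injective
        (MvPolynomial.X_injective (IsFractionRing.injective _ _ h)))
    rw [← hP] at h2
    have h3 := h1.unique h2
    have h4 : GPR (ev (MvPolynomial.C β)) (fun i => ev (MvPolynomial.X i)) l S = gpRat β l S := by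
      have h := GPR_map (algebraMap (MvPolynomial ℕ K) (RatFunNat K) (MvPolynomial.C β))
        (fun i => algebraMap (MvPolynomial ℕ K) (RatFunNat K) (MvPolynomial.X i))
        (Equiv.swap i j).toEmbedding l S
      rw [map_swap_of_mem hi hj] at h
      rw [gpRat, h, hev, MvPolynomial.rename_C]
      simp only [hev, MvPolynomial.rename_X, Equiv.coe_toEmbedding]
    rw [h4, hev, hev, rename_vander_swap hi hj hij, map_neg, neg_mul, ← hP, ← map_neg] at h3
    exact IsFractionRing.injective _ _ h3
  have hdvd : vander K S ∣ P := by
    rw [vander, pairProd_eq_prod_filter]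
    refine prod_dvd_of_ker _ _
      (fun p : ℕ × ℕ => (substVar (R := K) p.1 (MvPolynomial.X p.2)).toRingHom) ?_ ?_ ?_
    · intro p _ a ha
      exact dvd_of_substVar ha
    · rintro ⟨i, j⟩ hij ⟨m, n⟩ hmn hne
      simp only [Finset.mem_filter] at hij hmn
      change substVar i (MvPolynomial.X j) (MvPolynomial.X m - MvPolynomial.X n) ≠ 0
      rw [map_sub, substVar_X, substVar_X, Ne, sub_eq_zero]
      have hne' : ¬(i = m ∧ j = n) := fun h => hne (by rw [h.1, h.2])
      have h1 := hij.2
      have h2 := hmn.2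
      split_ifs with h3 h4 h4 <;> refine X_ne_X ?_ <;> omega
    · rintro ⟨i, j⟩ hij
      simp only [Finset.mem_filter, Finset.mem_product] at hij
      change substVar i (MvPolynomial.X j) P = 0
      have h1 := hswap i hij.1.1 j hij.1.2 hij.2.ne
      -- After setting `xᵢ = xⱼ` the transposition is invisible, so antisymmetry gives twice the
      -- restriction equal to zero.
      have h2 : (substVar i (MvPolynomial.X j)).comp (MvPolynomial.rename (Equiv.swap i j)) =
          substVar (R := K) i (MvPolynomial.X j) := by
        refine MvPolynomial.algHom_ext fun k => ?_
        rw [AlgHom.comp_apply, MvPolynomial.rename_X, substVar_X, substVar_X, Equiv.swap_apply_def]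
        have := hij.2
        split_ifs <;> first | rfl | omega | simp_all
      have h3 := AlgHom.congr_fun h2 P
      rw [AlgHom.comp_apply, h1, map_neg, neg_eq_iff_add_eq_zero, ← two_mul] at h3
      rcases mul_eq_zero.mp h3 with h | h
      · exact absurd h two_ne_zero
      · exact h
  obtain ⟨Q, hQ⟩ := hdvd
  refine ⟨Q, ?_⟩
  have hV : algebraMap (MvPolynomial ℕ K) (RatFunNat K) (vander K S) ≠ 0 := by
    rw [Ne, IsFractionRing.to_map_eq_zero_iff, vander, pairProd_eq_prod_filter,
      Finset.prod_eq_zero_iff]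
    rintro ⟨p, hp, h0⟩
    rw [Finset.mem_filter] at hp
    exact X_ne_X hp.2.ne (sub_eq_zero.mp h0)
  rw [hQ, map_mul] at hP
  exact mul_left_cancel₀ hV hP

end Polynomiality

/-! ### Symmetry, stability and cancellation of the polynomials -/

section Properties

variable {K : Type*} [Field K] [CharZero K] (β : K)

/-- The `K`-theoretic `P`-function in the variables indexed by `S`, as a polynomial. -/
def gpPoly (l : List ℕ) (S : Finset ℕ) : MvPolynomial ℕ K := (exists_gpRat β l S).choose

theorem algebraMap_gpPoly (l : List ℕ) (S : Finset ℕ) :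
    algebraMap _ (RatFunNat K) (gpPoly β l S) = gpRat β l S := (exists_gpRat β l S).choose_spec

theorem eval_gpPoly {F : Type*} [Field F] (ev : MvPolynomial ℕ K →+* F) (l : List ℕ)
    {S : Finset ℕ}
    (h : ∀ i ∈ S, ∀ j ∈ S, i ≠ j → ev (MvPolynomial.X i) ≠ ev (MvPolynomial.X j)) :
    ev (gpPoly β l S) = GPR (ev (MvPolynomial.C β)) (fun i => ev (MvPolynomial.X i)) l S := by
  have h1 : SpecRel ev (algebraMap _ (RatFunNat K) (gpPoly β l S)) (ev (gpPoly β l S)) :=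
    specRel_algebraMap _
  rw [algebraMap_gpPoly] at h1
  exact h1.unique (specRel_GPR _ _ l h)

theorem rename_gpPoly (σ : Equiv.Perm ℕ) (l : List ℕ) (S : Finset ℕ) :
    MvPolynomial.rename σ (gpPoly β l S) = gpPoly β l (S.map σ.toEmbedding) := by
  refine IsFractionRing.injective _ (RatFunNat K) ?_
  have h := eval_gpPoly β ((algebraMap _ (RatFunNat K)).comp
    (MvPolynomial.rename (R := K) σ).toRingHom) l (S := S) ?_
  · refine h.trans ?_
    rw [algebraMap_gpPoly, gpRat, GPR_map]
    simp
  · intro i _ j _ hij h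
    simp only [AlgHom.toRingHom_eq_coe, RingHom.coe_comp, RingHom.coe_coe, Function.comp_apply,
      MvPolynomial.rename_X] at h
    exact hij (σ.injective (MvPolynomial.X_injective (IsFractionRing.injective _ _ h)))

/-- Setting to zero the variables outside of a set. -/
def killOutside (R : Type*) [CommRing R] (S : Finset ℕ) :
    MvPolynomial ℕ R →ₐ[R] MvPolynomial ℕ R :=
  MvPolynomial.aeval fun i => if i ∈ S then MvPolynomial.X i else 0

theorem coeff_killOutside {R : Type*} [CommRing R] (S : Finset ℕ) (p : MvPolynomial ℕ R)
    (d : ℕ →₀ ℕ) : (killOutside R S p).coeff d = if d.support ⊆ S then p.coeff d else 0 := by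
  classical
  induction p using MvPolynomial.induction_on' with
  | add p q hp hq =>
    rw [map_add, MvPolynomial.coeff_add, hp, hq, MvPolynomial.coeff_add]
    split_ifs <;> simp
  | monomial m c =>
    have h : killOutside R S (MvPolynomial.monomial m c) =
        if m.support ⊆ S then MvPolynomial.monomial m c else 0 := by
      rw [killOutside, MvPolynomial.aeval_monomial]
      split_ifs with hm
      · rw [MvPolynomial.monomial_eq, MvPolynomial.algebraMap_eq]
        congr 1
        exact Finset.prod_congr rfl fun i hi => by
          simp only [if_pos (hm hi)]
      · rw [Finset.not_subset] at hm
        obtain ⟨i, hi, hiS⟩ := hm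
        rw [Finsupp.prod, Finset.prod_eq_zero hi, mul_zero]
        rw [if_neg hiS, zero_pow (Finsupp.mem_support_iff.mp hi)]
    rw [h]
    by_cases hmd : m = d
    · subst hmd
      split_ifs <;> simp
    · split_ifs <;> simp [MvPolynomial.coeff_monomial, hmd]

/-- At most one variable is set to zero at a time, because the specialisation of the rational
formula requires the values to stay distinct; `coeff_gpPoly_of_subset` iterates this. -/
theorem killOutside_gpPoly {l : List ℕ} (hl : ∀ a ∈ l, 0 < a) {S T : Finset ℕ} (hST : S ⊆ T)
    (hT : (T \ S).card ≤ 1) : killOutside K S (gpPoly β l T) = gpPoly β l S := by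
  refine IsFractionRing.injective _ (RatFunNat K) ?_
  have hev : ∀ i ∈ T, ∀ j ∈ T, i ≠ j →
      (if i ∈ S then MvPolynomial.X i else 0 : MvPolynomial ℕ K) ≠
        if j ∈ S then MvPolynomial.X j else 0 := by
    intro i hi j hj hij
    split_ifs with h1 h2 h2
    · exact X_ne_X hij
    · exact MvPolynomial.X_ne_zero i
    · exact (MvPolynomial.X_ne_zero j).symm
    · exact absurd (Finset.card_le_one.mp hT i (by simp [hi, h1]) j (by simp [hj, h2])) hij
  have h := eval_gpPoly β ((algebraMap _ (RatFunNat K)).comp (killOutside K S).toRingHom) l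
    (S := T) ?_
  · refine h.trans ?_
    have hX : ∀ i, ((algebraMap _ (RatFunNat K)).comp (killOutside K S).toRingHom)
        (MvPolynomial.X i) = algebraMap _ (RatFunNat K)
          (if i ∈ S then MvPolynomial.X i else 0 : MvPolynomial ℕ K) := fun i => by
      simp [killOutside]
    have hC : ((algebraMap _ (RatFunNat K)).comp (killOutside K S).toRingHom)
        (MvPolynomial.C β) = algebraMap (MvPolynomial ℕ K) _
          (MvPolynomial.C β) := by
      simp [killOutside]
    simp only [hX]
    rw [hC, algebraMap_gpPoly, gpRat]
    have hcongr : GPR (algebraMap (MvPolynomial ℕ K) _ (MvPolynomial.C β)) (fun i => algebraMap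
        (MvPolynomial ℕ K) (RatFunNat K) (if i ∈ S then MvPolynomial.X i else 0)) l S =
        GPR (algebraMap (MvPolynomial ℕ K) _
          (MvPolynomial.C β)) (fun i => algebraMap
          (MvPolynomial ℕ K) _ (MvPolynomial.X i)) l S :=
      GPR_congr l fun i hi => by rw [if_pos hi]
    rw [← hcongr]
    rcases Finset.card_le_one_iff_subset_singleton.mp hT with ⟨k, hk⟩
    by_cases hkT : k ∈ T \ S
    · have hTk : T = insert k S := by
        rw [← Finset.union_sdiff_of_subset hST, Finset.Subset.antisymm hk (by simpa using hkT),
          Finset.union_comm, Finset.insert_eq]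
      rw [Finset.mem_sdiff] at hkT
      rw [hTk]
      refine GPR_insert_zero _ _ (by rw [if_neg hkT.2, map_zero]) l hl hkT.2 fun i hi => ?_
      rw [if_pos hi, Ne, IsFractionRing.to_map_eq_zero_iff]
      exact MvPolynomial.X_ne_zero i
    · have : T \ S = ∅ := by
        rw [Finset.eq_empty_iff_forall_notMem]
        intro m hm
        have := hk hm
        rw [Finset.mem_singleton] at this
        exact hkT (this ▸ hm)
      rw [Finset.Subset.antisymm hST (Finset.sdiff_eq_empty_iff_subset.mp this)]
  · intro i hi j hj hij h
    simp only [AlgHom.toRingHom_eq_coe, RingHom.coe_comp, RingHom.coe_coe, Function.comp_apply,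
      killOutside, MvPolynomial.aeval_X] at h
    exact hev i hi j hj hij (IsFractionRing.injective _ _ h)

theorem coeff_gpPoly_of_not_subset {l : List ℕ} (hl : ∀ a ∈ l, 0 < a) {S : Finset ℕ}
    {d : ℕ →₀ ℕ} (hd : ¬ d.support ⊆ S) : (gpPoly β l S).coeff d = 0 := by
  rw [← killOutside_gpPoly β hl (Finset.Subset.refl S) (by simp), coeff_killOutside, if_neg hd]

theorem coeff_gpPoly_of_subset {l : List ℕ} (hl : ∀ a ∈ l, 0 < a) {S T : Finset ℕ} (hST : S ⊆ T)
    {d : ℕ →₀ ℕ} (hd : d.support ⊆ S) : (gpPoly β l T).coeff d = (gpPoly β l S).coeff d := by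
  induction hn : (T \ S).card generalizing T with
  | zero =>
    rw [Finset.card_eq_zero, Finset.sdiff_eq_empty_iff_subset] at hn
    rw [Finset.Subset.antisymm hST hn]
  | succ n ih =>
    obtain ⟨k, hk⟩ := Finset.card_pos.mp (by omega : 0 < (T \ S).card)
    rw [Finset.mem_sdiff] at hk
    have hS' : S ⊆ T.erase k := Finset.subset_erase.mpr ⟨hST, hk.2⟩
    rw [← ih hS' (by rw [Finset.erase_sdiff_comm, Finset.card_erase_of_mem (by simp [hk])]; omega),
      ← killOutside_gpPoly β hl (Finset.erase_subset k T) (by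
        rw [Finset.sdiff_erase_self hk.1, Finset.card_singleton]), coeff_killOutside,
      if_pos (hd.trans hS')]

theorem eval_gpPoly_cancel {F : Type*} [Field F] (ev : MvPolynomial ℕ K →+* F) (l : List ℕ)
    {i j : ℕ} {S : Finset ℕ} (hi : i ∉ S) (hj : j ∉ S) (hij : i ≠ j)
    (h : ∀ a ∈ insert i (insert j S), ∀ c ∈ insert i (insert j S), a ≠ c →
      ev (MvPolynomial.X a) ≠ ev (MvPolynomial.X c))
    (hbar : ev (MvPolynomial.X i) + ev (MvPolynomial.X j) + ev (MvPolynomial.C β) *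
      ev (MvPolynomial.X i) * ev (MvPolynomial.X j) = 0) :
    ev (gpPoly β l (insert i (insert j S))) = ev (gpPoly β l S) := by
  rw [eval_gpPoly β ev l h, eval_gpPoly β ev l fun a ha c hc => h a (by simp [ha]) c (by simp [hc])]
  refine GPR_insert_insert _ _ hij hbar l hi hj fun k hk => ⟨?_, ?_⟩
  · exact h k (by simp [hk]) i (by simp) fun h => hi (h ▸ hk)
  · exact h k (by simp [hk]) j (by simp) fun h => hj (h ▸ hk)

theorem rename_GPpoly (lam : StrictPartition) (n : ℕ) :
    MvPolynomial.rename (Fin.val : Fin n → ℕ) (GPpoly β lam n) =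
      gpPoly β lam.parts (Finset.range n) := by
  set back : MvPolynomial ℕ K →ₐ[K] MvPolynomial (Fin n) K :=
    MvPolynomial.aeval fun i => if h : i < n then MvPolynomial.X ⟨i, h⟩ else 0 with hback
  have hX : ∀ i (h : i < n), back (MvPolynomial.X i) = MvPolynomial.X ⟨i, h⟩ := fun i h => by
    rw [hback, MvPolynomial.aeval_X, dif_pos h]
  have h1 : GPpoly β lam n = back (gpPoly β lam.parts (Finset.range n)) := by
    have hinj : Function.Injective (algebraMap (MvPolynomial (Fin n) K) (RatFun K n)) :=
      IsFractionRing.injective _ _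
    have h2 := eval_gpPoly β ((algebraMap _ (RatFun K n)).comp back.toRingHom) lam.parts
      (S := Finset.range n) ?_
    · have hr : Finset.range n = Finset.univ.map (Fin.valEmbedding (n := n)) := by
        ext k
        simp only [Finset.mem_range, Finset.mem_map, Finset.mem_univ, true_and,
          Fin.valEmbedding_apply]
        exact ⟨fun h => ⟨⟨k, h⟩, rfl⟩, fun ⟨i, hi⟩ => hi ▸ i.2⟩
      have h3 : algebraMap _ (RatFun K n) (back (gpPoly β lam.parts (Finset.range n))) =
          GPrat β lam n := by
        refine h2.trans ?_
        rw [GPrat_eq_GPR, hr, GPR_map]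
        congr 1
        · simp [hback]
        · funext i
          simp [hback]
      rw [GPpoly, ← h3]
      exact Function.leftInverse_invFun hinj _
    · intro i hi j hj hij h
      rw [Finset.mem_range] at hi hj
      have h4 : back (MvPolynomial.X i) = back (MvPolynomial.X j) := IsFractionRing.injective _ _ h
      rw [hX i hi, hX j hj] at h4
      have := MvPolynomial.X_injective h4
      exact hij (by simpa using this)
  rw [h1]
  have h5 : (MvPolynomial.rename (Fin.val : Fin n → ℕ)).comp back =
      killOutside K (Finset.range n) := by
    refine MvPolynomial.algHom_ext fun i => ?_
    rw [AlgHom.comp_apply, killOutside, hback, MvPolynomial.aeval_X, MvPolynomial.aeval_X]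
    by_cases h : i < n
    · simp [h]
    · simp [h]
  rw [← AlgHom.comp_apply, h5, killOutside_gpPoly β lam.pos (Finset.Subset.refl _) (by simp)]

theorem coeff_GP (lam : StrictPartition) {d : ℕ →₀ ℕ} {S : Finset ℕ} (hd : d.support ⊆ S) :
    MvPowerSeries.coeff d (GP β lam) = (gpPoly β lam.parts S).coeff d := by
  set N := d.support.sup (fun i => i + 1) with hN
  have hdN : d.support ⊆ Finset.range N := fun i hi => by
    rw [Finset.mem_range]
    exact Finset.le_sup (f := fun i => i + 1) hi
  have h1 : MvPowerSeries.coeff d (GP β lam) = (GPpoly β lam N).coeff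
      (d.comapDomain (Fin.val : Fin N → ℕ) Fin.val_injective.injOn) := rfl
  have h2 : Finsupp.mapDomain (Fin.val : Fin N → ℕ)
      (d.comapDomain (Fin.val : Fin N → ℕ) Fin.val_injective.injOn) = d :=
    Finsupp.mapDomain_comapDomain _ Fin.val_injective _ fun i hi => by
      have := hdN hi
      rw [Finset.mem_range] at this
      exact ⟨⟨i, this⟩, rfl⟩
  rw [h1, ← MvPolynomial.coeff_rename_mapDomain _ Fin.val_injective, h2, rename_GPpoly,
    coeff_gpPoly_of_subset β lam.pos hdN (Finset.Subset.refl _),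
    coeff_gpPoly_of_subset β lam.pos hd (Finset.Subset.refl _)]

end Properties

/-! ### Bounds on the exponents of a power series -/

section Support

variable {σ R : Type*} [CommRing R] {e : (σ →₀ ℕ) →+ ℤ} {c c' : ℤ} {f g : MvPowerSeries σ R}

/-- All exponents `m` occurring in `f` satisfy `e m ≤ c`. -/
def SuppLE (e : (σ →₀ ℕ) →+ ℤ) (c : ℤ) (f : MvPowerSeries σ R) : Prop :=
  ∀ m, MvPowerSeries.coeff m f ≠ 0 → e m ≤ c

theorem SuppLE.mono (h : SuppLE e c f) (hc : c ≤ c') : SuppLE e c' f :=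
  fun m hm => (h m hm).trans hc

theorem SuppLE.coeff_eq_zero (h : SuppLE e c f) {m : σ →₀ ℕ} (hm : c < e m) :
    MvPowerSeries.coeff m f = 0 := by
  by_contra h'
  exact absurd (h m h') (not_le.mpr hm)

theorem SuppLE.add (hf : SuppLE e c f) (hg : SuppLE e c g) : SuppLE e c (f + g) := by
  intro m hm
  by_contra h
  rw [map_add, hf.coeff_eq_zero (not_le.mp h), hg.coeff_eq_zero (not_le.mp h), add_zero] at hm
  exact hm rfl

theorem SuppLE.neg (hf : SuppLE e c f) : SuppLE e c (-f) := by
  intro m hm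
  rw [map_neg, neg_ne_zero] at hm
  exact hf m hm

theorem SuppLE.sub (hf : SuppLE e c f) (hg : SuppLE e c g) : SuppLE e c (f - g) := by
  rw [sub_eq_add_neg]; exact hf.add hg.neg

theorem SuppLE.mul (hf : SuppLE e c f) (hg : SuppLE e c' g) : SuppLE e (c + c') (f * g) := by
  classical
  intro m hm
  rw [MvPowerSeries.coeff_mul] at hm
  obtain ⟨p, hp, hne⟩ := Finset.exists_ne_zero_of_sum_ne_zero hm
  rw [Finset.HasAntidiagonal.mem_antidiagonal] at hp
  rw [← hp, map_add]
  exact add_le_add (hf _ (left_ne_zero_of_mul hne)) (hg _ (right_ne_zero_of_mul hne))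

theorem suppLE_monomial {m : σ →₀ ℕ} {r : R} (h : e m ≤ c) :
    SuppLE e c (MvPowerSeries.monomial m r) := by
  classical
  intro n hn
  rw [MvPowerSeries.coeff_monomial] at hn
  split_ifs at hn with hnm
  · rwa [hnm]
  · exact absurd rfl hn

theorem suppLE_one : SuppLE e 0 (1 : MvPowerSeries σ R) := by
  rw [← MvPowerSeries.monomial_zero_one]
  exact suppLE_monomial (by rw [map_zero])

theorem suppLE_C (r : R) : SuppLE e 0 (MvPowerSeries.C r : MvPowerSeries σ R) := by
  rw [← MvPowerSeries.monomial_zero_eq_C_apply]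
  exact suppLE_monomial (by rw [map_zero])

theorem suppLE_sum {ι : Type*} (s : Finset ι) {f : ι → MvPowerSeries σ R}
    (h : ∀ i ∈ s, SuppLE e c (f i)) : SuppLE e c (∑ i ∈ s, f i) := by
  classical
  induction s using Finset.induction_on with
  | empty => intro m hm; simp at hm
  | insert i s hi ih =>
    rw [Finset.sum_insert hi]
    exact (h i (by simp)).add (ih fun j hj => h j (by simp [hj]))

theorem suppLE_prod {ι : Type*} (s : Finset ι) {f : ι → MvPowerSeries σ R} {c : ι → ℤ}
    (h : ∀ i ∈ s, SuppLE e (c i) (f i)) : SuppLE e (∑ i ∈ s, c i) (∏ i ∈ s, f i) := by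
  classical
  induction s using Finset.induction_on with
  | empty => rw [Finset.sum_empty, Finset.prod_empty]; exact suppLE_one
  | insert i s hi ih =>
    rw [Finset.sum_insert hi, Finset.prod_insert hi]
    exact (h i (by simp)).mul (ih fun j hj => h j (by simp [hj]))

theorem suppLE_prod_zero {ι : Type*} (s : Finset ι) {f : ι → MvPowerSeries σ R}
    (h : ∀ i ∈ s, SuppLE e 0 (f i)) : SuppLE e 0 (∏ i ∈ s, f i) := by
  simpa using suppLE_prod s h

theorem SuppLE.pow (h : SuppLE e c f) (n : ℕ) : SuppLE e (n * c) (f ^ n) := by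
  simpa using suppLE_prod (Finset.range n) (f := fun _ => f) (c := fun _ => c) fun _ _ => h

/-- The bound zero is closed under multiplication, and the recursion for the inverse only uses
products of coefficients of `f` with earlier coefficients of the inverse. -/
theorem SuppLE.invOfUnit (h : SuppLE e 0 f) (u : Rˣ) :
    SuppLE e 0 (MvPowerSeries.invOfUnit f u) := by
  classical
  intro m
  induction m using WellFoundedLT.induction with
  | ind m ih =>
    intro hm
    rw [MvPowerSeries.coeff_invOfUnit] at hm
    split_ifs at hm with h0
    · rw [h0, map_zero]
    · obtain ⟨p, hp, hne⟩ := Finset.exists_ne_zero_of_sum_ne_zero (right_ne_zero_of_mul hm)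
      rw [Finset.HasAntidiagonal.mem_antidiagonal] at hp
      split_ifs at hne with hlt
      · rw [← hp, map_add]
        exact (add_le_add (h _ (left_ne_zero_of_mul hne))
          (ih _ hlt (right_ne_zero_of_mul hne))).trans (by simp)
      · exact absurd rfl hne

end Support

/-! ### Triangularity: the pairing of `P`-functions with strict partitions -/

section Duality

/-- The exponent of `xₖ` in the monomial `s^m`. -/
def xExp (k : ℕ) : (ℕ →₀ ℕ) →+ ℤ where
  toFun m := (m k : ℤ) - m (k + 1)
  map_zero' := by simp
  map_add' m n := by simp only [Finsupp.add_apply]; push_cast; ring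

theorem xExp_apply (k : ℕ) (m : ℕ →₀ ℕ) : xExp k m = (m k : ℤ) - m (k + 1) := rfl

theorem xExp_preExp (k j : ℕ) : xExp k (preExp j) = if k = j then 1 else 0 := by
  rw [xExp_apply, preExp_apply, preExp_apply]
  split_ifs <;> omega

theorem xExp_segExp (k : ℕ) {i j : ℕ} (h : i < j) :
    xExp k (segExp i j) = (if k = j then 1 else 0) - if k = i then 1 else 0 := by
  rw [xExp_apply, segExp_apply, segExp_apply]
  split_ifs <;> omega

variable {R : Type*} [CommRing R] (b : R)

/-- The power series `GP_l(x_S) ∏_{i < j} κᵢⱼ`. -/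
def gpKap : List ℕ → Finset ℕ → MvPowerSeries ℕ R
  | [], S => kapProd b S
  | a :: l, S => ∑ i ∈ S, xs R i ^ a * (∏ j ∈ S.erase i, if i < j then 1 else
      -((1 + MvPowerSeries.C b * xs R j) *
        MvPowerSeries.invOfUnit (1 + MvPowerSeries.C b * xs R i) 1)) * gpKap l (S.erase i)

section Bounds

variable {b} {e : (ℕ →₀ ℕ) →+ ℤ}

theorem suppLE_linear {c : ℤ} (hc : 0 ≤ c) {j : ℕ} (h : e (preExp j) ≤ c) :
    SuppLE e c (1 + MvPowerSeries.C b * xs R j) :=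
  (suppLE_one.mono hc).add (((suppLE_C b).mul (suppLE_monomial h)).mono (by simp))

theorem suppLE_kap {i j : ℕ} (hj : e (preExp j) ≤ 0) (hij : e (segExp i j) ≤ 0) :
    SuppLE e 0 (kap b i j) := by
  have hr : SuppLE e 0 (ratio R i j) := suppLE_monomial hij
  have hden : SuppLE e 0 (kapDen b i j) :=
    ((suppLE_linear le_rfl hj).mul ((suppLE_one.add hr).add
      (((suppLE_C b).mul (suppLE_monomial hj)).mono (by simp)))).mono (by simp)
  exact ((suppLE_one.sub hr).mul (hden.invOfUnit 1)).mono (by simp)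

theorem suppLE_kapProd {S : Finset ℕ}
    (h : ∀ i ∈ S, ∀ j ∈ S, i < j → e (preExp j) ≤ 0 ∧ e (segExp i j) ≤ 0) :
    SuppLE e 0 (kapProd b S) := by
  refine suppLE_prod_zero _ fun i hi => suppLE_prod_zero _ fun j hj => ?_
  split_ifs with hij
  · exact suppLE_kap (h i hi j hj hij).1 (h i hi j hj hij).2
  · exact suppLE_one

theorem suppLE_gpKap (l : List ℕ) : ∀ {S : Finset ℕ}, (∀ j ∈ S, e (preExp j) ≤ 0) →
    (∀ i ∈ S, ∀ j ∈ S, i < j → e (segExp i j) ≤ 0) → SuppLE e 0 (gpKap b l S) := by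
  induction l with
  | nil => intro S h1 h2; exact suppLE_kapProd fun i hi j hj hij => ⟨h1 j hj, h2 i hi j hj hij⟩
  | cons a l ih =>
    intro S h1 h2
    rw [gpKap]
    refine suppLE_sum S fun i hi => ?_
    have hp : SuppLE e 0 (xs R i ^ a) :=
      ((suppLE_monomial (h1 i hi)).pow a).mono (by simp)
    refine ((hp.mul (suppLE_prod_zero _ fun j hj => ?_)).mul (ih ?_ ?_)).mono (by simp)
    · split_ifs
      · exact suppLE_one
      · exact ((suppLE_linear le_rfl (h1 j (Finset.mem_of_mem_erase hj))).mul
          ((suppLE_linear le_rfl (h1 i hi)).invOfUnit 1)).neg.mono (by simp)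
    · exact fun j hj => h1 j (Finset.mem_of_mem_erase hj)
    · exact fun j hj k hk => h2 j (Finset.mem_of_mem_erase hj) k (Finset.mem_of_mem_erase hk)

/-- Together the two bounds say that `xₖ` has exponent exactly zero when it is not among the
variables. -/
theorem suppLE_gpKap_of_notMem {k : ℕ} (l : List ℕ) {S : Finset ℕ} (hk : k ∉ S) :
    SuppLE (xExp k) 0 (gpKap b l S) ∧ SuppLE (-xExp k) 0 (gpKap b l S) := by
  have hne : ∀ j ∈ S, k ≠ j := fun j hj h => hk (h ▸ hj)
  constructor
  · refine suppLE_gpKap l (fun j hj => ?_) fun i hi j hj hij => ?_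
    · rw [xExp_preExp, if_neg (hne j hj)]
    · rw [xExp_segExp k hij, if_neg (hne j hj), if_neg (hne i hi), sub_zero]
  · refine suppLE_gpKap l (fun j hj => ?_) fun i hi j hj hij => ?_
    · rw [AddMonoidHom.neg_apply, xExp_preExp, if_neg (hne j hj), neg_zero]
    · rw [AddMonoidHom.neg_apply, xExp_segExp k hij, if_neg (hne j hj), if_neg (hne i hi), sub_zero,
        neg_zero]

/-- For the least index, `xₖ` occurs in `κ` only through the ratios `xⱼ/xₖ`, so with nonpositive
exponent. If another variable takes the first part, one factor `1 + b xₖ` may raise the exponent by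
one, but the next part is strictly smaller; this is where strictness of the partition enters. -/
theorem suppLE_gpKap_min {k : ℕ} (l : List ℕ) : ∀ {S : Finset ℕ}, k ∈ S → (∀ j ∈ S, k ≤ j) →
    l.Pairwise (fun a b => b < a) → (∀ a ∈ l, 0 < a) →
      SuppLE (xExp k) (l.headD 0 : ℕ) (gpKap b l S) := by
  induction l with
  | nil =>
    intro S hk hmin _ _
    refine suppLE_kapProd fun i hi j hj hij => ?_
    have h1 : k ≠ j := fun h => by have := hmin i hi; omega
    rw [xExp_preExp, xExp_segExp k hij, if_neg h1]
    refine ⟨le_rfl, ?_⟩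
    split_ifs <;> simp
  | cons a l ih =>
    intro S hk hmin hl hpos
    rw [List.pairwise_cons] at hl
    rw [gpKap]
    refine suppLE_sum S fun i hi => ?_
    rw [List.headD_cons]
    by_cases hik : i = k
    · subst hik
      have h1 : SuppLE (xExp i) a (xs R i ^ a) :=
        ((suppLE_monomial (c := 1) (by rw [xExp_preExp, if_pos rfl])).pow a).mono (by simp)
      have h2 : SuppLE (xExp i) 0 (∏ j ∈ S.erase i, if i < j then (1 : MvPowerSeries ℕ R) else
          -((1 + MvPowerSeries.C b * xs R j) *
            MvPowerSeries.invOfUnit (1 + MvPowerSeries.C b * xs R i) 1)) := by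
        refine suppLE_prod_zero _ fun j hj => ?_
        rw [if_pos (lt_of_le_of_ne (hmin j (Finset.mem_of_mem_erase hj))
          (Finset.ne_of_mem_erase hj).symm)]
        exact suppLE_one
      exact ((h1.mul h2).mul (suppLE_gpKap_of_notMem l (Finset.notMem_erase i S)).1).mono (by simp)
    · have h1 : SuppLE (xExp k) 0 (xs R i ^ a) :=
        ((suppLE_monomial (c := 0) (by rw [xExp_preExp, if_neg (Ne.symm hik)])).pow a).mono
          (by simp)
      have h2 : SuppLE (xExp k) 1 (∏ j ∈ S.erase i, if i < j then (1 : MvPowerSeries ℕ R) else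
          -((1 + MvPowerSeries.C b * xs R j) *
            MvPowerSeries.invOfUnit (1 + MvPowerSeries.C b * xs R i) 1)) := by
        -- Only the factor with `j = k` can contain a positive power of `xₖ`, hence the total bound
        -- one.
        refine SuppLE.mono (suppLE_prod _ (c := fun j => if j = k then 1 else 0) fun j hj => ?_) ?_
        · have h5 : SuppLE (xExp k) (if j = k then 1 else 0)
              (1 + MvPowerSeries.C b * xs R j) := by
            refine suppLE_linear (by split_ifs <;> simp) ?_
            rw [xExp_preExp]
            split_ifs <;> omega
          have h6 : SuppLE (xExp k) 0 (MvPowerSeries.invOfUnit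
              (1 + MvPowerSeries.C b * xs R i) 1) :=
            (suppLE_linear le_rfl (by rw [xExp_preExp, if_neg (Ne.symm hik)])).invOfUnit 1
          by_cases hij : i < j
          · rw [if_pos hij]
            exact suppLE_one.mono (by split_ifs <;> simp)
          · rw [if_neg hij]
            exact (h5.mul h6).neg.mono (by simp)
        · rw [Finset.sum_ite_eq' (S.erase i) k]
          split_ifs <;> simp
      have h3 := ih (S := S.erase i) (Finset.mem_erase.mpr ⟨Ne.symm hik, hk⟩)
        (fun j hj => hmin j (Finset.mem_of_mem_erase hj)) hl.2 (fun c hc => hpos c (by simp [hc]))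
      refine ((h1.mul h2).mul h3).mono ?_
      have : l.headD 0 < a := by
        cases l with
        | nil => exact hpos a (by simp)
        | cons c l => exact hl.1 c (by simp)
      push_cast
      omega

end Bounds

/-- The exponent of `xₖ^{a₁} xₖ₊₁^{a₂} ⋯`. -/
def expFrom (k : ℕ) : List ℕ → ℕ →₀ ℕ
  | [] => 0
  | a :: l => a • preExp k + expFrom (k + 1) l

theorem consExp_add (n n' : ℕ) (m m' : ℕ →₀ ℕ) :
    consExp n m + consExp n' m' = consExp (n + n') (m + m') := by
  rw [consExp, consExp, consExp, ← map_add, Prod.mk_add_mk, ← Finsupp.single_add]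

theorem consExp_zero_zero : consExp 0 0 = 0 := by
  rw [consExp, Finsupp.single_zero, ← Prod.zero_eq_mk, map_zero]

theorem expFrom_succ (l : List ℕ) : ∀ k : ℕ, expFrom (k + 1) l = consExp l.sum (expFrom k l) := by
  induction l with
  | nil => intro k; exact consExp_zero_zero.symm
  | cons a l ih =>
    intro k
    rw [expFrom, ih, preExp_succ, nsmul_consExp, consExp_add, mul_one, List.sum_cons, expFrom]

theorem tailList_eq_expFrom (l : List ℕ) : tailList l = expFrom 0 l := by
  induction l with
  | nil => rfl
  | cons a l ih =>
    rw [tailList, expFrom, expFrom_succ, preExp_zero, nsmul_consExp, consExp_add, ih, mul_one,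
      smul_zero, zero_add]

theorem xExp_expFrom_of_lt (l : List ℕ) : ∀ {k i : ℕ}, i < k → xExp i (expFrom k l) = 0 := by
  induction l with
  | nil => intro k i _; simp [expFrom]
  | cons a l ih =>
    intro k i hki
    rw [expFrom, map_add, map_nsmul, xExp_preExp, if_neg (by omega), ih (by omega), smul_zero,
      add_zero]

theorem xExp_expFrom (l : List ℕ) : ∀ {k i : ℕ}, k ≤ i →
    xExp i (expFrom k l) = (l.getD (i - k) 0 : ℕ) := by
  induction l with
  | nil => intro k i _; simp [expFrom]
  | cons a l ih =>
    intro k i hki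
    rw [expFrom, map_add, map_nsmul, xExp_preExp]
    rcases Nat.eq_or_lt_of_le hki with h | h
    · subst h
      rw [xExp_expFrom_of_lt l (Nat.lt_succ_self k)]; simp
    · rw [ih h, if_neg (by omega), smul_zero, zero_add, show i - k = (i - (k + 1)) + 1 by omega,
        List.getD_cons_succ]

/-- If the first part of `m` is smaller than that of `l`, the bound on the exponent of `xₖ` gives
zero. Otherwise the term choosing `i` has exponent at least that part in `xᵢ`, more than the
monomial allows unless `i = k` and the first parts agree; what is left is the same statement for the
tails. -/
theorem coeff_gpKap {l : List ℕ} (hl : l.Pairwise (fun a b => b < a)) (hpos : ∀ a ∈ l, 0 < a) :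
    ∀ {m : List ℕ} (k : ℕ), m.Pairwise (fun a b => b < a) → (∀ a ∈ m, 0 < a) →
      MvPowerSeries.coeff (expFrom k l) (gpKap b m (Finset.Ico k (k + l.length))) =
        if l = m then 1 else 0 := by
  induction l with
  | nil =>
    intro m k _ _
    cases m with
    | nil => simp [gpKap, kapProd, expFrom]
    | cons a m => simp [gpKap]
  | cons c l ih =>
    intro m k hm hmpos
    have hl' := List.pairwise_cons.mp hl
    have hkS : k ∈ Finset.Ico k (k + (c :: l).length) := by simp
    have hexp : ∀ i ∈ Finset.Ico k (k + (c :: l).length), i ≠ k →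
        xExp i (expFrom k (c :: l)) < c := by
      intro i hi hik
      rw [Finset.mem_Ico, List.length_cons] at hi
      rw [xExp_expFrom _ hi.1, show i - k = (i - k - 1) + 1 by omega, List.getD_cons_succ,
        List.getD_eq_getElem _ _ (by omega)]
      exact_mod_cast hl'.1 _ (List.getElem_mem _)
    have hexpk : xExp k (expFrom k (c :: l)) = c := by
      rw [xExp_expFrom _ le_rfl]; simp
    rcases lt_or_ge (m.headD 0) c with hc | hc
    · rw [if_neg]
      · refine (suppLE_gpKap_min m hkS (fun j hj => (Finset.mem_Ico.mp hj).1) hm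
          hmpos).coeff_eq_zero ?_
        rw [hexpk]; exact_mod_cast hc
      · rintro rfl
        simp at hc
    · cases m with
      | nil =>
        have := hpos c (by simp)
        simp at hc
        omega
      | cons a m =>
        rw [List.headD_cons] at hc
        have hm' := List.pairwise_cons.mp hm
        -- The power `xᵢ^a` cannot be lowered: the sign factors are series in the variables and the
        -- recursive factor does not involve `xᵢ`.
        have hterm : ∀ i ∈ Finset.Ico k (k + (c :: l).length),
            xExp i (expFrom k (c :: l)) < a → MvPowerSeries.coeff (expFrom k (c :: l))
            (xs R i ^ a * (∏ j ∈ (Finset.Ico k (k + (c :: l).length)).erase i,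
              if i < j then 1 else -((1 + MvPowerSeries.C b * xs R j) *
              MvPowerSeries.invOfUnit (1 + MvPowerSeries.C b * xs R i) 1)) *
              gpKap b m ((Finset.Ico k (k + (c :: l).length)).erase i)) = 0 := by
          intro i hi hlt
          have h1 : SuppLE (-xExp i) (-a) (xs R i ^ a) :=
            ((suppLE_monomial (c := -1) (by
              rw [AddMonoidHom.neg_apply, xExp_preExp, if_pos rfl])).pow a).mono (by simp)
          have h2 : SuppLE (-xExp i) 0 (∏ j ∈ (Finset.Ico k (k + (c :: l).length)).erase i,
              if i < j then (1 : MvPowerSeries ℕ R) else -((1 + MvPowerSeries.C b * xs R j) *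
              MvPowerSeries.invOfUnit (1 + MvPowerSeries.C b * xs R i) 1)) := by
            refine suppLE_prod_zero _ fun j _ => ?_
            have h : ∀ j, (-xExp i) (preExp j) ≤ 0 := fun j => by
              rw [AddMonoidHom.neg_apply, xExp_preExp]; split_ifs <;> simp
            split_ifs
            · exact suppLE_one
            · exact (((suppLE_linear le_rfl (h j)).mul
                ((suppLE_linear le_rfl (h i)).invOfUnit 1)).neg).mono (by simp)
          refine ((h1.mul h2).mul (suppLE_gpKap_of_notMem m
            (Finset.notMem_erase i _)).2).coeff_eq_zero ?_
          rw [AddMonoidHom.neg_apply]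
          omega
        rw [gpKap, map_sum]
        rcases Nat.eq_or_lt_of_le hc with hca | hca
        · subst hca
          rw [Finset.sum_eq_single k]
          · have hprod : (∏ j ∈ (Finset.Ico k (k + (c :: l).length)).erase k,
                if k < j then (1 : MvPowerSeries ℕ R) else -((1 + MvPowerSeries.C b * xs R j) *
                MvPowerSeries.invOfUnit (1 + MvPowerSeries.C b * xs R k) 1)) = 1 := by
              refine Finset.prod_eq_one fun j hj => if_pos ?_
              rw [Finset.mem_erase, Finset.mem_Ico] at hj
              omega
            have hI : (Finset.Ico k (k + (c :: l).length)).erase k =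
                Finset.Ico (k + 1) (k + 1 + l.length) := by
              ext j
              simp only [Finset.mem_erase, Finset.mem_Ico, List.length_cons]
              omega
            rw [hprod, mul_one, hI, xs, MvPowerSeries.monomial_pow, one_pow, expFrom,
              MvPowerSeries.coeff_add_monomial_mul, one_mul,
              ih hl'.2 (fun a ha => hpos a (by simp [ha])) (k + 1) hm'.2
                (fun a ha => hmpos a (by simp [ha]))]
            simp
          · intro i hi hik
            exact hterm i hi (hexp i hi hik)
          · exact fun h => absurd hkS h
        · rw [if_neg (by rintro h; injection h; omega)]
          refine Finset.sum_eq_zero fun i hi => hterm i hi ?_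
          by_cases hik : i = k
          · rw [hik, hexpk]; exact_mod_cast hca
          · exact (hexp i hi hik).trans (by exact_mod_cast hca)

end Duality

/-! ### Evaluating the `P`-functions at `xᵢ = s₀ ⋯ sᵢ` -/

section Evaluation

variable {K : Type*} [Field K] (β : K) (R : Type*) [CommRing R]

/-- The embedding of power series into their fraction field. -/
abbrev toFrac : MvPowerSeries ℕ R →+* FractionRing (MvPowerSeries ℕ R) :=
  algebraMap (MvPowerSeries ℕ R) (FractionRing (MvPowerSeries ℕ R))

theorem xs_injective (R : Type*) [CommRing R] [IsDomain R] {i j : ℕ} (h : xs R i = xs R j) :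
    i = j := by
  classical
  have h1 := congrArg (MvPowerSeries.coeff (preExp i)) h
  rw [xs, xs, MvPowerSeries.coeff_monomial_same, MvPowerSeries.coeff_monomial] at h1
  split_ifs at h1 with h2
  · by_contra hij
    have h3 := congrArg (xExp i) h2
    rw [xExp_preExp, xExp_preExp, if_pos rfl, if_neg hij] at h3
    omega
  · simp at h1

/-- Evaluation at `xᵢ = s₀ ⋯ sᵢ`, in the fraction field. -/
def xsFrac [Algebra K R] : MvPolynomial ℕ K →+* FractionRing (MvPowerSeries ℕ R) :=
  (toFrac R).comp (MvPolynomial.aeval (R := K) (xs R)).toRingHom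

theorem xsFrac_X [Algebra K R] (i : ℕ) : xsFrac (K := K) R (MvPolynomial.X i) = toFrac R (xs R i) := by
  simp [xsFrac]

theorem xsFrac_C [Algebra K R] (c : K) : xsFrac (K := K) R (MvPolynomial.C c) =
    toFrac R (MvPowerSeries.C (algebraMap K R c)) := by
  simp only [xsFrac, AlgHom.toRingHom_eq_coe, RingHom.coe_comp, RingHom.coe_coe,
    Function.comp_apply, MvPolynomial.aeval_C, MvPowerSeries.algebraMap_apply]

theorem rho_mul_kap [IsDomain R] (b : R) {i j : ℕ} (h : i < j) :
    rho (toFrac R (MvPowerSeries.C b))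
      (toFrac R (xs R i)) (toFrac R (xs R j)) * toFrac R (kap b i j) = 1 := by
  have hk := congrArg (toFrac R) (kap_mul_kapDen b h)
  have hx := congrArg (toFrac R)
    (xs_eq_mul_ratio (R := R) h)
  have hne : toFrac R (xs R i) -
      toFrac R (xs R j) ≠ 0 := by
    rw [sub_ne_zero]
    exact fun h' => h.ne (xs_injective R (IsFractionRing.injective _ _ h'))
  rw [kapDen] at hk
  simp only [map_mul, map_add, map_sub, map_one] at hk hx
  rw [rho_eq, div_mul_eq_mul_div, div_eq_one_iff_eq hne]
  set B := toFrac R (MvPowerSeries.C b)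
  set x := toFrac R (xs R i)
  set y := toFrac R (xs R j)
  set r := toFrac R (ratio R i j)
  set k := toFrac R (kap b i j)
  linear_combination x * hk + (k * (1 + B * y) + 1) * hx

theorem rho_mul_kap' [IsDomain R] (b : R) {i j : ℕ} (h : j < i) :
    rho (toFrac R (MvPowerSeries.C b))
      (toFrac R (xs R i)) (toFrac R (xs R j)) * toFrac R (kap b j i) =
      toFrac R (-((1 + MvPowerSeries.C b * xs R j) *
        MvPowerSeries.invOfUnit (1 + MvPowerSeries.C b * xs R i) 1)) := by
  have hk := congrArg (toFrac R) (kap_mul_kapDen b h)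
  have hx := congrArg (toFrac R)
    (xs_eq_mul_ratio (R := R) h)
  have hi := congrArg (toFrac R)
    (MvPowerSeries.mul_invOfUnit (1 + MvPowerSeries.C b * xs R i) 1
      (by simp [constantCoeff_xs]))
  have hne : toFrac R (xs R i) -
      toFrac R (xs R j) ≠ 0 := by
    rw [sub_ne_zero]
    exact fun h' => h.ne (xs_injective R (IsFractionRing.injective _ _ h')).symm
  rw [kapDen] at hk
  simp only [map_mul, map_add, map_sub, map_one, map_neg] at hk hx hi ⊢
  rw [rho_eq, div_mul_eq_mul_div, div_eq_iff hne]
  set B := toFrac R (MvPowerSeries.C b)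
  set x := toFrac R (xs R i)
  set y := toFrac R (xs R j)
  set r := toFrac R (ratio R j i)
  set k := toFrac R (kap b j i)
  set v := toFrac R
    (MvPowerSeries.invOfUnit (1 + MvPowerSeries.C b * xs R i) 1)
  have h1 : (x + y + B * x * y) * k * (1 + B * x) = y - x := by
    linear_combination y * hk + (k * (1 + B * x) + 1) * hx
  linear_combination (1 + B * y) * v * h1 - (x + y + B * x * y) * (1 + B * y) * k * hi

/-- In the term for `i`, the kernel cancels the rational factors: to `1` against `κᵢⱼ` when `i < j`,
and to `-(1 + bxⱼ)/(1 + bxᵢ)` against `κⱼᵢ` when `j < i`. These are exactly the factors in `gpKap`,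
so the product is a genuine power series. -/
theorem algebraMap_gpKap [IsDomain R] (b : R) (l : List ℕ) : ∀ S : Finset ℕ,
    toFrac R (gpKap b l S) =
      GPR (toFrac R (MvPowerSeries.C b)) (fun i => toFrac R (xs R i)) l S *
        toFrac R (kapProd b S) := by
  induction l with
  | nil => intro S; rw [gpKap, GPR, one_mul]
  | cons a l ih =>
    intro S
    rw [gpKap, GPR, map_sum, Finset.sum_mul]
    refine Finset.sum_congr rfl fun i hi => ?_
    have hkap : kapProd b S = kapProd b (S.erase i) *
        ∏ j ∈ S.erase i, if i < j then kap b i j else kap b j i := by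
      conv_lhs => rw [← Finset.insert_erase hi]
      exact pairProd_insert (kap b) (Finset.notMem_erase i S)
    have hprod : (∏ j ∈ S.erase i, rho (toFrac R
        (MvPowerSeries.C b)) (toFrac R (xs R i)) (toFrac R (xs R j))) *
        toFrac R (∏ j ∈ S.erase i, if i < j then kap b i j else kap b j i) =
        toFrac R (∏ j ∈ S.erase i, if i < j then 1 else
          -((1 + MvPowerSeries.C b * xs R j) *
            MvPowerSeries.invOfUnit (1 + MvPowerSeries.C b * xs R i) 1)) := by
      rw [map_prod, map_prod, ← Finset.prod_mul_distrib]
      refine Finset.prod_congr rfl fun j hj => ?_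
      split_ifs with hij
      · rw [rho_mul_kap R b hij, map_one]
      · exact rho_mul_kap' R b (lt_of_le_of_ne (not_lt.mp hij) (Finset.ne_of_mem_erase hj))
    rw [map_mul, map_mul, map_pow, ih, hkap, map_mul, ← hprod]
    ring

theorem aeval_gpPoly_mul_kapProd [CharZero K] [IsDomain R] [Algebra K R] (l : List ℕ) (S : Finset ℕ) :
    MvPolynomial.aeval (xs R) (gpPoly β l S) * kapProd (algebraMap K R β) S =
      gpKap (algebraMap K R β) l S := by
  refine IsFractionRing.injective _ (FractionRing (MvPowerSeries ℕ R)) ?_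
  have h := eval_gpPoly β (xsFrac R) l (S := S) fun i _ j _ hij h => by
    rw [xsFrac_X, xsFrac_X] at h
    exact hij (xs_injective R (IsFractionRing.injective _ _ h))
  rw [algebraMap_gpKap, map_mul]
  congr 1
  rw [xsFrac_C] at h
  simp only [xsFrac_X] at h
  exact h

open Classical in
/-- The functional `f ↦ [x^l] f(x) ∏_{i < j} κᵢⱼ` is dual to the `K`-theoretic
`P`-functions. -/
theorem coeff_gpPoly_mul_kapProd [CharZero K] [IsDomain R] [Algebra K R] (lam mu : StrictPartition) :
    MvPowerSeries.coeff (tailList lam.parts)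
      (MvPolynomial.aeval (xs R) (gpPoly β mu.parts (Finset.range lam.parts.length)) *
        kapProd (algebraMap K R β) (Finset.range lam.parts.length)) =
      if lam = mu then 1 else 0 := by
  rw [aeval_gpPoly_mul_kapProd, tailList_eq_expFrom]
  have h := coeff_gpKap (algebraMap K R β) lam.decreasing lam.pos 0 mu.decreasing mu.pos
  rw [zero_add, ← Finset.range_eq_Ico] at h
  rw [h]
  refine if_congr ?_ rfl rfl
  rw [StrictPartition.ext_iff]

end Evaluation

/-! ### Monomials in the `x` and their degree as the exponent of `s₀` -/

section Exponents

/-- The `xExp k` are successive differences, and finite support allows summing them back from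
infinity. -/
theorem eq_of_xExp_eq {m n : ℕ →₀ ℕ} (h : ∀ k, xExp k m = xExp k n) : m = n := by
  obtain ⟨N, hN⟩ : ∃ N, ∀ k, N ≤ k → m k = 0 ∧ n k = 0 := by
    refine ⟨(m.support ∪ n.support).sup id + 1, fun k hk => ?_⟩
    have hk' : k ∉ m.support ∪ n.support := fun h' => by
      have := Finset.le_sup (f := id) h'
      simp only [id] at this
      omega
    rw [Finset.mem_union, not_or, Finsupp.notMem_support_iff, Finsupp.notMem_support_iff] at hk'
    exact hk'
  have key : ∀ j k, N ≤ k + j → m k = n k := by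
    intro j
    induction j with
    | zero => intro k hk; rw [(hN k hk).1, (hN k hk).2]
    | succ j ih =>
      intro k hk
      have h1 := ih (k + 1) (by omega)
      have h2 := h k
      rw [xExp_apply, xExp_apply] at h2
      omega
  ext k
  exact key N k (by omega)

/-- The exponent of `x^m` in terms of `xᵢ = s₀ ⋯ sᵢ`. -/
def sExp (m : ℕ →₀ ℕ) : ℕ →₀ ℕ := m.sum fun i k => k • preExp i

theorem xExp_sExp (m : ℕ →₀ ℕ) (k : ℕ) : xExp k (sExp m) = m k := by
  rw [sExp, Finsupp.sum, map_sum]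
  simp only [map_nsmul, xExp_preExp, smul_ite, smul_zero, nsmul_eq_mul, mul_one]
  rw [Finset.sum_ite_eq]
  split_ifs with h
  · rfl
  · rw [Finsupp.notMem_support_iff.mp h]; rfl

theorem sExp_injective : Function.Injective sExp := fun m n h => by
  ext k
  have := congrArg (xExp k) h
  rw [xExp_sExp, xExp_sExp] at this
  exact_mod_cast this

theorem sExp_apply_zero (m : ℕ →₀ ℕ) : sExp m 0 = m.degree := by
  rw [sExp, Finsupp.sum, Finsupp.finsetSum_apply, Finsupp.degree_apply]
  exact Finset.sum_congr rfl fun i _ => by simp [preExp_apply]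

theorem tailList_map_range {m : ℕ →₀ ℕ} {r : ℕ} (hm : m.support ⊆ Finset.range r) :
    tailList ((List.range r).map m) = sExp m := by
  refine eq_of_xExp_eq fun k => ?_
  rw [tailList_eq_expFrom, xExp_expFrom _ (Nat.zero_le k), xExp_sExp, Nat.sub_zero]
  congr 1
  by_cases hk : k < r
  · simp [List.getD_eq_getElem?_getD, hk]
  · have : m k = 0 := by
      by_contra h
      exact hk (Finset.mem_range.mp (hm (Finsupp.mem_support_iff.mpr h)))
    simp [List.getD_eq_getElem?_getD, hk, this]

variable (R : Type*) [CommRing R]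

theorem prod_xs_pow (m : ℕ →₀ ℕ) :
    (m.prod fun i k => xs R i ^ k) = MvPowerSeries.monomial (sExp m) 1 := by
  rw [sExp, Finsupp.prod, Finsupp.sum]
  induction m.support using Finset.induction_on with
  | empty => simp
  | insert i s hi ih =>
    rw [Finset.prod_insert hi, Finset.sum_insert hi, ih, xs, MvPowerSeries.monomial_pow, one_pow,
      MvPowerSeries.monomial_mul_monomial, one_mul]

theorem hasSubst_family_xs : MvPowerSeries.HasSubst (xs R) where
  const_coeff i := by rw [constantCoeff_xs]; exact IsNilpotent.zero
  coeff_zero d := by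
    classical
    refine (Set.finite_singleton ((∑ i ∈ d.support, d i) - 1)).subset fun i hi => ?_
    rw [Set.mem_ofPred_eq, xs, MvPowerSeries.coeff_monomial] at hi
    have hd : d = preExp i := by
      by_contra h
      rw [if_neg h] at hi
      exact hi rfl
    have h1 : ∑ k ∈ d.support, d k = d.degree := (Finsupp.degree_apply d).symm
    rw [Set.mem_singleton_iff, h1, hd, preExp, map_sum]
    simp

variable {R}

theorem coeff_sExp_subst (f : MvPowerSeries ℕ R) (m : ℕ →₀ ℕ) :
    MvPowerSeries.coeff (sExp m) (MvPowerSeries.subst (xs R) f) = MvPowerSeries.coeff m f := by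
  classical
  rw [MvPowerSeries.coeff_subst (hasSubst_family_xs R), finsum_eq_single _ m]
  · rw [prod_xs_pow, MvPowerSeries.coeff_monomial_same, smul_eq_mul, mul_one]
  · intro n hn
    rw [prod_xs_pow, MvPowerSeries.coeff_monomial, if_neg fun h => hn (sExp_injective h).symm,
      smul_zero]

theorem exists_sExp_of_coeff_subst_ne_zero {f : MvPowerSeries ℕ R} {e : ℕ →₀ ℕ}
    (h : MvPowerSeries.coeff e (MvPowerSeries.subst (xs R) f) ≠ 0) :
    ∃ m, e = sExp m ∧ MvPowerSeries.coeff m f ≠ 0 := by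
  classical
  rw [MvPowerSeries.coeff_subst (hasSubst_family_xs R)] at h
  obtain ⟨m, hm⟩ : ∃ m : ℕ →₀ ℕ, MvPowerSeries.coeff m f •
      MvPowerSeries.coeff e (m.prod fun i k => xs R i ^ k) ≠ 0 := by
    by_contra! h'
    exact h (finsum_eq_zero_of_forall_eq_zero h')
  rw [prod_xs_pow, MvPowerSeries.coeff_monomial] at hm
  split_ifs at hm with he
  · exact ⟨m, he, left_ne_zero_of_smul hm⟩
  · simp at hm

/-- The exponent of `s₀`. -/
def headExp : (ℕ →₀ ℕ) →+ ℤ := (Nat.castAddMonoidHom ℤ).comp (Finsupp.applyAddHom 0)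

theorem headExp_apply (m : ℕ →₀ ℕ) : headExp m = m 0 := rfl

theorem suppLE_headExp_subst {f : MvPowerSeries ℕ R} {n : ℕ}
    (h : ∀ m, MvPowerSeries.coeff m f ≠ 0 → m.degree ≤ n) :
    SuppLE headExp n (MvPowerSeries.subst (xs R) f) := by
  intro e he
  obtain ⟨m, rfl, hm⟩ := exists_sExp_of_coeff_subst_ne_zero he
  rw [headExp_apply, sExp_apply_zero]
  exact_mod_cast h m hm

theorem suppLE_neg_headExp_subst {f : MvPowerSeries ℕ R} {n : ℕ}
    (h : ∀ m, MvPowerSeries.coeff m f ≠ 0 → n ≤ m.degree) :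
    SuppLE (-headExp) (-n) (MvPowerSeries.subst (xs R) f) := by
  intro e he
  obtain ⟨m, rfl, hm⟩ := exists_sExp_of_coeff_subst_ne_zero he
  rw [AddMonoidHom.neg_apply, headExp_apply, sExp_apply_zero, neg_le_neg_iff]
  exact_mod_cast h m hm

theorem suppLE_kapProd_zero (S : Finset ℕ) :
    SuppLE headExp 0 (kapProd (0 : R) S) := by
  refine suppLE_prod_zero _ fun i _ => suppLE_prod_zero _ fun j _ => ?_
  split_ifs with hij
  · have hr : SuppLE headExp 0 (ratio R i j) := suppLE_monomial (by
      rw [headExp_apply, segExp_apply, if_neg (by omega)]; simp)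
    have hden : SuppLE headExp 0 (kapDen (0 : R) i j) := by
      rw [kapDen, map_zero, zero_mul, add_zero, add_zero, one_mul]
      exact suppLE_one.add hr
    exact ((suppLE_one.sub hr).mul (hden.invOfUnit 1)).mono (by simp)
  · exact suppLE_one

/-- The parameter `b` enters `κ` only through `b xⱼ`, and every `xⱼ` is divisible by `s₀`; modulo
`s₀` the two kernels coincide. -/
theorem suppLE_kapProd_sub (b : R) (S : Finset ℕ) :
    SuppLE (-headExp) (-1) (kapProd b S - kapProd 0 S) := by
  set q := Ideal.Quotient.mk (Ideal.span {(MvPowerSeries.X 0 : MvPowerSeries ℕ R)}) with hq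
  have hx : ∀ j, q (xs R j) = 0 := fun j => by
    rw [hq, Ideal.Quotient.eq_zero_iff_mem, Ideal.mem_span_singleton,
      MvPowerSeries.X_dvd_iff]
    intro m hm
    classical
    rw [xs, MvPowerSeries.coeff_monomial, if_neg]
    rintro rfl
    simp [preExp_apply] at hm
  have hk : ∀ i j, i < j → q (kap b i j) = q (kap 0 i j) := by
    intro i j hij
    have h1 := congrArg q (kap_mul_kapDen b hij)
    have h2 := congrArg q (kap_mul_kapDen (0 : R) hij)
    have h3 : q (kapDen b i j) = q (kapDen 0 i j) := by
      simp [kapDen, hx]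
    rw [map_mul] at h1 h2
    rw [h3] at h1
    exact ((isUnit_kapDen (0 : R) hij).map q).mul_right_cancel (h1.trans h2.symm)
  have hd : q (kapProd b S - kapProd 0 S) = 0 := by
    rw [map_sub, sub_eq_zero]
    exact (map_pairProd q (kap b) S).trans ((pairProd_congr fun i _ j _ hij => hk i j hij).trans
      (map_pairProd q (kap 0) S).symm)
  rw [hq, Ideal.Quotient.eq_zero_iff_mem, Ideal.mem_span_singleton,
    MvPowerSeries.X_dvd_iff] at hd
  intro m hm
  rw [AddMonoidHom.neg_apply, headExp_apply]
  by_contra h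
  exact hm (hd m (by omega))

end Exponents

/-! ### Symmetric polynomials with cancellation at `β = 0` -/

section Alternating

variable {R : Type*} [CommRing R]

theorem exists_strictAnti_of_alternating [IsDomain R] [CharZero R] {g : MvPolynomial ℕ R}
    (hg : g ≠ 0) {r : ℕ}
    (halt : ∀ i j, i < j → j < r → MvPolynomial.rename (Equiv.swap i j) g = -g) :
    ∃ m : ℕ →₀ ℕ, g.coeff m ≠ 0 ∧ ∀ i j, i < j → j < r → m j < m i := by
  -- Minimising `∑ k mₖ` puts the large exponents first: a pair in increasing order could be
  -- exchanged to lower the sum, and equal exponents contradict antisymmetry.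
  obtain ⟨m, hm, hmin⟩ := Finset.exists_min_image g.support
    (fun m : ℕ →₀ ℕ => ∑ k ∈ Finset.range r, (k : ℤ) * m k)
    (MvPolynomial.support_nonempty.mpr hg)
  rw [MvPolynomial.mem_support_iff] at hm
  refine ⟨m, hm, fun i j hij hj => ?_⟩
  have hcoeff : g.coeff (m.mapDomain (Equiv.swap i j)) = -g.coeff m := by
    have h := MvPolynomial.coeff_rename_mapDomain _ (Equiv.swap i j).injective g m
    rw [halt i j hij hj, MvPolynomial.coeff_neg] at h
    rw [← h, neg_neg]
  have happ : ∀ k, m.mapDomain (Equiv.swap i j) k = m (Equiv.swap i j k) := fun k => by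
    conv_lhs => rw [← Equiv.swap_apply_self i j k]
    exact Finsupp.mapDomain_apply (Equiv.swap i j).injective m _
  by_contra hle
  rw [not_lt] at hle
  rcases hle.eq_or_lt with heq | hlt
  · have hfix : m.mapDomain (Equiv.swap i j) = m := by
      ext k
      rw [happ, Equiv.swap_apply_def]
      split_ifs with h1 h2
      · rw [h1, heq]
      · rw [h2, heq]
      · rfl
    rw [hfix] at hcoeff
    exact hm (self_eq_neg.mp hcoeff)
  · have h := hmin (m.mapDomain (Equiv.swap i j)) (by
      rw [MvPolynomial.mem_support_iff, hcoeff]; exact neg_ne_zero.mpr hm)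
    have hjr : j ∈ Finset.range r := Finset.mem_range.mpr hj
    have hir : i ∈ (Finset.range r).erase j :=
      Finset.mem_erase.mpr ⟨hij.ne, Finset.mem_range.mpr (hij.trans hj)⟩
    have hrest : ∑ k ∈ ((Finset.range r).erase j).erase i,
        (k : ℤ) * (m.mapDomain (Equiv.swap i j) k : ℤ) =
        ∑ k ∈ ((Finset.range r).erase j).erase i, (k : ℤ) * (m k : ℤ) :=
      Finset.sum_congr rfl fun k hk => by
        rw [Finset.mem_erase, Finset.mem_erase] at hk
        rw [happ, Equiv.swap_apply_of_ne_of_ne hk.1 hk.2.1]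
    rw [← Finset.add_sum_erase _ _ hjr, ← Finset.add_sum_erase _ _ hir,
      ← Finset.add_sum_erase _ (fun k : ℕ => (k : ℤ) * (m.mapDomain (Equiv.swap i j) k : ℤ)) hjr,
      ← Finset.add_sum_erase _ (fun k : ℕ => (k : ℤ) * (m.mapDomain (Equiv.swap i j) k : ℤ)) hir,
      hrest, happ, happ, Equiv.swap_apply_left, Equiv.swap_apply_right] at h
    have h1 : (j - i : ℤ) * (m j - m i : ℤ) ≤ 0 := by linarith
    have h2 : (0 : ℤ) < (j - i : ℤ) := by omega
    have h3 : (0 : ℤ) < (m j - m i : ℤ) := by omega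
    exact absurd (mul_pos h2 h3) (not_lt.mpr h1)

/-- `∏_{i < j} (xᵢ + xⱼ)` over a finite set of indices. -/
def plusProd (R : Type*) [CommRing R] (S : Finset ℕ) : MvPolynomial ℕ R :=
  pairProd (fun i j => MvPolynomial.X i + MvPolynomial.X j) S

/-- From `(xᵢ + xⱼ)(xᵢ - xⱼ) = xᵢ² - xⱼ²`. The symmetry of `plusProd` follows by comparing the signs
of the two Vandermonde products. -/
theorem plusProd_mul_vander (S : Finset ℕ) :
    plusProd R S * vander R S = MvPolynomial.expand 2 (vander R S) := by
  rw [plusProd, vander, ← pairProd_mul, map_pairProd]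
  refine pairProd_congr fun i _ j _ _ => ?_
  rw [map_sub, MvPolynomial.expand_X, MvPolynomial.expand_X]
  ring

theorem vander_ne_zero [IsDomain R] (S : Finset ℕ) : vander R S ≠ 0 := by
  rw [vander, pairProd_eq_prod_filter, Finset.prod_ne_zero_iff]
  intro p hp
  exact sub_ne_zero.mpr (X_ne_X (Finset.mem_filter.mp hp).2.ne)

theorem plusProd_ne_zero [IsDomain R] [CharZero R] (S : Finset ℕ) : plusProd R S ≠ 0 := by
  rw [plusProd, pairProd_eq_prod_filter, Finset.prod_ne_zero_iff]
  intro p _ h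
  have := congrArg (MvPolynomial.eval fun _ => (1 : R)) h
  simp only [map_add, MvPolynomial.eval_X, map_zero] at this
  norm_num at this

theorem rename_swap_plusProd [IsDomain R] {S : Finset ℕ} {i j : ℕ} (hi : i ∈ S) (hj : j ∈ S)
    (hij : i ≠ j) : MvPolynomial.rename (Equiv.swap i j) (plusProd R S) = plusProd R S := by
  have h := congrArg (MvPolynomial.rename (Equiv.swap i j)) (plusProd_mul_vander (R := R) S)
  rw [map_mul, MvPolynomial.rename_expand, rename_vander_swap hi hj hij, map_neg,
    ← plusProd_mul_vander, mul_neg, neg_inj] at h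
  exact mul_right_cancel₀ (vander_ne_zero S) h

theorem prod_X_mul_plusProd_dvd [IsDomain R] [CharZero R] {S : Finset ℕ} {h : MvPolynomial ℕ R}
    (hcancel : ∀ i ∈ S, ∀ j ∈ S, i < j → substVar j (-MvPolynomial.X i) h = 0)
    (hkill : ∀ k ∈ S, substVar k 0 h = 0) :
    (∏ k ∈ S, MvPolynomial.X k) * plusProd R S ∣ h := by
  -- A pair `(k, k)` encodes the divisor `xₖ` and a pair `i < j` the divisor `xⱼ + xᵢ`, so that both
  -- kinds are treated by one application of `prod_dvd_of_ker`.
  set u : ℕ × ℕ → MvPolynomial ℕ R := fun p => if p.1 = p.2 then 0 else -MvPolynomial.X p.1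
    with hu
  have h1 := prod_dvd_of_ker ((S ×ˢ S).filter (fun p => p.1 ≤ p.2))
    (fun p => MvPolynomial.X p.2 - u p) (fun p => (substVar p.2 (u p)).toRingHom)
    (fun p _ a ha => dvd_of_substVar ha) ?_ (P := h) ?_
  · convert h1 using 1
    rw [Finset.prod_filter, Finset.prod_product]
    rw [plusProd, pairProd, ← Finset.prod_mul_distrib]
    refine Finset.prod_congr rfl fun i hi => ?_
    have h2 : (MvPolynomial.X i : MvPolynomial ℕ R) =
        ∏ j ∈ S, if i = j then MvPolynomial.X i else 1 := by
      rw [Finset.prod_ite_eq, if_pos hi]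
    refine (congrArg (· * _) h2).trans ?_
    rw [← Finset.prod_mul_distrib]
    refine Finset.prod_congr rfl fun j _ => ?_
    rcases lt_trichotomy i j with hij | rfl | hij
    · simp [hu, hij.ne, hij, hij.le, add_comm]
    · simp [hu]
    · simp [hij.ne', hij.not_gt, hij.not_ge]
  · rintro ⟨i, j⟩ hp ⟨k, l⟩ hq hne h0
    simp only [Finset.mem_filter] at hp hq
    -- A test point on the hyperplane of the first divisor: the other coordinates are the distinct
    -- positive integers `m + 1`, so no other divisor vanishes there in characteristic zero.
    set v : ℕ → R := fun m => if m = j then (if i = j then 0 else -((i : R) + 1)) else (m : R) + 1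
      with hv
    have hX : ∀ m, MvPolynomial.eval v (substVar j (u (i, j)) (MvPolynomial.X m)) = v m := by
      intro m
      rw [substVar_X]
      by_cases hm : m = j
      · by_cases hij : i = j
        · simp [hu, hv, hm, hij]
        · simp [hu, hv, hm, hij]
      · simp [hv, hm]
    have h2 := congrArg (MvPolynomial.eval v) h0
    have hpos : ∀ a : ℕ, (a : R) + 1 ≠ 0 := fun a => by exact_mod_cast Nat.succ_ne_zero a
    have hsum : ∀ a c : ℕ, (a : R) + 1 + ((c : R) + 1) ≠ 0 := fun a c => by
      exact_mod_cast (Nat.succ_ne_zero (a + 1 + c))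
    have hsub : ∀ a c : ℕ, a ≠ c → (a : R) + 1 - ((c : R) + 1) ≠ 0 := fun a c hac h' => by
      apply hac
      have : (a : R) = c := by linear_combination h'
      exact_mod_cast this
    simp only [AlgHom.toRingHom_eq_coe, RingHom.coe_coe, map_sub, map_zero, hX] at h2
    by_cases hkl : k = l
    · subst hkl
      simp only [hu, if_true, map_zero, sub_zero] at h2
      simp only [hv] at h2
      split_ifs at h2 with h3 h4
      · exact hne (by simp [h3, h4])
      · exact hpos i (neg_eq_zero.mp h2)
      · exact hpos k h2
    · simp only [hu, if_neg hkl, map_neg, sub_neg_eq_add] at h2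
      rw [hX k] at h2
      simp only [hv] at h2
      by_cases h3 : l = j
      · rw [if_pos h3, if_neg (by omega : k ≠ j)] at h2
        split_ifs at h2 with h4
        · exact hpos k (by simpa using h2)
        · by_cases hki : k = i
          · exact hne (by simp [h3, hki])
          · exact hsub k i hki (by linear_combination h2)
      · rw [if_neg h3] at h2
        split_ifs at h2 with h4 h5
        · exact hpos l (by simpa using h2)
        · by_cases hli : l = i
          · omega
          · exact hsub l i hli (by linear_combination h2)
        · exact hsum l k h2
  · rintro ⟨i, j⟩ hp
    simp only [Finset.mem_filter, Finset.mem_product] at hp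
    simp only [AlgHom.toRingHom_eq_coe, RingHom.coe_coe, hu]
    split_ifs with hij
    · exact hkill j hp.1.2
    · exact hcancel i hp.1.1 j hp.1.2 (lt_of_le_of_ne hp.2 hij)

theorem aeval_plusProd_mul_kapProd (S : Finset ℕ) :
    MvPolynomial.aeval (xs R) (plusProd R S) * kapProd 0 S =
      MvPolynomial.aeval (xs R) (vander R S) := by
  rw [plusProd, vander, map_pairProd, map_pairProd]
  refine (pairProd_mul _ (kap (0 : R)) S).symm.trans (pairProd_congr fun i _ j _ hij => ?_)
  have h1 := kap_mul_kapDen (0 : R) hij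
  have h2 := xs_eq_mul_ratio (R := R) hij
  rw [kapDen, map_zero, zero_mul, add_zero, one_mul, add_zero] at h1
  simp only [map_add, map_sub, MvPolynomial.aeval_X]
  linear_combination xs R i * h1 + (kap 0 i j + 1) * h2

/-- A nonzero symmetric polynomial with the cancellation property has a nonzero pairing with
some strict partition of full length. -/
theorem exists_coeff_ne_zero [IsDomain R] [CharZero R] {r : ℕ} {h : MvPolynomial ℕ R} (h0 : h ≠ 0)
    (hsupp : ∀ m, h.coeff m ≠ 0 → m.support ⊆ Finset.range r)
    (hsymm : ∀ i j, i < j → j < r → MvPolynomial.rename (Equiv.swap i j) h = h)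
    (hcancel : ∀ i j, i < j → j < r → substVar j (-MvPolynomial.X i) h = 0)
    (hkill : ∀ k < r, substVar k 0 h = 0) :
    ∃ lam : StrictPartition, lam.parts.length = r ∧
      MvPowerSeries.coeff (tailList lam.parts)
        (MvPolynomial.aeval (xs R) h * kapProd 0 (Finset.range r)) ≠ 0 := by
  set S := Finset.range r with hS
  obtain ⟨g, hg⟩ := prod_X_mul_plusProd_dvd (S := S) (h := h)
    (fun i _ j hj hij => hcancel i j hij (Finset.mem_range.mp hj))
    (fun k hk => hkill k (Finset.mem_range.mp hk))
  have hX : killOutside R S (∏ k ∈ S, MvPolynomial.X k) = ∏ k ∈ S, MvPolynomial.X k := by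
    rw [map_prod]
    exact Finset.prod_congr rfl fun k hk => by rw [killOutside, MvPolynomial.aeval_X, if_pos hk]
  have hkX : ∀ k ∈ S, killOutside R S (MvPolynomial.X k) = MvPolynomial.X k := fun k hk => by
    rw [killOutside, MvPolynomial.aeval_X, if_pos hk]
  have hP : killOutside R S (plusProd R S) = plusProd R S := by
    rw [plusProd, map_pairProd]
    exact pairProd_congr fun i hi j hj _ => by rw [map_add, hkX i hi, hkX j hj]
  have hV : killOutside R S (vander R S) = vander R S := by
    rw [vander, map_pairProd]
    exact pairProd_congr fun i hi j hj _ => by rw [map_sub, hkX i hi, hkX j hj]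
  have hh : killOutside R S h = h := by
    ext m
    rw [coeff_killOutside]
    split_ifs with hm
    · rfl
    · by_contra h'
      exact hm (hsupp m (Ne.symm h'))
  -- This is `h` with `∏ (xᵢ + xⱼ)` replaced by `∏ (xᵢ - xⱼ)`, which is the effect of the kernel at
  -- `β = 0`. It is alternating because `h` is symmetric.
  set G := (∏ k ∈ S, MvPolynomial.X k) * killOutside R S g * vander R S with hG
  have hPG : h * vander R S = plusProd R S * G := by
    rw [← hh, hg, map_mul, map_mul, hX, hP, hG]
    ring
  have hG0 : G ≠ 0 := fun h' => by
    rw [h', mul_zero] at hPG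
    exact mul_ne_zero h0 (vander_ne_zero S) hPG
  obtain ⟨m, hm, hanti⟩ := exists_strictAnti_of_alternating hG0 (r := r) fun i j hij hj => by
    have hi' : i ∈ S := Finset.mem_range.mpr (hij.trans hj)
    have hj' : j ∈ S := Finset.mem_range.mpr hj
    have h' := congrArg (MvPolynomial.rename (Equiv.swap i j)) hPG
    rw [map_mul, map_mul, hsymm i j hij hj, rename_vander_swap hi' hj' hij.ne,
      rename_swap_plusProd hi' hj' hij.ne, mul_neg, hPG, ← mul_neg] at h'
    exact (mul_left_cancel₀ (plusProd_ne_zero S) h').symm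
  have hmsupp : m.support ⊆ S := by
    have h1 : killOutside R S G = G := by
      rw [hG, map_mul, map_mul, hX, hV]
      congr 2
      ext d
      rw [coeff_killOutside, coeff_killOutside]
      split_ifs <;> rfl
    by_contra h'
    apply hm
    rw [← h1, coeff_killOutside, if_neg h']
  have hmpos : ∀ k < r, 0 < m k := fun k hk => by
    have hdvd : MvPolynomial.X k ∣ G :=
      dvd_mul_of_dvd_left (dvd_mul_of_dvd_left
        (Finset.dvd_prod_of_mem _ (Finset.mem_range.mpr hk)) _) _
    obtain ⟨q, hq⟩ := hdvd
    by_contra h'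
    apply hm
    rw [hq, MvPolynomial.coeff_X_mul', if_neg]
    rw [Finsupp.mem_support_iff]
    omega
  refine ⟨⟨(List.range r).map m, ?_, ?_⟩, by simp, ?_⟩
  · rw [List.pairwise_map]
    refine List.Pairwise.imp_of_mem ?_ List.pairwise_lt_range
    intro i j _ hj hij
    exact hanti i j hij (List.mem_range.mp hj)
  · intro a ha
    obtain ⟨k, hk, rfl⟩ := List.mem_map.mp ha
    exact hmpos k (List.mem_range.mp hk)
  · have hval : MvPolynomial.aeval (xs R) h * kapProd 0 S = MvPolynomial.aeval (xs R) G := by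
      rw [← hh, hg, map_mul (killOutside R S), map_mul (killOutside R S), hX, hP, hG]
      simp only [map_mul]
      rw [← aeval_plusProd_mul_kapProd]
      ring
    rw [hval, tailList_map_range hmsupp, ← MvPowerSeries.subst_coe, coeff_sExp_subst]
    simpa using hm

end Alternating

/-! ### Lowest homogeneous parts -/

section LeadingForm

variable {R : Type*} [CommRing R]

/-- The part of degree `n` of a power series in the variables indexed by `S`. -/
def leadForm (S : Finset ℕ) (n : ℕ) (f : MvPowerSeries ℕ R) : MvPolynomial ℕ R :=
  ∑ m ∈ S.finsuppAntidiag n, MvPolynomial.monomial m (MvPowerSeries.coeff m f)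

theorem coeff_leadForm {S : Finset ℕ} {f : MvPowerSeries ℕ R}
    (hf : ∀ m : ℕ →₀ ℕ, MvPowerSeries.coeff m f ≠ 0 → m.support ⊆ S) (n : ℕ) (m : ℕ →₀ ℕ) :
    (leadForm S n f).coeff m = if m.degree = n then MvPowerSeries.coeff m f else 0 := by
  classical
  rw [leadForm, MvPolynomial.coeff_sum]
  simp only [MvPolynomial.coeff_monomial]
  rw [Finset.sum_ite_eq']
  by_cases h : m.support ⊆ S
  · refine if_congr ?_ rfl rfl
    rw [Finset.mem_finsuppAntidiag', Finsupp.degree_apply, Finsupp.sum, and_iff_left h]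
  · have h0 : MvPowerSeries.coeff m f = 0 := by
      by_contra h'
      exact h (hf m h')
    simp [h, h0]

theorem aeval_congr_of_support {B : Type*} [CommRing B] [Algebra R B] {u v : ℕ → B}
    {h : MvPolynomial ℕ R} (huv : ∀ m, h.coeff m ≠ 0 → ∀ k ∈ m.support, u k = v k) :
    MvPolynomial.aeval u h = MvPolynomial.aeval v h := by
  rw [MvPolynomial.aeval_def, MvPolynomial.aeval_def, MvPolynomial.eval₂_eq, MvPolynomial.eval₂_eq]
  refine Finset.sum_congr rfl fun m hm => ?_
  rw [Finset.prod_congr rfl fun k hk => by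
    rw [huv m (MvPolynomial.mem_support_iff.mp hm) k hk]]

theorem hasSubst_X_mul {B : Type*} [CommRing B] {η : ℕ → PowerSeries B}
    (hη : {k | η k ≠ 0}.Finite) :
    MvPowerSeries.HasSubst (S := B) (τ := Unit) fun k => PowerSeries.X * η k where
  const_coeff k := by
    have : MvPowerSeries.constantCoeff (σ := Unit) (PowerSeries.X * η k) = 0 := by
      rw [map_mul]
      exact mul_eq_zero_of_left PowerSeries.constantCoeff_X _
    rw [this]
    exact IsNilpotent.zero
  coeff_zero d := hη.subset fun k hk h => by
    rw [Set.mem_ofPred_eq, h, mul_zero, map_zero] at hk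
    exact hk rfl

/-- The lowest term of `f(tη₀, tη₁, …)`. -/
theorem coeff_subst_X_mul {B : Type*} [CommRing B] [Algebra R B] {η : ℕ → PowerSeries B}
    (hη : {k | η k ≠ 0}.Finite) {f : MvPowerSeries ℕ R} {n : ℕ} {h : MvPolynomial ℕ R}
    (hlow : ∀ m, m.degree < n → MvPowerSeries.coeff m f = 0)
    (hh : ∀ m, h.coeff m = if m.degree = n then MvPowerSeries.coeff m f else 0) :
    PowerSeries.coeff n (MvPowerSeries.subst (fun k => PowerSeries.X * η k) f :
      MvPowerSeries Unit B) = MvPolynomial.aeval (fun k => PowerSeries.constantCoeff (η k)) h := by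
  have hterm : ∀ m : ℕ →₀ ℕ, MvPowerSeries.coeff m f •
      PowerSeries.coeff n (m.prod fun k e => (PowerSeries.X * η k) ^ e) =
      h.coeff m • m.prod fun k e => PowerSeries.constantCoeff (η k) ^ e := by
    intro m
    have hprod : (m.prod fun k e => (PowerSeries.X * η k) ^ e) =
        PowerSeries.X ^ m.degree * m.prod fun k e => η k ^ e := by
      simp only [Finsupp.prod, mul_pow, Finset.prod_mul_distrib]
      rw [Finset.prod_pow_eq_pow_sum, Finsupp.degree_apply]
    rw [hprod, PowerSeries.coeff_X_pow_mul', hh]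
    rcases lt_trichotomy m.degree n with hm | hm | hm
    · rw [hlow m hm, if_neg hm.ne, zero_smul, zero_smul]
    · rw [if_pos hm.le, if_pos hm, hm, Nat.sub_self, PowerSeries.coeff_zero_eq_constantCoeff_apply,
        Finsupp.prod, map_prod]
      simp only [map_pow, Finsupp.prod]
    · rw [if_neg hm.not_ge, if_neg hm.ne', zero_smul, smul_zero]
  have h1 := MvPowerSeries.coeff_subst (hasSubst_X_mul hη) f (Finsupp.single () n)
  refine h1.trans ((finsum_congr hterm).trans ?_)
  rw [finsum_eq_sum_of_support_subset (s := h.support), MvPolynomial.aeval_def,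
    MvPolynomial.eval₂_eq]
  · exact Finset.sum_congr rfl fun m _ => by rw [Algebra.smul_def]; rfl
  · intro m hm
    rw [Finset.mem_coe, MvPolynomial.mem_support_iff]
    exact left_ne_zero_of_smul hm

end LeadingForm

/-! ### Families with the cancellation property are determined by their pairings -/

section KSymmetric

variable {R : Type*} [CommRing R]

/-- The point with coordinates `x̄ᵢ / t` in place `j`, where `x̄ = -x / (1 + bx)` is taken at
`x = xᵢ t`, and `xₖ` in the places `k ∈ S ∪ {i}`. -/
def cancelPt (b : R) (S : Finset ℕ) (i j k : ℕ) : PowerSeries (MvPolynomial ℕ R) :=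
  if k = j then -(PowerSeries.C (MvPolynomial.X i) *
      PowerSeries.invOfUnit
        (1 + PowerSeries.C (MvPolynomial.C b * MvPolynomial.X i) * PowerSeries.X) 1)
  else if k ∈ insert i S then PowerSeries.C (MvPolynomial.X k) else 0

theorem finite_cancelPt (b : R) (S : Finset ℕ) (i j : ℕ) : {k | cancelPt b S i j k ≠ 0}.Finite := by
  refine (insert j (insert i S)).finite_toSet.subset fun k hk => ?_
  rw [Set.mem_ofPred_eq, cancelPt] at hk
  rw [Finset.mem_coe, Finset.mem_insert]
  by_contra h
  rw [not_or] at h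
  rw [if_neg h.1, if_neg h.2] at hk
  exact hk rfl

theorem constantCoeff_cancelPt (b : R) (S : Finset ℕ) (i j k : ℕ) :
    PowerSeries.constantCoeff (cancelPt b S i j k) =
      if k = j then -MvPolynomial.X i else if k ∈ insert i S then MvPolynomial.X k else 0 := by
  rw [cancelPt]
  split_ifs
  · rw [map_neg, map_mul, PowerSeries.constantCoeff_invOfUnit]
    simp
  · rw [PowerSeries.constantCoeff_C]
  · rw [map_zero]

/-- Families of symmetric power series `f(x_S)`, stable in the set of variables, with the
cancellation property `f(x, t, t̄) = f(x)`. -/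
structure IsKSym (b : R) (f : Finset ℕ → MvPowerSeries ℕ R) : Prop where
  symm : ∀ (σ : Equiv.Perm ℕ) (S : Finset ℕ) (m : ℕ →₀ ℕ),
    MvPowerSeries.coeff (m.mapDomain σ) (f (S.map σ.toEmbedding)) = MvPowerSeries.coeff m (f S)
  supp : ∀ (S : Finset ℕ) (m : ℕ →₀ ℕ), MvPowerSeries.coeff m (f S) ≠ 0 → m.support ⊆ S
  stable : ∀ {S T : Finset ℕ} {m : ℕ →₀ ℕ}, S ⊆ T → m.support ⊆ S →
    MvPowerSeries.coeff m (f T) = MvPowerSeries.coeff m (f S)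
  cancel : ∀ {S : Finset ℕ} {i j : ℕ}, i ∉ S → j ∉ S → i ≠ j →
    (MvPowerSeries.subst (fun k => PowerSeries.X * cancelPt b S i j k)
      (f (insert i (insert j S))) : MvPowerSeries Unit (MvPolynomial ℕ R)) =
    MvPowerSeries.subst (fun k => PowerSeries.X * cancelPt b S i j k) (f S)

namespace IsKSym

variable {b : R} {f g : Finset ℕ → MvPowerSeries ℕ R}

theorem sub (hf : IsKSym b f) (hg : IsKSym b g) : IsKSym b (fun S => f S - g S) where
  symm σ S m := by rw [map_sub, map_sub, hf.symm, hg.symm]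
  supp S m h := by
    by_contra h'
    refine h ?_
    rw [map_sub, not_not.mp (mt (hf.supp S m) h'), not_not.mp (mt (hg.supp S m) h'), sub_zero]
  stable hST hm := by rw [map_sub, map_sub, hf.stable hST hm, hg.stable hST hm]
  cancel hi hj hij := by
    rw [MvPowerSeries.subst_sub (hasSubst_X_mul (finite_cancelPt _ _ _ _)),
      MvPowerSeries.subst_sub (hasSubst_X_mul (finite_cancelPt _ _ _ _)),
      hf.cancel hi hj hij, hg.cancel hi hj hij]

theorem C_mul (hf : IsKSym b f) (c : R) : IsKSym b (fun S => MvPowerSeries.C c * f S) where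
  symm σ S m := by rw [MvPowerSeries.coeff_C_mul, MvPowerSeries.coeff_C_mul, hf.symm]
  supp S m h := hf.supp S m (right_ne_zero_of_mul (by rwa [MvPowerSeries.coeff_C_mul] at h))
  stable hST hm := by
    rw [MvPowerSeries.coeff_C_mul, MvPowerSeries.coeff_C_mul, hf.stable hST hm]
  cancel hi hj hij := by
    rw [MvPowerSeries.subst_mul (hasSubst_X_mul (finite_cancelPt _ _ _ _)),
      MvPowerSeries.subst_mul (hasSubst_X_mul (finite_cancelPt _ _ _ _)), hf.cancel hi hj hij]

theorem zero : IsKSym b (fun _ => 0) where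
  symm σ S m := by rw [map_zero, map_zero]
  supp S m h := absurd (map_zero _) h
  stable _ _ := rfl
  cancel _ _ _ := rfl

theorem sum {ι : Type*} (s : Finset ι) {F : ι → Finset ℕ → MvPowerSeries ℕ R}
    (hF : ∀ a ∈ s, IsKSym b (F a)) : IsKSym b (fun S => ∑ a ∈ s, F a S) := by
  classical
  induction s using Finset.induction_on with
  | empty => simpa using zero
  | insert a s ha ih =>
    have h := (hF a (by simp)).sub ((ih fun c hc => hF c (by simp [hc])).C_mul (-1))
    convert h using 2 with S
    rw [Finset.sum_insert ha, map_neg, map_one, neg_one_mul, sub_neg_eq_add]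

/-- To first order in the scaling variable `t̄` is `-t`, so the lowest term of the cancellation
identity sets `xⱼ = -xᵢ` in the form. The other side of the identity has two variables fewer, where
degree `n` is already known to vanish. -/
theorem leadForm_eq_zero_of_cancel (hf : IsKSym b f) {n : ℕ} {S : Finset ℕ} {i j : ℕ} (hi : i ∈ S)
    (hj : j ∈ S) (hij : i ≠ j) (hlow : ∀ T m, m.degree < n → MvPowerSeries.coeff m (f T) = 0)
    (hS : ∀ T m, T.card < S.card → m.degree = n → MvPowerSeries.coeff m (f T) = 0) :
    substVar j (-MvPolynomial.X i) (leadForm S n (f S)) = 0 := by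
  set T := (S.erase i).erase j with hT
  have hiT : i ∉ T := fun h => Finset.notMem_erase i S (Finset.mem_of_mem_erase h)
  have hjT : j ∉ T := Finset.notMem_erase j _
  have hST : S = insert i (insert j T) := by
    rw [hT, Finset.insert_erase (Finset.mem_erase.mpr ⟨hij.symm, hj⟩), Finset.insert_erase hi]
  have hcard : T.card < S.card :=
    Finset.card_lt_card ⟨(Finset.erase_subset _ _).trans (Finset.erase_subset _ _),
      fun h => hiT (h hi)⟩
  have h1 := hf.cancel hiT hjT hij
  rw [← hST] at h1
  have h2 := congrArg (PowerSeries.coeff n) h1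
  rw [coeff_subst_X_mul (finite_cancelPt b T i j) (hlow S) (coeff_leadForm (hf.supp S) n),
    coeff_subst_X_mul (finite_cancelPt b T i j) (h := 0) (hlow T) (fun m => by
      rw [MvPolynomial.coeff_zero]
      split_ifs with hm
      · exact (hS T m hcard hm).symm
      · rfl), map_zero] at h2
  rw [substVar, ← h2]
  refine aeval_congr_of_support fun m hm k hk => ?_
  have hkS : k ∈ S := by
    rw [coeff_leadForm (hf.supp S)] at hm
    split_ifs at hm
    · exact hf.supp S m hm hk
    · exact absurd rfl hm
  rw [constantCoeff_cancelPt, Function.update_apply]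
  split_ifs with h3 h4
  · rfl
  · rfl
  · rw [hST] at hkS
    simp only [Finset.mem_insert] at hkS h4
    tauto

/-- A nonzero form `h` of degree `n` would pair nontrivially with a strict partition at `β = 0`.
Passing from the form to the series and from the kernel at `0` to the one at `b` only adds terms of
degree above `n` in `s₀`, so the pairing with `f` would be nonzero too. -/
theorem coeff_eq_zero_range [IsDomain R] [CharZero R] (hf : IsKSym b f) {n r : ℕ}
    (hL : ∀ lam : StrictPartition, lam.parts.length = r → lam.parts.sum ≤ n →
      MvPowerSeries.coeff (tailList lam.parts) (MvPowerSeries.subst (xs R) (f (Finset.range r)) *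
        kapProd b (Finset.range r)) = 0)
    (hlow : ∀ T m, m.degree < n → MvPowerSeries.coeff m (f T) = 0)
    (hr : ∀ T m, T.card < r → m.degree = n → MvPowerSeries.coeff m (f T) = 0) {m : ℕ →₀ ℕ}
    (hm : m.degree = n) : MvPowerSeries.coeff m (f (Finset.range r)) = 0 := by
  set S := Finset.range r with hS
  have hcardS : S.card = r := Finset.card_range r
  have hco := coeff_leadForm (hf.supp S) n
  set h := leadForm S n (f S) with hh
  by_contra hne
  have h0 : h ≠ 0 := fun h' => by
    have := hco m
    rw [h', if_pos hm, MvPolynomial.coeff_zero] at this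
    exact hne this.symm
  have hsupp : ∀ m, h.coeff m ≠ 0 → m.support ⊆ S := fun m hm => by
    rw [hco] at hm
    split_ifs at hm
    · exact hf.supp S m hm
    · exact absurd rfl hm
  have hsymm : ∀ i j, i < j → j < r → MvPolynomial.rename (Equiv.swap i j) h = h := by
    intro i j hij hj
    have hσ : S.map (Equiv.swap i j).toEmbedding = S :=
      map_swap_of_mem (Finset.mem_range.mpr (hij.trans hj)) (Finset.mem_range.mpr hj)
    ext d
    have hd : d = (d.mapDomain (Equiv.swap i j)).mapDomain (Equiv.swap i j) := by
      rw [← Finsupp.mapDomain_comp]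
      have : (Equiv.swap i j : ℕ → ℕ) ∘ Equiv.swap i j = id := by
        ext k; exact Equiv.swap_apply_self i j k
      rw [this, Finsupp.mapDomain_id]
    conv_lhs => rw [hd]
    rw [MvPolynomial.coeff_rename_mapDomain _ (Equiv.swap i j).injective, hco, hco,
      Finsupp.degree_mapDomain]
    have := hf.symm (Equiv.swap i j) S d
    rw [hσ] at this
    rw [this]
  have hcancel : ∀ i j, i < j → j < r → substVar j (-MvPolynomial.X i) h = 0 := by
    intro i j hij hj
    exact hf.leadForm_eq_zero_of_cancel (Finset.mem_range.mpr (hij.trans hj))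
      (Finset.mem_range.mpr hj) hij.ne hlow (by rwa [hcardS])
  -- A monomial missing `xₖ` already has the same coefficient in the family with `r - 1` variables,
  -- where it vanishes.
  have hkill : ∀ k < r, substVar k 0 h = 0 := by
    intro k hk
    rw [substVar, MvPolynomial.aeval_def, MvPolynomial.eval₂_eq]
    refine Finset.sum_eq_zero fun d hd => ?_
    have hkd : k ∈ d.support := by
      by_contra hkd
      rw [MvPolynomial.mem_support_iff, hco] at hd
      split_ifs at hd with hdeg
      · apply hd
        have hkS : k ∈ S := Finset.mem_range.mpr hk
        rw [hf.stable (Finset.erase_subset k S) (Finset.subset_erase.mpr ⟨hf.supp S d hd, hkd⟩)]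
        exact hr _ d (by rw [← hcardS]; exact Finset.card_erase_lt_of_mem hkS) hdeg
      · exact hd rfl
    rw [Finset.prod_eq_zero hkd, mul_zero]
    rw [Function.update_self, zero_pow (Finsupp.mem_support_iff.mp hkd)]
  obtain ⟨lam, hlen, hlam⟩ := exists_coeff_ne_zero h0 hsupp hsymm hcancel hkill
  -- The kernel at `0` has no positive power of `s₀`, so the size of the partition found is at most
  -- the degree of the form, and the hypothesis on pairings applies to it.
  have hsum : lam.parts.sum ≤ n := by
    have h1 : SuppLE headExp n (MvPowerSeries.subst (xs R) (h : MvPowerSeries ℕ R)) :=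
      suppLE_headExp_subst fun m hm => by
        rw [MvPolynomial.coeff_coe, hco] at hm
        split_ifs at hm with hd
        · exact hd.le
        · exact absurd rfl hm
    have h2 := (h1.mul (suppLE_kapProd_zero S)) (tailList lam.parts) (by
      rwa [MvPowerSeries.subst_coe])
    rw [headExp_apply, tailList_zero, add_zero] at h2
    exact_mod_cast h2
  have hdiff : SuppLE (-headExp) (-((n : ℤ) + 1))
      (MvPowerSeries.subst (xs R) (f S) * kapProd b S -
        MvPolynomial.aeval (xs R) h * kapProd 0 S) := by
    have e1 : MvPowerSeries.subst (xs R) (f S) * kapProd b S -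
        MvPolynomial.aeval (xs R) h * kapProd 0 S =
        MvPowerSeries.subst (xs R) (f S - (h : MvPowerSeries ℕ R)) * kapProd b S +
        MvPowerSeries.subst (xs R) (h : MvPowerSeries ℕ R) *
          (kapProd b S - kapProd 0 S) := by
      rw [MvPowerSeries.subst_sub (hasSubst_family_xs R), MvPowerSeries.subst_coe]
      ring
    rw [e1]
    have h1 : SuppLE (-headExp) (-((n + 1 : ℕ) : ℤ))
        (MvPowerSeries.subst (xs R) (f S - (h : MvPowerSeries ℕ R))) :=
      suppLE_neg_headExp_subst fun m hm => by
        by_contra hlt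
        apply hm
        rw [map_sub, MvPolynomial.coeff_coe, hco]
        split_ifs with hd
        · exact sub_self _
        · rw [sub_zero]; exact hlow S m (by omega)
    have h2 : SuppLE (-headExp) (-(n : ℤ))
        (MvPowerSeries.subst (xs R) (h : MvPowerSeries ℕ R)) :=
      suppLE_neg_headExp_subst fun m hm => by
        rw [MvPolynomial.coeff_coe, hco] at hm
        split_ifs at hm with hd
        · exact hd.ge
        · exact absurd rfl hm
    have h3 : SuppLE (-headExp) 0 (kapProd b S) := fun m _ => by
      rw [AddMonoidHom.neg_apply, headExp_apply]; omega
    exact ((h1.mul h3).mono (by push_cast; omega)).add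
      ((h2.mul (suppLE_kapProd_sub b S)).mono (by omega))
  have h4 := hdiff.coeff_eq_zero (m := tailList lam.parts) (by
    rw [AddMonoidHom.neg_apply, headExp_apply, tailList_zero]; omega)
  rw [map_sub, hL lam hlen hsum, zero_sub, neg_eq_zero] at h4
  exact hlam h4

theorem exists_perm_map_range (S : Finset ℕ) :
    ∃ σ : Equiv.Perm ℕ, S.map σ.toEmbedding = Finset.range S.card := by
  classical
  set T := Finset.range S.card with hT
  have e1 : {k // k ∈ S} ≃ {k // k ∈ T} := Finset.equivOfCardEq (by rw [hT, Finset.card_range])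
  have hinf : ∀ U : Finset ℕ, Infinite {k // k ∉ U} := fun U =>
    (Set.infinite_coe_iff (s := {k | k ∉ U})).mpr U.finite_toSet.infinite_compl
  have := hinf S
  have := hinf T
  -- Both complements are countably infinite, so a bijection between the finite sets extends to a
  -- permutation of all indices.
  obtain ⟨e2⟩ : Nonempty ({k // k ∉ S} ≃ {k // k ∉ T}) := nonempty_equiv_of_countable
  refine ⟨Equiv.subtypeCongr e1 e2, ?_⟩
  refine Finset.eq_of_subset_of_card_le ?_ (by
    rw [Finset.card_map]; exact (Finset.card_range _).le)
  intro k hk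
  obtain ⟨a, ha, rfl⟩ := Finset.mem_map.mp hk
  simp only [Equiv.coe_toEmbedding, Equiv.subtypeCongr, Equiv.trans_apply,
    Equiv.sumCompl_symm_apply_of_pos ha, Equiv.sumCongr_apply, Sum.map_inl,
    Equiv.sumCompl_apply_inl]
  exact (e1 ⟨a, ha⟩).2

/-- A family with the cancellation property whose pairings with all strict partitions of size at
most `D` vanish has no terms of degree at most `D`. -/
theorem coeff_eq_zero [IsDomain R] [CharZero R] (hf : IsKSym b f) {D : ℕ}
    (hL : ∀ lam : StrictPartition, lam.parts.sum ≤ D → MvPowerSeries.coeff (tailList lam.parts)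
      (MvPowerSeries.subst (xs R) (f (Finset.range lam.parts.length)) *
        kapProd b (Finset.range lam.parts.length)) = 0) (S : Finset ℕ) {m : ℕ →₀ ℕ}
    (hm : m.degree ≤ D) : MvPowerSeries.coeff m (f S) = 0 := by
  suffices h : ∀ n ≤ D, ∀ r S m, S.card = r → m.degree = n → MvPowerSeries.coeff m (f S) = 0 from
    h _ hm _ S m rfl rfl
  intro n
  induction n using Nat.strong_induction_on with
  | _ n ihn =>
    intro hn r
    induction r using Nat.strong_induction_on with
    | _ r ihr =>
      intro S m hS hm
      obtain ⟨σ, hσ⟩ := exists_perm_map_range S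
      rw [← hf.symm σ S m, hσ, hS]
      refine hf.coeff_eq_zero_range (n := n) (fun lam hlen hsum => ?_) (fun T d hd => ?_)
        (fun T d hT hd => ihr _ hT T d rfl hd) (by rw [Finsupp.degree_mapDomain, hm])
      · have := hL lam (hsum.trans hn)
        rwa [hlen] at this
      · exact ihn _ hd (hd.le.trans hn) _ T d rfl rfl

end IsKSym

end KSymmetric

/-! ### The series `x̄` and the points where cancellation is tested -/

section CancelPoint

variable {R : Type*} [CommRing R]

/-- The series `-x / (1 + bx)`. -/
def barSer (b : R) : PowerSeries R :=
  -(PowerSeries.X * PowerSeries.invOfUnit (1 + PowerSeries.C b * PowerSeries.X) 1)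

theorem barSer_mul (b : R) :
    barSer b * (1 + PowerSeries.C b * PowerSeries.X) = -PowerSeries.X := by
  have h := PowerSeries.mul_invOfUnit (1 + PowerSeries.C b * PowerSeries.X) 1 (by simp)
  rw [barSer]
  linear_combination -PowerSeries.X * h

theorem hasSubst_barSer (b : R) : PowerSeries.HasSubst (barSer b) :=
  PowerSeries.HasSubst.of_constantCoeff_zero' (by simp [barSer])

theorem X_mul_cancelPt_left (b : R) (S : Finset ℕ) {i j : ℕ} (hij : i ≠ j) :
    PowerSeries.X * cancelPt b S i j i = PowerSeries.X * PowerSeries.C (MvPolynomial.X i) := by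
  rw [cancelPt, if_neg hij, if_pos (Finset.mem_insert_self i S)]

theorem X_mul_cancelPt_right (b : R) (S : Finset ℕ) (i j : ℕ) :
    PowerSeries.X * cancelPt b S i j j * (1 + PowerSeries.C (MvPolynomial.C b) *
      (PowerSeries.X * PowerSeries.C (MvPolynomial.X i))) =
      -(PowerSeries.X * PowerSeries.C (MvPolynomial.X i)) := by
  have h := PowerSeries.mul_invOfUnit
    (1 + PowerSeries.C (MvPolynomial.C b * MvPolynomial.X i) * PowerSeries.X) 1 (by simp)
  rw [cancelPt, if_pos rfl]
  rw [map_mul] at h ⊢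
  linear_combination -PowerSeries.X * PowerSeries.C (MvPolynomial.X i) * h

theorem hasSubst_X_mul_C (i : ℕ) : PowerSeries.HasSubst
    (PowerSeries.X * PowerSeries.C (MvPolynomial.X i : MvPolynomial ℕ R)) :=
  PowerSeries.HasSubst.of_constantCoeff_zero' (by simp)

theorem subst_barSer (b : R) (S : Finset ℕ) (i j : ℕ) :
    PowerSeries.subst (PowerSeries.X * PowerSeries.C (MvPolynomial.X i : MvPolynomial ℕ R))
      (barSer b) = PowerSeries.X * cancelPt b S i j j := by
  set s : PowerSeries (MvPolynomial ℕ R) := PowerSeries.X * PowerSeries.C (MvPolynomial.X i)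
    with hs
  have h := congrArg (PowerSeries.substAlgHom (hasSubst_X_mul_C (R := R) i)) (barSer_mul b)
  have hC : PowerSeries.substAlgHom (hasSubst_X_mul_C (R := R) i) (PowerSeries.C b) =
      PowerSeries.C (MvPolynomial.C b) := by
    have h1 := (PowerSeries.substAlgHom (hasSubst_X_mul_C (R := R) i)).commutes b
    rwa [PowerSeries.algebraMap_apply, MvPowerSeries.algebraMap_apply] at h1
  rw [map_mul, map_add, map_mul, map_one, map_neg, PowerSeries.substAlgHom_X, hC,
    ← X_mul_cancelPt_right b S i j, PowerSeries.coe_substAlgHom] at h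
  refine IsUnit.mul_right_cancel ?_ h
  rw [PowerSeries.isUnit_iff_constantCoeff]
  simp

end CancelPoint

/-! ### The `P`-functions as a family with cancellation -/

section Instances

variable {K : Type*} [Field K] [CharZero K] (β : K) (R : Type*) [CommRing R] [Algebra K R]

/-- `GP_l(x_S)` with coefficients in an algebra over the base field. -/
def gpSer (l : List ℕ) (S : Finset ℕ) : MvPowerSeries ℕ R :=
  ((MvPolynomial.map (algebraMap K R) (gpPoly β l S) : MvPolynomial ℕ R) : MvPowerSeries ℕ R)

theorem coeff_gpSer (l : List ℕ) (S : Finset ℕ) (m : ℕ →₀ ℕ) :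
    MvPowerSeries.coeff m (gpSer β R l S) = algebraMap K R ((gpPoly β l S).coeff m) := by
  rw [gpSer, MvPolynomial.coeff_coe, MvPolynomial.coeff_map]

theorem subst_gpSer {B τ : Type*} [CommRing B] [Algebra R B] [Algebra K B] [IsScalarTower K R B]
    (a : ℕ → MvPowerSeries τ B) (l : List ℕ) (S : Finset ℕ) :
    MvPowerSeries.subst a (gpSer β R l S) = MvPolynomial.aeval a (gpPoly β l S) := by
  rw [gpSer, MvPowerSeries.subst_coe, MvPolynomial.aeval_map_algebraMap]

theorem isKSym_gpSer [IsDomain R] {l : List ℕ} (hl : ∀ a ∈ l, 0 < a) :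
    IsKSym (algebraMap K R β) (gpSer β R l) where
  symm σ S m := by
    rw [coeff_gpSer, coeff_gpSer, ← rename_gpPoly,
      MvPolynomial.coeff_rename_mapDomain _ σ.injective]
  supp S m h := by
    by_contra h'
    rw [coeff_gpSer, coeff_gpPoly_of_not_subset β hl h', map_zero] at h
    exact h rfl
  stable hST hm := by rw [coeff_gpSer, coeff_gpSer, coeff_gpPoly_of_subset β hl hST hm]
  cancel {S i j} hi hj hij := by
    have : CharZero R := charZero_of_injective_algebraMap (algebraMap K R).injective
    rw [subst_gpSer, subst_gpSer]
    set ξ : ℕ → PowerSeries (MvPolynomial ℕ R) :=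
      fun k => PowerSeries.X * cancelPt (algebraMap K R β) S i j k with hξ
    refine IsFractionRing.injective (PowerSeries (MvPolynomial ℕ R))
      (FractionRing (PowerSeries (MvPolynomial ℕ R))) ?_
    have hX : ∀ k, ((algebraMap (PowerSeries (MvPolynomial ℕ R))
        (FractionRing (PowerSeries (MvPolynomial ℕ R)))).comp
        (MvPolynomial.aeval (R := K) ξ).toRingHom) (MvPolynomial.X k) =
        algebraMap _ (FractionRing (PowerSeries (MvPolynomial ℕ R))) (ξ k) := fun k => by
      simp
    refine eval_gpPoly_cancel β ((algebraMap (PowerSeries (MvPolynomial ℕ R))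
        (FractionRing (PowerSeries (MvPolynomial ℕ R)))).comp
        (MvPolynomial.aeval (R := K) ξ).toRingHom) l hi hj hij ?_ ?_
    · intro a ha c hc hac h
      rw [hX, hX] at h
      -- The coordinates of the point are distinct already in first order, where they are the
      -- variables and `-xᵢ`; characteristic zero separates the latter from the variables.
      have h1 := congrArg (PowerSeries.coeff 1) (IsFractionRing.injective _ _ h)
      simp only [hξ] at h1
      rw [PowerSeries.coeff_succ_X_mul, PowerSeries.coeff_succ_X_mul,
        PowerSeries.coeff_zero_eq_constantCoeff_apply,
        PowerSeries.coeff_zero_eq_constantCoeff_apply, constantCoeff_cancelPt,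
        constantCoeff_cancelPt] at h1
      have hneg : ∀ k, (-MvPolynomial.X i : MvPolynomial ℕ R) ≠ MvPolynomial.X k := fun k h' => by
        have := congrArg (MvPolynomial.eval fun _ => (1 : R)) h'
        simp only [map_neg, MvPolynomial.eval_X] at this
        exact one_ne_zero (neg_eq_self.mp this)
      have hmem : ∀ k ∈ insert i (insert j S), k ≠ j → k ∈ insert i S := fun k hk hkj => by
        simp only [Finset.mem_insert] at hk ⊢
        tauto
      by_cases haj : a = j
      · have hcj : c ≠ j := fun h => hac (haj.trans h.symm)
        rw [if_pos haj, if_neg hcj, if_pos (hmem c hc hcj)] at h1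
        exact hneg c h1
      · rw [if_neg haj, if_pos (hmem a ha haj)] at h1
        by_cases hcj : c = j
        · rw [if_pos hcj] at h1
          exact hneg a h1.symm
        · rw [if_neg hcj, if_pos (hmem c hc hcj)] at h1
          exact X_ne_X hac h1
    · rw [hX, hX]
      have hC : ((algebraMap (PowerSeries (MvPolynomial ℕ R))
          (FractionRing (PowerSeries (MvPolynomial ℕ R)))).comp
          (MvPolynomial.aeval (R := K) ξ).toRingHom) (MvPolynomial.C β) =
          algebraMap (PowerSeries (MvPolynomial ℕ R))
            (FractionRing (PowerSeries (MvPolynomial ℕ R)))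
            (PowerSeries.C (MvPolynomial.C (algebraMap K R β))) := by
        simp only [AlgHom.toRingHom_eq_coe, RingHom.coe_comp, RingHom.coe_coe,
          Function.comp_apply, MvPolynomial.aeval_C]
        rw [PowerSeries.algebraMap_apply, MvPolynomial.algebraMap_apply]
      rw [hC, ← map_add, ← map_mul, ← map_mul, ← map_add]
      have h1 := X_mul_cancelPt_left (algebraMap K R β) S hij
      have h2 := X_mul_cancelPt_right (algebraMap K R β) S i j
      have h3 : ξ i + ξ j + PowerSeries.C (MvPolynomial.C (algebraMap K R β)) * ξ i * ξ j = 0 := by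
        simp only [hξ]
        rw [h1]
        linear_combination h2
      rw [h3, map_zero]

end Instances

/-! ### The family `∏ ω(xₖ)` -/

section OmegaFamily

variable {R : Type*} [CommRing R]

/-- `∏_{k ∈ S} ω(xₖ)`. -/
def omegaFam (ω : PowerSeries R) (S : Finset ℕ) : MvPowerSeries ℕ R :=
  ∏ k ∈ S, PowerSeries.subst (MvPowerSeries.X k : MvPowerSeries ℕ R) ω

theorem coeff_omegaFam (ω : PowerSeries R) (S : Finset ℕ) : ∀ m : ℕ →₀ ℕ,
    MvPowerSeries.coeff m (omegaFam ω S) =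
      if m.support ⊆ S then ∏ k ∈ S, PowerSeries.coeff (m k) ω else 0 := by
  classical
  induction S using Finset.induction_on with
  | empty =>
    intro m
    rw [omegaFam, Finset.prod_empty, Finset.prod_empty, MvPowerSeries.coeff_one]
    simp only [Finset.subset_empty, Finsupp.support_eq_empty]
  | insert k S hk ih =>
    intro m
    have hF : omegaFam ω (insert k S) =
        PowerSeries.subst (MvPowerSeries.X k : MvPowerSeries ℕ R) ω * omegaFam ω S := by
      rw [omegaFam, Finset.prod_insert hk, omegaFam]
    have hm : Finsupp.single k (m k) + m.erase k = m := Finsupp.single_add_erase k m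
    rw [hF, MvPowerSeries.coeff_mul, Finset.sum_eq_single (Finsupp.single k (m k), m.erase k)]
    · rw [PowerSeries.coeff_subst_single, Finsupp.single_eq_same, if_pos rfl, ih,
        Finsupp.support_erase, Finset.prod_insert hk, mul_ite, mul_zero]
      refine if_congr ?_ ?_ rfl
      · rw [Finset.subset_insert_iff]
      · congr 1
        refine Finset.prod_congr rfl fun j hj => ?_
        rw [Finsupp.erase_ne (fun h : j = k => hk (h ▸ hj))]
    · rintro ⟨p, q⟩ hpq hne
      rw [Finset.HasAntidiagonal.mem_antidiagonal] at hpq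
      simp only at hpq ⊢
      rw [PowerSeries.coeff_subst_single, ih]
      split_ifs with h1 h2
      · exfalso
        apply hne
        have hqk : q k = 0 := by
          by_contra h
          exact hk (h2 (Finsupp.mem_support_iff.mpr h))
        have hpk : p k = m k := by rw [← hpq, Finsupp.add_apply, hqk, add_zero]
        rw [hpk] at h1
        have h3 : Finsupp.single k (m k) + q = Finsupp.single k (m k) + m.erase k := by
          rw [← h1, hpq, h1, hm]
        rw [h1, add_right_injective _ h3]
      all_goals simp
    · intro h
      rw [Finset.HasAntidiagonal.mem_antidiagonal] at h
      exact absurd hm h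

theorem subst_omegaFam {B τ : Type*} [CommRing B] [Algebra R B] {a : ℕ → MvPowerSeries τ B}
    (ha : MvPowerSeries.HasSubst a) (ω : PowerSeries R) (S : Finset ℕ) :
    MvPowerSeries.subst a (omegaFam ω S) = ∏ k ∈ S, PowerSeries.subst (a k) ω := by
  rw [omegaFam, ← MvPowerSeries.coe_substAlgHom ha, map_prod, MvPowerSeries.coe_substAlgHom ha]
  refine Finset.prod_congr rfl fun k _ => ?_
  rw [PowerSeries.subst, MvPowerSeries.subst_comp_subst_apply
    (PowerSeries.HasSubst.X k).const ha]
  simp only [MvPowerSeries.subst_X ha]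
  rfl

/-- Stability comes from `ω(0) = 1` and cancellation from `ω(x) ω(x̄) = 1`; symmetry is built into
the product. -/
theorem isKSym_omegaFam (b : R) {ω : PowerSeries R} (h0 : PowerSeries.constantCoeff ω = 1)
    (hω : ω * PowerSeries.subst (barSer b) ω = 1) : IsKSym b (omegaFam ω) where
  symm σ S m := by
    rw [coeff_omegaFam, coeff_omegaFam, Finset.prod_map]
    have h1 : ∀ k, m.mapDomain σ (σ k) = m k :=
      fun k => Finsupp.mapDomain_apply σ.injective m k
    simp only [Equiv.coe_toEmbedding, h1]
    refine if_congr ?_ rfl rfl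
    constructor
    · intro h k hk
      have h2 := h (show σ k ∈ (m.mapDomain σ).support by
        rw [Finsupp.mem_support_iff, h1]; exact Finsupp.mem_support_iff.mp hk)
      rw [Finset.mem_map] at h2
      obtain ⟨k', hk', h3⟩ := h2
      rwa [← σ.injective h3]
    · intro h k hk
      rw [Finset.mem_map]
      refine ⟨σ.symm k, h ?_, by simp⟩
      rw [Finsupp.mem_support_iff, ← h1, Equiv.apply_symm_apply]
      exact Finsupp.mem_support_iff.mp hk
  supp S m h := by
    by_contra h'
    rw [coeff_omegaFam, if_neg h'] at h
    exact h rfl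
  stable {S T m} hST hm := by
    rw [coeff_omegaFam, coeff_omegaFam, if_pos hm, if_pos (hm.trans hST)]
    refine (Finset.prod_subset hST fun k _ hk => ?_).symm
    have : m k = 0 := by
      by_contra h
      exact hk (hm (Finsupp.mem_support_iff.mpr h))
    rw [this, PowerSeries.coeff_zero_eq_constantCoeff_apply, h0]
  cancel {S i j} hi hj hij := by
    have ha := hasSubst_X_mul (finite_cancelPt b S i j)
    rw [subst_omegaFam ha, subst_omegaFam ha, Finset.prod_insert (by simp [hij, hi]),
      Finset.prod_insert hj, ← mul_assoc]
    have h1 := congrArg (PowerSeries.substAlgHom (hasSubst_X_mul_C (R := R) i)) hω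
    rw [map_mul, map_one, PowerSeries.coe_substAlgHom,
      PowerSeries.subst_comp_subst_apply (hasSubst_barSer b) (hasSubst_X_mul_C i),
      subst_barSer b S i j] at h1
    rw [X_mul_cancelPt_left b S hij, h1, one_mul]

end OmegaFamily

/-! ### The series `ω`: inversion under `x ↦ x̄`, and its product formula -/

section Omega

variable {K : Type*} [Field K] (β : K) {R : Type*} [CommRing R] [Algebra K R]

/-- The exponent contains only odd powers of `z`, so changing the sign of `z` inverts the series. -/
theorem expSeries_mul_rescale [CharZero K] (τ : ℕ → R) :
    expSeries K τ * PowerSeries.rescale (-1 : R) (expSeries K τ) = 1 := by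
  have hder : ∀ f : PowerSeries R, PowerSeries.X *
      PowerSeries.derivative R (PowerSeries.rescale (-1 : R) f) =
      PowerSeries.rescale (-1 : R) (PowerSeries.X * PowerSeries.derivative R f) := by
    intro f
    ext n
    rw [PowerSeries.coeff_rescale]
    cases n with
    | zero => simp
    | succ n =>
      rw [PowerSeries.coeff_succ_X_mul, PowerSeries.coeff_succ_X_mul, PowerSeries.coeff_derivative,
        PowerSeries.coeff_derivative, PowerSeries.coeff_rescale]
      ring
  have hodd : PowerSeries.rescale (-1 : R) (logDerSeries τ) = -logDerSeries τ := by
    ext n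
    rw [PowerSeries.coeff_rescale, map_neg, logDerSeries, PowerSeries.coeff_mk]
    split_ifs with hn
    · rw [Odd.neg_one_pow (Nat.odd_iff.mpr hn), neg_one_mul]
    · rw [mul_zero, neg_zero]
  have h1 := expSeries_ode K τ
  have h2 := hder (expSeries K τ)
  rw [h1, map_mul, hodd] at h2
  refine ode_unique K (A := 0) (map_zero _) ?_ ?_ ?_
  · rw [Derivation.leibniz, smul_eq_mul, smul_eq_mul, zero_mul]
    linear_combination expSeries K τ * h2 + PowerSeries.rescale (-1 : R) (expSeries K τ) * h1
  · rw [Derivation.map_one_eq_zero, mul_zero, zero_mul]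
  · rw [map_mul, ← PowerSeries.coeff_zero_eq_constantCoeff_apply (PowerSeries.rescale _ _),
      PowerSeries.coeff_rescale]
    simp

theorem constantCoeff_omegaSer (τ : ℕ → R) :
    PowerSeries.constantCoeff (omegaSer R β τ) = 1 := by
  have h := coeff_mul_subst_zSeries (β / 2) (1 : PowerSeries R) (expSeries K τ) 0
  rw [one_mul] at h
  rw [← PowerSeries.coeff_zero_eq_constantCoeff_apply, omegaSer, h]
  simp

/-- The parameter `β/2` is chosen so that `x/(1 + (β/2)x)` changes sign under `x ↦ x̄`; with
`expSeries_mul_rescale` this gives `ω(x) ω(x̄) = 1`. -/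
theorem subst_barSer_zSeries [CharZero K] :
    PowerSeries.subst (barSer (algebraMap K R β)) (zSeries R (β / 2)) =
      -(zSeries R (β / 2)) := by
  have hs := hasSubst_barSer (algebraMap K R β)
  have h := congrArg (PowerSeries.substAlgHom hs) (zSeries_mul R (β / 2))
  have hC : PowerSeries.substAlgHom hs (PowerSeries.C (algebraMap K R (β / 2))) =
      PowerSeries.C (algebraMap K R (β / 2)) := by
    have h1 := (PowerSeries.substAlgHom hs).commutes (algebraMap K R (β / 2))
    rwa [PowerSeries.algebraMap_apply] at h1
  rw [map_mul, map_add, map_mul, map_one, PowerSeries.substAlgHom_X, hC,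
    PowerSeries.coe_substAlgHom] at h
  have hb := barSer_mul (algebraMap K R β)
  have hz := zSeries_mul R (β / 2)
  have hβ : algebraMap K R β = algebraMap K R (β / 2) + algebraMap K R (β / 2) := by
    rw [← map_add, add_halves]
  rw [hβ, map_add] at hb
  rw [hβ] at h ⊢
  have hunit : IsUnit (1 + PowerSeries.C (algebraMap K R (β / 2)) * PowerSeries.X) := by
    rw [PowerSeries.isUnit_iff_constantCoeff]; simp
  refine hunit.mul_right_cancel ?_
  set c := PowerSeries.C (algebraMap K R (β / 2))
  set B := barSer (algebraMap K R (β / 2) + algebraMap K R (β / 2))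
  set Z : PowerSeries R := PowerSeries.subst B (zSeries R (β / 2))
  linear_combination (1 + (c + c) * PowerSeries.X) * h + (1 - c * Z) * hb + hz

theorem omegaSer_mul_subst_barSer [CharZero K] (τ : ℕ → R) :
    omegaSer R β τ * PowerSeries.subst (barSer (algebraMap K R β)) (omegaSer R β τ) = 1 := by
  have hz := hasSubst_zSeries R (β / 2)
  have h := congrArg (PowerSeries.substAlgHom hz) (expSeries_mul_rescale (K := K) τ)
  rw [map_mul, map_one, PowerSeries.rescale_eq_subst, PowerSeries.coe_substAlgHom] at h
  have hneg : PowerSeries.HasSubst ((-1 : R) • PowerSeries.X : PowerSeries R) :=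
    PowerSeries.HasSubst.smul_X' _
  rw [PowerSeries.subst_comp_subst_apply hneg hz] at h
  rw [omegaSer, PowerSeries.subst_comp_subst_apply hz (hasSubst_barSer _), subst_barSer_zSeries]
  rw [PowerSeries.subst_smul hz, PowerSeries.subst_X hz, neg_one_smul] at h
  exact h

/-- The series `(1 - x̄ y) / (1 - x y)`. -/
def cauchySer (y : R) : PowerSeries R :=
  (1 + PowerSeries.C (algebraMap K R β + y) * PowerSeries.X) * PowerSeries.invOfUnit
    ((1 - PowerSeries.C y * PowerSeries.X) *
      (1 + PowerSeries.C (algebraMap K R β) * PowerSeries.X)) 1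

theorem isUnit_cauchyDen (b y : R) : IsUnit ((1 - PowerSeries.C y * PowerSeries.X) *
    (1 + PowerSeries.C b * PowerSeries.X)) := by
  rw [PowerSeries.isUnit_iff_constantCoeff]; simp

theorem cauchySer_mul (y : R) : cauchySer β y * ((1 - PowerSeries.C y * PowerSeries.X) *
    (1 + PowerSeries.C (algebraMap K R β) * PowerSeries.X)) =
      1 + PowerSeries.C (algebraMap K R β + y) * PowerSeries.X := by
  rw [cauchySer, mul_assoc, PowerSeries.invOfUnit_mul _ _ (by simp), mul_one]

/-- The parameters of the Hamiltonian in finitely many variables. -/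
def finPar {ι : Type*} (y : ι → R) (s : Finset ι) (j : ℕ) : R :=
  algebraMap K R (2 / (2 * j + 1 : ℕ)) * ∑ i ∈ s,
    ((y i + algebraMap K R (β / 2)) ^ (2 * j + 1) - algebraMap K R (β / 2) ^ (2 * j + 1))

theorem expSeries_zero [CharZero K] : expSeries K (fun _ => (0 : R)) = 1 := by
  refine ode_unique K (A := logDerSeries fun _ => (0 : R)) (by simp) (expSeries_ode K _) ?_ (by simp)
  have : logDerSeries (fun _ => (0 : R)) = 0 := by
    ext n
    simp [logDerSeries, eul]
  rw [this, Derivation.map_one_eq_zero, mul_zero, zero_mul]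

theorem omegaSer_finPar [CharZero K] {ι : Type*} (y : ι → R) (s : Finset ι) :
    omegaSer R β (finPar β y s) = ∏ i ∈ s, cauchySer β (y i) := by
  classical
  induction s using Finset.induction_on with
  | empty =>
    have : finPar β y ∅ = fun _ => (0 : R) := by
      funext j; simp [finPar]
    rw [this, Finset.prod_empty, omegaSer, expSeries_zero,
      ← PowerSeries.coe_substAlgHom (hasSubst_zSeries R (β / 2)), map_one]
  | insert i s hi ih =>
    set c := algebraMap K R (β / 2) with hc
    -- A new variable `yᵢ` amounts to two shifts, at `β/2` and at `-(yᵢ + β/2)`; the oddness of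
    -- `2j+1` turns the second subtraction into an addition.
    have hpar : finPar β y (insert i s) =
        shiftPar K (shiftPar K (finPar β y s) c) (-(y i + c)) := by
      funext j
      rw [finPar, Finset.sum_insert hi, shiftPar, shiftPar, finPar,
        Odd.neg_pow ⟨j, rfl⟩]
      ring
    have e1 := subst_shift β (τ := shiftPar K (finPar β y s) c) (σ := finPar β y s)
      (c := c) (d := -c) (by rw [expSeries_shiftPar, map_neg, neg_mul, ← sub_eq_add_neg])
    have e2 := subst_shift β (τ := finPar β y (insert i s)) (σ := shiftPar K (finPar β y s) c)
      (c := -(y i + c)) (d := y i + c)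
      (by rw [hpar, expSeries_shiftPar, map_neg, neg_mul, sub_neg_eq_add])
    have hβ : algebraMap K R β = c + c := by rw [hc, ← map_add, add_halves]
    have e3 := cauchySer_mul β (y i)
    rw [Finset.prod_insert hi, ← ih]
    refine (isUnit_cauchyDen (algebraMap K R β) (y i)).mul_right_cancel ?_
    rw [← hc] at e1 e2
    rw [hβ] at e3 ⊢
    simp only [map_add, map_neg, neg_add_rev, add_neg_cancel, map_zero, zero_mul, add_zero,
      mul_one] at e1 e2 e3 ⊢
    linear_combination (1 + (PowerSeries.C c + PowerSeries.C c) * PowerSeries.X) * e2 +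
      (1 + (PowerSeries.C c + (PowerSeries.C (y i) + PowerSeries.C c)) * PowerSeries.X) * e1 -
      omegaSer R β (finPar β y s) * e3

theorem map_omegaSer [CharZero K] {R' : Type*} [CommRing R'] [Algebra K R'] (f : R →ₐ[K] R') (τ : ℕ → R) :
    PowerSeries.map (f : R →+* R') (omegaSer R β τ) = omegaSer R' β (fun j => f (τ j)) := by
  rw [omegaSer, omegaSer, ← map_expSeries f]
  have h := PowerSeries.map_subst (hasSubst_zSeries R (β / 2)) (h := (f : R →+* R'))
    (expSeries K τ)
  have hz : MvPowerSeries.map (f : R →+* R') (zSeries R (β / 2)) = zSeries R' (β / 2) := by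
    have h1 : PowerSeries.map (f : R →+* R') (zSeries R (β / 2)) = zSeries R' (β / 2) := by
      rw [zSeries, zSeries, ← RingHom.comp_apply, ← PowerSeries.map_comp, f.comp_algebraMap]
    exact h1
  rw [hz] at h
  exact h

end Omega

/-! ### Restriction to finitely many `y`-variables -/

section Truncation

variable {K : Type*} [Field K]

/-- Setting to zero the variables outside of a set, for power series. -/
def killSer (K : Type*) [Field K] (S : Finset ℕ) : MvPowerSeries ℕ K →ₐ[K] MvPowerSeries ℕ K :=
  (MvPowerSeries.rename (Function.Embedding.subtype (· ∈ S))).comp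
    (MvPowerSeries.killCompl (Function.Embedding.subtype (· ∈ S)))

theorem coeff_killSer (S : Finset ℕ) (f : MvPowerSeries ℕ K) (d : ℕ →₀ ℕ) :
    MvPowerSeries.coeff d (killSer K S f) =
      if d.support ⊆ S then MvPowerSeries.coeff d f else 0 := by
  set e := Function.Embedding.subtype (· ∈ S) with he
  have hrange : d.support ⊆ S ↔ ∃ d' : {k // k ∈ S} →₀ ℕ, Finsupp.embDomain e d' = d := by
    constructor
    · intro h
      refine ⟨d.comapDomain e e.injective.injOn, ?_⟩
      rw [Finsupp.embDomain_eq_mapDomain]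
      exact Finsupp.mapDomain_comapDomain _ e.injective d fun k hk => ⟨⟨k, h hk⟩, rfl⟩
    · rintro ⟨d', rfl⟩ k hk
      rw [Finsupp.support_embDomain, Finset.mem_map] at hk
      obtain ⟨a, _, rfl⟩ := hk
      exact a.2
  rw [killSer, AlgHom.comp_apply]
  split_ifs with h
  · obtain ⟨d', rfl⟩ := hrange.mp h
    rw [MvPowerSeries.coeff_embDomain_rename, MvPowerSeries.coeff_killCompl]
  · refine MvPowerSeries.coeff_rename_eq_zero _ _ ?_
    rintro ⟨d', hd'⟩
    exact h (hrange.mpr ⟨d', by rw [Finsupp.embDomain_eq_mapDomain]; exact hd'⟩)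

theorem killSer_psum (S : Finset ℕ) {n : ℕ} (hn : n ≠ 0) :
    killSer K S (psum K n) = ∑ j ∈ S, MvPowerSeries.X j ^ n := by
  classical
  ext d
  rw [coeff_killSer, map_sum]
  simp only [MvPowerSeries.coeff_X_pow]
  have hpsum : MvPowerSeries.coeff d (psum K n) =
    if ∃ i, d = Finsupp.single i n then 1 else 0 := rfl
  rw [hpsum]
  by_cases h : ∃ i, d = Finsupp.single i n
  · obtain ⟨i, rfl⟩ := h
    have h1 : (if ∃ k, Finsupp.single i n = Finsupp.single k n then (1 : K) else 0) = 1 :=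
      if_pos ⟨i, rfl⟩
    rw [h1, Finsupp.support_single i hn]
    simp only [Finset.singleton_subset_iff, Finsupp.single_left_inj hn, Finset.sum_ite_eq]
  · rw [if_neg h, ite_self, Finset.sum_eq_zero]
    exact fun j _ => if_neg fun h' => h ⟨j, h'⟩

theorem killSer_hamPar [CharZero K] (β : K) (S : Finset ℕ) (j : ℕ) :
    killSer K S (hamPar β j) = finPar β MvPowerSeries.X S j := by
  rw [hamPar, map_smul, psumBr, map_sum, finPar, Algebra.smul_def]
  congr 1
  have h1 : ∀ i ∈ Finset.Icc 1 (2 * j + 1),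
      killSer K S (((2 * j + 1).choose i * (β / 2) ^ (2 * j + 1 - i) : K) • psum K i) =
      ∑ k ∈ S, (((2 * j + 1).choose i * (β / 2) ^ (2 * j + 1 - i) : K) •
        (MvPowerSeries.X k : MvPowerSeries ℕ K) ^ i) := fun i hi => by
    rw [map_smul, killSer_psum S (by have := (Finset.mem_Icc.mp hi).1; omega), Finset.smul_sum]
  rw [Finset.sum_congr rfl h1, Finset.sum_comm]
  refine Finset.sum_congr rfl fun k _ => ?_
  rw [add_pow, Finset.range_eq_Ico, Finset.sum_eq_sum_Ico_succ_bot (by omega), pow_zero, one_mul,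
    Nat.sub_zero, Nat.choose_zero_right, Nat.cast_one, mul_one, add_sub_cancel_left]
  refine Finset.sum_congr (by ext i; simp) fun i _ => ?_
  rw [Algebra.smul_def, map_mul, map_pow, map_natCast]
  ring

theorem map_killSer_omegaSer [CharZero K] (β : K) (S : Finset ℕ) :
    PowerSeries.map (killSer K S : MvPowerSeries ℕ K →+* MvPowerSeries ℕ K)
      (omegaSer (MvPowerSeries ℕ K) β (hamPar β)) =
      ∏ j ∈ S, cauchySer β (MvPowerSeries.X j : MvPowerSeries ℕ K) := by
  rw [map_omegaSer, ← omegaSer_finPar]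
  congr 1
  funext j
  exact killSer_hamPar β S j

end Truncation

/-! ### The infinite Cauchy product -/

section CauchyProduct

variable {K : Type*} [Field K] (β : K)

/-- The exponent with the given `x`-part and `y`-part. -/
def sumExp : (ℕ ⊕ ℕ →₀ ℕ) ≃+ (ℕ →₀ ℕ) × (ℕ →₀ ℕ) :=
  Finsupp.sumFinsuppAddEquivProdFinsupp.trans AddEquiv.prodComm

/-- The exponent with `x`-part `dx` and `y`-part `dy`. -/
def joinExp (dx dy : ℕ →₀ ℕ) : ℕ ⊕ ℕ →₀ ℕ := sumExp.symm (dy, dx)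

theorem joinExp_inl (dx dy : ℕ →₀ ℕ) (i : ℕ) : joinExp dx dy (Sum.inl i) = dx i := rfl

theorem joinExp_inr (dx dy : ℕ →₀ ℕ) (i : ℕ) : joinExp dx dy (Sum.inr i) = dy i := rfl

theorem exists_joinExp (d : ℕ ⊕ ℕ →₀ ℕ) : ∃ dx dy, d = joinExp dx dy :=
  ⟨(sumExp d).2, (sumExp d).1, (sumExp.symm_apply_apply d).symm⟩

theorem mvCurry_X_inl (i : ℕ) :
    mvCurry sumExp (MvPowerSeries.X (Sum.inl i) : MvPowerSeries (ℕ ⊕ ℕ) K) =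
      MvPowerSeries.X i := by
  have h : Finsupp.single (Sum.inl i : ℕ ⊕ ℕ) 1 = sumExp.symm (0, Finsupp.single i 1) := by
    ext k
    rcases k with k | k
    · refine Eq.trans ?_ (joinExp_inl (Finsupp.single i 1) 0 k).symm
      simp [Finsupp.single_apply]
    · refine Eq.trans ?_ (joinExp_inr (Finsupp.single i 1) 0 k).symm
      simp
  rw [MvPowerSeries.X, h, mvCurry_monomial]
  rfl

theorem mvCurry_X_inr (j : ℕ) :
    mvCurry sumExp (MvPowerSeries.X (Sum.inr j) : MvPowerSeries (ℕ ⊕ ℕ) K) =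
      MvPowerSeries.C (MvPowerSeries.X j) := by
  have h : Finsupp.single (Sum.inr j : ℕ ⊕ ℕ) 1 = sumExp.symm (Finsupp.single j 1, 0) := by
    ext k
    rcases k with k | k
    · refine Eq.trans ?_ (joinExp_inl 0 (Finsupp.single j 1) k).symm
      simp
    · refine Eq.trans ?_ (joinExp_inr 0 (Finsupp.single j 1) k).symm
      simp [Finsupp.single_apply]
  rw [MvPowerSeries.X, h, mvCurry_monomial]
  rfl

theorem mvCurry_C (c : K) : mvCurry sumExp (MvPowerSeries.C c : MvPowerSeries (ℕ ⊕ ℕ) K) =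
    MvPowerSeries.C (algebraMap K (MvPowerSeries ℕ K) c) := by
  have h : (0 : ℕ ⊕ ℕ →₀ ℕ) = sumExp.symm (0, 0) := by
    rw [← Prod.zero_eq_mk, map_zero]
  rw [← MvPowerSeries.monomial_zero_eq_C_apply, h, mvCurry_monomial]
  rfl

theorem cauchyFactor_mul (ij : ℕ × ℕ) : cauchyFactor β ij *
    ((1 - MvPowerSeries.X (Sum.inl ij.1) * MvPowerSeries.X (Sum.inr ij.2)) *
      (1 + MvPowerSeries.C β * MvPowerSeries.X (Sum.inl ij.1))) =
      1 + (MvPowerSeries.C β + MvPowerSeries.X (Sum.inr ij.2)) *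
        MvPowerSeries.X (Sum.inl ij.1) := by
  have h1 := MvPowerSeries.inv_mul_cancel (1 - MvPowerSeries.X (Sum.inl ij.1) *
    MvPowerSeries.X (Sum.inr ij.2) : MvPowerSeries (ℕ ⊕ ℕ) K) (by simp)
  have h2 := MvPowerSeries.inv_mul_cancel (1 + MvPowerSeries.C β *
    MvPowerSeries.X (Sum.inl ij.1) : MvPowerSeries (ℕ ⊕ ℕ) K) (by simp)
  rw [cauchyFactor]
  set x : MvPowerSeries (ℕ ⊕ ℕ) K := MvPowerSeries.X (Sum.inl ij.1)
  set y : MvPowerSeries (ℕ ⊕ ℕ) K := MvPowerSeries.X (Sum.inr ij.2)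
  set b : MvPowerSeries (ℕ ⊕ ℕ) K := MvPowerSeries.C β
  set u := (1 - x * y)⁻¹
  set v := (1 + b * x)⁻¹
  linear_combination (1 + b * x) * (1 + x * v * y) * h1 + x * y * h2

theorem mvCurry_cauchyFactor (i j : ℕ) : mvCurry sumExp (cauchyFactor β (i, j)) =
    PowerSeries.subst (MvPowerSeries.X i : MvPowerSeries ℕ (MvPowerSeries ℕ K))
      (cauchySer β (MvPowerSeries.X j : MvPowerSeries ℕ K)) := by
  have hs : PowerSeries.HasSubst (MvPowerSeries.X i : MvPowerSeries ℕ (MvPowerSeries ℕ K)) :=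
    PowerSeries.HasSubst.X i
  have h1 := congrArg (mvCurry sumExp) (cauchyFactor_mul β (i, j))
  have h2 := congrArg (PowerSeries.substAlgHom hs)
    (cauchySer_mul β (MvPowerSeries.X j : MvPowerSeries ℕ K))
  have hC : ∀ c : MvPowerSeries ℕ K, PowerSeries.substAlgHom hs (PowerSeries.C c) =
      MvPowerSeries.C c := fun c => by
    rw [PowerSeries.coe_substAlgHom]; exact PowerSeries.subst_C c
  simp only [map_mul, map_add, map_sub, map_one, mvCurry_X_inl, mvCurry_X_inr, mvCurry_C] at h1
  simp only [map_mul, map_add, map_sub, map_one, hC, PowerSeries.substAlgHom_X] at h2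
  rw [PowerSeries.coe_substAlgHom] at h2
  have hunit : IsUnit ((1 - MvPowerSeries.X i * MvPowerSeries.C (MvPowerSeries.X j)) *
      (1 + MvPowerSeries.C (algebraMap K (MvPowerSeries ℕ K) β) * MvPowerSeries.X i) :
        MvPowerSeries ℕ (MvPowerSeries ℕ K)) := by
    rw [MvPowerSeries.isUnit_iff_constantCoeff]; simp
  refine hunit.mul_right_cancel ?_
  rw [h1, mul_comm (MvPowerSeries.X i) (MvPowerSeries.C _), h2]

/-- For fixed `x`, the product over finitely many `y` is `ω` with the other `y`-variables set to
zero, which does not change the coefficient of a monomial supported on `B`. -/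
theorem coeff_prod_cauchyFactor [CharZero K] {A B : Finset ℕ} {dx dy : ℕ →₀ ℕ}
    (hdy : dy.support ⊆ B) :
    MvPowerSeries.coeff (joinExp dx dy) (∏ p ∈ A ×ˢ B, cauchyFactor β p) =
      MvPowerSeries.coeff dy (MvPowerSeries.coeff dx
        (omegaFam (omegaSer (MvPowerSeries ℕ K) β (hamPar β)) A)) := by
  classical
  have h1 : mvCurry sumExp (∏ p ∈ A ×ˢ B, cauchyFactor β p) =
      omegaFam (PowerSeries.map (killSer K B : MvPowerSeries ℕ K →+* MvPowerSeries ℕ K)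
        (omegaSer (MvPowerSeries ℕ K) β (hamPar β))) A := by
    rw [Finset.prod_product, map_prod, omegaFam, map_killSer_omegaSer]
    refine Finset.prod_congr rfl fun i _ => ?_
    rw [map_prod, ← PowerSeries.coe_substAlgHom (PowerSeries.HasSubst.X i), map_prod]
    refine Finset.prod_congr rfl fun j _ => ?_
    rw [mvCurry_cauchyFactor, PowerSeries.coe_substAlgHom]
  rw [joinExp, ← coeff_coeff_mvCurry, h1, coeff_omegaFam, coeff_omegaFam]
  split_ifs with h
  · simp only [PowerSeries.coeff_map]
    rw [← map_prod]
    exact (coeff_killSer B _ dy).trans (if_pos hdy)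
  · rfl

theorem coeff_mul_of_X_dvd {σ : Type*} {f g : MvPowerSeries σ K} {v : σ} {d : σ →₀ ℕ} (hd : d v = 0)
    (hg : MvPowerSeries.X v ∣ g - 1) :
    MvPowerSeries.coeff d (f * g) = MvPowerSeries.coeff d f := by
  have h : MvPowerSeries.X v ∣ f * g - f := by
    have : f * g - f = f * (g - 1) := by ring
    rw [this]
    exact hg.mul_left f
  rw [MvPowerSeries.X_dvd_iff] at h
  have := h d hd
  rwa [map_sub, sub_eq_zero] at this

theorem X_mul_X_dvd_cauchyFactor_sub_one (ij : ℕ × ℕ) :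
    MvPowerSeries.X (Sum.inl ij.1) * MvPowerSeries.X (Sum.inr ij.2) ∣ cauchyFactor β ij - 1 := by
  have h := cauchyFactor_mul β ij
  set x : MvPowerSeries (ℕ ⊕ ℕ) K := MvPowerSeries.X (Sum.inl ij.1) with hx
  set y : MvPowerSeries (ℕ ⊕ ℕ) K := MvPowerSeries.X (Sum.inr ij.2) with hy
  set b : MvPowerSeries (ℕ ⊕ ℕ) K := MvPowerSeries.C β
  have hunit : IsUnit ((1 - x * y) * (1 + b * x)) := by
    rw [MvPowerSeries.isUnit_iff_constantCoeff]; simp [hx, hy]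
  refine (hunit.dvd_mul_right).mp ⟨2 + b * x, ?_⟩
  linear_combination h

/-- Every factor is `1` modulo `xᵢyⱼ`, hence invisible to a monomial lacking `xᵢ` or `yⱼ`. This is
the convergence of the infinite product. -/
theorem coeff_prod_cauchyFactor_of_subset {A B : Finset ℕ} {dx dy : ℕ →₀ ℕ}
    (hdx : dx.support ⊆ A) (hdy : dy.support ⊆ B) {s : Finset (ℕ × ℕ)} (hs : A ×ˢ B ⊆ s) :
    MvPowerSeries.coeff (joinExp dx dy) (∏ p ∈ s, cauchyFactor β p) =
      MvPowerSeries.coeff (joinExp dx dy) (∏ p ∈ A ×ˢ B, cauchyFactor β p) := by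
  classical
  rw [← Finset.prod_sdiff hs, mul_comm]
  have hne : ∀ p ∈ s \ A ×ˢ B, p.1 ∉ A ∨ p.2 ∉ B := fun p hp => by
    rw [Finset.mem_sdiff, Finset.mem_product, not_and_or] at hp
    exact hp.2
  generalize s \ A ×ˢ B = t at hne
  induction t using Finset.induction_on with
  | empty => rw [Finset.prod_empty, mul_one]
  | insert p t hp ih =>
    rw [Finset.prod_insert hp, mul_comm (cauchyFactor β p), ← mul_assoc]
    have hdvd := X_mul_X_dvd_cauchyFactor_sub_one β p
    rcases hne p (by simp) with h | h
    · rw [coeff_mul_of_X_dvd (v := Sum.inl p.1) (by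
        rw [joinExp_inl]; exact Finsupp.notMem_support_iff.mp fun h' => h (hdx h'))
        ((dvd_mul_right _ _).trans hdvd)]
      exact ih fun q hq => hne q (by simp [hq])
    · rw [coeff_mul_of_X_dvd (v := Sum.inr p.2) (by
        rw [joinExp_inr]; exact Finsupp.notMem_support_iff.mp fun h' => h (hdy h'))
        ((dvd_mul_left _ _).trans hdvd)]
      exact ih fun q hq => hne q (by simp [hq])

/-- The product `∏_{i,j} (1 - x̄ᵢ yⱼ) / (1 - xᵢ yⱼ)`. -/
def cauchyProd : MvPowerSeries (ℕ ⊕ ℕ) K := fun d =>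
  MvPowerSeries.coeff d (∏ p ∈ (sumExp d).2.support ×ˢ (sumExp d).1.support, cauchyFactor β p)

theorem coeff_cauchyProd {A B : Finset ℕ} {dx dy : ℕ →₀ ℕ} (hdx : dx.support ⊆ A)
    (hdy : dy.support ⊆ B) {s : Finset (ℕ × ℕ)} (hs : A ×ˢ B ⊆ s) :
    MvPowerSeries.coeff (joinExp dx dy) (cauchyProd β) =
      MvPowerSeries.coeff (joinExp dx dy) (∏ p ∈ s, cauchyFactor β p) := by
  have h1 : MvPowerSeries.coeff (joinExp dx dy) (cauchyProd β) =
      MvPowerSeries.coeff (joinExp dx dy)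
        (∏ p ∈ dx.support ×ˢ dy.support, cauchyFactor β p) := by
    have e : sumExp (joinExp dx dy) = (dy, dx) := sumExp.apply_symm_apply _
    have h2 : MvPowerSeries.coeff (joinExp dx dy) (cauchyProd β) =
      MvPowerSeries.coeff (joinExp dx dy) (∏ p ∈ (sumExp (joinExp dx dy)).2.support ×ˢ
        (sumExp (joinExp dx dy)).1.support, cauchyFactor β p) := rfl
    rw [h2, e]
  rw [h1, coeff_prod_cauchyFactor_of_subset β (Finset.Subset.refl _) (Finset.Subset.refl _)
    ((Finset.product_subset_product hdx hdy).trans hs)]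

theorem formalHasProd_cauchyProd : FormalHasProd (cauchyFactor β) (cauchyProd β) := by
  intro d
  obtain ⟨dx, dy, rfl⟩ := exists_joinExp d
  rw [Filter.eventually_atTop]
  exact ⟨dx.support ×ˢ dy.support, fun s hs =>
    (coeff_cauchyProd β (Finset.Subset.refl _) (Finset.Subset.refl _) hs).symm⟩

theorem FormalHasProd.unique {σ ι : Type*} {f : ι → MvPowerSeries σ K} {a b : MvPowerSeries σ K}
    (ha : FormalHasProd f a) (hb : FormalHasProd f b) : a = b := by
  ext d
  obtain ⟨s, h1, h2⟩ := ((ha d).and (hb d)).exists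
  rw [← h1, ← h2]

theorem coeff_cauchyProd_eq [CharZero K] {S : Finset ℕ} {dx : ℕ →₀ ℕ} (hdx : dx.support ⊆ S)
    (dy : ℕ →₀ ℕ) : MvPowerSeries.coeff (joinExp dx dy) (cauchyProd β) =
      MvPowerSeries.coeff dy (MvPowerSeries.coeff dx
        (omegaFam (omegaSer (MvPowerSeries ℕ K) β (hamPar β)) S)) := by
  rw [coeff_cauchyProd β hdx (Finset.Subset.refl _) (Finset.Subset.refl _),
    coeff_prod_cauchyFactor β (Finset.Subset.refl _)]

end CauchyProduct

/-! ### Finiteness of the pairings -/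

section Pairing

variable {R : Type*} [CommRing R]

/-- With `finite_sExp_le` this shows that a pairing depends on finitely many coefficients, so it may
be applied to a formal sum through a single finite partial sum. -/
theorem coeff_subst_xs_mul_eq_zero {F k : MvPowerSeries ℕ R} {e : ℕ →₀ ℕ}
    (h : ∀ m, sExp m ≤ e → MvPowerSeries.coeff m F = 0) :
    MvPowerSeries.coeff e (MvPowerSeries.subst (xs R) F * k) = 0 := by
  classical
  rw [MvPowerSeries.coeff_mul]
  refine Finset.sum_eq_zero fun p hp => ?_
  rw [Finset.HasAntidiagonal.mem_antidiagonal] at hp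
  have : MvPowerSeries.coeff p.1 (MvPowerSeries.subst (xs R) F) = 0 := by
    by_contra hne
    obtain ⟨m, hm, hF⟩ := exists_sExp_of_coeff_subst_ne_zero hne
    refine hF (h m ?_)
    rw [← hm, ← hp]
    exact le_self_add
  rw [this, zero_mul]

theorem finite_sExp_le (e : ℕ →₀ ℕ) : {m | sExp m ≤ e}.Finite :=
  (Set.finite_Iic e).preimage sExp_injective.injOn

theorem finite_strictPartition (D : ℕ) : {lam : StrictPartition | lam.parts.sum ≤ D}.Finite := by
  have hlist : ((fun l : List (Fin (D + 1)) => l.map Fin.val) '' {l | l.length ≤ D}).Finite :=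
    (List.finite_length_le (Fin (D + 1)) D).image _
  have hinj : Function.Injective StrictPartition.parts := fun _ _ => StrictPartition.ext
  refine (hlist.preimage hinj.injOn).subset fun lam hlam => ?_
  rw [Set.mem_ofPred_eq] at hlam
  have hle : ∀ a ∈ lam.parts, a < D + 1 := fun a ha =>
    Nat.lt_succ_of_le ((List.le_sum_of_mem ha).trans hlam)
  refine ⟨lam.parts.pmap (fun a ha => ⟨a, ha⟩) hle, ?_, ?_⟩
  · rw [Set.mem_ofPred_eq, List.length_pmap]
    exact (List.length_le_sum_of_one_le _ lam.pos).trans hlam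
  · simp [List.map_pmap]

end Pairing

/-! ### The Cauchy identity and uniqueness -/

section Cauchy

variable {K : Type*} [Field K] (β : K)

theorem coeff_rename_mul_rename (f g : MvPowerSeries ℕ K) (dx dy : ℕ →₀ ℕ) :
    MvPowerSeries.coeff (joinExp dx dy)
      (MvPowerSeries.rename (Function.Embedding.inl : ℕ ↪ ℕ ⊕ ℕ) f *
        MvPowerSeries.rename (Function.Embedding.inr : ℕ ↪ ℕ ⊕ ℕ) g) =
      MvPowerSeries.coeff dx f * MvPowerSeries.coeff dy g := by
  classical
  have hinl : ∀ d : ℕ →₀ ℕ, Finsupp.mapDomain (Function.Embedding.inl : ℕ ↪ ℕ ⊕ ℕ) d =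
      joinExp d 0 := fun d => by
    ext k
    rcases k with k | k
    · exact Finsupp.mapDomain_apply Sum.inl_injective d k
    · exact Finsupp.mapDomain_of_notMem_range d _ (by simp)
  have hinr : ∀ d : ℕ →₀ ℕ, Finsupp.mapDomain (Function.Embedding.inr : ℕ ↪ ℕ ⊕ ℕ) d =
      joinExp 0 d := fun d => by
    ext k
    rcases k with k | k
    · exact Finsupp.mapDomain_of_notMem_range d _ (by simp)
    · exact Finsupp.mapDomain_apply Sum.inr_injective d k
  have hadd : ∀ a c a' c' : ℕ →₀ ℕ, joinExp a c + joinExp a' c' = joinExp (a + a') (c + c') :=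
    fun a c a' c' => by rw [joinExp, joinExp, joinExp, ← map_add, Prod.mk_add_mk]
  rw [MvPowerSeries.coeff_mul, Finset.sum_eq_single (joinExp dx 0, joinExp 0 dy)]
  · simp only
    rw [← hinl, ← hinr, ← Finsupp.embDomain_eq_mapDomain, ← Finsupp.embDomain_eq_mapDomain,
      MvPowerSeries.coeff_embDomain_rename, MvPowerSeries.coeff_embDomain_rename]
  · rintro ⟨p, q⟩ hpq hne
    rw [Finset.HasAntidiagonal.mem_antidiagonal] at hpq
    simp only at hpq ⊢
    by_contra h
    have hp : p ∈ Set.range (Finsupp.mapDomain (Function.Embedding.inl : ℕ ↪ ℕ ⊕ ℕ)) := by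
      by_contra h'
      exact left_ne_zero_of_mul h (MvPowerSeries.coeff_rename_eq_zero _ _ h')
    have hq : q ∈ Set.range (Finsupp.mapDomain (Function.Embedding.inr : ℕ ↪ ℕ ⊕ ℕ)) := by
      by_contra h'
      exact right_ne_zero_of_mul h (MvPowerSeries.coeff_rename_eq_zero _ _ h')
    obtain ⟨a, rfl⟩ := hp
    obtain ⟨c, rfl⟩ := hq
    rw [hinl, hinr] at hpq hne
    rw [hadd, add_zero, zero_add] at hpq
    have h1 := sumExp.symm.injective hpq
    rw [Prod.mk.injEq] at h1
    exact hne (by rw [h1.1, h1.2])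
  · intro h
    rw [Finset.HasAntidiagonal.mem_antidiagonal, hadd, add_zero, zero_add] at h
    exact absurd rfl h

variable [CharZero K]

open Classical in
theorem coeff_subst_gpSer_mul_kapProd (R : Type*) [CommRing R] [IsDomain R] [Algebra K R]
    (lam mu : StrictPartition) : MvPowerSeries.coeff (tailList lam.parts)
      (MvPowerSeries.subst (xs R) (gpSer β R mu.parts (Finset.range lam.parts.length)) *
        kapProd (algebraMap K R β) (Finset.range lam.parts.length)) =
      if lam = mu then 1 else 0 := by
  rw [subst_gpSer, coeff_gpPoly_mul_kapProd]

theorem coeff_subst_sum_gpSer (R : Type*) [CommRing R] [IsDomain R] [Algebra K R]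
    (s : Finset StrictPartition) (c : StrictPartition → R) {lam : StrictPartition} (hlam : lam ∈ s) :
    MvPowerSeries.coeff (tailList lam.parts)
      (MvPowerSeries.subst (xs R)
        (∑ mu ∈ s, MvPowerSeries.C (c mu) * gpSer β R mu.parts (Finset.range lam.parts.length)) *
        kapProd (algebraMap K R β) (Finset.range lam.parts.length)) = c lam := by
  classical
  rw [← MvPowerSeries.coe_substAlgHom (hasSubst_family_xs R), map_sum, Finset.sum_mul, map_sum]
  simp only [map_mul, MvPowerSeries.coe_substAlgHom (hasSubst_family_xs R), MvPowerSeries.subst_C,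
    mul_assoc, MvPowerSeries.coeff_C_mul]
  rw [Finset.sum_eq_single lam]
  · rw [coeff_subst_gpSer_mul_kapProd, if_pos rfl, mul_one]
  · intro mu _ hne
    rw [coeff_subst_gpSer_mul_kapProd, if_neg hne.symm, mul_zero]
  · exact fun h => absurd hlam h

theorem isDualQ_vevBr : IsDualQ β fun lam => vevBr β (ketq β lam) := by
  refine ⟨cauchyProd β, formalHasProd_cauchyProd β, fun d => ?_⟩
  obtain ⟨dx, dy, rfl⟩ := exists_joinExp d
  rw [Filter.eventually_atTop]
  refine ⟨(finite_strictPartition dx.degree).toFinset, fun s hs => ?_⟩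
  have : IsDomain (MvPowerSeries ℕ K) := NoZeroDivisors.to_isDomain _
  have : CharZero (MvPowerSeries ℕ K) :=
    charZero_of_injective_algebraMap (algebraMap K (MvPowerSeries ℕ K)).injective
  set ω := omegaSer (MvPowerSeries ℕ K) β (hamPar β) with hω
  set b := algebraMap K (MvPowerSeries ℕ K) β with hb
  -- The finite set `s` contains every partition of size at most the degree of the `x`-monomial. All
  -- pairings of this difference up to that size vanish, by `vevBr_ketq` and duality, so its
  -- coefficient at the monomial vanishes.
  have hf : IsKSym b fun S => omegaFam ω S -
      ∑ lam ∈ s, MvPowerSeries.C (vevBr β (ketq β lam)) * gpSer β (MvPowerSeries ℕ K) lam.parts S :=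
    (isKSym_omegaFam b (constantCoeff_omegaSer β _) (omegaSer_mul_subst_barSer β _)).sub
      (IsKSym.sum s fun lam _ => (isKSym_gpSer β (MvPowerSeries ℕ K) lam.pos).C_mul _)
  have h0 := hf.coeff_eq_zero (D := dx.degree) (fun lam hlam => by
    rw [MvPowerSeries.subst_sub (hasSubst_family_xs _), sub_mul, map_sub,
      coeff_subst_sum_gpSer β _ s _ (hs (by simpa using hlam)), vevBr_ketq, omegaProd,
      subst_omegaFam (hasSubst_family_xs _), sub_self]) dx.support le_rfl
  rw [map_sub, sub_eq_zero] at h0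
  rw [coeff_cauchyProd_eq β (Finset.Subset.refl _), ← hω, h0, map_sum, map_sum, map_sum]
  refine Finset.sum_congr rfl fun lam _ => ?_
  have h1 : MvPowerSeries.coeff dx
      (MvPowerSeries.C (vevBr β (ketq β lam)) * gpSer β (MvPowerSeries ℕ K) lam.parts dx.support) =
      (gpPoly β lam.parts dx.support).coeff dx • vevBr β (ketq β lam) := by
    rw [MvPowerSeries.coeff_C_mul, coeff_gpSer, Algebra.smul_def, mul_comm]
  rw [coeff_rename_mul_rename, h1, coeff_GP β lam (Finset.Subset.refl _), map_smul, smul_eq_mul]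

/-- For each `y`-monomial the difference of the two expansions is a formal combination of the
`P`-functions equal to zero; applying the functional dual to `GP_λ` extracts the coefficient at `λ`.
-/
theorem IsDualQ.unique {g g' : StrictPartition → MvPowerSeries ℕ K} (hg : IsDualQ β g)
    (hg' : IsDualQ β g') : g = g' := by
  obtain ⟨P, hP, hs⟩ := hg
  obtain ⟨P', hP', hs'⟩ := hg'
  obtain rfl := hP.unique hP'
  funext lam
  ext dy
  set r := lam.parts.length
  -- One finite set of partitions must serve all the `x`-monomials seen by the functional at once;
  -- this is possible because there are finitely many.
  have hev : ∀ᶠ s : Finset StrictPartition in Filter.atTop, ∀ m ∈ {m | sExp m ≤ tailList lam.parts},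
      ∑ mu ∈ s, MvPowerSeries.coeff m (GP β mu) * MvPowerSeries.coeff dy (g mu) =
      ∑ mu ∈ s, MvPowerSeries.coeff m (GP β mu) * MvPowerSeries.coeff dy (g' mu) := by
    rw [Filter.eventually_all_finite (finite_sExp_le _)]
    intro m _
    filter_upwards [hs (joinExp m dy), hs' (joinExp m dy)] with s h1 h2
    have := h1.trans h2.symm
    simpa only [map_sum, coeff_rename_mul_rename] using this
  obtain ⟨s, hs, hlam⟩ := (hev.and (Filter.eventually_ge_atTop {lam})).exists
  rw [Finset.singleton_subset_iff] at hlam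
  have h1 := coeff_subst_sum_gpSer β K s
    (fun mu => MvPowerSeries.coeff dy (g mu) - MvPowerSeries.coeff dy (g' mu)) hlam
  rw [coeff_subst_xs_mul_eq_zero] at h1
  · exact sub_eq_zero.mp h1.symm
  · intro m hm
    by_cases hsupp : m.support ⊆ Finset.range r
    · rw [map_sum, ← sub_eq_zero.mpr (hs m hm), ← Finset.sum_sub_distrib]
      refine Finset.sum_congr rfl fun mu _ => ?_
      rw [MvPowerSeries.coeff_C_mul, coeff_gpSer, coeff_GP β mu hsupp, Algebra.algebraMap_self,
        RingHom.id_apply]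
      ring
    · rw [map_sum]
      refine Finset.sum_eq_zero fun mu _ => ?_
      rw [MvPowerSeries.coeff_C_mul, coeff_gpSer, coeff_gpPoly_of_not_subset β mu.pos hsupp,
        map_zero, mul_zero]

end Cauchy

end NeutralFermion

end

theorem theorem6p1 :
    (∃! gq : NeutralFermion.StrictPartition → MvPowerSeries ℕ (RatFunc ℚ),
      NeutralFermion.IsDualQ (RatFunc.X : RatFunc ℚ) gq) ∧
    ∀ gq : NeutralFermion.StrictPartition → MvPowerSeries ℕ (RatFunc ℚ),
      NeutralFermion.IsDualQ (RatFunc.X : RatFunc ℚ) gq →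
      ∀ lam : NeutralFermion.StrictPartition,
        gq lam ∈ NeutralFermion.gGamma (RatFunc.X : RatFunc ℚ) ∧
        gq lam = NeutralFermion.vevBr (RatFunc.X : RatFunc ℚ)
          (NeutralFermion.ketq (RatFunc.X : RatFunc ℚ) lam) ∧
        ∃ h : NeutralFermion.ketq (RatFunc.X : RatFunc ℚ) lam ∈
            NeutralFermion.Feven (RatFunc ℚ),
          gq lam = NeutralFermion.chi (RatFunc.X : RatFunc ℚ)
            ⟨NeutralFermion.ketq (RatFunc.X : RatFunc ℚ) lam, h⟩ := by
  have hex := NeutralFermion.isDualQ_vevBr (RatFunc.X : RatFunc ℚ)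
  refine ⟨⟨_, hex, fun g hg => hg.unique _ hex⟩, fun gq hgq lam => ?_⟩
  obtain rfl := hgq.unique _ hex
  exact ⟨NeutralFermion.vevBr_mem_gGamma _ _, rfl, NeutralFermion.ketq_mem_Feven _ lam, rfl⟩
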